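/- Proposition (pushforward bimodule $\mathcal M$). Complex manifolds are Hausdorff, second countable, and modelled on a fixed $\mathbb C^m$; $\otimes$ is the completed projective tensor product of Fréchet spaces, and $P\otimes_A N$ is the quotient of $P\otimes N$ by the closed span of the elements $pa\otimes n-p\otimes an$. Definitions. A Fréchet curved DGA $(\mathcal A^\bullet,d,c)$ is a non-negatively graded Fréchet $\mathbb C$-algebra with a continuous degree one derivation $d$ and $c\in\mathcal A^2$ with $d^2a=ca-ac$, $dc=0$; put $A=\mathcal A^0$. A right Fréchet $A$-module is (relatively) projective if it is a direct summand, by continuous $A$-linear maps, of $V\otimes A$ for a Fréchet space $V$. An object of $q\mathcal P_{\mathcal A^\bullet}$ is a pair $(E^\bullet,\mathbb E)$ with $E^\bullet$ a bounded $\mathbb Z$-graded projective right Fréchet $A$-module and $\mathbb E$ a continuous linear endomorphism of $E^\bullet\otimes_A\mathcal A^\bullet$ of total degree one with $\mathbb E(t\omega)=\mathbb E(t)\omega+(-1)^{|t|}t\,d\omega$ (a $\mathbb Z$-connection) and $\mathbb E\mathbb E(e)=-e\cdot c$. Morphisms $E_1\to E_2$ of degree $k$ are the continuous right $\mathcal A^\bullet$-linear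 maps $\varphi:E_1^\bullet\otimes_A\mathcal A^\bullet\to E_2^\bullet\otimes_A\mathcal A^\bullet$ of degree $k$, with $d\varphi=\mathbb E_2\varphi-(-1)^k\varphi\mathbb E_1$. A quasi-perfect twisted $\mathcal A_1^\bullet$–$\mathcal A_2^\bullet$ bimodule is a pair $(X^\bullet,\mathbb X)$ with $X^\bullet$ a bounded graded Fréchet $A_1$–$A_2$ bimodule, projective as a right $A_2$-module, $\mathbb X$ a continuous $\mathbb Z$-connection on $X^\bullet\otimes_{A_2}\mathcal A_2^\bullet$, and a continuous graded left action of $\mathcal A_1^\bullet$ on $X^\bullet\otimes_{A_2}\mathcal A_2^\bullet$ that extends the one of $A_1$ on $X^\bullet$, commutes with the right action of $\mathcal A_2^\bullet$, and satisfies $\mathbb X(a t)=da\cdot t+(-1)^{|a|}a\,\mathbb X(t)$ and $\mathbb X\mathbb X(t)=c_1t-tc_2$. Statement. Let $X,Y$ be complex manifolds, $p_1,p_2$ the projections of $X\times Y$, $\mathcal A^{0,\bullet}(\cdot)$ the Dolbeault algebra with the $C^\infty$ topology and $d=\bar\partial$, $c=0$, and let $M^\bullet=\Gamma(X\times Y;\wedge^\bullet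 p_1^*(T^{0,1}X)^*)$ be the smooth $(0,\bullet)$-forms along the fibres of $p_2$, a graded right module over $\mathcal A(Y)=C^\infty(Y)$. Then $\mathcal A^{0,\bullet}(X\times Y)$ and $\mathcal A^{0,\bullet}(Y)$ are Fréchet (curved) DGAs; the map $m\otimes\omega\mapsto m\wedge p_2^*\omega$ extends to a topological isomorphism $M^\bullet\otimes_{\mathcal A(Y)}\mathcal A^{0,\bullet}(Y)\cong\mathcal A^{0,\bullet}(X\times Y)$; and under it the operator $\mathbb M=\bar\partial_X+\bar\partial_Y=\bar\partial$, with left multiplication by $\mathcal A^{0,\bullet}(X\times Y)$ as left action, makes $\mathcal M=(M^\bullet,\mathbb M)$ a quasi-perfect twisted $\mathcal A^{0,\bullet}(X\times Y)$–$\mathcal A^{0,\bullet}(Y)$ bimodule. For $m \in M^\bullet$ one has $\mathbb M(m)=\mathbb M^0(m)+\mathbb M^1(m)$ with $\mathbb M^0=\bar\partial_X$ having values in $M^\bullet$ and $\mathbb M^1=\bar\partial_Y$ having values in $M^\bullet\otimes_{\mathcal A(Y)}\mathcal A^{0,1}(Y)$. Consequently there is a DG functor $$\mathcal M_*:q\mathcal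 P_{\mathcal A^{0,\bullet}(X\times Y)}\to q\mathcal P_{\mathcal A^{0,\bullet}(Y)},$$ which sends $(E^\bullet,\mathbb E)$ to $E^\bullet\otimes_{\mathcal A(X\times Y)}M^\bullet$ with the connection $e\otimes x\mapsto\mathbb E(e)\cdot x+(-1)^{|e|}e\otimes\mathbb M(x)$, and a morphism $\varphi$ to $e\otimes x\mapsto\varphi(e)\cdot x$. -/

import Mathlib

open scoped TensorProduct ContDiff Manifold Uniformity
open Set Topology

set_option linter.unusedSectionVars false
set_option linter.unusedSimpArgs false

universe u v w w'

noncomputable section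

/-- A Fréchet space over `ℂ`: a complete metrizable locally convex Hausdorff
topological vector space. -/
structure IsFrechet (V : Type*) [AddCommGroup V] [Module ℂ V] [UniformSpace V] : Prop where
  isUniformAddGroup : IsUniformAddGroup V
  continuousSMul : ContinuousSMul ℂ V
  locallyConvex : LocallyConvexSpace ℝ V
  t2 : T2Space V
  complete : CompleteSpace V
  countable : (𝓤 V).IsCountablyGenerated

/-! ### Completed projective tensor products -/

section Tensor

variable {A M N N' : Type*} [AddCommGroup A] [Module ℂ A]
  [AddCommGroup M] [Module ℂ M] [UniformSpace M]
  [AddCommGroup N] [Module ℂ N] [UniformSpace N]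
  [AddCommGroup N'] [Module ℂ N'] [UniformSpace N']

/-- The continuous seminorms of the projective topology on `M ⊗ N` that vanish on
`m a ⊗ n - m ⊗ a n`; here `ra m a = m a` and `la a n = a n`. -/
structure Admissible (ra : M →ₗ[ℂ] A →ₗ[ℂ] M) (la : A →ₗ[ℂ] N →ₗ[ℂ] N)
    (r : Seminorm ℂ (M ⊗[ℂ] N)) : Prop where
  continuous_tmul : Continuous fun p : M × N => r (p.1 ⊗ₜ[ℂ] p.2)
  balanced : ∀ m a n, r (ra m a ⊗ₜ[ℂ] n - m ⊗ₜ[ℂ] la a n) = 0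

/-- The algebraic tensor product `M ⊗ N` over `ℂ`, with the (non-Hausdorff) locally convex
topology given by all admissible seminorms. -/
def PreTensor (_ra : M →ₗ[ℂ] A →ₗ[ℂ] M) (_la : A →ₗ[ℂ] N →ₗ[ℂ] N) : Type _ := M ⊗[ℂ] N

variable (ra : M →ₗ[ℂ] A →ₗ[ℂ] M) (la : A →ₗ[ℂ] N →ₗ[ℂ] N) (la' : A →ₗ[ℂ] N' →ₗ[ℂ] N')

instance : AddCommGroup (PreTensor ra la) := inferInstanceAs (AddCommGroup (M ⊗[ℂ] N))
instance : Module ℂ (PreTensor ra la) := inferInstanceAs (Module ℂ (M ⊗[ℂ] N))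

/-- The identification of `M ⊗ N` with the underlying space of `PreTensor`. -/
def PreTensor.of : M ⊗[ℂ] N ≃ₗ[ℂ] PreTensor ra la := LinearEquiv.refl ℂ (M ⊗[ℂ] N)

/-- The uniform structure of a seminorm. -/
abbrev seminormUniform {V : Type*} [AddCommGroup V] [Module ℂ V] (r : Seminorm ℂ V) :
    UniformSpace V :=
  r.toAddGroupSeminorm.toSeminormedAddCommGroup.toUniformSpace

instance : UniformSpace (PreTensor ra la) :=
  ⨅ r : {r : Seminorm ℂ (M ⊗[ℂ] N) // Admissible ra la r}, seminormUniform r.1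

theorem uniformContinuous_seminorm {V W : Type*} [AddCommGroup V] [Module ℂ V]
    [AddCommGroup W] [Module ℂ W] (r : Seminorm ℂ V) (s : Seminorm ℂ W) (f : V →ₗ[ℂ] W)
    (C : NNReal) (h : ∀ x, s (f x) ≤ C * r x) :
    @UniformContinuous V W (seminormUniform r) (seminormUniform s) f := by
  let _ := r.toAddGroupSeminorm.toSeminormedAddCommGroup
  let _ := s.toAddGroupSeminorm.toSeminormedAddCommGroup
  refine LipschitzWith.uniformContinuous (K := C) ?_
  refine LipschitzWith.of_dist_le_mul fun x y => ?_
  rw [dist_eq_norm, dist_eq_norm, ← map_sub]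
  exact h _

instance : IsUniformAddGroup (PreTensor ra la) := by
  refine isUniformAddGroup_iInf fun r => ?_
  let _ := r.1.toAddGroupSeminorm.toSeminormedAddCommGroup
  exact (inferInstance : IsUniformAddGroup (M ⊗[ℂ] N))

instance : UniformContinuousConstSMul ℂ (PreTensor ra la) := by
  refine ⟨fun c => ?_⟩
  refine uniformContinuous_iInf_rng.2 fun r => uniformContinuous_iInf_dom (i := r) ?_
  refine uniformContinuous_seminorm r.1 r.1 (LinearMap.lsmul ℂ (M ⊗[ℂ] N) c) ‖c‖₊ fun x => ?_
  simp [map_smul_eq_mul]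

/-- The completed projective tensor product `M ⊗̂_A N`: the Hausdorff completion of the
algebraic tensor product, i.e. the quotient of `M ⊗̂ N` by the closed subspace generated by
the elements `m a ⊗ n - m ⊗ a n`. -/
abbrev CTensor : Type _ := UniformSpace.Completion (PreTensor ra la)

namespace CTensor

/-- The element `m ⊗ n` of `M ⊗̂_A N`. -/
def tmul (m : M) (n : N) : CTensor ra la :=
  ((PreTensor.of ra la (m ⊗ₜ[ℂ] n) : PreTensor ra la) : UniformSpace.Completion (PreTensor ra la))

theorem zero_tmul (n : N) : tmul ra la 0 n = 0 := by
  rw [tmul, TensorProduct.zero_tmul, map_zero, UniformSpace.Completion.coe_zero]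

theorem tmul_zero (m : M) : tmul ra la m 0 = 0 := by
  rw [tmul, TensorProduct.tmul_zero, map_zero, UniformSpace.Completion.coe_zero]

theorem add_tmul (m m' : M) (n : N) :
    tmul ra la (m + m') n = tmul ra la m n + tmul ra la m' n := by
  rw [tmul, TensorProduct.add_tmul, map_add, UniformSpace.Completion.coe_add]
  rfl

theorem tmul_add (m : M) (n n' : N) :
    tmul ra la m (n + n') = tmul ra la m n + tmul ra la m n' := by
  rw [tmul, TensorProduct.tmul_add, map_add, UniformSpace.Completion.coe_add]
  rfl

variable {ra la la'}

/-- `id ⊗ f` before completion. -/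
def preMap (f : N →L[ℂ] N') (hf : ∀ a n, f (la a n) = la' a (f n)) :
    PreTensor ra la →L[ℂ] PreTensor ra la' where
  toLinearMap := (PreTensor.of ra la').toLinearMap ∘ₗ (f : N →ₗ[ℂ] N').lTensor M ∘ₗ
    (PreTensor.of ra la).symm.toLinearMap
  cont := by
    refine UniformContinuous.continuous ?_
    refine uniformContinuous_iInf_rng.2 fun r => ?_
    have hadm : Admissible ra la (r.1.comp ((f : N →ₗ[ℂ] N').lTensor M)) := by
      refine ⟨?_, fun m a n => ?_⟩
      · have := r.2.continuous_tmul.comp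
          ((continuous_fst (X := M) (Y := N)).prodMk (f.continuous.comp continuous_snd))
        simpa [Function.comp_def] using this
      · have := r.2.balanced m a (f n)
        simpa [map_sub, hf] using this
    refine uniformContinuous_iInf_dom (i := ⟨_, hadm⟩) ?_
    exact uniformContinuous_seminorm _ _ ((f : N →ₗ[ℂ] N').lTensor M) 1 fun x => by simp

/-- The continuous extension `id ⊗ f : M ⊗̂_A N → M ⊗̂_A N'` of a continuous `A`-linear map. -/
def map (f : N →L[ℂ] N') (hf : ∀ a n, f (la a n) = la' a (f n)) :
    CTensor ra la →L[ℂ] CTensor ra la' :=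
  (preMap (ra := ra) f hf).completion

theorem map_tmul (f : N →L[ℂ] N') (hf : ∀ a n, f (la a n) = la' a (f n)) (m : M) (n : N) :
    map (ra := ra) f hf (tmul ra la m n) = tmul ra la' m (f n) := by
  refine ((preMap (ra := ra) f hf).completion_apply_coe _).trans ?_
  rfl

theorem dense_tmul : Dense (Submodule.span ℂ {t | ∃ m n, t = tmul ra la m n} : Set (CTensor ra la)) := by
  refine Dense.mono ?_ (UniformSpace.Completion.denseRange_coe (α := PreTensor ra la))
  rintro _ ⟨x, rfl⟩
  have key : ∀ y : M ⊗[ℂ] N, ((PreTensor.of ra la y : PreTensor ra la) : CTensor ra la) ∈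
      Submodule.span ℂ {t | ∃ m n, t = tmul ra la m n} := by
    intro y
    induction y using TensorProduct.induction_on with
    | zero => rw [map_zero]; exact (Submodule.span ℂ _).zero_mem
    | tmul m n => exact Submodule.subset_span ⟨m, n, rfl⟩
    | add y z hy hz =>
      rw [map_add, UniformSpace.Completion.coe_add]
      exact (Submodule.span ℂ _).add_mem hy hz
  exact key ((PreTensor.of ra la).symm x)

end CTensor

/-- The completed projective tensor product `V ⊗̂ N` over `ℂ`. -/
abbrev CTensorC (V N : Type*) [AddCommGroup V] [Module ℂ V] [UniformSpace V]
    [AddCommGroup N] [Module ℂ N] [UniformSpace N] : Type _ :=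
  CTensor (LinearMap.lsmul ℂ V).flip (LinearMap.lsmul ℂ N)

end Tensor

/-! ### Curved differential graded algebras -/

/-- The data of a curved differential graded algebra with a topology: the total algebra, its
homogeneous parts, the differential and the curvature. -/
structure DGAData where
  carrier : Type u
  [ring : Ring carrier]
  [algebra : Algebra ℂ carrier]
  [uniform : UniformSpace carrier]
  gr : ℕ → Submodule ℂ carrier
  d : carrier →ₗ[ℂ] carrier
  curv : carrier

attribute [instance] DGAData.ring DGAData.algebra DGAData.uniform

instance : CoeSort DGAData.{u} (Type u) := ⟨DGAData.carrier⟩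

/-- The axioms of a Fréchet curved differential graded algebra. -/
structure IsCurvedDGA (𝒜 : DGAData.{u}) : Prop where
  frechet : IsFrechet 𝒜
  continuous_mul : Continuous fun p : 𝒜 × 𝒜 => p.1 * p.2
  continuous_d : Continuous 𝒜.d
  one_mem : (1 : 𝒜) ∈ 𝒜.gr 0
  mul_mem : ∀ {p q : ℕ} {a b : 𝒜}, a ∈ 𝒜.gr p → b ∈ 𝒜.gr q → a * b ∈ 𝒜.gr (p + q)
  internal : DirectSum.IsInternal 𝒜.gr
  isClosed_gr : ∀ p, IsClosed (𝒜.gr p : Set 𝒜)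
  d_mem : ∀ {p : ℕ} {a : 𝒜}, a ∈ 𝒜.gr p → 𝒜.d a ∈ 𝒜.gr (p + 1)
  leibniz : ∀ {p : ℕ} {a : 𝒜} (b : 𝒜), a ∈ 𝒜.gr p →
    𝒜.d (a * b) = 𝒜.d a * b + ((-1 : ℂ) ^ p) • (a * 𝒜.d b)
  d_d : ∀ a : 𝒜, 𝒜.d (𝒜.d a) = 𝒜.curv * a - a * 𝒜.curv
  curv_mem : 𝒜.curv ∈ 𝒜.gr 2
  d_curv : 𝒜.d 𝒜.curv = 0

/-- A Fréchet curved differential graded algebra `(𝒜, d, c)` over `ℂ`. -/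
structure CurvedDGA extends DGAData.{u} where
  isCurvedDGA : IsCurvedDGA toDGAData

instance : CoeSort CurvedDGA.{u} (Type u) := ⟨fun 𝒜 => 𝒜.carrier⟩

namespace CurvedDGA

/-- The degree zero part `A = 𝒜⁰`. -/
abbrev zero (𝒜 : CurvedDGA.{u}) : Type u := 𝒜.gr 0

variable (𝒜 : CurvedDGA.{u})

/-- Left multiplication of `A = 𝒜⁰` on `𝒜`. -/
def lmul0 : 𝒜.zero →ₗ[ℂ] 𝒜 →ₗ[ℂ] 𝒜 := LinearMap.mul ℂ 𝒜 ∘ₗ (𝒜.gr 0).subtype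

/-- Right multiplication by `b` on `𝒜`. -/
def mulRight (b : 𝒜) : 𝒜 →L[ℂ] 𝒜 where
  toLinearMap := LinearMap.mulRight ℂ b
  cont := 𝒜.isCurvedDGA.continuous_mul.comp (continuous_id.prodMk continuous_const)

theorem mulRight_lmul0 (b : 𝒜) (a : 𝒜.zero) (n : 𝒜) :
    𝒜.mulRight b (𝒜.lmul0 a n) = 𝒜.lmul0 a (𝒜.mulRight b n) :=
  mul_assoc _ _ _

/-- Right multiplication by `b ∈ A` on `A = 𝒜⁰`. -/
def mulRight0 (b : 𝒜.zero) : 𝒜.zero →L[ℂ] 𝒜.zero where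
  toLinearMap := (LinearMap.mulRight ℂ (b : 𝒜)).restrict fun _ ha =>
    𝒜.isCurvedDGA.mul_mem ha b.2
  cont := ((𝒜.mulRight b).continuous.comp continuous_subtype_val).subtype_mk _

end CurvedDGA

/-! ### Graded modules -/

/-- The data of a `ℤ`-graded right `A`-module with a topology, `A = 𝒜⁰`. -/
structure GrModule (𝒜 : CurvedDGA.{u}) where
  carrier : Type v
  [addCommGroup : AddCommGroup carrier]
  [module : Module ℂ carrier]
  [uniform : UniformSpace carrier]
  gr : ℤ → Submodule ℂ carrier
  ract : carrier →ₗ[ℂ] 𝒜.zero →ₗ[ℂ] carrier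

attribute [instance] GrModule.addCommGroup GrModule.module GrModule.uniform

instance (𝒜 : CurvedDGA.{u}) : CoeSort (GrModule.{u, v} 𝒜) (Type v) := ⟨GrModule.carrier⟩

namespace GrModule

variable {𝒜 : CurvedDGA.{u}} (E : GrModule.{u, v} 𝒜)

/-- `E` is a bounded `ℤ`-graded right Fréchet `A`-module. -/
structure IsFrechetModule : Prop where
  frechet : IsFrechet E
  continuous_ract : Continuous fun p : E × 𝒜.zero => E.ract p.1 p.2
  ract_one : ∀ (x : E) (a : 𝒜.zero), (a : 𝒜) = 1 → E.ract x a = x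
  ract_mul : ∀ (x : E) (a b c : 𝒜.zero), (c : 𝒜) = a * b → E.ract (E.ract x a) b = E.ract x c
  ract_mem : ∀ {i : ℤ} {x : E} (a : 𝒜.zero), x ∈ E.gr i → E.ract x a ∈ E.gr i
  internal : DirectSum.IsInternal E.gr
  isClosed_gr : ∀ i, IsClosed (E.gr i : Set E)
  bounded : ∃ n : ℕ, ∀ i : ℤ, (n : ℤ) < |i| → E.gr i = ⊥

/-- `E` is a relatively projective right `A`-module: a direct summand, through continuous
`A`-linear maps, of a relatively free module `V ⊗̂ A` with `V` a Fréchet space. -/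
def IsRelProjective : Prop :=
  ∃ (V : Type v) (_ : AddCommGroup V) (_ : Module ℂ V) (_ : UniformSpace V),
    IsFrechet V ∧ ∃ (s : E →L[ℂ] CTensorC V 𝒜.zero) (π : CTensorC V 𝒜.zero →L[ℂ] E),
      (∀ x, π (s x) = x) ∧
      (∀ x b, s (E.ract x b) =
        CTensor.map (𝒜.mulRight0 b) (fun c n => map_smul (𝒜.mulRight0 b) c n) (s x)) ∧
      ∀ t b, π (CTensor.map (𝒜.mulRight0 b) (fun c n => map_smul (𝒜.mulRight0 b) c n) t) =
        E.ract (π t) b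

/-- The completed tensor product `E ⊗̂_A 𝒜`. -/
abbrev T : Type max u v := CTensor E.ract 𝒜.lmul0

/-- The element `e ⊗ η` of `E ⊗̂_A 𝒜`. -/
abbrev tmul (e : E) (η : 𝒜) : E.T := CTensor.tmul E.ract 𝒜.lmul0 e η

/-- The element `e ⊗ 1` of `E ⊗̂_A 𝒜`. -/
abbrev incl (e : E) : E.T := E.tmul e 1

/-- The part of total degree `n` of `E ⊗̂_A 𝒜`. -/
def T.gr (n : ℤ) : Submodule ℂ E.T :=
  (Submodule.span ℂ {t | ∃ (i : ℤ) (j : ℕ) (e : E) (η : 𝒜),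
    i + j = n ∧ e ∈ E.gr i ∧ η ∈ 𝒜.gr j ∧ t = E.tmul e η}).topologicalClosure

/-- The part `E ⊗̂_A 𝒜ʲ` of `E ⊗̂_A 𝒜`. -/
def T.formDegree (j : ℕ) : Submodule ℂ E.T :=
  (Submodule.span ℂ {t | ∃ (e : E) (η : 𝒜), η ∈ 𝒜.gr j ∧ t = E.tmul e η}).topologicalClosure

/-- The right multiplication `t ↦ t · b` on `E ⊗̂_A 𝒜`. -/
def rmul (b : 𝒜) : E.T →L[ℂ] E.T := CTensor.map (𝒜.mulRight b) (𝒜.mulRight_lmul0 b)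

/-- A continuous `ℤ`-connection: a map of total degree one with the Leibniz rule. -/
structure IsZConnection (D : E.T →L[ℂ] E.T) : Prop where
  map_mem : ∀ {n : ℤ} {t : E.T}, t ∈ T.gr E n → D t ∈ T.gr E (n + 1)
  leibniz : ∀ {n : ℤ} {t : E.T} (b : 𝒜), t ∈ T.gr E n →
    D (E.rmul b t) = E.rmul b (D t) + ((-1 : ℂ) ^ n) • E.rmul (𝒜.d b) t

end GrModule

/-! ### The quasi-perfect category -/

/-- A quasi-perfect twisted complex `(E, 𝔼)` over `𝒜`. -/
structure QPObj (𝒜 : CurvedDGA.{u}) extends GrModule.{u, v} 𝒜 where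
  isFrechetModule : toGrModule.IsFrechetModule
  isRelProjective : toGrModule.IsRelProjective
  conn : toGrModule.T →L[ℂ] toGrModule.T
  isZConnection : toGrModule.IsZConnection conn
  curvature : ∀ e, conn (conn (toGrModule.incl e)) = -toGrModule.rmul 𝒜.curv (toGrModule.incl e)

namespace GrModule

variable {𝒜 : CurvedDGA.{u}} {E : GrModule.{u, v} 𝒜}

theorem rmul_tmul (b : 𝒜) (e : E) (η : 𝒜) : E.rmul b (E.tmul e η) = E.tmul e (η * b) :=
  CTensor.map_tmul _ _ _ _

end GrModule

namespace QPObj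

variable {𝒜 : CurvedDGA.{u}}

/-- The morphisms of degree `k`: the continuous maps `E₁ ⊗̂_A 𝒜 → E₂ ⊗̂_A 𝒜` of degree `k` that
are linear over the right action of `𝒜`. -/
def Hom (k : ℤ) (E₁ E₂ : QPObj.{u, v} 𝒜) : Submodule ℂ (E₁.T →L[ℂ] E₂.T) where
  carrier := {φ | (∀ (n : ℤ) (t : E₁.T), t ∈ GrModule.T.gr E₁.toGrModule n →
      φ t ∈ GrModule.T.gr E₂.toGrModule (n + k)) ∧
    ∀ (t : E₁.T) (a : 𝒜), φ (E₁.rmul a t) = E₂.rmul a (φ t)}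
  add_mem' := by
    rintro φ ψ ⟨h1, h2⟩ ⟨h3, h4⟩
    exact ⟨fun n t ht => Submodule.add_mem _ (h1 n t ht) (h3 n t ht), fun t a => by simp [h2, h4]⟩
  zero_mem' := ⟨fun n t _ => Submodule.zero_mem _, fun t a => by simp⟩
  smul_mem' := by
    rintro c φ ⟨h1, h2⟩
    exact ⟨fun n t ht => Submodule.smul_mem _ _ (h1 n t ht), fun t a => by simp [h2]⟩

/-- The identity morphism. -/
def id (E : QPObj.{u, v} 𝒜) : Hom 0 E E :=
  ⟨ContinuousLinearMap.id ℂ E.T, fun n t ht => by simpa using ht, fun _ _ => rfl⟩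

/-- Composition of morphisms. -/
def comp {k l : ℤ} {E₁ E₂ E₃ : QPObj.{u, v} 𝒜} (ψ : Hom l E₂ E₃) (φ : Hom k E₁ E₂) :
    Hom (k + l) E₁ E₃ :=
  ⟨ψ.1.comp φ.1, fun n t ht => by
    have := ψ.2.1 _ _ (φ.2.1 n t ht)
    rwa [add_assoc] at this, fun t a => by
    simp [φ.2.2, ψ.2.2]⟩

theorem dense_gr (E : QPObj.{u, v} 𝒜) :
    Dense (Submodule.span ℂ {t | ∃ n, t ∈ GrModule.T.gr E.toGrModule n} : Set E.T) := by
  refine CTensor.dense_tmul.mono (SetLike.coe_subset_coe.2 (Submodule.span_le.2 ?_))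
  rintro _ ⟨e, η, rfl⟩
  have he : e ∈ iSup E.gr := by
    rw [E.isFrechetModule.internal.submodule_iSup_eq_top]; trivial
  have hη : η ∈ iSup 𝒜.gr := by
    rw [𝒜.isCurvedDGA.internal.submodule_iSup_eq_top]; trivial
  show E.tmul e η ∈ Submodule.span ℂ {t | ∃ n, t ∈ GrModule.T.gr E.toGrModule n}
  induction he using Submodule.iSup_induction' with
  | zero => rw [GrModule.tmul, CTensor.zero_tmul]; exact Submodule.zero_mem _
  | add x y _ _ hx hy => rw [GrModule.tmul, CTensor.add_tmul]; exact Submodule.add_mem _ hx hy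
  | mem i x hx =>
    induction hη using Submodule.iSup_induction' with
    | zero => rw [GrModule.tmul, CTensor.tmul_zero]; exact Submodule.zero_mem _
    | add y z _ _ hy hz => rw [GrModule.tmul, CTensor.tmul_add]; exact Submodule.add_mem _ hy hz
    | mem j y hy =>
      exact Submodule.subset_span ⟨i + j, Submodule.le_topologicalClosure _
        (Submodule.subset_span ⟨i, j, x, y, rfl, hx, hy, rfl⟩)⟩

/-- The differential `dφ = 𝔼₂ φ - (-1)ᵏ φ 𝔼₁` on morphisms of degree `k`. -/
def d {k : ℤ} {E₁ E₂ : QPObj.{u, v} 𝒜} (φ : Hom k E₁ E₂) : Hom (k + 1) E₁ E₂ :=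
  ⟨E₂.conn.comp φ.1 - ((-1 : ℂ) ^ k) • φ.1.comp E₁.conn, by
    constructor
    · intro n t ht
      refine Submodule.sub_mem _ ?_ (Submodule.smul_mem _ _ ?_)
      · have := E₂.isZConnection.map_mem (φ.2.1 n t ht)
        rwa [add_assoc] at this
      · have := φ.2.1 _ _ (E₁.isZConnection.map_mem ht)
        rwa [add_assoc, add_comm 1 k] at this
    · intro t a
      set δ : E₁.T →L[ℂ] E₂.T := E₂.conn.comp φ.1 - ((-1 : ℂ) ^ k) • φ.1.comp E₁.conn with hδ
      have key : δ.comp (E₁.rmul a) = (E₂.rmul a).comp δ := by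
        refine ContinuousLinearMap.ext_on E₁.dense_gr ?_
        rintro t ⟨n, ht⟩
        have h1 := E₁.isZConnection.leibniz a ht
        have h2 := E₂.isZConnection.leibniz a (φ.2.1 n t ht)
        have h3 : ((-1 : ℂ) ^ (n + k)) = (-1) ^ k * (-1) ^ n := by
          rw [zpow_add₀ (by norm_num), mul_comm]
        simp only [hδ, ContinuousLinearMap.comp_apply, sub_apply,
          smul_apply, map_sub, map_smul, φ.2.2, h2]
        rw [h1, map_add, map_smul, φ.2.2, φ.2.2, h3, smul_add, smul_smul]
        abel
      exact DFunLike.congr_fun key t⟩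

end QPObj

/-- A DG functor `q𝒫_𝒜 → q𝒫_ℬ`: linear on morphisms of each degree, and compatible with
identities, compositions and differentials. -/
structure DGFunctor (𝒜 : CurvedDGA.{u}) (ℬ : CurvedDGA.{v}) where
  obj : QPObj.{u, w} 𝒜 → QPObj.{v, w} ℬ
  map : ∀ {k : ℤ} {E₁ E₂ : QPObj.{u, w} 𝒜},
    QPObj.Hom k E₁ E₂ →ₗ[ℂ] QPObj.Hom k (obj E₁) (obj E₂)
  map_id : ∀ E, map (QPObj.id E) = QPObj.id (obj E)
  map_comp : ∀ {k l : ℤ} {E₁ E₂ E₃ : QPObj.{u, w} 𝒜} (ψ : QPObj.Hom l E₂ E₃)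
    (φ : QPObj.Hom k E₁ E₂), map (QPObj.comp ψ φ) = QPObj.comp (map ψ) (map φ)
  map_d : ∀ {k : ℤ} {E₁ E₂ : QPObj.{u, w} 𝒜} (φ : QPObj.Hom k E₁ E₂),
    map (QPObj.d φ) = QPObj.d (map φ)

/-! ### Twisted bimodules -/

/-- The data of a twisted `𝒜`-`ℬ`-bimodule: a graded right `B`-module `X` with a left action of
`A = 𝒜⁰`, a left action of `𝒜` on `X ⊗̂_B ℬ`, and a map `𝕏` on `X ⊗̂_B ℬ`. -/
structure BimoduleData (𝒜 : CurvedDGA.{u}) (ℬ : CurvedDGA.{v}) extends GrModule.{v, w} ℬ where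
  lact0 : 𝒜.zero →ₗ[ℂ] carrier →ₗ[ℂ] carrier
  lact : 𝒜 →ₗ[ℂ] toGrModule.T →ₗ[ℂ] toGrModule.T
  conn : toGrModule.T →L[ℂ] toGrModule.T

/-- The axioms of a quasi-perfect twisted `𝒜`-`ℬ`-bimodule. -/
structure IsQPTwistedBimodule {𝒜 : CurvedDGA.{u}} {ℬ : CurvedDGA.{v}}
    (𝒳 : BimoduleData.{u, v, w} 𝒜 ℬ) : Prop where
  isFrechetModule : 𝒳.IsFrechetModule
  isRelProjective : 𝒳.IsRelProjective
  isZConnection : 𝒳.IsZConnection 𝒳.conn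
  continuous_lact0 : Continuous fun p : 𝒜.zero × 𝒳.carrier => 𝒳.lact0 p.1 p.2
  lact0_one : ∀ (a : 𝒜.zero) (x : 𝒳.carrier), (a : 𝒜) = 1 → 𝒳.lact0 a x = x
  lact0_mul : ∀ (a b c : 𝒜.zero) (x : 𝒳.carrier), (c : 𝒜) = a * b →
    𝒳.lact0 c x = 𝒳.lact0 a (𝒳.lact0 b x)
  lact0_mem : ∀ {i : ℤ} {x : 𝒳.carrier} (a : 𝒜.zero), x ∈ 𝒳.gr i → 𝒳.lact0 a x ∈ 𝒳.gr i
  lact0_ract : ∀ a x b, 𝒳.lact0 a (𝒳.ract x b) = 𝒳.ract (𝒳.lact0 a x) b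
  lact_incl : ∀ (a : 𝒜.zero) x, 𝒳.lact a (𝒳.incl x) = 𝒳.incl (𝒳.lact0 a x)
  continuous_lact : Continuous fun p : 𝒜 × 𝒳.T => 𝒳.lact p.1 p.2
  lact_one : ∀ t, 𝒳.lact 1 t = t
  lact_mul : ∀ a b t, 𝒳.lact (a * b) t = 𝒳.lact a (𝒳.lact b t)
  lact_mem : ∀ {p : ℕ} {n : ℤ} {a : 𝒜} {t : 𝒳.T}, a ∈ 𝒜.gr p →
    t ∈ GrModule.T.gr 𝒳.toGrModule n → 𝒳.lact a t ∈ GrModule.T.gr 𝒳.toGrModule (p + n)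
  lact_rmul : ∀ a t b, 𝒳.lact a (𝒳.rmul b t) = 𝒳.rmul b (𝒳.lact a t)
  leibniz : ∀ {p : ℕ} {a : 𝒜} (t : 𝒳.T), a ∈ 𝒜.gr p →
    𝒳.conn (𝒳.lact a t) = 𝒳.lact (𝒜.d a) t + ((-1 : ℂ) ^ p) • 𝒳.lact a (𝒳.conn t)
  curvature : ∀ t, 𝒳.conn (𝒳.conn t) = 𝒳.lact 𝒜.curv t - 𝒳.rmul ℬ.curv t

/-- `F` is the functor `𝒳_*`: it sends `(E, 𝔼)` to `E ⊗̂_A X` with the `ℤ`-connection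
`(𝔼 # 𝕏)(e ⊗ x) = 𝔼(e) · x + (-1)^|e| e ⊗ 𝕏(x)`, and a morphism `φ` to `e ⊗ x ↦ φ(e) · x`.
Here `θ` identifies `E ⊗̂_A X` with the module underlying `F E`, and `μ s t = s · t` is the
pairing of `s ∈ E ⊗̂_A 𝒜` with `t ∈ X ⊗̂_B ℬ`, with values in `E ⊗̂_A X ⊗̂_B ℬ`. -/
def IsPushforward {𝒜 : CurvedDGA.{u}} {ℬ : CurvedDGA.{v}} (𝒳 : BimoduleData.{u, v, w'} 𝒜 ℬ)
    (F : DGFunctor.{u, v, w} 𝒜 ℬ) : Prop :=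
  ∃ (θ : ∀ E : QPObj.{u, w} 𝒜, CTensor E.ract 𝒳.lact0 ≃L[ℂ] (F.obj E).carrier)
    (μ : ∀ E : QPObj.{u, w} 𝒜, E.T →ₗ[ℂ] 𝒳.T →ₗ[ℂ] (F.obj E).T),
    (∀ E n, (F.obj E).gr n = ((Submodule.span ℂ {t | ∃ (i j : ℤ) (e : E.carrier) (x : 𝒳.carrier),
      i + j = n ∧ e ∈ E.gr i ∧ x ∈ 𝒳.gr j ∧
        t = CTensor.tmul E.ract 𝒳.lact0 e x}).topologicalClosure).map (θ E).toLinearMap) ∧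
    (∀ E e x b, (F.obj E).ract (θ E (CTensor.tmul E.ract 𝒳.lact0 e x)) b =
      θ E (CTensor.tmul E.ract 𝒳.lact0 e (𝒳.ract x b))) ∧
    (∀ E, Continuous fun p : E.T × 𝒳.T => μ E p.1 p.2) ∧
    (∀ E e x b, μ E (E.incl e) (𝒳.tmul x b) =
      (F.obj E).tmul (θ E (CTensor.tmul E.ract 𝒳.lact0 e x)) b) ∧
    (∀ E s a t, μ E (E.rmul a s) t = μ E s (𝒳.lact a t)) ∧
    (∀ (E : QPObj.{u, w} 𝒜) (n : ℤ) (s : E.T) (t : 𝒳.T), s ∈ GrModule.T.gr E.toGrModule n → (F.obj E).conn (μ E s t) =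
      μ E (E.conn s) t + ((-1 : ℂ) ^ n) • μ E s (𝒳.conn t)) ∧
    ∀ (k : ℤ) (E₁ E₂ : QPObj.{u, w} 𝒜) (φ : QPObj.Hom k E₁ E₂) s t,
      (F.map φ).1 (μ E₁ s t) = μ E₂ (φ.1 s) t


/-! ### Antiholomorphic forms on a complex vector space -/

section LinearForms

variable {E F G : Type*} [NormedAddCommGroup E] [NormedSpace ℂ E] [FiniteDimensional ℂ E]
  [NormedAddCommGroup F] [NormedSpace ℂ F] [FiniteDimensional ℂ F]
  [NormedAddCommGroup G] [NormedSpace ℂ G] [FiniteDimensional ℂ G]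

/-- The conjugate-linear functionals on `E`: the covectors of type `(0,1)`. -/
abbrev ConjDual (E : Type*) [NormedAddCommGroup E] [NormedSpace ℂ E] : Type _ := E →ₗ⋆[ℂ] ℂ

instance : Module.Finite ℂ (ConjDual E) := by
  let b := Module.finBasis ℂ E
  let f : ConjDual E →ₗ[ℂ] (Fin (Module.finrank ℂ E) → ℂ) :=
    { toFun := fun α i => α (b i)
      map_add' := fun _ _ => rfl
      map_smul' := fun _ _ => rfl }
  refine Module.Finite.of_injective f fun α β h => b.ext fun i => congrFun h i

/-- The exterior algebra of the space of `(0,1)`-covectors: the values of `(0,•)`-forms. -/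
def ExtConj (E : Type*) [NormedAddCommGroup E] [NormedSpace ℂ E] : Type _ :=
  ExteriorAlgebra ℂ (ConjDual E)

instance : Ring (ExtConj E) := inferInstanceAs (Ring (ExteriorAlgebra ℂ (ConjDual E)))
instance : Algebra ℂ (ExtConj E) :=
  inferInstanceAs (Algebra ℂ (ExteriorAlgebra ℂ (ConjDual E)))

instance : Module.Finite ℂ (ExtConj E) :=
  Module.Finite.of_basis (Module.finBasis ℂ (ConjDual E)).ExteriorAlgebra

/-- The coordinate norm on the finite dimensional space `ExtConj E`. -/
instance : NormedAddCommGroup (ExtConj E) :=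
  NormedAddCommGroup.induced (ExtConj E) (Fin (Module.finrank ℂ (ExtConj E)) → ℂ)
    (Module.finBasis ℂ (ExtConj E)).equivFun (Module.finBasis ℂ (ExtConj E)).equivFun.injective

instance : NormedSpace ℂ (ExtConj E) :=
  NormedSpace.induced ℂ (ExtConj E) (Fin (Module.finrank ℂ (ExtConj E)) → ℂ)
    (Module.finBasis ℂ (ExtConj E)).equivFun

instance : FiniteDimensional ℝ (ExtConj E) := FiniteDimensional.complexToReal _

/-- A covector of type `(0,1)` as an element of the exterior algebra. -/
def ExtConj.ι : ConjDual E →ₗ[ℂ] ExtConj E := ExteriorAlgebra.ι ℂ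

/-- The elements of type `(0,q)`. -/
def ExtConj.gr (E : Type*) [NormedAddCommGroup E] [NormedSpace ℂ E] (q : ℕ) :
    Submodule ℂ (ExtConj E) := ⋀[ℂ]^q (ConjDual E)

/-- The pullback of `(0,1)`-covectors along a linear map. -/
def pullConj (L : E →L[ℂ] F) : ConjDual F →ₗ[ℂ] ConjDual E where
  toFun α := α.comp (L : E →ₗ[ℂ] F)
  map_add' _ _ := rfl
  map_smul' _ _ := rfl

/-- The pullback of `(0,•)`-covectors along a linear map. -/
def pull (L : E →L[ℂ] F) : ExtConj F →ₐ[ℂ] ExtConj E :=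
  ExteriorAlgebra.map (pullConj L)

theorem pull_ι (L : E →L[ℂ] F) (α : ConjDual F) :
    pull L (ExtConj.ι α) = ExtConj.ι (pullConj L α) :=
  ExteriorAlgebra.map_apply_ι _ _

theorem ExtConj.hom_ext {f g : ExtConj F →ₐ[ℂ] ExtConj E}
    (h : ∀ α, f (ExtConj.ι α) = g (ExtConj.ι α)) : f = g :=
  ExteriorAlgebra.hom_ext (LinearMap.ext h)

/-- The `(0,1)`-covector `dz̄ⱼ` of the linear coordinates `z` given by a basis of `E`. -/
def dzbar (j : Fin (Module.finrank ℂ E)) : ConjDual E where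
  toFun v := starRingEnd ℂ ((Module.finBasis ℂ E).repr v j)
  map_add' _ _ := by simp
  map_smul' _ _ := by simp

/-- `(D v + i D (i v)) / 2`; for `D` the derivative of `f` this is the derivative of `f` along
`v` of type `(0,1)`. -/
def conjPart (D : E →L[ℝ] ExtConj F) (v : E) : ExtConj F :=
  (2⁻¹ : ℂ) • (D v + Complex.I • D (Complex.I • v))

/-- `∑ⱼ P*dz̄ⱼ ∧ ∂f/∂z̄ⱼ` with `D` the derivative of `f`. For `P = id` this is `∂̄f`; for `P` the
projection to a direct summand it is the part of `∂̄f` along this summand. -/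
def wedgeDeriv (P : E →L[ℂ] E) (D : E →L[ℝ] ExtConj E) : ExtConj E :=
  ∑ j, ExtConj.ι (pullConj P (dzbar j)) * conjPart D (Module.finBasis ℂ E j)

theorem pull_comp (L : E →L[ℂ] F) (L' : F →L[ℂ] G) (x : ExtConj G) :
    pull L (pull L' x) = pull (L'.comp L) x := by
  have : (pull L).comp (pull L') = pull (L'.comp L) := by
    refine ExtConj.hom_ext fun α => ?_
    simp only [AlgHom.comp_apply, AlgHom.id_apply, pull_ι]
    rfl
  exact DFunLike.congr_fun this x

theorem pull_id (x : ExtConj E) : pull (ContinuousLinearMap.id ℂ E) x = x := by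
  have : pull (ContinuousLinearMap.id ℂ E) = AlgHom.id ℂ (ExtConj E) := by
    refine ExtConj.hom_ext fun α => ?_
    simp only [AlgHom.comp_apply, AlgHom.id_apply, pull_ι]
    rfl
  exact DFunLike.congr_fun this x

theorem conjDual_eq_sum (α : ConjDual E) :
    α = ∑ j, α (Module.finBasis ℂ E j) • dzbar j := by
  refine (Module.finBasis ℂ E).ext fun k => ?_
  simp [dzbar, Finsupp.single_apply]

theorem conjPart_add (D D' : E →L[ℝ] ExtConj F) (v : E) :
    conjPart (D + D') v = conjPart D v + conjPart D' v := by
  simp only [conjPart, add_apply, smul_add]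
  abel

theorem wedgeDeriv_add (P : E →L[ℂ] E) (D D' : E →L[ℝ] ExtConj E) :
    wedgeDeriv P (D + D') = wedgeDeriv P D + wedgeDeriv P D' := by
  simp only [wedgeDeriv, conjPart_add, mul_add, Finset.sum_add_distrib]

theorem wedgeDeriv_smul (P : E →L[ℂ] E) (c : ℝ) (D : E →L[ℝ] ExtConj E) :
    wedgeDeriv P (c • D) = c • wedgeDeriv P D := by
  have : ∀ v, conjPart (c • D) v = (c : ℂ) • conjPart D v := by
    intro v
    simp only [conjPart, smul_apply, ← Complex.coe_smul, smul_add, smul_smul]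
    congr 2 <;> ring_nf
  simp only [wedgeDeriv, this, mul_smul_comm, ← Finset.smul_sum, Complex.coe_smul]

/-- `wedgeDeriv P` as a continuous real-linear map. -/
def wedgeDerivL (P : E →L[ℂ] E) : (E →L[ℝ] ExtConj E) →L[ℝ] ExtConj E :=
  haveI : FiniteDimensional ℝ E := FiniteDimensional.complexToReal E
  LinearMap.toContinuousLinearMap
    { toFun := wedgeDeriv P
      map_add' := wedgeDeriv_add P
      map_smul' := wedgeDeriv_smul P }

theorem conjPart_smul (D : E →L[ℝ] ExtConj F) (c : ℂ) (v : E) :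
    conjPart D (c • v) = starRingEnd ℂ c • conjPart D v := by
  have h : ∀ (r : ℝ) (w : E), D ((r : ℂ) • w) = (r : ℂ) • D w := by
    intro r w
    rw [Complex.coe_smul, map_smul, Complex.coe_smul]
  have h1 : c • v = (c.re : ℂ) • v + (c.im : ℂ) • (Complex.I • v) := by
    rw [smul_smul, ← add_smul, Complex.re_add_im]
  have h2 : Complex.I • (c • v) = (c.re : ℂ) • (Complex.I • v) + ((-c.im : ℝ) : ℂ) • v := by
    rw [h1, smul_add, smul_smul, smul_smul, smul_smul, smul_smul]
    congr 1
    · rw [mul_comm]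
    · congr 1
      push_cast
      linear_combination (c.im : ℂ) * Complex.I_mul_I
  have h3 : starRingEnd ℂ c = c.re - c.im * Complex.I := by
    rw [Complex.ext_iff]; simp
  have h4 : D (c • v) = (c.re : ℂ) • D v + (c.im : ℂ) • D (Complex.I • v) := by
    rw [h1, map_add, h, h]
  have h5 : D (Complex.I • (c • v)) = (c.re : ℂ) • D (Complex.I • v) - (c.im : ℂ) • D v := by
    rw [h2, map_add, h, h]
    push_cast
    rw [neg_smul, sub_eq_add_neg]
  rw [conjPart, h4, h5, conjPart, h3]
  have h6 : (c.im : ℂ) • D (Complex.I • v) =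
      -((c.im : ℂ) * Complex.I * Complex.I) • D (Complex.I • v) := by
    rw [mul_assoc, Complex.I_mul_I]; simp
  rw [h6]
  module

theorem conjPart_comp (A : E →L[ℂ] F) (D : F →L[ℝ] ExtConj G) (v : E) :
    conjPart (D.comp (A.restrictScalars ℝ)) v = conjPart D (A v) := by
  simp [conjPart]

/-- Naturality of `∑ⱼ dz̄ⱼ ∧ ∂/∂z̄ⱼ` under complex linear maps. -/
theorem wedgeDeriv_pull (A : E →L[ℂ] E) (D : E →L[ℝ] ExtConj E) :
    wedgeDeriv (ContinuousLinearMap.id ℂ E)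
      ((((pull A).toLinearMap.toContinuousLinearMap).restrictScalars ℝ).comp
        (D.comp (A.restrictScalars ℝ))) =
      pull A (wedgeDeriv (ContinuousLinearMap.id ℂ E) D) := by
  have h1 : ∀ v, conjPart ((((pull A).toLinearMap.toContinuousLinearMap).restrictScalars ℝ).comp
        (D.comp (A.restrictScalars ℝ))) v = pull A (conjPart D (A v)) := by
    intro v
    simp [conjPart]
  have h2 : ∀ v : E, conjPart D v = ∑ k, starRingEnd ℂ ((Module.finBasis ℂ E).repr v k) •
      conjPart D (Module.finBasis ℂ E k) := by
    intro v
    have hadd : ∀ x y, conjPart D (x + y) = conjPart D x + conjPart D y := by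
      intro x y
      simp only [conjPart, smul_add, map_add]
      abel
    let f : E →ₗ⋆[ℂ] ExtConj E :=
      { toFun := conjPart D, map_add' := hadd, map_smul' := conjPart_smul D }
    have : f v = f (∑ k, (Module.finBasis ℂ E).repr v k • Module.finBasis ℂ E k) := by
      rw [(Module.finBasis ℂ E).sum_repr]
    rw [map_sum] at this
    refine this.trans (Finset.sum_congr rfl fun k _ => ?_)
    exact conjPart_smul D _ _
  have h3 : ∀ k, pull A (ExtConj.ι (dzbar k)) = ∑ j : Fin (Module.finrank ℂ E),
      starRingEnd ℂ ((Module.finBasis ℂ E).repr (A (Module.finBasis ℂ E j)) k) •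
        ExtConj.ι (dzbar j) := by
    intro k
    rw [pull_ι, conjDual_eq_sum (pullConj A (dzbar k)), map_sum]
    refine Finset.sum_congr rfl fun j _ => ?_
    rw [map_smul]
    rfl
  have h4 : ∀ α : ConjDual E, pullConj (ContinuousLinearMap.id ℂ E) α = α := fun α => rfl
  simp only [wedgeDeriv, h1, h4, map_sum, map_mul, h3]
  conv_lhs => enter [2, j]; rw [h2, map_sum, Finset.mul_sum]
  rw [Finset.sum_comm]
  refine Finset.sum_congr rfl fun k _ => ?_
  rw [Finset.sum_mul]
  refine Finset.sum_congr rfl fun j _ => ?_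
  rw [map_smul, mul_smul_comm, smul_mul_assoc]

theorem wedgeDeriv_eq (D : E →L[ℝ] ExtConj E) :
    wedgeDeriv (ContinuousLinearMap.id ℂ E) D =
      ∑ j, ExtConj.ι (dzbar j) * conjPart D (Module.finBasis ℂ E j) := rfl

theorem ExtConj.ι_mul_ι (α β : ConjDual E) :
    ExtConj.ι α * ExtConj.ι β = -(ExtConj.ι β * ExtConj.ι α) := by
  have h : ∀ γ : ConjDual E, ExtConj.ι γ * ExtConj.ι γ = 0 := fun γ =>
    ExteriorAlgebra.ι_sq_zero γ
  have h1 := h (α + β)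
  rw [map_add, add_mul, mul_add, mul_add, h, h, zero_add, add_zero] at h1
  exact eq_neg_of_add_eq_zero_left h1

theorem ExtConj.induction {p : ExtConj E → Prop} (h0 : ∀ c : ℂ, p (algebraMap ℂ _ c))
    (hadd : ∀ x y, p x → p y → p (x + y)) (hι : ∀ x α, p x → p (ExtConj.ι α * x))
    (x : ExtConj E) : p x :=
  CliffordAlgebra.left_induction (0 : QuadraticForm ℂ (ConjDual E)) (P := p) h0 hadd hι x

/-- Left multiplication as a continuous real-linear map. -/
def ExtConj.mulL (x : ExtConj E) : ExtConj E →L[ℝ] ExtConj E :=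
  ((LinearMap.mulLeft ℂ x).toContinuousLinearMap).restrictScalars ℝ

/-- Pullbacks of constant forms along holomorphic maps are `∂̄`-closed. -/
theorem hasFDerivAt_pull {φ : E → E} {z : E} (hφ : ContDiffAt ℂ 2 φ z) (b : ExtConj E) :
    ∃ D : E →L[ℝ] ExtConj E, HasFDerivAt (fun w => pull (fderiv ℂ φ w) b) D z ∧
      wedgeDeriv (ContinuousLinearMap.id ℂ E) D = 0 := by
  have : FiniteDimensional ℝ E := FiniteDimensional.complexToReal E
  induction b using ExtConj.induction with
  | h0 c =>
    refine ⟨0, ?_, ?_⟩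
    · simp only [AlgHom.commutes]
      exact hasFDerivAt_const _ _
    · simp [wedgeDeriv, conjPart]
  | hadd x y hx hy =>
    obtain ⟨D, hD, h0⟩ := hx
    obtain ⟨D', hD', h0'⟩ := hy
    refine ⟨D + D', ?_, ?_⟩
    · simp only [map_add]
      exact hD.add hD'
    · rw [wedgeDeriv_add, h0, h0', add_zero]
  | hι x β hx =>
    obtain ⟨D, hD, hD0⟩ := hx
    let bE := Module.finBasis ℂ E
    have hd1 : ContDiffAt ℂ 1 (fderiv ℂ φ) z := hφ.fderiv_right (by norm_num)
    let S := fderiv ℂ (fderiv ℂ φ) z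
    have hS : HasFDerivAt (fderiv ℂ φ) S z := (hd1.differentiableAt (by norm_num)).hasFDerivAt
    have hsymm : ∀ v w, S v w = S w v := by
      intro v w
      exact (hφ.isSymmSndFDerivAt (by simp)).eq v w
    let βR : E →L[ℝ] ℂ := LinearMap.toContinuousLinearMap
      { toFun := β
        map_add' := map_add β
        map_smul' := fun r v => by
          rw [← Complex.coe_smul, map_smulₛₗ]
          simp }
    have hβR : ∀ v, βR v = β v := fun _ => rfl
    let c' : Fin (Module.finrank ℂ E) → E →L[ℝ] ℂ := fun j =>
      βR.comp (((ContinuousLinearMap.apply ℂ E (bE j)).comp S).restrictScalars ℝ)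
    have hc' : ∀ j v, c' j v = β (S v (bE j)) := fun j v => rfl
    have hc : ∀ j, HasFDerivAt (fun w => β (fderiv ℂ φ w (bE j))) (c' j) z := by
      intro j
      have h1 : HasFDerivAt (fun w => fderiv ℂ φ w (bE j))
          ((ContinuousLinearMap.apply ℂ E (bE j)).comp S) z :=
        (ContinuousLinearMap.apply ℂ E (bE j)).hasFDerivAt.comp z hS
      exact βR.hasFDerivAt.comp z (h1.restrictScalars ℝ)
    let X : Fin (Module.finrank ℂ E) → ExtConj E := fun j =>
      ExtConj.ι (dzbar j) * pull (fderiv ℂ φ z) x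
    let Dj : Fin (Module.finrank ℂ E) → E →L[ℝ] ExtConj E := fun j =>
      β (fderiv ℂ φ z (bE j)) • ((ExtConj.ι (dzbar j)).mulL.comp D) + (c' j).smulRight (X j)
    have hDj : ∀ j v, Dj j v = β (fderiv ℂ φ z (bE j)) • (ExtConj.ι (dzbar j) * D v) +
      β (S v (bE j)) • X j := fun j v => rfl
    refine ⟨∑ j, Dj j, ?_, ?_⟩
    · have hfun : (fun w => pull (fderiv ℂ φ w) (ExtConj.ι β * x)) = fun w =>
          ∑ j, β (fderiv ℂ φ w (bE j)) • (ExtConj.ι (dzbar j)).mulL (pull (fderiv ℂ φ w) x) := by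
        funext w
        rw [map_mul, pull_ι, conjDual_eq_sum (pullConj (fderiv ℂ φ w) β), map_sum,
          Finset.sum_mul]
        refine Finset.sum_congr rfl fun j _ => ?_
        rw [map_smul, smul_mul_assoc]
        rfl
      rw [hfun]
      refine HasFDerivAt.fun_sum fun j _ => ?_
      exact (hc j).smul ((ExtConj.ι (dzbar j)).mulL.hasFDerivAt.comp z hD)
    · have hconj : ∀ v, conjPart (∑ j, Dj j) v = ∑ j, (β (fderiv ℂ φ z (bE j)) •
          (ExtConj.ι (dzbar j) * conjPart D v) + β (S v (bE j)) • X j) := by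
        intro v
        have hS' : ∀ j, β (S (Complex.I • v) (bE j)) = -Complex.I * β (S v (bE j)) := by
          intro j
          rw [map_smul, smul_apply, map_smulₛₗ, Complex.conj_I, smul_eq_mul]
        simp only [conjPart, sum_apply, hDj, hS', Finset.smul_sum,
          ← Finset.sum_add_distrib, mul_add, mul_smul_comm]
        refine Finset.sum_congr rfl fun j _ => ?_
        have hII : (-Complex.I * β (S v (bE j))) • X j = -(Complex.I • (β (S v (bE j)) • X j)) := by
          rw [neg_mul, neg_smul, smul_smul]
        have hIII : Complex.I • Complex.I • (β (S v (bE j)) • X j) = -(β (S v (bE j)) • X j) := by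
          rw [smul_smul, Complex.I_mul_I, neg_one_smul]
        rw [hII, smul_add Complex.I, smul_neg Complex.I, hIII]
        module
      have hsym : ∑ k, ∑ j, ExtConj.ι (dzbar k) * (β (S (bE k) (bE j)) • X j) = 0 := by
        have h1 : ∑ k, ∑ j, ExtConj.ι (dzbar k) * (β (S (bE k) (bE j)) • X j) =
            -∑ k, ∑ j, ExtConj.ι (dzbar k) * (β (S (bE k) (bE j)) • X j) := by
          conv_rhs => rw [Finset.sum_comm]
          rw [← Finset.sum_neg_distrib]
          refine Finset.sum_congr rfl fun k _ => ?_
          rw [← Finset.sum_neg_distrib]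
          refine Finset.sum_congr rfl fun j _ => ?_
          rw [hsymm (bE j) (bE k), mul_smul_comm, mul_smul_comm, ← smul_neg]
          congr 1
          simp only [X]
          rw [← mul_assoc, ← mul_assoc, ExtConj.ι_mul_ι, neg_mul]
        have h2 := add_eq_zero_iff_eq_neg.2 h1
        rw [← two_smul ℂ] at h2
        exact (smul_eq_zero.1 h2).resolve_left two_ne_zero
      rw [wedgeDeriv_eq] at hD0
      rw [wedgeDeriv_eq]
      simp only [hconj, Finset.mul_sum, mul_add, Finset.sum_add_distrib]
      rw [hsym, add_zero, Finset.sum_comm]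
      refine Finset.sum_eq_zero fun j _ => ?_
      have h3 : ∀ k, ExtConj.ι (dzbar k) * (β (fderiv ℂ φ z (bE j)) •
          (ExtConj.ι (dzbar j) * conjPart D (bE k))) = (-β (fderiv ℂ φ z (bE j))) •
            (ExtConj.ι (dzbar j) * (ExtConj.ι (dzbar k) * conjPart D (bE k))) := by
        intro k
        rw [mul_smul_comm, ← mul_assoc, ← mul_assoc, ExtConj.ι_mul_ι (dzbar k), neg_mul, smul_neg,
          neg_smul]
      refine (Finset.sum_congr rfl fun k _ => h3 k).trans ?_
      rw [← Finset.smul_sum, ← Finset.mul_sum, hD0, mul_zero, smul_zero]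

theorem ExtConj.eq_sum (x : ExtConj E) : x = ∑ i, (Module.finBasis ℂ (ExtConj E)).repr x i •
    Module.finBasis ℂ (ExtConj E) i := ((Module.finBasis ℂ (ExtConj E)).sum_repr x).symm

theorem wedgeDeriv_sum {ι : Type*} (s : Finset ι) (P : E →L[ℂ] E) (D : ι → E →L[ℝ] ExtConj E) :
    wedgeDeriv P (∑ i ∈ s, D i) = ∑ i ∈ s, wedgeDeriv P (D i) :=
  map_sum (wedgeDerivL P) D s

/-- Naturality of `∂̄` under holomorphic maps. -/
theorem wedgeDeriv_fderiv_pull {φ : E → E} {z : E} (hφ : ContDiffAt ℂ 2 φ z)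
    {g : E → ExtConj E} (hg : DifferentiableAt ℝ g (φ z)) :
    wedgeDeriv (ContinuousLinearMap.id ℂ E)
      (fderiv ℝ (fun w => pull (fderiv ℂ φ w) (g (φ w))) z) =
    pull (fderiv ℂ φ z) (wedgeDeriv (ContinuousLinearMap.id ℂ E) (fderiv ℝ g (φ z))) := by
  let B := Module.finBasis ℂ (ExtConj E)
  choose D hD hD0 using fun i => hasFDerivAt_pull hφ (B i)
  have hφ1 : HasFDerivAt φ ((fderiv ℂ φ z).restrictScalars ℝ) z :=
    ((hφ.differentiableAt (by norm_num)).hasFDerivAt).restrictScalars ℝ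
  let co : Fin (Module.finrank ℂ (ExtConj E)) → ExtConj E →L[ℝ] ℂ := fun i =>
    ((B.coord i).toContinuousLinearMap).restrictScalars ℝ
  have hco : ∀ i x, co i x = B.repr x i := fun i x => rfl
  let G := (fderiv ℝ g (φ z)).comp ((fderiv ℂ φ z).restrictScalars ℝ)
  have hG : HasFDerivAt (fun w => g (φ w)) G z := hg.hasFDerivAt.comp z hφ1
  have hderiv : HasFDerivAt (fun w => pull (fderiv ℂ φ w) (g (φ w)))
      (∑ i, (co i (g (φ z)) • D i + ((co i).comp G).smulRight (pull (fderiv ℂ φ z) (B i)))) z := by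
    have hfun : (fun w => pull (fderiv ℂ φ w) (g (φ w))) = fun w =>
        ∑ i, co i (g (φ w)) • pull (fderiv ℂ φ w) (B i) := by
      funext w
      conv_lhs => rw [ExtConj.eq_sum (g (φ w)), map_sum]
      refine Finset.sum_congr rfl fun i _ => ?_
      rw [map_smul]
      rfl
    rw [hfun]
    refine HasFDerivAt.fun_sum fun i _ => ?_
    exact ((co i).hasFDerivAt.comp z hG).smul (hD i)
  rw [hderiv.fderiv, ← wedgeDeriv_pull]
  have hsum : ∑ i, ((co i).comp G).smulRight (pull (fderiv ℂ φ z) (B i)) =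
      (((pull (fderiv ℂ φ z)).toLinearMap.toContinuousLinearMap).restrictScalars ℝ).comp G := by
    ext v
    rw [sum_apply]
    show ∑ i, B.repr (G v) i • pull (fderiv ℂ φ z) (B i) = pull (fderiv ℂ φ z) (G v)
    conv_rhs => rw [ExtConj.eq_sum (G v), map_sum]
    refine Finset.sum_congr rfl fun i _ => ?_
    rw [map_smul]
  rw [Finset.sum_add_distrib, wedgeDeriv_add, hsum, wedgeDeriv_sum]
  have : ∀ i, wedgeDeriv (ContinuousLinearMap.id ℂ E) (co i (g (φ z)) • D i) = 0 := by
    intro i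
    have h1 : ∀ v, conjPart (co i (g (φ z)) • D i) v = co i (g (φ z)) • conjPart (D i) v := by
      intro v
      simp only [conjPart, smul_apply, smul_add, smul_smul]
      congr 2 <;> ring
    have h2 := hD0 i
    rw [wedgeDeriv_eq] at h2 ⊢
    simp only [h1, mul_smul_comm]
    rw [← Finset.smul_sum, h2, smul_zero]
  simp only [this, Finset.sum_const_zero, zero_add]
  rfl

end LinearForms

/-! ### Dolbeault forms on a complex manifold -/

section Manifold

variable {E : Type*} [NormedAddCommGroup E] [NormedSpace ℂ E] [FiniteDimensional ℂ E]
  {H : Type*} [TopologicalSpace H] (I : ModelWithCorners ℂ E H) [I.Boundaryless]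
  {X : Type*} [TopologicalSpace X] [ChartedSpace H X] [IsManifold I ω X]

/-- The expression in the preferred chart at `x₀` of a section `η` of `Λ•(T*⁰'¹X)`, where the
value `η p` is read in the preferred chart at `p`, through which `T_p X` is identified with `E`. -/
def inChart (η : X → ExtConj E) (x₀ : X) (z : E) : ExtConj E :=
  pull (tangentCoordChange I x₀ ((extChartAt I x₀).symm z) ((extChartAt I x₀).symm z))
    (η ((extChartAt I x₀).symm z))

/-- Smoothness of a section of `Λ•(T*⁰'¹X)`. -/
def IsSmoothForm (η : X → ExtConj E) : Prop :=
  ∀ x₀ : X, ContDiffOn ℝ ∞ (inChart I η x₀) (extChartAt I x₀).target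

/-- The part `∑ⱼ P*dz̄ⱼ ∧ ∂η/∂z̄ⱼ` of `∂̄η`, computed at `x` in the preferred chart at `x`. For
`P = id` this is `∂̄η`. -/
def dbarAlong (P : E →L[ℂ] E) (η : X → ExtConj E) (x : X) : ExtConj E :=
  wedgeDeriv P (fderiv ℝ (inChart I η x) (extChartAt I x x))

variable {I}

theorem inChart_self (η : X → ExtConj E) (x : X) : inChart I η x (extChartAt I x x) = η x := by
  rw [inChart, extChartAt_to_inv]
  have : tangentCoordChange I x x x = ContinuousLinearMap.id ℂ E :=
    ContinuousLinearMap.ext fun v => tangentCoordChange_self (mem_extChartAt_source x)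
  rw [this, pull_id]

theorem inChart_change (η : X → ExtConj E) (x₀ x₁ : X) {z : E}
    (hz : z ∈ (extChartAt I x₀).target)
    (hz' : (extChartAt I x₀).symm z ∈ (extChartAt I x₁).source) :
    inChart I η x₀ z = pull (fderiv ℂ (extChartAt I x₁ ∘ (extChartAt I x₀).symm) z)
      (inChart I η x₁ ((extChartAt I x₁ ∘ (extChartAt I x₀).symm) z)) := by
  rw [inChart, inChart, Function.comp_apply, (extChartAt I x₁).left_inv hz', pull_comp]
  congr 2
  have h1 : fderiv ℂ (extChartAt I x₁ ∘ (extChartAt I x₀).symm) z =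
      tangentCoordChange I x₀ x₁ ((extChartAt I x₀).symm z) := by
    rw [tangentCoordChange_def, I.range_eq_univ, fderivWithin_univ,
      (extChartAt I x₀).right_inv hz]
  refine ContinuousLinearMap.ext fun v => ?_
  rw [h1, ContinuousLinearMap.comp_apply, tangentCoordChange_comp]
  exact ⟨⟨(extChartAt I x₀).map_target hz, hz'⟩, mem_extChartAt_source _⟩

theorem contDiffAt_change (x₀ x₁ : X) {z : E}
    (hz : z ∈ (extChartAt I x₀).target)
    (hz' : (extChartAt I x₀).symm z ∈ (extChartAt I x₁).source) :
    ContDiffAt ℂ 2 (extChartAt I x₁ ∘ (extChartAt I x₀).symm) z := by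
  have h := contDiffWithinAt_ext_coord_change (I := I) (n := ω) x₁ x₀ (y := z) (by
    rw [PartialEquiv.trans_source]
    exact ⟨hz, hz'⟩)
  rw [I.range_eq_univ, contDiffWithinAt_univ] at h
  exact h.of_le le_top

theorem inChart_dbar {η : X → ExtConj E} (hη : IsSmoothForm I η) (x₀ : X) {z : E}
    (hz : z ∈ (extChartAt I x₀).target) :
    inChart I (dbarAlong I (ContinuousLinearMap.id ℂ E) η) x₀ z =
      wedgeDeriv (ContinuousLinearMap.id ℂ E) (fderiv ℝ (inChart I η x₀) z) := by
  set p := (extChartAt I x₀).symm z with hp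
  have hps : p ∈ (extChartAt I p).source := mem_extChartAt_source p
  have hev : ∀ᶠ w in 𝓝 z, inChart I η x₀ w =
      pull (fderiv ℂ (extChartAt I p ∘ (extChartAt I x₀).symm) w)
        (inChart I η p ((extChartAt I p ∘ (extChartAt I x₀).symm) w)) := by
    have h1 : (extChartAt I x₀).target ∈ 𝓝 z := (isOpen_extChartAt_target x₀).mem_nhds hz
    have h2 : ∀ᶠ w in 𝓝 z, (extChartAt I x₀).symm w ∈ (extChartAt I p).source :=
      (continuousAt_extChartAt_symm'' hz).eventually
        ((isOpen_extChartAt_source p).mem_nhds hps)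
    filter_upwards [h1, h2] with w hw hw'
    exact inChart_change η x₀ p hw hw'
  rw [Filter.EventuallyEq.fderiv_eq hev, wedgeDeriv_fderiv_pull (contDiffAt_change x₀ p hz hps)]
  · rw [inChart_change _ x₀ p hz hps]
    congr 1
    rw [Function.comp_apply, ← hp, inChart_self]
    rfl
  · rw [Function.comp_apply, ← hp]
    exact ((hη p).contDiffAt ((isOpen_extChartAt_target p).mem_nhds
      (mem_extChartAt_target p))).differentiableAt (by simp)

theorem IsSmoothForm.dbar {η : X → ExtConj E} (hη : IsSmoothForm I η) :
    IsSmoothForm I (dbarAlong I (ContinuousLinearMap.id ℂ E) η) := by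
  intro x₀
  have h1 : ContDiffOn ℝ ∞ (fun z => fderiv ℝ (inChart I η x₀) z) (extChartAt I x₀).target :=
    (hη x₀).fderiv_of_isOpen (isOpen_extChartAt_target x₀) (by simp)
  have h2 := (wedgeDerivL (ContinuousLinearMap.id ℂ E)).contDiff.comp_contDiffOn h1
  exact h2.congr fun z hz => inChart_dbar hη x₀ hz

/-- Multiplication as a continuous real-bilinear map. -/
def ExtConj.mulB (E : Type*) [NormedAddCommGroup E] [NormedSpace ℂ E] [FiniteDimensional ℂ E] :
    ExtConj E →L[ℝ] ExtConj E →L[ℝ] ExtConj E :=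
  LinearMap.toContinuousLinearMap
    { toFun := ExtConj.mulL
      map_add' := fun x y => ContinuousLinearMap.ext fun z => add_mul x y z
      map_smul' := fun c x => ContinuousLinearMap.ext fun z => by
        show (c • x) * z = c • (x * z)
        rw [← Complex.coe_smul, smul_mul_assoc, Complex.coe_smul] }

variable (I X)

/-- The algebra of smooth `(0,•)`-forms, as a subalgebra of all sections. -/
def smoothForms : Subalgebra ℂ (X → ExtConj E) where
  carrier := {η | IsSmoothForm I η}
  mul_mem' := by
    intro η η' h h' x₀
    have := (ExtConj.mulB E).isBoundedBilinearMap.contDiff.comp_contDiffOn ((h x₀).prodMk (h' x₀))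
    refine this.congr fun z _ => ?_
    exact map_mul (pull _) _ _
  add_mem' := by
    intro η η' h h' x₀
    refine ((h x₀).add (h' x₀)).congr fun z _ => ?_
    exact map_add (pull _) _ _
  algebraMap_mem' := by
    intro c x₀
    refine (contDiffOn_const (c := algebraMap ℂ (ExtConj E) c)).congr fun z _ => ?_
    exact AlgHom.commutes _ c

/-- The algebra `𝒜^{0,•}(X)` of smooth `(0,•)`-forms on `X`. -/
def DForm : Type _ := smoothForms I X

instance : Ring (DForm I X) := inferInstanceAs (Ring (smoothForms I X))
instance : Algebra ℂ (DForm I X) := inferInstanceAs (Algebra ℂ (smoothForms I X))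
instance : CoeFun (DForm I X) (fun _ => X → ExtConj E) := ⟨fun η => η.1⟩

/-- The `C^∞` uniform structure: uniform convergence on compact subsets of the (preferred)
charts of all derivatives of the coordinate expressions. -/
instance : UniformSpace (DForm I X) :=
  ⨅ (x₀ : X) (k : ℕ), UniformSpace.comap
    (fun η : DForm I X =>
      UniformOnFun.ofFun {K : Set E | IsCompact K ∧ K ⊆ (extChartAt I x₀).target}
        (iteratedFDeriv ℝ k (inChart I η x₀))) inferInstance

variable {X}

/-- The forms of type `(0,q)`. -/
def DForm.gr (q : ℕ) : Submodule ℂ (DForm I X) where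
  carrier := {η | ∀ x, η x ∈ ExtConj.gr E q}
  add_mem' h h' x := Submodule.add_mem _ (h x) (h' x)
  zero_mem' _ := Submodule.zero_mem _
  smul_mem' c _ h x := Submodule.smul_mem _ c (h x)

theorem hasFDerivAt_inChart (η : DForm I X) (x : X) :
    DifferentiableAt ℝ (inChart I η.1 x) (extChartAt I x x) :=
  ((η.2 x).contDiffAt ((isOpen_extChartAt_target x).mem_nhds
    (mem_extChartAt_target x))).differentiableAt (by simp)

theorem conjPart_csmul {F G : Type*} [NormedAddCommGroup F] [NormedSpace ℂ F]
    [NormedAddCommGroup G] [NormedSpace ℂ G] [FiniteDimensional ℂ G]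
    (c : ℂ) (D : F →L[ℝ] ExtConj G) (v : F) :
    conjPart (c • D) v = c • conjPart D v := by
  simp only [conjPart, smul_apply, smul_add, smul_smul]
  congr 2 <;> ring

variable (X) in
/-- The operator `∂̄` on `𝒜^{0,•}(X)`. -/
def dbar : DForm I X →ₗ[ℂ] DForm I X where
  toFun η := ⟨dbarAlong I (ContinuousLinearMap.id ℂ E) η.1, IsSmoothForm.dbar η.2⟩
  map_add' η η' := by
    refine Subtype.ext (funext fun x => ?_)
    show wedgeDeriv _ (fderiv ℝ (inChart I (η + η').1 x) _) = wedgeDeriv _ _ + wedgeDeriv _ _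
    have : inChart I (η + η').1 x = inChart I η.1 x + inChart I η'.1 x :=
      funext fun z => map_add (pull _) _ _
    rw [this, fderiv_add (hasFDerivAt_inChart I η x) (hasFDerivAt_inChart I η' x), wedgeDeriv_add]
  map_smul' c η := by
    refine Subtype.ext (funext fun x => ?_)
    show wedgeDeriv _ (fderiv ℝ (inChart I (c • η).1 x) _) = c • wedgeDeriv _ _
    have : inChart I (c • η).1 x = c • inChart I η.1 x := funext fun z => by
      show pull _ (c • η.1 _) = c • pull _ (η.1 _)
      exact map_smul _ _ _
    rw [this, fderiv_const_smul (hasFDerivAt_inChart I η x)]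
    simp only [wedgeDeriv, conjPart_csmul, mul_smul_comm, ← Finset.smul_sum]

variable (X)

/-- The Dolbeault algebra `(𝒜^{0,•}(X), ∂̄)`, with curvature `0`. -/
def dolbeault : DGAData where
  carrier := DForm I X
  gr := DForm.gr I
  d := dbar I X
  curv := 0

end Manifold

/-! ### The fibrewise Dolbeault bimodule of the projection `X × Y → Y` -/

section Product

variable {E : Type*} [NormedAddCommGroup E] [NormedSpace ℂ E] [FiniteDimensional ℂ E]
  {H : Type*} [TopologicalSpace H] (I : ModelWithCorners ℂ E H) [I.Boundaryless]
  (X : Type*) [TopologicalSpace X] [ChartedSpace H X] [IsManifold I ω X]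
  {F : Type*} [NormedAddCommGroup F] [NormedSpace ℂ F] [FiniteDimensional ℂ F]
  {H' : Type*} [TopologicalSpace H'] (J : ModelWithCorners ℂ F H') [J.Boundaryless]
  {Y : Type*} [TopologicalSpace Y] [ChartedSpace H' Y] [IsManifold J ω Y]

variable {X} in
theorem snd_tangentCoordChange (x₀ x : X) (y₀ y : Y) (hx : x ∈ (extChartAt I x₀).source)
    (hy : y ∈ (extChartAt J y₀).source) :
    (ContinuousLinearMap.snd ℂ E F).comp (tangentCoordChange (I.prod J) (x₀, y₀) (x, y) (x, y)) =
      (tangentCoordChange J y₀ y y).comp (ContinuousLinearMap.snd ℂ E F) := by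
  have h1 := hasFDerivWithinAt_tangentCoordChange (I := I.prod J) (x := (x₀, y₀)) (y := (x, y))
    (z := (x, y)) ⟨by rw [extChartAt_prod]; exact ⟨hx, hy⟩, mem_extChartAt_source _⟩
  have h2 := hasFDerivWithinAt_tangentCoordChange (I := J) (x := y₀) (y := y)
    (z := y) ⟨hy, mem_extChartAt_source _⟩
  rw [ModelWithCorners.range_eq_univ, hasFDerivWithinAt_univ] at h1 h2
  have h3 := (ContinuousLinearMap.snd ℂ E F).hasFDerivAt.comp _ h1
  have hpt : (extChartAt (I.prod J) (x₀, y₀) (x, y)).2 = extChartAt J y₀ y := by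
    rw [extChartAt_prod]; rfl
  rw [← hpt] at h2
  have h4 := h2.comp _ (ContinuousLinearMap.snd ℂ E F).hasFDerivAt
  refine h3.unique ?_
  convert! h4 using 1

/-- The pullback `p₂*η` of a form along the projection `p₂ : X × Y → Y`. -/
def sndPull : DForm J Y →ₗ[ℂ] DForm (I.prod J) (X × Y) where
  toFun η := ⟨fun p => pull (ContinuousLinearMap.snd ℂ E F) (η p.2), by
    rintro ⟨x₀, y₀⟩
    have h1 : ContDiffOn ℝ ∞ (fun z : E × F => inChart J η.1 y₀ z.2)
        (extChartAt (I.prod J) (x₀, y₀)).target := by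
      refine (η.2 y₀).comp contDiff_snd.contDiffOn fun z hz => ?_
      rw [extChartAt_prod] at hz
      exact hz.2
    have h2 := (((pull (ContinuousLinearMap.snd ℂ E F)).toLinearMap.toContinuousLinearMap
      ).restrictScalars ℝ).contDiff.comp_contDiffOn h1
    refine h2.congr fun z hz => ?_
    rw [extChartAt_prod] at hz
    show pull _ (pull _ _) = pull _ (pull _ _)
    rw [pull_comp, pull_comp, extChartAt_prod]
    congr 2
    exact snd_tangentCoordChange I J x₀ _ y₀ _ ((extChartAt I x₀).map_target hz.1)
      ((extChartAt J y₀).map_target hz.2)⟩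
  map_add' _ _ := Subtype.ext (funext fun _ => map_add (pull _) _ _)
  map_smul' c η := Subtype.ext (funext fun p => by
    show pull _ (c • η.1 p.2) = c • pull _ (η.1 p.2)
    exact map_smul _ _ _)

variable (Y) in
/-- The space `M• = Γ(X × Y; Λ• p₁* T*⁰'¹X)` of smooth forms along the fibres of `p₂`, as the
space of those `(0,•)`-forms on `X × Y` with values in `Λ• p₁* T*⁰'¹X ⊆ Λ• T*⁰'¹(X × Y)`. -/
def fibreForms : Submodule ℂ (DForm (I.prod J) (X × Y)) where
  carrier := {η | ∀ p, η p ∈ (pull (ContinuousLinearMap.fst ℂ E F)).range}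
  add_mem' h h' p := add_mem (h p) (h' p)
  zero_mem' _ := zero_mem _
  smul_mem' c _ h p := Subalgebra.smul_mem _ (h p) c

variable {X} in
theorem mul_mem_fibreForms {η η' : DForm (I.prod J) (X × Y)} (h : η ∈ fibreForms I X J Y)
    (h' : η' ∈ fibreForms I X J Y) : η * η' ∈ fibreForms I X J Y :=
  fun p => mul_mem (h p) (h' p)

theorem ExtConj.exists_of_mem_gr_zero {x : ExtConj E} (hx : x ∈ ExtConj.gr E 0) :
    ∃ c : ℂ, x = algebraMap ℂ _ c := by
  have : x ∈ (1 : Submodule ℂ (ExteriorAlgebra ℂ (ConjDual E))) := by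
    have h0 : ExtConj.gr E 0 = (1 : Submodule ℂ (ExteriorAlgebra ℂ (ConjDual E))) := pow_zero _
    rw [← h0]; exact hx
  obtain ⟨c, hc⟩ := Submodule.mem_one.1 this
  exact ⟨c, hc.symm⟩

variable {X} in
theorem mem_fibreForms_of_gr_zero {η : DForm (I.prod J) (X × Y)} (h : η ∈ DForm.gr (I.prod J) 0) :
    η ∈ fibreForms I X J Y := by
  intro p
  obtain ⟨c, hc⟩ := ExtConj.exists_of_mem_gr_zero (h p)
  rw [hc]
  exact algebraMap_mem _ c

theorem sndPull_mem_fibreForms {η : DForm J Y} (h : η ∈ DForm.gr J 0) :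
    sndPull I X J η ∈ fibreForms I X J Y := by
  intro p
  obtain ⟨c, hc⟩ := ExtConj.exists_of_mem_gr_zero (h p.2)
  show pull (ContinuousLinearMap.snd ℂ E F) (η p.2) ∈ _
  rw [hc, AlgHom.commutes]
  exact algebraMap_mem _ c

/-- The right action of `𝒜(Y)` on `M•`: `m · f = m (f ∘ p₂)`. -/
def fibreRact : fibreForms I X J Y →ₗ[ℂ] DForm.gr J (X := Y) 0 →ₗ[ℂ] fibreForms I X J Y :=
  LinearMap.mk₂ ℂ
    (fun m f => ⟨m.1 * sndPull I X J f.1,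
      mul_mem_fibreForms I J m.2 (sndPull_mem_fibreForms I X J f.2)⟩)
    (fun _ _ _ => Subtype.ext (add_mul _ _ _))
    (fun _ _ _ => Subtype.ext (smul_mul_assoc _ _ _))
    (fun m f f' => Subtype.ext (by
      show m.1 * sndPull I X J (f.1 + f'.1) = m.1 * sndPull I X J f.1 + m.1 * sndPull I X J f'.1
      rw [map_add, mul_add]))
    (fun c m f => Subtype.ext (by
      show m.1 * sndPull I X J (c • f.1) = c • (m.1 * sndPull I X J f.1)
      rw [map_smul, mul_smul_comm]))

/-- The left action of `𝒜(X × Y)` on `M•` by multiplication. -/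
def fibreLact0 : DForm.gr (I.prod J) (X := X × Y) 0 →ₗ[ℂ] fibreForms I X J Y →ₗ[ℂ]
    fibreForms I X J Y :=
  LinearMap.mk₂ ℂ
    (fun a m => ⟨a.1 * m.1, mul_mem_fibreForms I J (mem_fibreForms_of_gr_zero I J a.2) m.2⟩)
    (fun _ _ _ => Subtype.ext (add_mul _ _ _))
    (fun _ _ _ => Subtype.ext (smul_mul_assoc _ _ _))
    (fun _ _ _ => Subtype.ext (mul_add _ _ _))
    (fun _ _ _ => Subtype.ext (mul_smul_comm _ _ _))

/-- Left multiplication of an algebra on itself, transported along `Φ`. -/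
def transportMul {B T : Type*} [Ring B] [Algebra ℂ B] [AddCommGroup T] [Module ℂ T]
    (Φ : T ≃ₗ[ℂ] B) : B →ₗ[ℂ] T →ₗ[ℂ] T :=
  LinearMap.mk₂ ℂ (fun a t => Φ.symm (a * Φ t))
    (fun a a' t => by rw [add_mul, map_add])
    (fun c a t => by rw [smul_mul_assoc, map_smul])
    (fun a t t' => by rw [map_add, mul_add, map_add])
    (fun c a t => by rw [map_smul, mul_smul_comm, map_smul])

/-- The graded right module `M•` over `𝒜(Y)`. -/
def fibreModule (hY : IsCurvedDGA (dolbeault J Y)) : GrModule ⟨dolbeault J Y, hY⟩ where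
  carrier := fibreForms I X J Y
  gr i := if 0 ≤ i then (DForm.gr (I.prod J) i.toNat).comap (fibreForms I X J Y).subtype else ⊥
  ract := fibreRact I X J

/-- The bimodule `ℳ`: with respect to an identification `Φ` of `M• ⊗̂ 𝒜^{0,•}(Y)` with
`𝒜^{0,•}(X × Y)`, the `ℤ`-connection is `∂̄` and the left action of `𝒜^{0,•}(X × Y)` is left
multiplication; functions on `X × Y` act on `M•` by multiplication. -/
def fibreBimodule (hXY : IsCurvedDGA (dolbeault (I.prod J) (X × Y)))
    (hY : IsCurvedDGA (dolbeault J Y))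
    (Φ : (fibreModule I X J hY).T ≃L[ℂ] DForm (I.prod J) (X × Y)) :
    BimoduleData ⟨dolbeault (I.prod J) (X × Y), hXY⟩ ⟨dolbeault J Y, hY⟩ where
  toGrModule := fibreModule I X J hY
  lact0 := fibreLact0 I X J
  lact := transportMul Φ.toLinearEquiv
  conn := (Φ.symm : DForm (I.prod J) (X × Y) →L[ℂ] (fibreModule I X J hY).T).comp
    ((⟨dbar (I.prod J) (X × Y), hXY.continuous_d⟩ :
      DForm (I.prod J) (X × Y) →L[ℂ] DForm (I.prod J) (X × Y)).comp
      (Φ : (fibreModule I X J hY).T →L[ℂ] DForm (I.prod J) (X × Y)))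

/-- The canonical identification `m ⊗ η ↦ m ∧ p₂*η` of `M• ⊗̂ 𝒜^{0,•}(Y)` with
`𝒜^{0,•}(X × Y)`. -/
def IsCanonicalIso {hY : IsCurvedDGA (dolbeault J Y)}
    (Φ : (fibreModule I X J hY).T ≃L[ℂ] DForm (I.prod J) (X × Y)) : Prop :=
  ∀ (m : fibreForms I X J Y) (η : DForm J Y),
    Φ ((fibreModule I X J hY).tmul m η) = m.1 * sndPull I X J η

/-- The operator `∂̄_X` along the fibres of `p₂`. -/
def dbarX (η : X × Y → ExtConj (E × F)) : X × Y → ExtConj (E × F) :=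
  dbarAlong (I.prod J)
    ((ContinuousLinearMap.inl ℂ E F).comp (ContinuousLinearMap.fst ℂ E F)) η

/-- The operator `∂̄_Y` along the base. -/
def dbarY (η : X × Y → ExtConj (E × F)) : X × Y → ExtConj (E × F) :=
  dbarAlong (I.prod J)
    ((ContinuousLinearMap.inr ℂ E F).comp (ContinuousLinearMap.snd ℂ E F)) η

end Product

end

/-! The proof has a formal half and an analytic half, both resting on three facts about Fréchet
spaces: the closed graph theorem (`FrechetSpace.continuous_of_seq_closed_graph`, obtained from
Baire), Banach–Steinhaus, and the consequence that separately continuous bilinear maps are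
continuous. By `FrechetSpace.continuous_of_separating`, continuity of a linear map into a space of
forms only has to be tested by evaluation at points. The completed tensor product is again Fréchet
(`CTensor.frechetSpace`) and has the expected universal property, so maps out of it are defined and
compared on pure tensors.

Formal half: any quasi-perfect twisted bimodule `𝒳` induces a DG functor (`pushFunctor`). If `E` is
a summand of `V ⊗ A` and `X` a summand of `W ⊗ B`, then `E ⊗_A X` is a summand of `V ⊗ X` and hence
of `(V ⊗ W) ⊗ B` (`pushModule_isRelProjective`). The operator `e ⊗ t ↦ 𝔼(e) t + (-1)^|e| e ⊗ 𝕏(t)`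
respects the balancing over `A` because the two Leibniz rules produce the same term in `da`. In its
square the mixed terms cancel and the two curvatures add up to `-c₂` (`pushConn_curvature`).
Functoriality and compatibility with `d` are similar sign computations.

Analytic half: the forms along the fibres are such a bimodule. Spaces of forms are Fréchet because
countably many charts control them and a limit of all derivatives is again smooth. On a manifold
there are compactly supported functions `wt`, `cut` in charts with `∑ wt * cut = 1`. On `Y` they
give local generators of the forms, and a form on `X × Y` is the sum of its coefficients, which lie
in `M•`, times the pulled back generators. The inverse of the canonical map sends a form to the sum
of coefficient tensor generator. This series converges for any coefficients, since a continuous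
seminorm on the forms of `Y` sees only finitely many generators (`exists_wedgeIso`).

Relative projectivity of `M•` over `𝒜(Y)` comes from an infinite frame. In charts of `X`, the
coefficients of a form along the fibres are expanded in Fourier series on a cube. The frame elements
are cut-off exponentials times constant covectors, of polynomial growth in the frequency. The
coefficients are functions on `Y` which, by integration by parts, decay rapidly in every continuous
seminorm. So `m ↦ ∑ e_a ⊗ θ_a(m)` converges in `M• ⊗ 𝒜(Y)` and splits the action map,
`𝒜(Y)`-linearly (`isRelProjective_fibreModule`).

The remaining bimodule axioms are identities of the Dolbeault algebra of `X × Y` read through the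
canonical isomorphism (`IsGradedIso.isQPTwistedBimodule`). The splitting of the connection is the
decomposition of `∂̄m` by degree along `Y`. -/

noncomputable section

/-! ### Fréchet spaces -/

/-- The class version of `IsFrechet`. -/
class FrechetSpace (V : Type*) [AddCommGroup V] [Module ℂ V] [UniformSpace V] : Prop extends
    IsUniformAddGroup V, ContinuousSMul ℂ V, LocallyConvexSpace ℝ V, T2Space V, CompleteSpace V,
    (𝓤 V).IsCountablyGenerated

theorem IsFrechet.frechetSpace {V : Type*} [AddCommGroup V] [Module ℂ V] [UniformSpace V]
    (h : IsFrechet V) : FrechetSpace V :=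
  { h.isUniformAddGroup, h.continuousSMul, h.locallyConvex, h.t2, h.complete, h.countable with }

theorem FrechetSpace.isFrechet (V : Type*) [AddCommGroup V] [Module ℂ V] [UniformSpace V]
    [FrechetSpace V] : IsFrechet V :=
  ⟨inferInstance, inferInstance, inferInstance, inferInstance, inferInstance, inferInstance⟩

namespace FrechetSpace

section

variable {V W Z : Type*} [AddCommGroup V] [Module ℂ V] [UniformSpace V] [FrechetSpace V]
  [AddCommGroup W] [Module ℂ W] [UniformSpace W] [FrechetSpace W]
  [AddCommGroup Z] [Module ℂ Z] [UniformSpace Z] [FrechetSpace Z]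

instance (priority := 50) : UniformContinuousConstSMul ℂ V :=
  uniformContinuousConstSMul_of_continuousConstSMul ℂ V

open scoped ComplexOrder in
instance (priority := 50) : PolynormableSpace ℂ V := by
  have : ContinuousSMul ℝ V := IsScalarTower.continuousSMul (M := ℝ) ℂ
  have : LocallyConvexSpace ℂ V := by
    refine ⟨fun x => (LocallyConvexSpace.convex_basis (𝕜 := ℝ) x).to_hasBasis
      (fun s hs => ⟨s, ⟨hs.1, ?_⟩, subset_rfl⟩) (fun s hs => ⟨s, ⟨hs.1, hs.2.lift ℝ⟩, subset_rfl⟩)⟩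
    -- In the order on `ℂ` the nonnegative scalars are the nonnegative reals, so convexity over `ℝ`
    -- and over `ℂ` is the same condition.
    exact convex_of_nonneg_surjective_algebraMap ℂ
      (fun _ h => RCLike.nonneg_iff_exists_ofReal.mp h) hs.2
  exact LocallyConvexSpace.toPolynormableSpace

-- Baire category: `V` is the union of the multiples `(n + 1) • f ⁻¹' D`, where `D - D ⊆ U`, so the
-- closure of `f ⁻¹' D` has an interior point. Translating by that point gives a neighbourhood of
-- `0`. Completeness of `W` plays no role.
omit [FrechetSpace W] in
theorem closure_preimage_mem_nhds [IsTopologicalAddGroup W] [ContinuousSMul ℂ W] (f : V →ₗ[ℂ] W)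
    {U : Set W} (hU : U ∈ 𝓝 (0 : W)) : closure (f ⁻¹' U) ∈ 𝓝 (0 : V) := by
  obtain ⟨U', hU', hsub⟩ := exists_nhds_zero_half hU
  obtain ⟨D, hD, hDU⟩ : ∃ D ∈ 𝓝 (0 : W), D ⊆ U' ∧ -D ⊆ U' :=
    ⟨U' ∩ -U', Filter.inter_mem hU' (neg_mem_nhds_zero W hU'), inter_subset_left, by
      intro x hx; simpa using hx.2⟩
  have hcov : (⋃ n : ℕ, closure ((fun x : V => ((n : ℂ) + 1)⁻¹ • x) ⁻¹' (f ⁻¹' D))) = univ := by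
    refine eq_univ_of_forall fun x => ?_
    have ht : Filter.Tendsto (fun n : ℕ => ((n : ℂ) + 1)⁻¹ • f x) Filter.atTop (𝓝 0) := by
      have h1 : Filter.Tendsto (fun n : ℕ => ((n : ℂ) + 1)⁻¹) Filter.atTop (𝓝 0) := by
        simpa using tendsto_one_div_add_atTop_nhds_zero_nat (𝕜 := ℂ)
      simpa using h1.smul_const (f x)
    obtain ⟨n, hn⟩ := (ht.eventually hD).exists
    refine mem_iUnion.2 ⟨n, subset_closure ?_⟩
    show f (((n : ℂ) + 1)⁻¹ • x) ∈ D
    rw [map_smul]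
    exact hn
  obtain ⟨n, hn⟩ := nonempty_interior_of_iUnion_of_closed (fun n => isClosed_closure) hcov
  have hne : ((n : ℂ) + 1)⁻¹ ≠ 0 := inv_ne_zero (by exact_mod_cast n.succ_ne_zero)
  let e : V ≃ₜ V := Homeomorph.smulOfNeZero _ hne
  have hpre : closure ((fun x : V => ((n : ℂ) + 1)⁻¹ • x) ⁻¹' (f ⁻¹' D)) =
      e ⁻¹' closure (f ⁻¹' D) := (e.preimage_closure _).symm
  rw [hpre, ← e.preimage_interior] at hn
  obtain ⟨x, hx⟩ := hn
  set y := e x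
  have hy : closure (f ⁻¹' D) ∈ 𝓝 y := mem_interior_iff_mem_nhds.1 hx
  have h0 : (fun z => y + z) ⁻¹' closure (f ⁻¹' D) ∈ 𝓝 (0 : V) := by
    refine (continuous_const.add continuous_id).continuousAt.preimage_mem_nhds ?_
    simpa using hy
  refine Filter.mem_of_superset h0 fun z hz => ?_
  have hz' : (y + z) + -y ∈ closure (f ⁻¹' U) := by
    refine map_mem_closure₂ (f := fun a b : V => a + -b) (by fun_prop) hz (mem_of_mem_nhds hy) ?_
    intro a ha b hb
    show f (a + -b) ∈ U
    rw [map_add, map_neg]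
    exact hsub _ (hDU.1 ha) _ (hDU.2 (by simpa using hb))
  simpa using hz'

/-- The closed graph theorem for Fréchet spaces. -/
theorem continuous_of_seq_closed_graph (f : V →ₗ[ℂ] W)
    (hf : ∀ (s : ℕ → V) (x : V) (y : W), Filter.Tendsto s Filter.atTop (𝓝 x) →
      Filter.Tendsto (fun n => f (s n)) Filter.atTop (𝓝 y) → y = f x) : Continuous f := by
  refine continuous_of_continuousAt_zero f ?_
  rw [ContinuousAt, map_zero]
  intro U₀ hU₀
  obtain ⟨U, hU, hUc, hUU⟩ := exists_mem_nhds_isClosed_subset hU₀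
  obtain ⟨u, hu, hadd⟩ := IsTopologicalAddGroup.exists_antitone_basis_nhds_zero W
  obtain ⟨b, hb, -⟩ := IsTopologicalAddGroup.exists_antitone_basis_nhds_zero V
  obtain ⟨N, hN⟩ := hu.mem_iff.1 hU
  have hC : ∀ n, closure (f ⁻¹' (u n)) ∈ 𝓝 (0 : V) := fun n =>
    closure_preimage_mem_nhds f (hu.mem_iff.2 ⟨n, subset_rfl⟩)
  rw [Filter.mem_map]
  refine Filter.mem_of_superset (hC (N + 1)) fun x hx => hUU ?_
  -- Successive approximation: subtracting some `y` with `f y` small moves a point of one closure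
  -- into the next, smaller one, and makes it small in `V` as well.
  have step : ∀ n (z : V), z ∈ closure (f ⁻¹' (u (N + 1 + n))) → ∃ y, f y ∈ u (N + 1 + n) ∧
      z - y ∈ closure (f ⁻¹' (u (N + 1 + (n + 1)))) ∧ z - y ∈ b n := by
    intro n z hz
    have h1 : (fun y => z - y) ⁻¹' (closure (f ⁻¹' (u (N + 1 + (n + 1)))) ∩ b n) ∈ 𝓝 z := by
      refine (continuous_const.sub continuous_id).continuousAt.preimage_mem_nhds ?_
      simpa using ⟨hC (N + 1 + (n + 1)), hb.mem_iff.2 ⟨n, subset_rfl⟩⟩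
    obtain ⟨y, hy1, hy2⟩ := mem_closure_iff_nhds.1 hz _ h1
    exact ⟨y, hy2, hy1.1, hy1.2⟩
  choose! g hg1 hg2 hg3 using step
  let z : ℕ → V := fun n => Nat.rec x (fun n z => z - g n z) n
  have hz0 : z 0 = x := rfl
  have hzs : ∀ n, z (n + 1) = z n - g n (z n) := fun n => rfl
  have hzmem : ∀ n, z n ∈ closure (f ⁻¹' (u (N + 1 + n))) := by
    intro n
    induction n with
    | zero => exact hx
    | succ n ih => rw [hzs]; exact hg2 n _ ih
  have hzlim : Filter.Tendsto z Filter.atTop (𝓝 0) := by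
    rw [← Filter.tendsto_add_atTop_iff_nat 1]
    refine hb.tendsto_right_iff.2 fun i _ => ?_
    filter_upwards [Filter.eventually_ge_atTop i] with n hn
    rw [hzs]
    exact hb.antitone hn (hg3 n _ (hzmem n))
  have hu0 : ∀ n, (0 : W) ∈ u n := fun n => mem_of_mem_nhds (hu.mem_iff.2 ⟨n, subset_rfl⟩)
  -- Since `u (n + 1) + u (n + 1) ⊆ u n`, sums of increments in `u (N + 1 + k)`, `u (N + 2 + k)` and
  -- so on stay in `u (N + k)`. This is why the iteration starts at `N + 1`.
  have hdiff : ∀ l k, f (z k - z (k + l)) ∈ u (N + k) := by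
    intro l
    induction l with
    | zero => intro k; simpa using hu0 _
    | succ l ih =>
      intro k
      have h1 := ih (k + 1)
      have h2 : z k - z (k + (l + 1)) = g k (z k) + (z (k + 1) - z (k + 1 + l)) := by
        rw [hzs, show k + 1 + l = k + (l + 1) by ring]; abel
      rw [h2, map_add]
      refine hadd (N + k) (add_mem_add ?_ ?_)
      · have := hg1 k _ (hzmem k)
        rwa [show N + k + 1 = N + 1 + k by ring]
      · rwa [show N + k + 1 = N + (k + 1) by ring]
  have hcau : CauchySeq fun n => f (x - z n) := by
    rw [cauchySeq_iff_tendsto, uniformity_eq_comap_nhds_zero W, Filter.tendsto_comap_iff]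
    refine hu.tendsto_right_iff.2 fun i _ => ?_
    have hsymm : -u i ∈ 𝓝 (0 : W) := neg_mem_nhds_zero W (hu.mem_iff.2 ⟨i, subset_rfl⟩)
    obtain ⟨j, hj⟩ := hu.mem_iff.1 hsymm
    filter_upwards [Filter.eventually_ge_atTop (i ⊔ j, i ⊔ j)] with p hp
    obtain ⟨k, l⟩ := p
    have hk : i ⊔ j ≤ k := hp.1
    have hl : i ⊔ j ≤ l := hp.2
    have heq : f (x - z l) - f (x - z k) = f (z k - z l) := by
      rw [← map_sub]; congr 1; abel
    show f (x - z l) - f (x - z k) ∈ u i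
    rw [heq]
    rcases le_total k l with h | h
    · obtain ⟨m, rfl⟩ := Nat.exists_eq_add_of_le h
      exact hu.antitone ((le_sup_left.trans hk).trans (by lia)) (hdiff m k)
    · obtain ⟨m, rfl⟩ := Nat.exists_eq_add_of_le h
      have h3 := hj (hu.antitone ((le_sup_right.trans hl).trans (by lia : l ≤ N + l)) (hdiff m l))
      have h4 : f (z (l + m) - z l) = -f (z l - z (l + m)) := by rw [← map_neg]; congr 1; abel
      rw [h4]; exact h3
  obtain ⟨y, hy⟩ := cauchySeq_tendsto_of_complete hcau
  -- The partial sums `x - z n` tend to `x` and their images converge, so closedness of the graph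
  -- identifies the limit of the images with `f x`.
  have hxlim : Filter.Tendsto (fun n => x - z n) Filter.atTop (𝓝 x) := by
    simpa using hzlim.const_sub x
  have hyx := hf _ _ _ hxlim hy
  show f x ∈ U
  rw [← hyx]
  refine hUc.mem_of_tendsto hy (Filter.Eventually.of_forall fun n => hN ?_)
  have := hdiff n 0
  simpa [hz0] using this

/-- A linear map is continuous as soon as its composition with a separating family of continuous
functions is sequentially continuous. -/
theorem continuous_of_separating (f : V →ₗ[ℂ] W) {ι : Type*} {S : ι → Type*}
    [∀ i, TopologicalSpace (S i)] [∀ i, T2Space (S i)] (g : ∀ i, W → S i)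
    (hg : ∀ i, Continuous (g i)) (hsep : ∀ x y, (∀ i, g i x = g i y) → x = y)
    (hf : ∀ i, Continuous fun x => g i (f x)) : Continuous f := by
  -- The graph is closed: by uniqueness of limits each `g i` takes the same value at the limit of
  -- the images and at the image of the limit.
  refine continuous_of_seq_closed_graph f fun s x y hs hy => hsep _ _ fun i => ?_
  exact tendsto_nhds_unique (((hg i).tendsto y).comp hy) (((hf i).tendsto x).comp hs)

/-- A separately continuous bilinear map is continuous. -/
theorem continuous_of_separately (b : V →ₗ[ℂ] W →ₗ[ℂ] Z) (h1 : ∀ x, Continuous (b x))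
    (h2 : ∀ y, Continuous fun x => b x y) : Continuous fun p : V × W => b p.1 p.2 := by
  have key : ∀ (s : ℕ → V) (t : ℕ → W), Filter.Tendsto s Filter.atTop (𝓝 0) →
      Filter.Tendsto t Filter.atTop (𝓝 0) →
      Filter.Tendsto (fun n => b (s n) (t n)) Filter.atTop (𝓝 0) := by
    intro s t hs ht
    let F : ℕ → V →L[ℂ] Z := fun n => ⟨b.flip (t n), h2 (t n)⟩
    -- Banach–Steinhaus for the maps `x ↦ b x (t n)`: for fixed `x` the values converge as `n`
    -- grows, hence are bounded.
    have hF : UniformEquicontinuous ((↑) ∘ F : ℕ → V → Z) := by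
      refine PolynormableSpace.banach_steinhaus fun x => ?_
      have : Filter.Tendsto (fun n => F n x) Filter.atTop (𝓝 (b x 0)) :=
        ((h1 x).tendsto 0).comp ht
      exact this.isVonNBounded_range ℂ
    have h3 := hF.equicontinuous 0
    intro U hU
    rw [Filter.mem_map]
    have hU' : {p : Z × Z | p.2 - p.1 ∈ U} ∈ 𝓤 Z := by
      rw [uniformity_eq_comap_nhds_zero Z]
      exact Filter.preimage_mem_comap hU
    have h4 := hs.eventually (h3 _ hU')
    filter_upwards [h4] with n hn
    have := hn n
    simp only [Function.comp, map_zero, sub_zero, mem_ofPred_eq] at this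
    exact this
  rw [continuous_iff_continuousAt]
  rintro ⟨x, y⟩
  refine Filter.tendsto_of_seq_tendsto fun s hs => ?_
  have hs1 : Filter.Tendsto (fun n => (s n).1) Filter.atTop (𝓝 x) :=
    (continuous_fst.tendsto _).comp hs
  have hs2 : Filter.Tendsto (fun n => (s n).2) Filter.atTop (𝓝 y) :=
    (continuous_snd.tendsto _).comp hs
  -- The decomposition is `b s t = b (s - x) (t - y) + b x t + b s y - b x y`. Only the first term
  -- needs equicontinuity; the others need separate continuity.
  have a1 := key (fun n => (s n).1 - x) (fun n => (s n).2 - y)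
    (by simpa using hs1.sub_const x) (by simpa using hs2.sub_const y)
  have a2 : Filter.Tendsto (fun n => b x (s n).2) Filter.atTop (𝓝 (b x y)) :=
    ((h1 x).tendsto y).comp hs2
  have a3 : Filter.Tendsto (fun n => b (s n).1 y) Filter.atTop (𝓝 (b x y)) :=
    ((h2 y).tendsto x).comp hs1
  have := ((a1.add a2).add a3).sub_const (b x y)
  simp only [zero_add, add_sub_cancel_right] at this
  refine this.congr fun n => ?_
  simp only [map_sub, LinearMap.sub_apply, Function.comp]
  abel

/-- A pointwise limit of continuous linear maps is continuous. -/
theorem continuous_of_tendsto (f : V → W) {α : Type*} (l : Filter α) [l.IsCountablyGenerated]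
    [l.NeBot] (g : α → V →L[ℂ] W) (h : ∀ x, Filter.Tendsto (fun n => g n x) l (𝓝 (f x))) :
    Continuous f :=
  (continuousLinearMapOfTendsto g (tendsto_pi_nhds.2 h)).continuous

/-- A continuous linear bijection is an isomorphism. -/
def equivOfBijective (f : V →L[ℂ] W) (g : W →ₗ[ℂ] V) (h1 : ∀ x, g (f x) = x)
    (h2 : ∀ y, f (g y) = y) : V ≃L[ℂ] W where
  toLinearEquiv := LinearEquiv.ofLinearMap f.toLinearMap g (LinearMap.ext h2) (LinearMap.ext h1)
  continuous_toFun := f.continuous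
  continuous_invFun := by
    show Continuous g
    -- The graph of the inverse is the transposed graph of `f`, which is closed.
    refine continuous_of_seq_closed_graph g fun s x y hs hy => ?_
    have h3 := (f.continuous.tendsto y).comp hy
    have h4 := tendsto_nhds_unique h3 (hs.congr fun n => (h2 (s n)).symm)
    rw [← h4, h1]

/-- A finite supremum of continuous seminorms is a continuous seminorm, and division by the radius
normalises the ball. So a single unit ball replaces the balls of finite suprema with varying radii.
-/
theorem hasBasis_seminorm (V : Type*) [AddCommGroup V] [Module ℂ V] [TopologicalSpace V]
    [PolynormableSpace ℂ V] : (𝓝 (0 : V)).HasBasis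
      (fun q : Seminorm ℂ V => Continuous q) (fun q => {x | q x < 1}) := by
  have h := (PolynormableSpace.withSeminorms ℂ V).hasBasis_zero_ball
  refine ⟨fun U => ?_⟩
  rw [h.mem_iff]
  constructor
  · rintro ⟨⟨s, r⟩, hr, hU⟩
    simp only at hr hU
    refine ⟨(r⁻¹.toNNReal) • s.sup (fun p => p.1), ?_, fun x hx => hU ?_⟩
    · have : Continuous (s.sup (fun p : {p : Seminorm ℂ V // Continuous p} => p.1) : Seminorm ℂ V) := by
        refine Finset.sup_induction (p := fun q : Seminorm ℂ V => Continuous q) ?_ ?_ ?_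
        · exact (continuous_const (y := (0 : ℝ)) : Continuous fun _ : V => (0 : ℝ))
        · intro a ha b hb
          exact Continuous.sup ha hb
        · exact fun i _ => i.2
      exact this.const_smul (r⁻¹.toNNReal)
    · rw [Seminorm.mem_ball_zero]
      have hx' : (r⁻¹.toNNReal : ℝ) * (s.sup fun p : {p : Seminorm ℂ V // Continuous p} => p.1) x < 1 := hx
      rwa [Real.coe_toNNReal _ (inv_pos.2 hr).le, inv_mul_lt_iff₀ hr, mul_one] at hx'
  · rintro ⟨q, hq, hU⟩
    refine ⟨⟨{⟨q, hq⟩}, 1⟩, one_pos, fun x hx => hU ?_⟩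
    simpa [Seminorm.mem_ball_zero] using hx

/-- A family is summable if it is absolutely summable for every continuous seminorm. -/
theorem summable_of_seminorm {ι : Type*} (f : ι → V)
    (h : ∀ q : Seminorm ℂ V, Continuous q → Summable fun i => q (f i)) : Summable f := by
  rw [summable_iff_cauchySeq_finset, cauchySeq_finset_iff_sum_vanishing]
  intro e he
  obtain ⟨q, hq, hU⟩ := (hasBasis_seminorm V).mem_iff.1 he
  have h1 := (cauchySeq_finset_iff_sum_vanishing.1 (summable_iff_cauchySeq_finset.1 (h q hq))) (Metric.ball 0 1) (Metric.ball_mem_nhds _ one_pos)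
  obtain ⟨s, hs⟩ := h1
  refine ⟨s, fun t ht => hU ?_⟩
  have h2 := hs t ht
  rw [Metric.mem_ball, dist_zero_right] at h2
  show q _ < 1
  refine lt_of_le_of_lt ?_ (lt_of_le_of_lt (Real.le_norm_self _) h2)
  exact Finset.le_sum_of_subadditive q (map_zero q).le (fun x y => map_add_le_add q x y) t f

end


end FrechetSpace

/-! ### The completed projective tensor product is a Fréchet space -/

section TensorFrechet

variable {A M N : Type*} [AddCommGroup A] [Module ℂ A]
  [AddCommGroup M] [Module ℂ M] [UniformSpace M]
  [AddCommGroup N] [Module ℂ N] [UniformSpace N]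
  {ra : M →ₗ[ℂ] A →ₗ[ℂ] M} {la : A →ₗ[ℂ] N →ₗ[ℂ] N}

/-- A seminorm on `M ⊗ N` as a seminorm on `PreTensor`. -/
def PreTensor.seminorm (r : Seminorm ℂ (M ⊗[ℂ] N)) : Seminorm ℂ (PreTensor ra la) := r

theorem PreTensor.withSeminorms :
    WithSeminorms (E := PreTensor ra la) (𝕜 := ℂ)
      fun r : {r : Seminorm ℂ (M ⊗[ℂ] N) // Admissible ra la r} => PreTensor.seminorm r.1 := by
  rw [SeminormFamily.withSeminorms_iff_uniformSpace_eq_iInf]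
  rfl

variable [FrechetSpace M] [FrechetSpace N]

/-- Homogeneity: the hypothesis is applied to `m / (p m + ε)` and `n / (q n + ε)`, and then `ε → 0`.
The `ε` is there because `p m` or `q n` may vanish. -/
theorem tmul_seminorm_le (r : Seminorm ℂ (M ⊗[ℂ] N)) {p : Seminorm ℂ M} {q : Seminorm ℂ N}
    (h : ∀ m n, p m < 1 → q n < 1 → r (m ⊗ₜ[ℂ] n) ≤ 1) (m : M) (n : N) :
    r (m ⊗ₜ[ℂ] n) ≤ p m * q n := by
  refine le_of_forall_gt_imp_ge_of_dense fun c hc => ?_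
  have key : ∀ ε : ℝ, 0 < ε → r (m ⊗ₜ[ℂ] n) ≤ (p m + ε) * (q n + ε) := by
    intro ε hε
    have hp : 0 < p m + ε := add_pos_of_nonneg_of_pos (apply_nonneg p m) hε
    have hq : 0 < q n + ε := add_pos_of_nonneg_of_pos (apply_nonneg q n) hε
    have h1 := h ((((p m + ε)⁻¹ : ℝ) : ℂ) • m) ((((q n + ε)⁻¹ : ℝ) : ℂ) • n)
      (by rw [map_smul_eq_mul, Complex.norm_real, Real.norm_of_nonneg (inv_pos.2 hp).le,
            inv_mul_lt_iff₀ hp]; linarith)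
      (by rw [map_smul_eq_mul, Complex.norm_real, Real.norm_of_nonneg (inv_pos.2 hq).le,
            inv_mul_lt_iff₀ hq]; linarith)
    rw [TensorProduct.smul_tmul_smul, map_smul_eq_mul, norm_mul, Complex.norm_real,
      Complex.norm_real, Real.norm_of_nonneg (inv_pos.2 hp).le,
      Real.norm_of_nonneg (inv_pos.2 hq).le, ← mul_inv, inv_mul_le_iff₀ (mul_pos hp hq),
      mul_one] at h1
    exact h1
  have ht : Filter.Tendsto (fun ε : ℝ => (p m + ε) * (q n + ε)) (𝓝[>] 0) (𝓝 (p m * q n)) := by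
    have : Continuous fun ε : ℝ => (p m + ε) * (q n + ε) := by fun_prop
    have h2 := this.tendsto 0
    simp only [add_zero] at h2
    exact h2.mono_left nhdsWithin_le_nhds
  have h3 := ge_of_tendsto ht (eventually_nhdsWithin_of_forall fun ε hε => key ε hε)
  exact h3.trans hc.le

/-- The difference of two pure tensors is expanded in the increments of the factors. Each of the
three terms is bounded by a product of values of `p` and `q` that tends to `0`. -/
theorem continuous_seminorm_tmul (r : Seminorm ℂ (M ⊗[ℂ] N)) {p : Seminorm ℂ M}
    {q : Seminorm ℂ N} (hp : Continuous p) (hq : Continuous q)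
    (h : ∀ m n, r (m ⊗ₜ[ℂ] n) ≤ p m * q n) :
    Continuous fun x : M × N => r (x.1 ⊗ₜ[ℂ] x.2) := by
  rw [continuous_iff_continuousAt]
  rintro ⟨m, n⟩
  have h1 : Filter.Tendsto (fun x : M × N => p (x.1 - m) * q (x.2 - n) + p m * q (x.2 - n) +
      p (x.1 - m) * q n) (𝓝 (m, n)) (𝓝 0) := by
    have hc : Continuous (fun x : M × N => p (x.1 - m) * q (x.2 - n) + p m * q (x.2 - n) +
      p (x.1 - m) * q n) := by fun_prop
    simpa using hc.tendsto (m, n)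
  rw [ContinuousAt, tendsto_iff_norm_sub_tendsto_zero]
  refine squeeze_zero (fun _ => norm_nonneg _) (fun x => ?_) h1
  refine (abs_sub_map_le_sub r _ _).trans ?_
  have : x.1 ⊗ₜ[ℂ] x.2 - m ⊗ₜ[ℂ] n = (x.1 - m) ⊗ₜ[ℂ] (x.2 - n) + m ⊗ₜ[ℂ] (x.2 - n) +
      (x.1 - m) ⊗ₜ[ℂ] n := by
    simp only [TensorProduct.sub_tmul, TensorProduct.tmul_sub]; abel
  rw [this]
  exact (map_add_le_add r _ _).trans (add_le_add ((map_add_le_add r _ _).trans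
    (add_le_add (h _ _) (h _ _))) (h _ _))

/-- Only continuity of `r (m ⊗ n)` at the origin enters; the global bound follows by homogeneity. -/
theorem Admissible.exists_le {r : Seminorm ℂ (M ⊗[ℂ] N)} (hr : Admissible ra la r) :
    ∃ (p : Seminorm ℂ M) (q : Seminorm ℂ N), Continuous p ∧ Continuous q ∧
      ∀ m n, r (m ⊗ₜ[ℂ] n) ≤ p m * q n := by
  have h1 : {x : M × N | r (x.1 ⊗ₜ[ℂ] x.2) < 1} ∈ 𝓝 ((0 : M), (0 : N)) := by
    refine (hr.continuous_tmul.tendsto (0, 0)).eventually (gt_mem_nhds ?_)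
    simp
  rw [nhds_prod_eq, ((FrechetSpace.hasBasis_seminorm M).prod
    (FrechetSpace.hasBasis_seminorm N)).mem_iff] at h1
  obtain ⟨⟨p, q⟩, ⟨hp, hq⟩, h⟩ := h1
  exact ⟨p, q, hp, hq, tmul_seminorm_le r fun m n hm hn => (h (mk_mem_prod hm hn) : r _ < 1).le⟩

theorem PreTensor.continuous_of_tmul :
    Continuous fun x : M × N => PreTensor.of ra la (x.1 ⊗ₜ[ℂ] x.2) := by
  rw [continuous_iff_continuousAt]
  rintro ⟨m, n⟩
  rw [ContinuousAt, PreTensor.withSeminorms.tendsto_nhds]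
  rintro ⟨r, hr⟩ ε hε
  obtain ⟨p, q, hp, hq, h⟩ := hr.exists_le
  have h1 : Filter.Tendsto (fun x : M × N => p (x.1 - m) * q (x.2 - n) + p m * q (x.2 - n) +
      p (x.1 - m) * q n) (𝓝 (m, n)) (𝓝 0) := by
    have hc : Continuous (fun x : M × N => p (x.1 - m) * q (x.2 - n) + p m * q (x.2 - n) +
      p (x.1 - m) * q n) := by fun_prop
    simpa using hc.tendsto (m, n)
  filter_upwards [h1.eventually (gt_mem_nhds hε)] with x hx
  refine lt_of_le_of_lt ?_ hx
  have : x.1 ⊗ₜ[ℂ] x.2 - m ⊗ₜ[ℂ] n = (x.1 - m) ⊗ₜ[ℂ] (x.2 - n) + m ⊗ₜ[ℂ] (x.2 - n) +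
      (x.1 - m) ⊗ₜ[ℂ] n := by
    simp only [TensorProduct.sub_tmul, TensorProduct.tmul_sub]; abel
  show r (x.1 ⊗ₜ[ℂ] x.2 - m ⊗ₜ[ℂ] n) ≤ _
  rw [this]
  exact (map_add_le_add r _ _).trans (add_le_add ((map_add_le_add r _ _).trans
    (add_le_add (h _ _) (h _ _))) (h _ _))

/-- The admissible seminorms are therefore all the continuous ones. Composition with the continuous
map `(m, n) ↦ m ⊗ n` gives the first condition. A balancing relation is inseparable from `0`, so a
continuous seminorm must vanish on it. -/
theorem PreTensor.continuous_iff (r : Seminorm ℂ (PreTensor ra la)) :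
    Continuous r ↔ Admissible ra la (r : Seminorm ℂ (M ⊗[ℂ] N)) := by
  refine ⟨fun h => ⟨h.comp PreTensor.continuous_of_tmul, fun m a n => ?_⟩,
    fun h => PreTensor.withSeminorms.continuous_seminorm ⟨r, h⟩⟩
  have h0 : Filter.Tendsto (fun _ : ℕ => PreTensor.of ra la (ra m a ⊗ₜ[ℂ] n - m ⊗ₜ[ℂ] la a n))
      Filter.atTop (𝓝 0) := by
    rw [PreTensor.withSeminorms.tendsto_nhds]
    rintro ⟨r', hr'⟩ ε hε
    refine Filter.Eventually.of_forall fun _ => ?_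
    show r' (ra m a ⊗ₜ[ℂ] n - m ⊗ₜ[ℂ] la a n - 0) < ε
    rw [sub_zero, hr'.balanced]
    exact hε
  have h1 := (h.tendsto 0).comp h0
  rw [map_zero] at h1
  exact tendsto_nhds_unique tendsto_const_nhds h1

theorem PreTensor.hasBasis : (𝓝 (0 : PreTensor ra la)).HasBasis
    (fun r : Seminorm ℂ (M ⊗[ℂ] N) => Admissible ra la r) (fun r => {x : M ⊗[ℂ] N | r x < 1}) := by
  have := PreTensor.withSeminorms (ra := ra) (la := la).toPolynormableSpace
  refine (FrechetSpace.hasBasis_seminorm (PreTensor ra la)).to_hasBasis (fun r hr => ?_)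
    (fun r hr => ?_)
  · exact ⟨r, (PreTensor.continuous_iff r).1 hr, subset_rfl⟩
  · exact ⟨r, (PreTensor.continuous_iff (PreTensor.seminorm r)).2 hr, subset_rfl⟩

namespace CTensor

theorem uniformContinuous_preSeminorm {r : Seminorm ℂ (M ⊗[ℂ] N)} (hr : Admissible ra la r) :
    UniformContinuous (PreTensor.seminorm (ra := ra) (la := la) r) :=
  Seminorm.uniformContinuous_of_continuousAt_zero
    ((PreTensor.continuous_iff (PreTensor.seminorm r)).2 hr).continuousAt

/-- The extension of an admissible seminorm to the completed tensor product. -/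
def seminorm {r : Seminorm ℂ (M ⊗[ℂ] N)} (hr : Admissible ra la r) : Seminorm ℂ (CTensor ra la) :=
  have hcoe : ∀ x : PreTensor ra la, UniformSpace.Completion.extension
      (PreTensor.seminorm (ra := ra) (la := la) r) x = PreTensor.seminorm r x := fun x =>
    UniformSpace.Completion.extension_coe (uniformContinuous_preSeminorm hr) x
  Seminorm.of (UniformSpace.Completion.extension (PreTensor.seminorm (ra := ra) (la := la) r))
    (fun x y => UniformSpace.Completion.induction_on₂ x y
      (isClosed_le (UniformSpace.Completion.continuous_extension.comp continuous_add)
          ((UniformSpace.Completion.continuous_extension.comp continuous_fst).add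
            (UniformSpace.Completion.continuous_extension.comp continuous_snd)))
      fun x y => by
        rw [← UniformSpace.Completion.coe_add, hcoe, hcoe, hcoe]
        exact map_add_le_add _ x y)
    (fun c x => UniformSpace.Completion.induction_on x
      (isClosed_eq (UniformSpace.Completion.continuous_extension.comp
          (continuous_const_smul c)) (continuous_const.mul UniformSpace.Completion.continuous_extension))
      fun x => by
        rw [← UniformSpace.Completion.coe_smul, hcoe, hcoe]
        exact map_smul_eq_mul _ c x)

theorem seminorm_coe {r : Seminorm ℂ (M ⊗[ℂ] N)} (hr : Admissible ra la r) (x : PreTensor ra la) :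
    seminorm hr x = PreTensor.seminorm r x :=
  UniformSpace.Completion.extension_coe (uniformContinuous_preSeminorm hr) x

theorem continuous_seminorm {r : Seminorm ℂ (M ⊗[ℂ] N)} (hr : Admissible ra la r) :
    Continuous (seminorm hr) :=
  UniformSpace.Completion.continuous_extension (f := PreTensor.seminorm (ra := ra) (la := la) r)

theorem seminorm_mono {r r' : Seminorm ℂ (M ⊗[ℂ] N)} (hr : Admissible ra la r)
    (hr' : Admissible ra la r') (h : r ≤ r') : seminorm hr ≤ seminorm hr' := by
  intro x
  show seminorm hr x ≤ seminorm hr' x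
  induction x using UniformSpace.Completion.induction_on with
  | hp => exact isClosed_le (continuous_seminorm hr) (continuous_seminorm hr')
  | ih x => rw [seminorm_coe, seminorm_coe]; exact h x

/-- A neighbourhood is shrunk to a closed one, whose trace on the dense subspace contains a seminorm
ball. Points of the open ball of the extended seminorm are limits of points of the dense subspace in
that ball, so they lie in the closed neighbourhood. -/
theorem nhds_zero_basis : (𝓝 (0 : CTensor ra la)).HasBasis
    (fun r : Seminorm ℂ (M ⊗[ℂ] N) => Admissible ra la r)
    (fun r => {x | ∃ hr : Admissible ra la r, seminorm hr x < 1}) := by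
  refine ⟨fun U => ⟨fun hU => ?_, ?_⟩⟩
  · obtain ⟨C, hC, hCc, hCU⟩ := exists_mem_nhds_isClosed_subset hU
    have h1 : (fun x : PreTensor ra la => (x : CTensor ra la)) ⁻¹' C ∈ 𝓝 (0 : PreTensor ra la) :=
      (UniformSpace.Completion.continuous_coe (PreTensor ra la)).continuousAt.preimage_mem_nhds
        (by rwa [UniformSpace.Completion.coe_zero])
    obtain ⟨r, hr, h2⟩ := PreTensor.hasBasis.mem_iff.1 h1
    refine ⟨r, hr, fun x hx => hCU ?_⟩
    obtain ⟨_, hx⟩ := hx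
    have hopen : IsOpen {x | seminorm hr x < 1} :=
      isOpen_lt (continuous_seminorm hr) continuous_const
    have h3 := (UniformSpace.Completion.denseRange_coe
      (α := PreTensor ra la)).open_subset_closure_inter hopen hx
    refine hCc.closure_subset_iff.2 ?_ h3
    rintro _ ⟨hy, ⟨y, rfl⟩⟩
    refine h2 ?_
    have hy' : seminorm hr y < 1 := hy
    rwa [seminorm_coe] at hy'
  · rintro ⟨r, hr, h⟩
    refine Filter.mem_of_superset ?_ h
    have : {x | seminorm hr x < 1} ∈ 𝓝 (0 : CTensor ra la) :=
      (isOpen_lt (continuous_seminorm hr) continuous_const).mem_nhds (by simp)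
    exact Filter.mem_of_superset this fun x hx => ⟨hr, hx⟩

theorem nhds_zero_eq : 𝓝 (0 : CTensor ra la) =
    ⨅ r : {r : Seminorm ℂ (M ⊗[ℂ] N) // Admissible ra la r}, (𝓝 0).comap (seminorm r.2) := by
  refine le_antisymm (le_iInf fun r => ?_) ?_
  · rw [← Filter.tendsto_iff_comap]
    simpa using (continuous_seminorm r.2).tendsto 0
  · intro U hU
    obtain ⟨r, hr, h⟩ := nhds_zero_basis.mem_iff.1 hU
    refine Filter.mem_iInf_of_mem ⟨r, hr⟩ ?_
    refine ⟨Iio 1, Iio_mem_nhds one_pos, fun x hx => h ⟨hr, hx⟩⟩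

theorem withSeminorms : WithSeminorms (E := CTensor ra la) (𝕜 := ℂ)
    fun r : {r : Seminorm ℂ (M ⊗[ℂ] N) // Admissible ra la r} => seminorm r.2 := by
  rw [SeminormFamily.withSeminorms_iff_nhds_eq_iInf]
  exact nhds_zero_eq

/-- The largest seminorm that is at most one on the tensors `m ⊗ n` with `m ∈ U`, `n ∈ V`. -/
theorem exists_largest (U : Set M) (V : Set N) (hU : U ∈ 𝓝 0) (hV : V ∈ 𝓝 0) :
    ∃ R, Admissible ra la R ∧ ∀ r, Admissible ra la r →
      (∀ m ∈ U, ∀ n ∈ V, r (m ⊗ₜ[ℂ] n) ≤ 1) → r ≤ R := by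
  obtain ⟨p, hp, hpU⟩ := (FrechetSpace.hasBasis_seminorm M).mem_iff.1 hU
  obtain ⟨q, hq, hqV⟩ := (FrechetSpace.hasBasis_seminorm N).mem_iff.1 hV
  let ι := {r : Seminorm ℂ (M ⊗[ℂ] N) // Admissible ra la r ∧
    ∀ m ∈ U, ∀ n ∈ V, r (m ⊗ₜ[ℂ] n) ≤ 1}
  -- On pure tensors all competing seminorms are bounded by `p m * q n`. By subadditivity they are
  -- bounded at every element, so their supremum is a seminorm, and the same bound makes it
  -- admissible.
  have hle : ∀ (i : ι) m n, i.1 (m ⊗ₜ[ℂ] n) ≤ p m * q n := fun i =>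
    tmul_seminorm_le i.1 fun m n hm hn => i.2.2 m (hpU hm) n (hqV hn)
  have : Nonempty ι := ⟨⟨0, ⟨continuous_const, fun _ _ _ => rfl⟩, fun _ _ _ _ => zero_le_one⟩⟩
  have hbdd : BddAbove (range fun i : ι => i.1) := by
    rw [Seminorm.bddAbove_range_iff]
    intro x
    induction x using TensorProduct.induction_on with
    | zero => exact ⟨0, by rintro _ ⟨i, rfl⟩; simp⟩
    | tmul m n => exact ⟨_, by rintro _ ⟨i, rfl⟩; exact hle i m n⟩
    | add x y hx hy =>
      obtain ⟨a, ha⟩ := hx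
      obtain ⟨b, hb⟩ := hy
      exact ⟨a + b, by
        rintro _ ⟨i, rfl⟩
        exact (map_add_le_add i.1 x y).trans (add_le_add (ha ⟨i, rfl⟩) (hb ⟨i, rfl⟩))⟩
  have happ : ∀ x, (⨆ i : ι, i.1) x = ⨆ i : ι, i.1 x := fun x => by
    rw [Seminorm.iSup_apply hbdd]
  refine ⟨⨆ i : ι, i.1, ⟨continuous_seminorm_tmul _ hp hq fun m n => ?_, fun m a n => ?_⟩,
    fun r hr h => le_ciSup hbdd (⟨r, hr, h⟩ : ι)⟩
  · rw [happ]
    exact ciSup_le fun i => hle i m n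
  · rw [happ]
    simp only [fun i : ι => i.2.1.balanced m a n]
    exact ciSup_const

/-- Metrizability is the point. The family of all admissible seminorms need not be countable, but
each of them is dominated by the largest seminorm attached to some pair taken from countable
neighbourhood bases of `M` and `N`. -/
instance frechetSpace : FrechetSpace (CTensor ra la) := by
  have h1 := (withSeminorms (ra := ra) (la := la)).continuousSMul
  have h2 := (withSeminorms (ra := ra) (la := la)).toLocallyConvexSpace
  have h3 : (𝓝 (0 : CTensor ra la)).IsCountablyGenerated := by
    obtain ⟨U, hU⟩ := (𝓝 (0 : M)).exists_antitone_basis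
    obtain ⟨V, hV⟩ := (𝓝 (0 : N)).exists_antitone_basis
    choose R hR hmax using fun k : ℕ × ℕ => exists_largest (ra := ra) (la := la) (U k.1) (V k.2)
      (hU.mem k.1) (hV.mem k.2)
    have : 𝓝 (0 : CTensor ra la) = ⨅ k : ℕ × ℕ, (𝓝 0).comap (seminorm (hR k)) := by
      refine le_antisymm (le_iInf fun k => ?_) ?_
      · rw [← Filter.tendsto_iff_comap]
        simpa using (continuous_seminorm (hR k)).tendsto 0
      · intro W hW
        obtain ⟨r, hr, h⟩ := nhds_zero_basis.mem_iff.1 hW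
        have h4 : {x : M × N | r (x.1 ⊗ₜ[ℂ] x.2) < 1} ∈ 𝓝 ((0 : M), (0 : N)) := by
          refine (hr.continuous_tmul.tendsto (0, 0)).eventually (gt_mem_nhds ?_)
          simp
        rw [nhds_prod_eq, (hU.toHasBasis.prod hV.toHasBasis).mem_iff] at h4
        obtain ⟨k, -, hk⟩ := h4
        have h5 : r ≤ R k := hmax k r hr fun m hm n hn => (hk (mk_mem_prod hm hn) : r _ < 1).le
        refine Filter.mem_iInf_of_mem k ?_
        exact ⟨Iio 1, Iio_mem_nhds one_pos, fun x hx =>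
          h ⟨hr, (seminorm_mono hr (hR k) h5 x).trans_lt hx⟩⟩
    rw [this]
    infer_instance
  have h4 : (𝓤 (CTensor ra la)).IsCountablyGenerated :=
    IsUniformAddGroup.uniformity_countably_generated
  exact { h1, h2, h4 with }

end CTensor

end TensorFrechet

/-! ### Closed subspaces and countable products -/

namespace FrechetSpace

variable {V W : Type*} [AddCommGroup V] [Module ℂ V] [UniformSpace V]
  [AddCommGroup W] [Module ℂ W] [UniformSpace W] [FrechetSpace W]

/-- A space embedded as a closed subspace in a Fréchet space is a Fréchet space. -/
theorem of_isUniformInducing (f : V →ₗ[ℂ] W) (hf : IsUniformInducing f)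
    (hinj : Function.Injective f) (hcl : IsClosed (range f)) : FrechetSpace V := by
  have h1 : IsUniformAddGroup V := hf.isUniformAddGroup f
  have h2 : ContinuousSMul ℂ V := hf.isInducing.continuousSMul continuous_id (map_smul f _ _)
  have h3 : LocallyConvexSpace ℝ V := by
    have := LocallyConvexSpace.induced (𝕜 := ℝ) (f.restrictScalars ℝ)
    convert! this
    exact hf.isInducing.eq_induced
  have h4 : T2Space V := T2Space.of_injective_continuous hinj hf.isInducing.continuous
  have h5 : CompleteSpace V := (completeSpace_iff_isComplete_range hf).2 hcl.isComplete
  have h6 : (𝓤 V).IsCountablyGenerated := by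
    rw [← hf.comap_uniformity]; infer_instance
  exact { h1, h2, h3, h4, h5, h6 with }

theorem of_isClosed (S : Submodule ℂ W) (hS : IsClosed (S : Set W)) : FrechetSpace S :=
  of_isUniformInducing S.subtype (isUniformInducing_val (S : Set W)) Subtype.val_injective (by
    simpa using hS)

instance pi {ι : Type*} [Countable ι] {V : ι → Type*} [∀ i, AddCommGroup (V i)]
    [∀ i, Module ℂ (V i)] [∀ i, UniformSpace (V i)] [∀ i, FrechetSpace (V i)] :
    FrechetSpace (∀ i, V i) := by
  have h3 : LocallyConvexSpace ℝ (∀ i, V i) := inferInstance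
  exact { h3 with }

end FrechetSpace

/-! ### Continuous bilinear maps with one variable fixed -/

section Bilinear

variable {M S Z : Type*} [AddCommGroup M] [Module ℂ M] [AddCommGroup S] [Module ℂ S]
  [AddCommGroup Z] [Module ℂ Z] [TopologicalSpace M] [TopologicalSpace S] [TopologicalSpace Z]

/-- A continuous bilinear map as a continuous linear map in the second variable. -/
def clmRight (T : M →ₗ[ℂ] S →ₗ[ℂ] Z) (hT : Continuous fun x : M × S => T x.1 x.2) (m : M) :
    S →L[ℂ] Z :=
  ⟨T m, hT.comp (continuous_const.prodMk continuous_id)⟩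

/-- A continuous bilinear map as a continuous linear map in the first variable. -/
def clmLeft (T : M →ₗ[ℂ] S →ₗ[ℂ] Z) (hT : Continuous fun x : M × S => T x.1 x.2) (s : S) :
    M →L[ℂ] Z :=
  ⟨T.flip s, hT.comp (continuous_id.prodMk continuous_const)⟩

theorem continuous_flip {T : M →ₗ[ℂ] S →ₗ[ℂ] Z} (hT : Continuous fun x : M × S => T x.1 x.2) :
    Continuous fun x : S × M => T.flip x.1 x.2 := hT.comp continuous_swap

@[simp] theorem clmRight_apply (T : M →ₗ[ℂ] S →ₗ[ℂ] Z)
    (hT : Continuous fun x : M × S => T x.1 x.2) (m : M) (s : S) : clmRight T hT m s = T m s := rfl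

end Bilinear

/-! ### Universal property and associativity of the completed tensor product -/

namespace CTensor

variable {A M N V Z : Type*} [AddCommGroup A] [Module ℂ A]
  [AddCommGroup M] [Module ℂ M] [UniformSpace M] [FrechetSpace M]
  [AddCommGroup N] [Module ℂ N] [UniformSpace N] [FrechetSpace N]
  [AddCommGroup V] [Module ℂ V] [UniformSpace V] [FrechetSpace V]
  [AddCommGroup Z] [Module ℂ Z] [UniformSpace Z] [FrechetSpace Z]
  {ra : M →ₗ[ℂ] A →ₗ[ℂ] M} {la : A →ₗ[ℂ] N →ₗ[ℂ] N}

theorem continuous_tmul : Continuous fun x : M × N => tmul ra la x.1 x.2 :=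
  (UniformSpace.Completion.continuous_coe _).comp PreTensor.continuous_of_tmul

/-- Every admissible seminorm kills the difference, and the extended seminorms separate the points
of the Hausdorff completion. -/
theorem balanced (m : M) (a : A) (n : N) : tmul ra la (ra m a) n = tmul ra la m (la a n) := by
  rw [← sub_eq_zero]
  by_contra hne
  obtain ⟨r, hr⟩ := (withSeminorms (ra := ra) (la := la)).separating_of_T1 _ hne
  refine hr ?_
  have : tmul ra la (ra m a) n - tmul ra la m (la a n) =
      ((PreTensor.of ra la (ra m a ⊗ₜ[ℂ] n - m ⊗ₜ[ℂ] la a n) : PreTensor ra la) :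
        CTensor ra la) := by
    rw [map_sub, UniformSpace.Completion.coe_sub]; rfl
  rw [this, seminorm_coe]
  exact r.2.balanced m a n

theorem smul_tmul (c : ℂ) (m : M) (n : N) : tmul ra la (c • m) n = c • tmul ra la m n := by
  rw [tmul, ← TensorProduct.smul_tmul', map_smul, UniformSpace.Completion.coe_smul]; rfl

theorem tmul_smul (c : ℂ) (m : M) (n : N) : tmul ra la m (c • n) = c • tmul ra la m n := by
  rw [tmul, TensorProduct.tmul_smul, map_smul, UniformSpace.Completion.coe_smul]; rfl

variable (ra la) in
/-- The bilinear map `(m, n) ↦ m ⊗ n`. -/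
def mk : M →ₗ[ℂ] N →ₗ[ℂ] CTensor ra la :=
  LinearMap.mk₂ ℂ (tmul ra la) (add_tmul ra la) smul_tmul (tmul_add ra la) tmul_smul

@[simp] theorem mk_apply (m : M) (n : N) : mk ra la m n = tmul ra la m n := rfl

/-- The working principle for completed tensor products: pure tensors span a dense subspace, so
closed linear conditions need checking only on them. -/
theorem closed_induction {S : Submodule ℂ (CTensor ra la)} (hS : IsClosed (S : Set (CTensor ra la)))
    (h : ∀ m n, tmul ra la m n ∈ S) (t : CTensor ra la) : t ∈ S := by
  have h1 : (Submodule.span ℂ {t | ∃ m n, t = tmul ra la m n}) ≤ S :=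
    Submodule.span_le.2 (by rintro _ ⟨m, n, rfl⟩; exact h m n)
  have h2 := dense_tmul (ra := ra) (la := la)
  exact hS.closure_subset_iff.2 h1 (h2 t)

theorem ext {Y : Type*} [AddCommGroup Y] [Module ℂ Y] [TopologicalSpace Y] [T2Space Y]
    {f g : CTensor ra la →L[ℂ] Y} (h : ∀ m n, f (tmul ra la m n) = g (tmul ra la m n)) : f = g :=
  ContinuousLinearMap.ext_on dense_tmul (by rintro _ ⟨m, n, rfl⟩; exact h m n)

/-- The continuous linear map out of a completed tensor product given by a continuous balanced
bilinear map. -/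
def lift (b : M →ₗ[ℂ] N →ₗ[ℂ] Z) (hb : Continuous fun p : M × N => b p.1 p.2)
    (hbal : ∀ m a n, b (ra m a) n = b m (la a n)) : CTensor ra la →L[ℂ] Z :=
  ContinuousLinearMap.fromCompletion (α := PreTensor ra la)
    { toLinearMap := TensorProduct.lift b ∘ₗ (PreTensor.of ra la).symm.toLinearMap
      cont := by
        refine WithSeminorms.continuous_of_isBounded PreTensor.withSeminorms
          (PolynormableSpace.withSeminorms ℂ Z) _ ?_
        rintro ⟨q, hq⟩
        let r : Seminorm ℂ (M ⊗[ℂ] N) := q.comp (TensorProduct.lift b)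
        have hr : Admissible ra la r := by
          refine ⟨?_, fun m a n => ?_⟩
          · show Continuous fun p : M × N => q (TensorProduct.lift b (p.1 ⊗ₜ p.2))
            simp only [TensorProduct.lift.tmul]
            exact hq.comp hb
          · show q (TensorProduct.lift b _) = 0
            rw [map_sub, TensorProduct.lift.tmul, TensorProduct.lift.tmul, hbal, sub_self, map_zero]
        -- The pullback of the seminorm `q` of `Z` is itself admissible, so a single seminorm with
        -- constant `1` gives the bound.
        refine ⟨{⟨r, hr⟩}, 1, ?_⟩
        rw [one_smul, Finset.sup_singleton]
        exact le_rfl }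

@[simp] theorem lift_tmul (b : M →ₗ[ℂ] N →ₗ[ℂ] Z) (hb : Continuous fun p : M × N => b p.1 p.2)
    (hbal : ∀ m a n, b (ra m a) n = b m (la a n)) (m : M) (n : N) :
    lift b hb hbal (tmul ra la m n) = b m n := by
  refine (ContinuousLinearMap.fromCompletion_apply_coe _ _).trans ?_
  exact TensorProduct.lift.tmul m n

/-- A bilinear map on `V × (M ⊗ N)` is continuous as soon as it is continuous in the second
variable, and in the first one on pure tensors. -/
theorem continuous_bilin (B : V →ₗ[ℂ] CTensor ra la →ₗ[ℂ] Z) (h1 : ∀ x, Continuous (B x))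
    (h2 : ∀ m n, Continuous fun x => B x (tmul ra la m n)) :
    Continuous fun p : V × CTensor ra la => B p.1 p.2 := by
  refine FrechetSpace.continuous_of_separately B h1 fun t => ?_
  let S : Submodule ℂ (CTensor ra la) :=
    { carrier := {t | Continuous fun x => B x t}
      add_mem' := fun {s t} hs ht => by
        have : (fun x => B x (s + t)) = fun x => B x s + B x t := funext fun x => map_add _ _ _
        show Continuous _
        rw [this]
        exact Continuous.add hs ht
      zero_mem' := by
        show Continuous fun x => B x 0
        simp only [map_zero]
        exact continuous_const
      smul_mem' := fun c t ht => by
        have : (fun x => B x (c • t)) = fun x => c • B x t := funext fun x => map_smul _ _ _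
        show Continuous _
        rw [this]
        exact Continuous.const_smul ht c }
  refine closed_induction (S := S) ?_ h2 t
  -- By metrizability `t` is the limit of a sequence in `S`. Then `x ↦ B x t` is a pointwise limit
  -- of continuous linear maps, hence continuous by Banach–Steinhaus.
  refine isClosed_of_closure_subset fun t ht => ?_
  obtain ⟨s, hs, hst⟩ := mem_closure_iff_seq_limit.1 ht
  exact FrechetSpace.continuous_of_tendsto _ Filter.atTop (fun n => ⟨B.flip (s n), hs n⟩)
    fun x => ((h1 x).tendsto t).comp hst

/-- The bilinear map on `V × (M ⊗ N)` given by a trilinear map on `V × M × N`. -/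
def liftBilin (b : V →ₗ[ℂ] M →ₗ[ℂ] N →ₗ[ℂ] Z)
    (hb : ∀ x, Continuous fun p : M × N => b x p.1 p.2)
    (hbal : ∀ x m a n, b x (ra m a) n = b x m (la a n)) :
    V →ₗ[ℂ] CTensor ra la →ₗ[ℂ] Z where
  toFun x := (lift (b x) (hb x) (hbal x) : CTensor ra la →ₗ[ℂ] Z)
  map_add' x y := by
    rw [← ContinuousLinearMap.toLinearMap_add]
    congr 1
    exact ext fun m n => by simp
  map_smul' c x := by
    rw [RingHom.id_apply, ← ContinuousLinearMap.toLinearMap_smul]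
    congr 1
    exact ext fun m n => by simp

section liftBilin

variable (b : V →ₗ[ℂ] M →ₗ[ℂ] N →ₗ[ℂ] Z)
    (hb : ∀ x, Continuous fun p : M × N => b x p.1 p.2)
    (hbal : ∀ x m a n, b x (ra m a) n = b x m (la a n))

@[simp] theorem liftBilin_tmul (x : V) (m : M) (n : N) :
    liftBilin b hb hbal x (tmul ra la m n) = b x m n :=
  lift_tmul _ (hb x) (hbal x) m n

theorem continuous_liftBilin (hV : ∀ m n, Continuous fun x => b x m n) :
    Continuous fun p : V × CTensor ra la => liftBilin b hb hbal p.1 p.2 := by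
  refine continuous_bilin _ (fun x => (lift (b x) (hb x) (hbal x)).continuous) fun m n => ?_
  simpa using hV m n

end liftBilin

/-- The tensor product of two continuous linear maps. -/
def map₂ {A' M' N' : Type*} [AddCommGroup A'] [Module ℂ A']
    [AddCommGroup M'] [Module ℂ M'] [UniformSpace M'] [FrechetSpace M']
    [AddCommGroup N'] [Module ℂ N'] [UniformSpace N'] [FrechetSpace N']
    {ra' : M' →ₗ[ℂ] A' →ₗ[ℂ] M'} {la' : A' →ₗ[ℂ] N' →ₗ[ℂ] N'} (f : M →L[ℂ] M') (g : N →L[ℂ] N')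
    (h : ∀ m a n, tmul ra' la' (f (ra m a)) (g n) = tmul ra' la' (f m) (g (la a n))) :
    CTensor ra la →L[ℂ] CTensor ra' la' :=
  lift ((mk ra' la').compl₁₂ (f : M →ₗ[ℂ] M') (g : N →ₗ[ℂ] N'))
    (continuous_tmul.comp ((f.continuous.comp continuous_fst).prodMk
      (g.continuous.comp continuous_snd))) h

@[simp] theorem map₂_tmul {A' M' N' : Type*} [AddCommGroup A'] [Module ℂ A']
    [AddCommGroup M'] [Module ℂ M'] [UniformSpace M'] [FrechetSpace M']
    [AddCommGroup N'] [Module ℂ N'] [UniformSpace N'] [FrechetSpace N']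
    {ra' : M' →ₗ[ℂ] A' →ₗ[ℂ] M'} {la' : A' →ₗ[ℂ] N' →ₗ[ℂ] N'} (f : M →L[ℂ] M') (g : N →L[ℂ] N')
    (h : ∀ m a n, tmul ra' la' (f (ra m a)) (g n) = tmul ra' la' (f m) (g (la a n)))
    (m : M) (n : N) : map₂ f g h (tmul ra la m n) = tmul ra' la' (f m) (g n) :=
  lift_tmul _ _ _ m n

/-- `lift` for a bilinear map with its variables exchanged. -/
def liftSwap (b : N →ₗ[ℂ] M →ₗ[ℂ] Z) (hb : Continuous fun p : N × M => b p.1 p.2)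
    (hbal : ∀ m a n, b n (ra m a) = b (la a n) m) : CTensor ra la →L[ℂ] Z :=
  lift b.flip (hb.comp continuous_swap) hbal

theorem liftSwap_tmul (b : N →ₗ[ℂ] M →ₗ[ℂ] Z) (hb : Continuous fun p : N × M => b p.1 p.2)
    (hbal : ∀ m a n, b n (ra m a) = b (la a n) m) (m : M) (n : N) :
    liftSwap b hb hbal (tmul ra la m n) = b n m :=
  lift_tmul _ _ _ m n

/-- The trilinear map `(p, m, n) ↦ T m (β n p)`. -/
def trilin {M N P S Z : Type*} [AddCommGroup M] [Module ℂ M] [AddCommGroup N] [Module ℂ N]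
    [AddCommGroup P] [Module ℂ P] [AddCommGroup S] [Module ℂ S] [AddCommGroup Z] [Module ℂ Z]
    (T : M →ₗ[ℂ] S →ₗ[ℂ] Z) (β : N →ₗ[ℂ] P →ₗ[ℂ] S) : P →ₗ[ℂ] M →ₗ[ℂ] N →ₗ[ℂ] Z where
  toFun p := T.compl₂ (β.flip p)
  map_add' _ _ := LinearMap.ext₂ fun _ _ => by simp
  map_smul' _ _ := LinearMap.ext₂ fun _ _ => by simp

theorem trilin_apply {M N P S Z : Type*} [AddCommGroup M] [Module ℂ M] [AddCommGroup N]
    [Module ℂ N] [AddCommGroup P] [Module ℂ P] [AddCommGroup S] [Module ℂ S] [AddCommGroup Z]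
    [Module ℂ Z] (T : M →ₗ[ℂ] S →ₗ[ℂ] Z) (β : N →ₗ[ℂ] P →ₗ[ℂ] S) (p : P) (m : M) (n : N) :
    trilin T β p m n = T m (β n p) := rfl

section

variable {M N P S Z : Type*} [AddCommGroup M] [Module ℂ M] [AddCommGroup N] [Module ℂ N]
    [AddCommGroup P] [Module ℂ P] [AddCommGroup S] [Module ℂ S] [AddCommGroup Z] [Module ℂ Z]
    [TopologicalSpace M] [TopologicalSpace N] [TopologicalSpace P] [TopologicalSpace S]
    [TopologicalSpace Z] {T : M →ₗ[ℂ] S →ₗ[ℂ] Z} {β : N →ₗ[ℂ] P →ₗ[ℂ] S}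
    (hT : Continuous fun x : M × S => T x.1 x.2) (hβ : Continuous fun x : N × P => β x.1 x.2)

include hT hβ

theorem continuous_trilin (p : P) : Continuous fun x : M × N => trilin T β p x.1 x.2 := by
  simp only [trilin_apply]
  exact hT.comp (continuous_fst.prodMk (hβ.comp (continuous_snd.prodMk continuous_const)))

theorem continuous_trilin' (m : M) (n : N) : Continuous fun p => trilin T β p m n := by
  simp only [trilin_apply]
  exact hT.comp (continuous_const.prodMk (hβ.comp (continuous_const.prodMk continuous_id)))

end

section Assoc

variable {B P : Type*} [AddCommGroup B] [Module ℂ B]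
  [AddCommGroup P] [Module ℂ P] [UniformSpace P] [FrechetSpace P]
  {rb : N →ₗ[ℂ] B →ₗ[ℂ] N} {lb : B →ₗ[ℂ] P →ₗ[ℂ] P}
  {rb₂ : CTensor ra la →ₗ[ℂ] B →ₗ[ℂ] CTensor ra la}
  (hrb : ∀ m n b, rb₂ (tmul ra la m n) b = tmul ra la m (rb n b))
  (hrbc : ∀ b, Continuous fun t => rb₂ t b)

/-- The bilinear map `(m, n ⊗ p) ↦ (m ⊗ n) ⊗ p`. -/
def assocMk : M →ₗ[ℂ] CTensor rb lb →ₗ[ℂ] CTensor rb₂ lb :=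
  liftBilin
    { toFun := fun m => mk rb₂ lb ∘ₗ mk ra la m
      map_add' := fun x y => by rw [map_add, LinearMap.comp_add]
      map_smul' := fun c x => by rw [map_smul, LinearMap.comp_smul, RingHom.id_apply] }
    (fun x => continuous_tmul.comp (((continuous_tmul.comp
      (continuous_const.prodMk continuous_id)).comp continuous_fst).prodMk continuous_snd))
    (fun m n b p => by
      show tmul rb₂ lb (tmul ra la m (rb n b)) p = tmul rb₂ lb (tmul ra la m n) (lb b p)
      rw [← hrb, balanced])

@[simp] theorem assocMk_tmul (m : M) (n : N) (p : P) :
    assocMk (lb := lb) hrb m (tmul rb lb n p) = tmul rb₂ lb (tmul ra la m n) p :=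
  liftBilin_tmul _ _ _ m n p

theorem continuous_assocMk :
    Continuous fun p : M × CTensor rb lb => assocMk (rb₂ := rb₂) hrb p.1 p.2 := by
  refine continuous_liftBilin _ _ _ fun n p => ?_
  exact continuous_tmul.comp ((continuous_tmul.comp (continuous_id.prodMk continuous_const)).prodMk
      continuous_const)

/-- The trilinear map underlying `liftAssoc`, read as a bilinear map on `P × (M ⊗ N)`. -/
def liftAssocAux (T : M →ₗ[ℂ] CTensor rb lb →ₗ[ℂ] Z)
    (hT : Continuous fun p : M × CTensor rb lb => T p.1 p.2)
    (hbal : ∀ m a n p, T (ra m a) (tmul rb lb n p) = T m (tmul rb lb (la a n) p)) :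
    P →ₗ[ℂ] CTensor ra la →ₗ[ℂ] Z :=
  liftBilin (trilin T (mk rb lb)) (continuous_trilin hT continuous_tmul)
    (fun p m a n => hbal m a n p)

theorem liftAssocAux_tmul (T : M →ₗ[ℂ] CTensor rb lb →ₗ[ℂ] Z)
    (hT : Continuous fun p : M × CTensor rb lb => T p.1 p.2)
    (hbal : ∀ m a n p, T (ra m a) (tmul rb lb n p) = T m (tmul rb lb (la a n) p)) (m : M) (n : N)
    (p : P) : liftAssocAux T hT hbal p (tmul ra la m n) = T m (tmul rb lb n p) :=
  liftBilin_tmul _ _ _ p m n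

theorem continuous_liftAssocAux (T : M →ₗ[ℂ] CTensor rb lb →ₗ[ℂ] Z)
    (hT : Continuous fun p : M × CTensor rb lb => T p.1 p.2)
    (hbal : ∀ m a n p, T (ra m a) (tmul rb lb n p) = T m (tmul rb lb (la a n) p)) :
    Continuous fun x : P × CTensor ra la => liftAssocAux T hT hbal x.1 x.2 := by
  exact continuous_liftBilin _ _ _ (continuous_trilin' hT continuous_tmul)

-- Both sides are continuous in `t`. On `m ⊗ n` the scalar `b` moves to `n` by `hrb`, and then
-- crosses to `p` because the second argument of `T` lives in a tensor product balanced over `B`.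
include hrb hrbc in
theorem liftAssocAux_balanced (T : M →ₗ[ℂ] CTensor rb lb →ₗ[ℂ] Z)
    (hT : Continuous fun p : M × CTensor rb lb => T p.1 p.2)
    (hbal : ∀ m a n p, T (ra m a) (tmul rb lb n p) = T m (tmul rb lb (la a n) p))
    (t : CTensor ra la) (b : B) (p : P) :
    liftAssocAux T hT hbal p (rb₂ t b) = liftAssocAux T hT hbal (lb b p) t := by
  let f : CTensor ra la →L[ℂ] Z := (clmRight _ (continuous_liftAssocAux T hT hbal) p).comp
    ⟨rb₂.flip b, hrbc b⟩
  have : f = clmRight _ (continuous_liftAssocAux T hT hbal) (lb b p) := ext fun m n => by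
    show liftAssocAux T hT hbal p (rb₂ (tmul ra la m n) b) =
      liftAssocAux T hT hbal (lb b p) (tmul ra la m n)
    rw [hrb, liftAssocAux_tmul, liftAssocAux_tmul, balanced]
  exact DFunLike.congr_fun this t

/-- The continuous linear map on `(M ⊗ N) ⊗ P` given by a bilinear map on `M × (N ⊗ P)`. -/
def liftAssoc (T : M →ₗ[ℂ] CTensor rb lb →ₗ[ℂ] Z)
    (hT : Continuous fun p : M × CTensor rb lb => T p.1 p.2)
    (hbal : ∀ m a n p, T (ra m a) (tmul rb lb n p) = T m (tmul rb lb (la a n) p)) :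
    CTensor rb₂ lb →L[ℂ] Z :=
  liftSwap (liftAssocAux T hT hbal) (continuous_liftAssocAux T hT hbal)
    (liftAssocAux_balanced hrb hrbc T hT hbal)

@[simp] theorem liftAssoc_tmul (T : M →ₗ[ℂ] CTensor rb lb →ₗ[ℂ] Z)
    (hT : Continuous fun p : M × CTensor rb lb => T p.1 p.2)
    (hbal : ∀ m a n p, T (ra m a) (tmul rb lb n p) = T m (tmul rb lb (la a n) p)) (m : M) (n : N)
    (p : P) : liftAssoc hrb hrbc T hT hbal (tmul rb₂ lb (tmul ra la m n) p) =
      T m (tmul rb lb n p) := by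
  refine (liftSwap_tmul _ _ _ _ _).trans ?_
  exact liftAssocAux_tmul T hT hbal m n p

/-- Both sides are continuous in `t` and agree on `n ⊗ p`. So a map out of `(M ⊗ N) ⊗ P` can be
evaluated on a whole element of `N ⊗ P` at once, which keeps later computations free of triple
tensors. -/
theorem liftAssoc_assocMk (T : M →ₗ[ℂ] CTensor rb lb →ₗ[ℂ] Z)
    (hT : Continuous fun p : M × CTensor rb lb => T p.1 p.2)
    (hbal : ∀ m a n p, T (ra m a) (tmul rb lb n p) = T m (tmul rb lb (la a n) p)) (m : M)
    (t : CTensor rb lb) : liftAssoc hrb hrbc T hT hbal (assocMk hrb m t) = T m t := by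
  have : (liftAssoc hrb hrbc T hT hbal).comp (clmRight _ (continuous_assocMk hrb) m) =
      clmRight T hT m := ext fun n p => by
    rw [ContinuousLinearMap.comp_apply, clmRight_apply, clmRight_apply, assocMk_tmul,
      liftAssoc_tmul]
  exact DFunLike.congr_fun this t

/-- Two continuous linear maps on `(M ⊗ N) ⊗ P` agree if they agree on pure tensors. -/
theorem ext₃ {Y : Type*} [AddCommGroup Y] [Module ℂ Y] [TopologicalSpace Y] [T2Space Y]
    {f g : CTensor rb₂ lb →L[ℂ] Y}
    (h : ∀ m n p, f (tmul rb₂ lb (tmul ra la m n) p) = g (tmul rb₂ lb (tmul ra la m n) p)) :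
    f = g := by
  refine ext fun t p => ?_
  have : f.comp (clmLeft (mk rb₂ lb) continuous_tmul p) =
      g.comp (clmLeft (mk rb₂ lb) continuous_tmul p) := ext fun m n => h m n p
  exact DFunLike.congr_fun this t

end Assoc

end CTensor

/-! ### Gradings -/

section Grading

variable {ι V : Type*} [DecidableEq ι] [AddCommGroup V] [Module ℂ V]

/-- `P i` is the identity on the `i`-th piece and kills the sum of the others, which gives
independence; the finite sum of the projections gives spanning. -/
theorem isInternal_of_projections (gr : ι → Submodule ℂ V) (P : ι → V →ₗ[ℂ] V) (s : Finset ι)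
    (hmem : ∀ i x, P i x ∈ gr i) (hid : ∀ i, ∀ x ∈ gr i, P i x = x)
    (hne : ∀ i j, i ≠ j → ∀ x ∈ gr j, P i x = 0) (hsum : ∀ x, ∑ i ∈ s, P i x = x) :
    DirectSum.IsInternal gr := by
  rw [DirectSum.isInternal_submodule_iff_iSupIndep_and_iSup_eq_top]
  refine ⟨fun i => ?_, ?_⟩
  · rw [Submodule.disjoint_def]
    intro x hx hx'
    have hle : ⨆ (j) (_ : j ≠ i), gr j ≤ LinearMap.ker (P i) :=
      iSup₂_le fun j hj y hy => hne i j hj.symm y hy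
    rw [← hid i x hx]
    exact hle hx'
  · refine eq_top_iff.2 fun x _ => ?_
    rw [← hsum x]
    exact Submodule.sum_mem _ fun i _ => Submodule.mem_iSup_of_mem i (hmem i x)

variable [UniformSpace V] [FrechetSpace V]

/-- The projections of a finite grading by closed subspaces are continuous. -/
theorem exists_projections {gr : ι → Submodule ℂ V} (h : DirectSum.IsInternal gr)
    (hcl : ∀ i, IsClosed (gr i : Set V)) (s : Finset ι) (hs : ∀ i ∉ s, gr i = ⊥) :
    ∃ P : ι → V →L[ℂ] V, (∀ i x, P i x ∈ gr i) ∧ (∀ i, ∀ x ∈ gr i, P i x = x) ∧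
      (∀ i j, i ≠ j → ∀ x ∈ gr j, P i x = 0) ∧ ∀ x, ∑ i ∈ s, P i x = x := by
  classical
  let := h.chooseDecomposition
  have : ∀ i, FrechetSpace (gr i) := fun i => FrechetSpace.of_isClosed _ (hcl i)
  let p : ∀ i, V →ₗ[ℂ] gr i := fun i =>
    DirectSum.component ℂ ι (fun i => gr i) i ∘ₗ (DirectSum.decomposeLinearEquiv gr).toLinearMap
  have hp : ∀ i x, p i x = DirectSum.decompose gr x i := fun i x => rfl
  have h0 : ∀ i ∉ s, ∀ y : gr i, y = 0 := fun i hi y =>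
    Subtype.ext ((Submodule.mem_bot ℂ).1 ((hs i hi).le y.2))
  have hsum : ∀ x, ∑ i ∈ s, (p i x : V) = x := by
    intro x
    conv_rhs => rw [← DirectSum.sum_support_decompose gr x]
    symm
    refine Finset.sum_subset (fun i hi => ?_) fun i _ hi => ?_
    · by_contra his
      exact (DFinsupp.mem_support_iff.1 hi) (h0 i his _)
    · rw [DFinsupp.notMem_support_iff.1 hi]; rfl
  -- The product of the pieces indexed by `s` maps continuously and bijectively onto `V`. Both are
  -- Fréchet spaces, so the inverse, whose components are the projections, is continuous.
  let f : (∀ i : s, gr i.1) →L[ℂ] V :=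
    ∑ i : s, (gr i.1).subtypeL.comp (ContinuousLinearMap.proj i)
  have hf : ∀ y, f y = ∑ i : s, (y i : V) := fun y => by
    simp [f, sum_apply]
  let g : V →ₗ[ℂ] (∀ i : s, gr i.1) := LinearMap.pi fun i => p i.1
  have hid : ∀ i, ∀ x ∈ gr i, (p i x : V) = x := fun i x hx => by
    rw [hp]; exact DirectSum.decompose_of_mem_same gr hx
  have hne : ∀ i j, i ≠ j → ∀ x ∈ gr j, (p i x : V) = 0 := fun i j hij x hx => by
    rw [hp]; exact DirectSum.decompose_of_mem_ne gr hx hij.symm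
  have hg1 : ∀ y, g (f y) = y := by
    intro y
    funext i
    refine Subtype.ext ?_
    show (p i.1 (f y) : V) = y i
    rw [hf, map_sum, AddSubmonoidClass.coe_finsetSum, Finset.sum_eq_single i]
    · exact hid _ _ (y i).2
    · intro j _ hj
      exact hne _ _ (fun h => hj (Subtype.ext h.symm)) _ (y j).2
    · intro hi; exact absurd (Finset.mem_univ i) hi
  have hg2 : ∀ x, f (g x) = x := by
    intro x
    rw [hf]
    show ∑ i : s, (p i.1 x : V) = x
    rw [Finset.sum_coe_sort s (fun i => (p i x : V)), hsum]
  have hgc : Continuous g := (FrechetSpace.equivOfBijective f g hg1 hg2).symm.continuous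
  have hc : ∀ i, Continuous fun x => (p i x : V) := by
    intro i
    by_cases hi : i ∈ s
    · exact continuous_subtype_val.comp ((continuous_apply (⟨i, hi⟩ : s)).comp hgc)
    · have : (fun x => (p i x : V)) = fun _ => 0 := funext fun x => by
        rw [h0 i hi (p i x)]; rfl
      rw [this]; exact continuous_const
  exact ⟨fun i => ⟨(gr i).subtype ∘ₗ p i, hc i⟩, fun i x => (p i x).2, hid, hne, hsum⟩

end Grading

/-- Elements of the closed span of a set are mapped into a closed subspace if the elements of the
set are. -/
theorem map_mem_of_mem_closure_span {V Z : Type*} [AddCommGroup V] [Module ℂ V] [UniformSpace V]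
    [IsTopologicalAddGroup V] [ContinuousConstSMul ℂ V]
    [AddCommGroup Z] [Module ℂ Z] [TopologicalSpace Z] {s : Set V} {t : V}
    (ht : t ∈ (Submodule.span ℂ s).topologicalClosure) (f : V →L[ℂ] Z) {S : Submodule ℂ Z}
    (hS : IsClosed (S : Set Z)) (h : ∀ x ∈ s, f x ∈ S) : f t ∈ S := by
  have h1 : (Submodule.span ℂ s).topologicalClosure ≤ S.comap (f : V →ₗ[ℂ] Z) :=
    Submodule.topologicalClosure_minimal _ (Submodule.span_le.2 h)
      (hS.preimage f.continuous)
  exact h1 ht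

theorem eq_of_mem_closure_span {V Z : Type*} [AddCommGroup V] [Module ℂ V] [UniformSpace V]
    [IsTopologicalAddGroup V] [ContinuousConstSMul ℂ V]
    [AddCommGroup Z] [Module ℂ Z] [UniformSpace Z] [FrechetSpace Z] {s : Set V} {t : V}
    (ht : t ∈ (Submodule.span ℂ s).topologicalClosure) (f g : V →L[ℂ] Z)
    (h : ∀ x ∈ s, f x = g x) : f t = g t := by
  rw [← sub_eq_zero]
  have := map_mem_of_mem_closure_span ht (f - g) (S := ⊥) isClosed_singleton fun x hx => by
    simp [h x hx]
  simpa using this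

/-- A sharpening of `closed_induction`: the gradings exhaust both modules algebraically, so only
tensors of homogeneous elements have to be tested. -/
theorem CTensor.homog_induction {A M N : Type*} [AddCommGroup A] [Module ℂ A]
    [AddCommGroup M] [Module ℂ M] [UniformSpace M] [FrechetSpace M]
    [AddCommGroup N] [Module ℂ N] [UniformSpace N] [FrechetSpace N]
    {ra : M →ₗ[ℂ] A →ₗ[ℂ] M} {la : A →ₗ[ℂ] N →ₗ[ℂ] N} {ι κ : Type*} {gM : ι → Submodule ℂ M}
    {gN : κ → Submodule ℂ N} (hM : iSup gM = ⊤) (hN : iSup gN = ⊤)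
    {S : Submodule ℂ (CTensor ra la)} (hS : IsClosed (S : Set (CTensor ra la)))
    (h : ∀ i j, ∀ m ∈ gM i, ∀ n ∈ gN j, tmul ra la m n ∈ S) (t : CTensor ra la) : t ∈ S := by
  refine closed_induction hS (fun m n => ?_) t
  have hm : m ∈ iSup gM := by rw [hM]; trivial
  have hn : n ∈ iSup gN := by rw [hN]; trivial
  induction hm using Submodule.iSup_induction' with
  | zero => rw [zero_tmul]; exact S.zero_mem
  | add x y _ _ hx hy => rw [add_tmul]; exact S.add_mem hx hy
  | mem i x hx =>
    induction hn using Submodule.iSup_induction' with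
    | zero => rw [tmul_zero]; exact S.zero_mem
    | add y z _ _ hy hz => rw [tmul_add]; exact S.add_mem hy hz
    | mem j y hy => exact h i j x hx y hy

/-! ### Right actions on completed tensor products -/

section RightAction

namespace CTensor

variable {A M N B : Type*} [AddCommGroup A] [Module ℂ A]
    [AddCommGroup M] [Module ℂ M] [UniformSpace M] [FrechetSpace M]
    [AddCommGroup N] [Module ℂ N] [UniformSpace N] [FrechetSpace N]
    [AddCommGroup B] [Module ℂ B] [UniformSpace B] [FrechetSpace B]
    {ra : M →ₗ[ℂ] A →ₗ[ℂ] M} {la : A →ₗ[ℂ] N →ₗ[ℂ] N} (β : N →ₗ[ℂ] B →ₗ[ℂ] N)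
    (hβ : Continuous fun p : N × B => β p.1 p.2) (hc : ∀ a n b, la a (β n b) = β (la a n) b)

include hc in
theorem rightAct_balanced (b : B) (m : M) (a : A) (n : N) :
    trilin (mk ra la) β b (ra m a) n = trilin (mk ra la) β b m (la a n) := by
  rw [trilin_apply, trilin_apply, ← hc, mk_apply, mk_apply, balanced]

/-- The right action on `M ⊗ N` induced by a right action on `N`. -/
def rightAct : CTensor ra la →ₗ[ℂ] B →ₗ[ℂ] CTensor ra la :=
  (liftBilin (trilin (mk ra la) β) (continuous_trilin continuous_tmul hβ)
    (rightAct_balanced β hc)).flip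

theorem rightAct_tmul (m : M) (n : N) (b : B) :
    rightAct β hβ hc (tmul ra la m n) b = tmul ra la m (β n b) := by
  rw [rightAct, LinearMap.flip_apply, liftBilin_tmul]; rfl

theorem continuous_rightAct :
    Continuous fun p : CTensor ra la × B => rightAct β hβ hc p.1 p.2 := by
  have := continuous_liftBilin (trilin (mk ra la) β) (continuous_trilin continuous_tmul hβ)
    (rightAct_balanced β hc) (continuous_trilin' continuous_tmul hβ)
  exact continuous_flip this

end CTensor

end RightAction

instance (𝒜 : CurvedDGA.{u}) : FrechetSpace 𝒜.carrier := 𝒜.isCurvedDGA.frechet.frechetSpace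

instance (𝒜 : CurvedDGA.{u}) : FrechetSpace 𝒜.zero :=
  FrechetSpace.of_isClosed _ (𝒜.isCurvedDGA.isClosed_gr 0)

/-! ### Projections and signs on a bounded graded module -/

namespace GrModule

variable {𝒜 : CurvedDGA.{u}} {E : GrModule.{u, v} 𝒜}

theorem IsFrechetModule.iSup_gr (hE : E.IsFrechetModule) : iSup E.gr = ⊤ :=
  hE.internal.submodule_iSup_eq_top

theorem IsFrechetModule.exists_projections (hE : E.IsFrechetModule) :
    ∃ (n : ℕ) (P : ℤ → E →L[ℂ] E), (∀ i : ℤ, (n : ℤ) < |i| → E.gr i = ⊥) ∧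
      (∀ i x, P i x ∈ E.gr i) ∧ (∀ i, ∀ x ∈ E.gr i, P i x = x) ∧
      (∀ i j, i ≠ j → ∀ x ∈ E.gr j, P i x = 0) ∧
      (∀ x, ∑ i ∈ Finset.Icc (-n : ℤ) n, P i x = x) := by
  have := hE.frechet.frechetSpace
  obtain ⟨n, hn⟩ := hE.bounded
  obtain ⟨P, h⟩ := _root_.exists_projections hE.internal hE.isClosed_gr (Finset.Icc (-n : ℤ) n)
    fun i hi => hn i (by rw [Finset.mem_Icc, not_and_or] at hi; rw [lt_abs]; lia)
  exact ⟨n, P, hn, h⟩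

/-- An additive property of linear maps that holds on homogeneous elements holds everywhere. -/
theorem IsFrechetModule.linear_ext (hE : E.IsFrechetModule) {Z : Type*} [AddCommGroup Z]
    [Module ℂ Z] {f g : E →ₗ[ℂ] Z} (h : ∀ i, ∀ x ∈ E.gr i, f x = g x) (x : E) : f x = g x := by
  have h1 : iSup E.gr ≤ LinearMap.eqLocus f g := iSup_le fun i y hy => h i y hy
  rw [hE.iSup_gr] at h1
  exact h1 (Submodule.mem_top (x := x))

/-- Turns the sign `(-1)^|e|` into a continuous linear operator on all of `E`, so that the
connection on `E ⊗ X` can be defined by a bilinear map. Boundedness of the grading makes it a finite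
combination of the continuous projections. -/
theorem IsFrechetModule.exists_sign (hE : E.IsFrechetModule) :
    ∃ ε : E →L[ℂ] E, (∀ i, ∀ x ∈ E.gr i, ε x = ((-1 : ℂ) ^ i) • x) ∧
      ∀ x a, ε (E.ract x a) = E.ract (ε x) a := by
  have := hE.frechet.frechetSpace
  obtain ⟨n, P, hn, hmem, hid, hne, hsum⟩ := hE.exists_projections
  let ε : E →L[ℂ] E := ∑ i ∈ Finset.Icc (-n : ℤ) n, ((-1 : ℂ) ^ i) • P i
  have hε : ∀ x, ε x = ∑ i ∈ Finset.Icc (-n : ℤ) n, ((-1 : ℂ) ^ i) • P i x := fun x => by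
    simp [ε, sum_apply]
  have h1 : ∀ i, ∀ x ∈ E.gr i, ε x = ((-1 : ℂ) ^ i) • x := by
    intro i x hx
    rw [hε]
    have h2 : ∀ j, ((-1 : ℂ) ^ j) • P j x = ((-1 : ℂ) ^ i) • P j x := by
      intro j
      rcases eq_or_ne j i with rfl | hj
      · rfl
      · rw [hne j i hj x hx, smul_zero, smul_zero]
    rw [Finset.sum_congr rfl fun j _ => h2 j, ← Finset.smul_sum, hsum]
  refine ⟨ε, h1, fun x a => ?_⟩
  refine hE.linear_ext (f := ε.toLinearMap ∘ₗ E.ract.flip a) (g := E.ract.flip a ∘ₗ ε.toLinearMap)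
    (fun i y hy => ?_) x
  show ε (E.ract y a) = E.ract (ε y) a
  rw [h1 i y hy, h1 i _ (hE.ract_mem a hy), map_smul, LinearMap.smul_apply]

/-- The projections commute with linear maps that preserve the grading. -/
theorem IsFrechetModule.proj_comm (hE : E.IsFrechetModule) {P : ℤ → E →L[ℂ] E}
    (hid : ∀ i, ∀ x ∈ E.gr i, P i x = x) (hne : ∀ i j, i ≠ j → ∀ x ∈ E.gr j, P i x = 0)
    (f : E →ₗ[ℂ] E) (hf : ∀ i, ∀ x ∈ E.gr i, f x ∈ E.gr i) (i : ℤ) (x : E) :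
    P i (f x) = f (P i x) := by
  refine hE.linear_ext (f := (P i).toLinearMap ∘ₗ f) (g := f ∘ₗ (P i).toLinearMap)
    (fun j y hy => ?_) x
  show P i (f y) = f (P i y)
  rcases eq_or_ne i j with rfl | hij
  · rw [hid i y hy, hid i _ (hf i y hy)]
  · rw [hne i j hij y hy, hne i j hij _ (hf j y hy), map_zero]

end GrModule

instance {𝒜 : CurvedDGA.{u}} (E : QPObj.{u, v} 𝒜) : FrechetSpace E.carrier :=
  E.isFrechetModule.frechet.frechetSpace

/-- A quasi-perfect twisted bimodule. -/
structure TwBimodule (𝒜 : CurvedDGA.{u}) (ℬ : CurvedDGA.{v}) extends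
    BimoduleData.{u, v, w} 𝒜 ℬ where
  prop : IsQPTwistedBimodule toBimoduleData

instance {𝒜 : CurvedDGA.{u}} {ℬ : CurvedDGA.{v}} (𝒳 : TwBimodule.{u, v, w} 𝒜 ℬ) :
    FrechetSpace 𝒳.carrier :=
  𝒳.prop.isFrechetModule.frechet.frechetSpace

/-! ### The module underlying the pushforward -/

section Pushforward

variable {𝒜 : CurvedDGA.{u}} {ℬ : CurvedDGA.{v}} (𝒳 : TwBimodule.{u, v, w'} 𝒜 ℬ)
  (E : QPObj.{u, w} 𝒜)

open CTensor

/-- The tensor product `E ⊗ X` over `A`. -/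
abbrev PushCarrier : Type (max w w') := CTensor E.ract 𝒳.lact0

/-- The right action of `B` on `E ⊗ X`. -/
def pushRact : PushCarrier 𝒳 E →ₗ[ℂ] ℬ.zero →ₗ[ℂ] PushCarrier 𝒳 E :=
  rightAct 𝒳.ract 𝒳.prop.isFrechetModule.continuous_ract 𝒳.prop.lact0_ract

@[simp] theorem pushRact_tmul (e : E.carrier) (x : 𝒳.carrier) (b : ℬ.zero) :
    pushRact 𝒳 E (tmul E.ract 𝒳.lact0 e x) b = tmul E.ract 𝒳.lact0 e (𝒳.ract x b) :=
  rightAct_tmul _ _ _ e x b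

theorem continuous_pushRact :
    Continuous fun p : PushCarrier 𝒳 E × ℬ.zero => pushRact 𝒳 E p.1 p.2 :=
  continuous_rightAct _ _ _

/-- Right multiplication by `b` on `E ⊗ X`. -/
def pushRactL (b : ℬ.zero) : PushCarrier 𝒳 E →L[ℂ] PushCarrier 𝒳 E :=
  clmLeft (pushRact 𝒳 E) (continuous_pushRact 𝒳 E) b

/-- The part of degree `n` of `E ⊗ X`. -/
def pushGr (n : ℤ) : Submodule ℂ (PushCarrier 𝒳 E) :=
  (Submodule.span ℂ {t | ∃ (i j : ℤ) (e : E.carrier) (x : 𝒳.carrier),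
      i + j = n ∧ e ∈ E.gr i ∧ x ∈ 𝒳.gr j ∧
        t = CTensor.tmul E.ract 𝒳.lact0 e x}).topologicalClosure

/-- The graded right module `E ⊗ X`. -/
abbrev pushModule : GrModule.{v, max w w'} ℬ where
  carrier := PushCarrier 𝒳 E
  gr := pushGr 𝒳 E
  ract := pushRact 𝒳 E

variable {𝒳 E} in
theorem tmul_mem_pushGr {i j n : ℤ} (h : i + j = n) {e : E.carrier} (he : e ∈ E.gr i)
    {x : 𝒳.carrier} (hx : x ∈ 𝒳.gr j) : tmul E.ract 𝒳.lact0 e x ∈ pushGr 𝒳 E n :=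
  Submodule.le_topologicalClosure _ (Submodule.subset_span ⟨i, j, e, x, h, he, hx, rfl⟩)

variable {𝒳 E} in
theorem isClosed_pushGr (n : ℤ) : IsClosed (pushGr 𝒳 E n : Set (PushCarrier 𝒳 E)) :=
  Submodule.isClosed_topologicalClosure _

/-- The projection to degree `n` is `∑ᵢ Pᵢ ⊗ Qₙ₋ᵢ`, a finite sum since `E` is bounded. It is well
defined over `A` because the projections commute with the actions. On a tensor of homogeneous
elements it is the identity or zero, and closedness carries this over to all elements. -/
theorem pushGr_internal_bounded : DirectSum.IsInternal (pushGr 𝒳 E) ∧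
    ∃ n : ℕ, ∀ i : ℤ, (n : ℤ) < |i| → pushGr 𝒳 E i = ⊥ := by
  obtain ⟨a, P, ha, hPm, hPi, hPn, hPs⟩ := E.isFrechetModule.exists_projections
  obtain ⟨b, Q, hb, hQm, hQi, hQn, hQs⟩ := 𝒳.prop.isFrechetModule.exists_projections
  have hPr : ∀ i e c, P i (E.ract e c) = E.ract (P i e) c := fun i e c =>
    E.isFrechetModule.proj_comm hPi hPn (E.ract.flip c)
      (fun i x hx => E.isFrechetModule.ract_mem c hx) i e
  have hQl : ∀ i c x, Q i (𝒳.lact0 c x) = 𝒳.lact0 c (Q i x) := fun i c x =>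
    𝒳.prop.isFrechetModule.proj_comm hQi hQn (𝒳.lact0 c)
      (fun i x hx => 𝒳.prop.lact0_mem c hx) i x
  let R : ℤ → ℤ → PushCarrier 𝒳 E →L[ℂ] PushCarrier 𝒳 E := fun i j =>
    map₂ (P i) (Q j) (fun e c x => by rw [hPr, hQl, balanced])
  have hR : ∀ i j e x, R i j (tmul E.ract 𝒳.lact0 e x) = tmul E.ract 𝒳.lact0 (P i e) (Q j x) :=
    fun i j e x => map₂_tmul _ _ _ e x
  let p : ℤ → PushCarrier 𝒳 E →L[ℂ] PushCarrier 𝒳 E := fun n =>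
    ∑ i ∈ Finset.Icc (-a : ℤ) a, R i (n - i)
  have hp : ∀ n t, p n t = ∑ i ∈ Finset.Icc (-a : ℤ) a, R i (n - i) t := fun n t => by
    simp [p, sum_apply]
  have hhom : ∀ n i j, ∀ e ∈ E.gr i, ∀ x ∈ 𝒳.gr j, p n (tmul E.ract 𝒳.lact0 e x) =
      if i + j = n then tmul E.ract 𝒳.lact0 e x else 0 := by
    intro n i j e he x hx
    rw [hp]
    by_cases hi : i ∈ Finset.Icc (-a : ℤ) a
    · rw [Finset.sum_eq_single i]
      · rw [hR, hPi i e he]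
        split_ifs with h
        · rw [show n - i = j by lia, hQi j x hx]
        · rw [hQn (n - i) j (by lia) x hx, tmul_zero]
      · intro k _ hk
        rw [hR, hPn k i hk e he, zero_tmul]
      · exact fun h => absurd hi h
    -- Outside the range of summation the module `E` is zero, so both sides vanish.
    · have he0 : e = 0 := by
        have := ha i (by rw [Finset.mem_Icc, not_and_or] at hi; rw [lt_abs]; lia)
        rw [this] at he
        exact (Submodule.mem_bot ℂ).1 he
      subst he0
      simp [zero_tmul]
  -- A total degree beyond `a + b` forces `|i| > a` or `|j| > b`, and then one of the factors is
  -- zero.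
  have hbd : ∀ i j e x, e ∈ E.gr i → x ∈ 𝒳.gr j → ((a + b : ℕ) : ℤ) < |i + j| →
      tmul E.ract 𝒳.lact0 e x = 0 := by
    intro i j e x he hx hij
    have h1 := abs_add_le i j
    by_cases hi : (a : ℤ) < |i|
    · rw [ha i hi] at he
      rw [(Submodule.mem_bot ℂ).1 he, zero_tmul]
    · rw [hb j (by push_cast at hij; lia)] at hx
      rw [(Submodule.mem_bot ℂ).1 hx, tmul_zero]
  refine ⟨isInternal_of_projections _ (fun n => (p n).toLinearMap)
    (Finset.Icc (-(a + b : ℕ) : ℤ) (a + b : ℕ)) ?_ ?_ ?_ ?_, a + b, fun n hn => ?_⟩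
  · intro n t
    refine homog_induction (S := (pushGr 𝒳 E n).comap (p n).toLinearMap)
      E.isFrechetModule.iSup_gr 𝒳.prop.isFrechetModule.iSup_gr
      ((isClosed_pushGr n).preimage (p n).continuous) (fun i j e he x hx => ?_) t
    show p n (tmul E.ract 𝒳.lact0 e x) ∈ pushGr 𝒳 E n
    rw [hhom n i j e he x hx]
    split_ifs with h
    · exact tmul_mem_pushGr h he hx
    · exact zero_mem _
  · intro n t ht
    refine eq_of_mem_closure_span ht (p n) (ContinuousLinearMap.id ℂ _) ?_
    rintro _ ⟨i, j, e, x, h, he, hx, rfl⟩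
    rw [hhom n i j e he x hx, if_pos h]; rfl
  · intro m n hmn t ht
    refine eq_of_mem_closure_span ht (p m) 0 ?_
    rintro _ ⟨i, j, e, x, h, he, hx, rfl⟩
    rw [hhom m i j e he x hx, if_neg (by lia)]; rfl
  · intro t
    let q : PushCarrier 𝒳 E →L[ℂ] PushCarrier 𝒳 E :=
      ∑ n ∈ Finset.Icc (-(a + b : ℕ) : ℤ) (a + b : ℕ), p n - ContinuousLinearMap.id ℂ _
    have hq : ∀ t, q t = ∑ n ∈ Finset.Icc (-(a + b : ℕ) : ℤ) (a + b : ℕ), p n t - t := fun t => by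
      simp [q, sum_apply]
    have h0 : t ∈ LinearMap.ker q.toLinearMap := by
      refine homog_induction E.isFrechetModule.iSup_gr 𝒳.prop.isFrechetModule.iSup_gr
        (isClosed_singleton.preimage q.continuous) (fun i j e he x hx => ?_) t
      show q _ = 0
      rw [hq, sub_eq_zero]
      simp only [hhom _ i j e he x hx]
      rw [Finset.sum_ite_eq]
      split_ifs with h
      · rfl
      · exact (hbd i j e x he hx (by rw [Finset.mem_Icc, not_and_or] at h; rw [lt_abs]; lia)).symm
    have h1 : q t = 0 := h0
    rw [hq, sub_eq_zero] at h1
    exact h1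
  · refine eq_bot_iff.2 fun t ht => ?_
    refine map_mem_of_mem_closure_span ht (ContinuousLinearMap.id ℂ _) (S := ⊥)
      isClosed_singleton ?_
    rintro _ ⟨i, j, e, x, h, he, hx, rfl⟩
    exact (Submodule.mem_bot ℂ).2 (hbd i j e x he hx (by rw [h]; exact hn))

theorem pushModule_isFrechetModule : (pushModule 𝒳 E).IsFrechetModule where
  frechet := FrechetSpace.isFrechet (PushCarrier 𝒳 E)
  continuous_ract := continuous_pushRact 𝒳 E
  ract_one t a ha := by
    have : pushRactL 𝒳 E a = ContinuousLinearMap.id ℂ _ := CTensor.ext fun e x => by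
      show pushRact 𝒳 E _ a = _
      rw [pushRact_tmul, 𝒳.prop.isFrechetModule.ract_one x a ha]; rfl
    exact DFunLike.congr_fun this t
  ract_mul t a b c h := by
    have : (pushRactL 𝒳 E b).comp (pushRactL 𝒳 E a) = pushRactL 𝒳 E c := CTensor.ext fun e x => by
      show pushRact 𝒳 E (pushRact 𝒳 E _ a) b = pushRact 𝒳 E _ c
      rw [pushRact_tmul, pushRact_tmul, pushRact_tmul,
        𝒳.prop.isFrechetModule.ract_mul x a b c h]
    exact DFunLike.congr_fun this t
  ract_mem {n t} a ht := by
    refine map_mem_of_mem_closure_span (V := PushCarrier 𝒳 E) ht (pushRactL 𝒳 E a)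
      (isClosed_pushGr n) ?_
    rintro _ ⟨i, j, e, x, h, he, hx, rfl⟩
    show pushRact 𝒳 E (tmul E.ract 𝒳.lact0 e x) a ∈ pushGr 𝒳 E n
    rw [pushRact_tmul]
    exact tmul_mem_pushGr h he (𝒳.prop.isFrechetModule.ract_mem a hx)
  internal := (pushGr_internal_bounded 𝒳 E).1
  isClosed_gr := isClosed_pushGr
  bounded := (pushGr_internal_bounded 𝒳 E).2

end Pushforward

/-! ### Relative projectivity of the pushforward -/

namespace CTensor

section Compl

variable {M S Z X : Type*} [AddCommGroup M] [Module ℂ M] [UniformSpace M] [FrechetSpace M]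
  [AddCommGroup S] [Module ℂ S] [UniformSpace S]
  [AddCommGroup Z] [Module ℂ Z] [UniformSpace Z] [FrechetSpace Z]
  [AddCommGroup X] [Module ℂ X] [UniformSpace X] [FrechetSpace X]

/-- The bilinear map `(m, x) ↦ T m (s x)`. -/
def precomp (T : M →ₗ[ℂ] S →ₗ[ℂ] Z) (s : X →L[ℂ] S) : M →ₗ[ℂ] X →ₗ[ℂ] Z :=
  T.compl₂ s.toLinearMap

theorem precomp_apply (T : M →ₗ[ℂ] S →ₗ[ℂ] Z) (s : X →L[ℂ] S) (m : M) (x : X) :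
    precomp T s m x = T m (s x) := rfl

theorem continuous_precomp {T : M →ₗ[ℂ] S →ₗ[ℂ] Z} (hT : Continuous fun p : M × S => T p.1 p.2)
    (s : X →L[ℂ] S) : Continuous fun p : M × X => precomp T s p.1 p.2 :=
  hT.comp (continuous_fst.prodMk (s.continuous.comp continuous_snd))

/-- The map `m ⊗ x ↦ T m (s x)`. -/
def liftPrecomp (T : M →ₗ[ℂ] S →ₗ[ℂ] Z) (hT : Continuous fun p : M × S => T p.1 p.2)
    (s : X →L[ℂ] S) : CTensorC M X →L[ℂ] Z :=
  lift (precomp T s) (continuous_precomp hT s) (fun v c x => by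
    simp only [precomp_apply, LinearMap.flip_apply, LinearMap.lsmul_apply, map_smul,
      LinearMap.smul_apply])

theorem liftPrecomp_tmul (T : M →ₗ[ℂ] S →ₗ[ℂ] Z) (hT : Continuous fun p : M × S => T p.1 p.2)
    (s : X →L[ℂ] S) (m : M) (x : X) : liftPrecomp T hT s (tmul _ _ m x) = T m (s x) :=
  lift_tmul _ _ _ m x

theorem precomp_mk_smul {X' : Type*} [AddCommGroup X'] [Module ℂ X'] [UniformSpace X']
    (π : X' →L[ℂ] X) [FrechetSpace X'] (m : M) (c : ℂ) (w : X') :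
    precomp (mk (LinearMap.lsmul ℂ M).flip (LinearMap.lsmul ℂ X)) π
      ((LinearMap.lsmul ℂ M).flip m c) w =
    precomp (mk (LinearMap.lsmul ℂ M).flip (LinearMap.lsmul ℂ X)) π m (c • w) := by
  simp only [precomp_apply, LinearMap.flip_apply, LinearMap.lsmul_apply, map_smul,
    LinearMap.smul_apply]

end Compl

end CTensor

section RelProjective

open CTensor

variable {𝒜 : CurvedDGA.{u}} {ℬ : CurvedDGA.{v}} (𝒳 : TwBimodule.{u, v, w'} 𝒜 ℬ)
  (E : QPObj.{u, w} 𝒜)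

/-- Right multiplication by `b` on `V ⊗ A`. -/
abbrev freeMul (V : Type*) [AddCommGroup V] [Module ℂ V] [UniformSpace V] (𝒜 : CurvedDGA.{u})
    (b : 𝒜.zero) : CTensorC V 𝒜.zero →L[ℂ] CTensorC V 𝒜.zero :=
  CTensor.map (𝒜.mulRight0 b) (fun c n => map_smul (𝒜.mulRight0 b) c n)

theorem freeMul_tmul {V : Type*} [AddCommGroup V] [Module ℂ V] [UniformSpace V]
    {𝒜 : CurvedDGA.{u}} (b : 𝒜.zero) (v : V) (a : 𝒜.zero) :
    freeMul V 𝒜 b (tmul _ _ v a) = tmul _ _ v (𝒜.mulRight0 b a) :=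
  CTensor.map_tmul _ _ v a

variable (V : Type*) [AddCommGroup V] [Module ℂ V] [UniformSpace V] [FrechetSpace V]

/-- The map `(x, v ⊗ a) ↦ v ⊗ a x`. -/
def freeAct : 𝒳.carrier →ₗ[ℂ] CTensorC V 𝒜.zero →ₗ[ℂ] CTensorC V 𝒳.carrier :=
  liftBilin (trilin (mk _ _) 𝒳.lact0)
    (continuous_trilin continuous_tmul 𝒳.prop.continuous_lact0)
    (fun x v c a => by
      rw [trilin_apply, trilin_apply, mk_apply, mk_apply, LinearMap.flip_apply,
        LinearMap.lsmul_apply, LinearMap.lsmul_apply, map_smul, LinearMap.smul_apply, smul_tmul,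
        tmul_smul])

theorem freeAct_tmul (x : 𝒳.carrier) (v : V) (a : 𝒜.zero) :
    freeAct 𝒳 V x (tmul _ _ v a) = tmul _ _ v (𝒳.lact0 a x) :=
  liftBilin_tmul _ _ _ x v a

theorem continuous_freeAct :
    Continuous fun p : 𝒳.carrier × CTensorC V 𝒜.zero => freeAct 𝒳 V p.1 p.2 :=
  continuous_liftBilin _ _ _ (continuous_trilin' continuous_tmul 𝒳.prop.continuous_lact0)

/-- On `v ⊗ a` both sides are `v ⊗ (a b) x`. This is the balancing over `A` that lets `e ⊗ x ↦ s(e)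
x` descend to `E ⊗_A X`. -/
theorem freeAct_freeMul (x : 𝒳.carrier) (b : 𝒜.zero) (t : CTensorC V 𝒜.zero) :
    freeAct 𝒳 V x (freeMul V 𝒜 b t) = freeAct 𝒳 V (𝒳.lact0 b x) t := by
  have : (clmRight _ (continuous_freeAct 𝒳 V) x).comp (freeMul V 𝒜 b) =
      clmRight _ (continuous_freeAct 𝒳 V) (𝒳.lact0 b x) := CTensor.ext fun v a => by
    rw [ContinuousLinearMap.comp_apply, freeMul_tmul, clmRight_apply, clmRight_apply,
      freeAct_tmul, freeAct_tmul, 𝒳.prop.lact0_mul a b (𝒜.mulRight0 b a) x rfl]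
  exact DFunLike.congr_fun this t

variable {V} {W : Type*} [AddCommGroup W] [Module ℂ W] [UniformSpace W] [FrechetSpace W]

theorem lsmul_tmul (v : V) (n : W) (c : ℂ) :
    (LinearMap.lsmul ℂ (CTensorC V W)).flip (tmul _ _ v n) c =
      tmul _ _ v ((LinearMap.lsmul ℂ W).flip n c) := by
  rw [LinearMap.flip_apply, LinearMap.flip_apply, LinearMap.lsmul_apply, LinearMap.lsmul_apply,
    tmul_smul]

variable (V W) in
theorem continuous_lsmul_flip (c : ℂ) :
    Continuous fun t => (LinearMap.lsmul ℂ (CTensorC V W)).flip t c := by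
  simp only [LinearMap.flip_apply, LinearMap.lsmul_apply]
  exact continuous_const_smul c

variable (V) in
/-- The associativity map `(v, w ⊗ b) ↦ (v ⊗ w) ⊗ b`. -/
def freeAssoc (s : 𝒳.carrier →L[ℂ] CTensorC W ℬ.zero) :
    CTensorC V 𝒳.carrier →L[ℂ] CTensorC (CTensorC V W) ℬ.zero :=
  liftPrecomp (assocMk (lb := LinearMap.lsmul ℂ ℬ.zero) lsmul_tmul)
    (continuous_assocMk (lb := LinearMap.lsmul ℂ ℬ.zero) lsmul_tmul) s

theorem freeAssoc_tmul (s : 𝒳.carrier →L[ℂ] CTensorC W ℬ.zero) (v : V) (x : 𝒳.carrier) :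
    freeAssoc 𝒳 V s (tmul _ _ v x) = assocMk (lb := LinearMap.lsmul ℂ ℬ.zero) lsmul_tmul v (s x) :=
  liftPrecomp_tmul _ _ s v x

theorem freeMul_assocMk (b : ℬ.zero) (v : V) (t : CTensorC W ℬ.zero) :
    freeMul (CTensorC V W) ℬ b (assocMk (lb := LinearMap.lsmul ℂ ℬ.zero) lsmul_tmul v t) =
      assocMk (lb := LinearMap.lsmul ℂ ℬ.zero) lsmul_tmul v (freeMul W ℬ b t) := by
  have : (freeMul (CTensorC V W) ℬ b).comp
        (clmRight _ (continuous_assocMk (lb := LinearMap.lsmul ℂ ℬ.zero) lsmul_tmul) v) =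
      (clmRight _ (continuous_assocMk (lb := LinearMap.lsmul ℂ ℬ.zero) lsmul_tmul) v).comp
        (freeMul W ℬ b) := CTensor.ext fun w b' => by
    rw [ContinuousLinearMap.comp_apply, ContinuousLinearMap.comp_apply, clmRight_apply,
      clmRight_apply, freeMul_tmul, assocMk_tmul, assocMk_tmul, freeMul_tmul]
  exact DFunLike.congr_fun this t

theorem freeAssoc_freeAct_ract (s : 𝒳.carrier →L[ℂ] CTensorC W ℬ.zero)
    (hs : ∀ x b, s (𝒳.ract x b) = freeMul W ℬ b (s x)) (x : 𝒳.carrier) (b : ℬ.zero)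
    (t : CTensorC V 𝒜.zero) :
    freeAssoc 𝒳 V s (freeAct 𝒳 V (𝒳.ract x b) t) =
      freeMul (CTensorC V W) ℬ b (freeAssoc 𝒳 V s (freeAct 𝒳 V x t)) := by
  have : (freeAssoc 𝒳 V s).comp (clmRight _ (continuous_freeAct 𝒳 V) (𝒳.ract x b)) =
      (freeMul (CTensorC V W) ℬ b).comp
        ((freeAssoc 𝒳 V s).comp (clmRight _ (continuous_freeAct 𝒳 V) x)) :=
    CTensor.ext fun v a => by
      simp only [ContinuousLinearMap.comp_apply, clmRight_apply, freeAct_tmul, freeAssoc_tmul]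
      rw [𝒳.prop.lact0_ract, hs, freeMul_assocMk]
  exact DFunLike.congr_fun this t

variable (V) in
/-- The map `(v ⊗ w) ⊗ b ↦ v ⊗ π (w ⊗ b)`. -/
def freeUnassoc (π : CTensorC W ℬ.zero →L[ℂ] 𝒳.carrier) :
    CTensorC (CTensorC V W) ℬ.zero →L[ℂ] CTensorC V 𝒳.carrier :=
  liftAssoc (rb := (LinearMap.lsmul ℂ W).flip) lsmul_tmul (continuous_lsmul_flip V W)
    (precomp (mk (LinearMap.lsmul ℂ V).flip (LinearMap.lsmul ℂ 𝒳.carrier)) π)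
    (continuous_precomp continuous_tmul π)
    (fun v c w b => (precomp_mk_smul π v c _).trans (by rw [← smul_tmul]; rfl))

theorem freeUnassoc_tmul (π : CTensorC W ℬ.zero →L[ℂ] 𝒳.carrier) (v : V) (w : W) (b : ℬ.zero) :
    freeUnassoc 𝒳 V π (tmul _ _ (tmul _ _ v w) b) = tmul _ _ v (π (tmul _ _ w b)) :=
  liftAssoc_tmul _ _ _ _ _ v w b

theorem freeUnassoc_freeAssoc (s : 𝒳.carrier →L[ℂ] CTensorC W ℬ.zero)
    (π : CTensorC W ℬ.zero →L[ℂ] 𝒳.carrier) (h : ∀ x, π (s x) = x) (t : CTensorC V 𝒳.carrier) :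
    freeUnassoc 𝒳 V π (freeAssoc 𝒳 V s t) = t := by
  have : (freeUnassoc 𝒳 V π).comp (freeAssoc 𝒳 V s) = ContinuousLinearMap.id ℂ _ :=
    CTensor.ext fun v x => by
      rw [ContinuousLinearMap.comp_apply, freeAssoc_tmul, freeUnassoc, liftAssoc_assocMk,
        precomp_apply, h]
      rfl
  exact DFunLike.congr_fun this t

variable {E}

/-- The map `e ⊗ x ↦ s(e) x`, `E ⊗ X → V ⊗ X`. -/
def pushSec (s : E.carrier →L[ℂ] CTensorC V 𝒜.zero)
    (hs : ∀ e a, s (E.ract e a) = freeMul V 𝒜 a (s e)) :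
    PushCarrier 𝒳 E →L[ℂ] CTensorC V 𝒳.carrier :=
  liftSwap (precomp (freeAct 𝒳 V) s) (continuous_precomp (continuous_freeAct 𝒳 V) s)
    (fun e a x => by rw [precomp_apply, precomp_apply, hs, freeAct_freeMul])

theorem pushSec_tmul (s : E.carrier →L[ℂ] CTensorC V 𝒜.zero)
    (hs : ∀ e a, s (E.ract e a) = freeMul V 𝒜 a (s e)) (e : E.carrier) (x : 𝒳.carrier) :
    pushSec 𝒳 s hs (tmul _ _ e x) = freeAct 𝒳 V x (s e) :=
  liftSwap_tmul _ _ _ e x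

/-- The unit of `A`. -/
def CurvedDGA.one0 (𝒜 : CurvedDGA.{u}) : 𝒜.zero := ⟨1, 𝒜.isCurvedDGA.one_mem⟩

/-- The map `v ⊗ x ↦ π(v ⊗ 1) ⊗ x`, `V ⊗ X → E ⊗ X`. -/
def pushRetr (π : CTensorC V 𝒜.zero →L[ℂ] E.carrier) :
    CTensorC V 𝒳.carrier →L[ℂ] PushCarrier 𝒳 E :=
  map₂ (π.comp (clmLeft (mk _ _) continuous_tmul 𝒜.one0)) (ContinuousLinearMap.id ℂ _)
    (fun v c x => by
      rw [LinearMap.flip_apply, LinearMap.lsmul_apply, LinearMap.lsmul_apply, map_smul,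
        map_smul, smul_tmul, tmul_smul])

theorem pushRetr_tmul (π : CTensorC V 𝒜.zero →L[ℂ] E.carrier) (v : V) (x : 𝒳.carrier) :
    pushRetr 𝒳 π (tmul _ _ v x) = tmul _ _ (π (tmul _ _ v 𝒜.one0)) x :=
  map₂_tmul _ _ _ v x

/-- The computation is `π(v ⊗ 1) ⊗ a x = π(v ⊗ 1) a ⊗ x = π(v ⊗ a) ⊗ x`, by balancing and
`A`-linearity of `π`. -/
theorem pushRetr_freeAct (π : CTensorC V 𝒜.zero →L[ℂ] E.carrier)
    (hπ : ∀ t a, π (freeMul V 𝒜 a t) = E.ract (π t) a) (x : 𝒳.carrier)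
    (t : CTensorC V 𝒜.zero) :
    pushRetr 𝒳 π (freeAct 𝒳 V x t) = tmul _ _ (π t) x := by
  have : (pushRetr 𝒳 π).comp (clmRight _ (continuous_freeAct 𝒳 V) x) =
      (clmLeft (mk E.ract 𝒳.lact0) continuous_tmul x).comp π := CTensor.ext fun v a => by
    show pushRetr 𝒳 π (freeAct 𝒳 V x (tmul _ _ v a)) = tmul _ _ (π (tmul _ _ v a)) x
    rw [freeAct_tmul, pushRetr_tmul, ← CTensor.balanced, ← hπ, freeMul_tmul]
    congr 3
    exact Subtype.ext (one_mul _)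
  exact DFunLike.congr_fun this t

variable (E)

/-- Two retractions are composed. `E` as a summand of `V ⊗ A` makes `E ⊗_A X` a summand of `V ⊗ X`,
and `X` as a summand of `W ⊗ B` makes `V ⊗ X` a summand of `V ⊗ (W ⊗ B) = (V ⊗ W) ⊗ B`. The free
module obtained is the one on `V ⊗ W`. -/
theorem pushModule_isRelProjective :
    (pushModule.{u, v, w, w'} 𝒳 E).IsRelProjective := by
  obtain ⟨V, i1, i2, i3, hV, sE, πE, hE1, hE2, hE3⟩ := E.isRelProjective
  obtain ⟨W, j1, j2, j3, hW, sX, πX, hX1, hX2, hX3⟩ := 𝒳.prop.isRelProjective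
  have := hV.frechetSpace
  have := hW.frechetSpace
  refine ⟨CTensorC V W, inferInstance, inferInstance, inferInstance,
    FrechetSpace.isFrechet _, (freeAssoc 𝒳 V sX).comp (pushSec 𝒳 sE hE2),
    (pushRetr 𝒳 πE).comp (freeUnassoc 𝒳 V πX), ?_, ?_, ?_⟩
  · intro t
    have : (pushRetr 𝒳 πE).comp (pushSec 𝒳 sE hE2) = ContinuousLinearMap.id ℂ _ :=
      CTensor.ext fun e x => by
        rw [ContinuousLinearMap.comp_apply, pushSec_tmul, pushRetr_freeAct 𝒳 πE hE3, hE1]; rfl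
    show pushRetr 𝒳 πE (freeUnassoc 𝒳 V πX (freeAssoc 𝒳 V sX (pushSec 𝒳 sE hE2 t))) = t
    rw [freeUnassoc_freeAssoc 𝒳 sX πX hX1]
    exact DFunLike.congr_fun this t
  · intro t b
    have : ((freeAssoc 𝒳 V sX).comp (pushSec 𝒳 sE hE2)).comp (pushRactL 𝒳 E b) =
        (freeMul (CTensorC V W) ℬ b).comp ((freeAssoc 𝒳 V sX).comp (pushSec 𝒳 sE hE2)) :=
      CTensor.ext fun e x => by
        show freeAssoc 𝒳 V sX (pushSec 𝒳 sE hE2 (pushRact 𝒳 E (tmul _ _ e x) b)) =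
          freeMul (CTensorC V W) ℬ b (freeAssoc 𝒳 V sX (pushSec 𝒳 sE hE2 (tmul _ _ e x)))
        rw [pushRact_tmul, pushSec_tmul, pushSec_tmul, freeAssoc_freeAct_ract 𝒳 sX hX2]
    exact DFunLike.congr_fun this t
  · intro t b
    have : ((pushRetr 𝒳 πE).comp (freeUnassoc 𝒳 V πX)).comp (freeMul (CTensorC V W) ℬ b) =
        (pushRactL 𝒳 E b).comp ((pushRetr 𝒳 πE).comp (freeUnassoc 𝒳 V πX)) :=
      ext₃ fun v w b' => by
        show pushRetr 𝒳 πE (freeUnassoc 𝒳 V πX (freeMul (CTensorC V W) ℬ b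
          (tmul _ _ (tmul _ _ v w) b'))) =
          pushRact 𝒳 E (pushRetr 𝒳 πE (freeUnassoc 𝒳 V πX (tmul _ _ (tmul _ _ v w) b'))) b
        rw [freeMul_tmul, freeUnassoc_tmul, freeUnassoc_tmul, pushRetr_tmul, pushRetr_tmul,
          pushRact_tmul, ← hX3, freeMul_tmul]
    exact DFunLike.congr_fun this t

end RelProjective

/-! ### The pairing `(E ⊗ 𝒜) × (X ⊗ ℬ) → E ⊗ X ⊗ ℬ` -/

section Functor

open CTensor

variable {𝒜 : CurvedDGA.{u}} {ℬ : CurvedDGA.{v}} (𝒳 : TwBimodule.{u, v, w'} 𝒜 ℬ)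

/-- The left action of `a` on `X ⊗ ℬ`. -/
abbrev lactL (a : 𝒜) : 𝒳.T →L[ℂ] 𝒳.T := clmRight 𝒳.lact 𝒳.prop.continuous_lact a

/-- `x ⊗ b` is `(x ⊗ 1) b`; the left action commutes with the right one and is prescribed on `X`. -/
theorem TwBimodule.lact_tmul (a : 𝒜.zero) (x : 𝒳.carrier) (b : ℬ) :
    𝒳.lact (a : 𝒜) (𝒳.tmul x b) = 𝒳.tmul (𝒳.lact0 a x) b := by
  have h : ∀ y : 𝒳.carrier, 𝒳.tmul y b = 𝒳.rmul b (𝒳.incl y) := fun y => by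
    rw [GrModule.incl, GrModule.rmul_tmul, one_mul]
  rw [h, h, 𝒳.prop.lact_rmul, 𝒳.prop.lact_incl]

variable (E : QPObj.{u, w} 𝒜)

/-- The space `E ⊗ X ⊗ ℬ`. -/
abbrev PushT : Type (max w w' v) := (pushModule 𝒳 E).T

/-- The bilinear map `(e, x ⊗ b) ↦ e ⊗ x ⊗ b`. -/
def pushNu : E.carrier →ₗ[ℂ] 𝒳.T →ₗ[ℂ] PushT 𝒳 E :=
  assocMk (lb := ℬ.lmul0) (rb₂ := pushRact 𝒳 E) (pushRact_tmul 𝒳 E)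

theorem pushNu_tmul (e : E.carrier) (x : 𝒳.carrier) (b : ℬ) :
    pushNu 𝒳 E e (𝒳.tmul x b) = (pushModule 𝒳 E).tmul (tmul E.ract 𝒳.lact0 e x) b :=
  assocMk_tmul (lb := ℬ.lmul0) (rb₂ := pushRact 𝒳 E) (pushRact_tmul 𝒳 E) e x b

theorem continuous_pushNu : Continuous fun p : E.carrier × 𝒳.T => pushNu 𝒳 E p.1 p.2 :=
  continuous_assocMk (lb := ℬ.lmul0) (rb₂ := pushRact 𝒳 E) (pushRact_tmul 𝒳 E)

theorem rmul_pushNu (b : ℬ) (e : E.carrier) (t : 𝒳.T) :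
    (pushModule 𝒳 E).rmul b (pushNu 𝒳 E e t) = pushNu 𝒳 E e (𝒳.rmul b t) := by
  have : ((pushModule 𝒳 E).rmul b).comp (clmRight _ (continuous_pushNu 𝒳 E) e) =
      (clmRight _ (continuous_pushNu 𝒳 E) e).comp (𝒳.rmul b) := CTensor.ext fun x c => by
    show (pushModule 𝒳 E).rmul b (pushNu 𝒳 E e (𝒳.tmul x c)) =
      pushNu 𝒳 E e (𝒳.rmul b (𝒳.tmul x c))
    rw [pushNu_tmul, GrModule.rmul_tmul, GrModule.rmul_tmul, pushNu_tmul]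
  exact DFunLike.congr_fun this t

/-- The balancing over `A` behind the pairing; on `x ⊗ c` it is the relation `e a ⊗ x = e ⊗ a x`. -/
theorem pushNu_ract (e : E.carrier) (a : 𝒜.zero) (t : 𝒳.T) :
    pushNu 𝒳 E (E.ract e a) t = pushNu 𝒳 E e (𝒳.lact (a : 𝒜) t) := by
  have : clmRight _ (continuous_pushNu 𝒳 E) (E.ract e a) =
      (clmRight _ (continuous_pushNu 𝒳 E) e).comp (lactL 𝒳 (a : 𝒜)) := CTensor.ext fun x c => by
    show pushNu 𝒳 E (E.ract e a) (𝒳.tmul x c) = pushNu 𝒳 E e (𝒳.lact (a : 𝒜) (𝒳.tmul x c))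
    rw [TwBimodule.lact_tmul, pushNu_tmul, pushNu_tmul, balanced]
  exact DFunLike.congr_fun this t

theorem trilin_pushNu_balanced (t : 𝒳.T) (e : E.carrier) (a : 𝒜.zero) (c : 𝒜) :
    trilin (pushNu 𝒳 E) 𝒳.lact t (E.ract e a) c =
      trilin (pushNu 𝒳 E) 𝒳.lact t e (𝒜.lmul0 a c) := by
  rw [trilin_apply, trilin_apply, pushNu_ract, ← 𝒳.prop.lact_mul]; rfl

/-- The pairing `(t, e ⊗ a) ↦ e ⊗ a t`. -/
def pushMuSwap : 𝒳.T →ₗ[ℂ] E.T →ₗ[ℂ] PushT 𝒳 E :=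
  liftBilin (trilin (pushNu 𝒳 E) 𝒳.lact)
    (continuous_trilin (continuous_pushNu 𝒳 E) 𝒳.prop.continuous_lact)
    (trilin_pushNu_balanced 𝒳 E)

theorem continuous_pushMuSwap : Continuous fun p : 𝒳.T × E.T => pushMuSwap 𝒳 E p.1 p.2 :=
  continuous_liftBilin _ (continuous_trilin (continuous_pushNu 𝒳 E) 𝒳.prop.continuous_lact)
    (trilin_pushNu_balanced 𝒳 E)
    (continuous_trilin' (continuous_pushNu 𝒳 E) 𝒳.prop.continuous_lact)

/-- The pairing `(e ⊗ a, t) ↦ e ⊗ a t`. -/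
def pushMu : E.T →ₗ[ℂ] 𝒳.T →ₗ[ℂ] PushT 𝒳 E := (pushMuSwap 𝒳 E).flip

theorem pushMu_tmul (e : E.carrier) (a : 𝒜) (t : 𝒳.T) :
    pushMu 𝒳 E (E.tmul e a) t = pushNu 𝒳 E e (𝒳.lact a t) :=
  liftBilin_tmul _ (continuous_trilin (continuous_pushNu 𝒳 E) 𝒳.prop.continuous_lact)
    (trilin_pushNu_balanced 𝒳 E) t e a

theorem pushMu_incl (e : E.carrier) (t : 𝒳.T) :
    pushMu 𝒳 E (E.incl e) t = pushNu 𝒳 E e t := by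
  rw [GrModule.incl, pushMu_tmul, 𝒳.prop.lact_one]

theorem continuous_pushMu : Continuous fun p : E.T × 𝒳.T => pushMu 𝒳 E p.1 p.2 :=
  continuous_flip (continuous_pushMuSwap 𝒳 E)

theorem pushMu_rmul (s : E.T) (a : 𝒜) (t : 𝒳.T) :
    pushMu 𝒳 E (E.rmul a s) t = pushMu 𝒳 E s (𝒳.lact a t) := by
  have : (clmLeft _ (continuous_pushMu 𝒳 E) t).comp (E.rmul a) =
      clmLeft _ (continuous_pushMu 𝒳 E) (𝒳.lact a t) := CTensor.ext fun e c => by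
    show pushMu 𝒳 E (E.rmul a (E.tmul e c)) t = pushMu 𝒳 E (E.tmul e c) (𝒳.lact a t)
    rw [GrModule.rmul_tmul, pushMu_tmul, pushMu_tmul, 𝒳.prop.lact_mul]
  exact DFunLike.congr_fun this s

theorem rmul_pushMu (b : ℬ) (s : E.T) (t : 𝒳.T) :
    (pushModule 𝒳 E).rmul b (pushMu 𝒳 E s t) = pushMu 𝒳 E s (𝒳.rmul b t) := by
  have : ((pushModule 𝒳 E).rmul b).comp (clmLeft _ (continuous_pushMu 𝒳 E) t) =
      clmLeft _ (continuous_pushMu 𝒳 E) (𝒳.rmul b t) := CTensor.ext fun e c => by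
    show (pushModule 𝒳 E).rmul b (pushMu 𝒳 E (E.tmul e c) t) =
      pushMu 𝒳 E (E.tmul e c) (𝒳.rmul b t)
    rw [pushMu_tmul, pushMu_tmul, rmul_pushNu, 𝒳.prop.lact_rmul]
  exact DFunLike.congr_fun this s

/-! ### Degrees -/

theorem GrModule.tmul_mem_T_gr {𝒜 : CurvedDGA.{u}} {M : GrModule.{u, v} 𝒜} {i n : ℤ} {j : ℕ}
    (h : i + j = n) {e : M} (he : e ∈ M.gr i) {a : 𝒜} (ha : a ∈ 𝒜.gr j) :
    M.tmul e a ∈ GrModule.T.gr M n :=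
  Submodule.le_topologicalClosure _ (Submodule.subset_span ⟨i, j, e, a, h, he, ha, rfl⟩)

theorem GrModule.isClosed_T_gr {𝒜 : CurvedDGA.{u}} (M : GrModule.{u, v} 𝒜) (n : ℤ) :
    IsClosed (GrModule.T.gr M n : Set M.T) :=
  Submodule.isClosed_topologicalClosure _

variable {𝒳 E}

theorem pushNu_mem {i j n : ℤ} (h : i + j = n) {e : E.carrier} (he : e ∈ E.gr i) {t : 𝒳.T}
    (ht : t ∈ GrModule.T.gr 𝒳.toGrModule j) :
    pushNu 𝒳 E e t ∈ GrModule.T.gr (pushModule 𝒳 E) n := by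
  refine map_mem_of_mem_closure_span ht (clmRight _ (continuous_pushNu 𝒳 E) e)
    (GrModule.isClosed_T_gr _ n) ?_
  rintro _ ⟨k, l, x, b, hkl, hx, hb, rfl⟩
  show pushNu 𝒳 E e (𝒳.tmul x b) ∈ _
  rw [pushNu_tmul]
  exact GrModule.tmul_mem_T_gr (M := pushModule 𝒳 E) (i := i + k) (by lia)
    (tmul_mem_pushGr rfl he hx) hb

theorem pushMu_mem {i j n : ℤ} (h : i + j = n) {s : E.T} (hs : s ∈ GrModule.T.gr E.toGrModule i)
    {t : 𝒳.T} (ht : t ∈ GrModule.T.gr 𝒳.toGrModule j) :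
    pushMu 𝒳 E s t ∈ GrModule.T.gr (pushModule 𝒳 E) n := by
  refine map_mem_of_mem_closure_span hs (clmLeft _ (continuous_pushMu 𝒳 E) t)
    (GrModule.isClosed_T_gr _ n) ?_
  rintro _ ⟨k, l, e, a, hkl, he, ha, rfl⟩
  show pushMu 𝒳 E (E.tmul e a) t ∈ _
  rw [pushMu_tmul]
  exact pushNu_mem (by lia) he (𝒳.prop.lact_mem ha ht)

/-- Closed subspaces containing the `e ⊗ t` of total degree `n` contain all elements of
degree `n`. -/
theorem pushT_gr_le {n : ℤ} {S : Submodule ℂ (PushT 𝒳 E)} (hS : IsClosed (S : Set (PushT 𝒳 E)))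
    (h : ∀ (i j : ℤ), i + j = n → ∀ e ∈ E.gr i, ∀ t ∈ GrModule.T.gr 𝒳.toGrModule j,
      pushNu 𝒳 E e t ∈ S) : GrModule.T.gr (pushModule 𝒳 E) n ≤ S := by
  refine Submodule.topologicalClosure_minimal _ (Submodule.span_le.2 ?_) hS
  rintro _ ⟨i, j, p, b, hij, hp, hb, rfl⟩
  refine map_mem_of_mem_closure_span (V := PushCarrier 𝒳 E) hp
    (clmLeft (mk (pushRact 𝒳 E) ℬ.lmul0) continuous_tmul b) hS ?_
  rintro _ ⟨k, l, e, x, hkl, he, hx, rfl⟩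
  have := h k (l + j) (by lia) e he (𝒳.tmul x b) (GrModule.tmul_mem_T_gr rfl hx hb)
  rw [pushNu_tmul] at this
  exact this

theorem pushT_induction {S : Submodule ℂ (PushT 𝒳 E)} (hS : IsClosed (S : Set (PushT 𝒳 E)))
    (h : ∀ (i : ℤ), ∀ e ∈ E.gr i, ∀ t, pushNu 𝒳 E e t ∈ S) (p : PushT 𝒳 E) : p ∈ S := by
  refine closed_induction hS (fun q b => ?_) p
  refine closed_induction
    (S := S.comap (clmLeft (mk (pushRact 𝒳 E) ℬ.lmul0) continuous_tmul b).toLinearMap)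
    (hS.preimage (ContinuousLinearMap.continuous _)) (fun e x => ?_) q
  show (pushModule 𝒳 E).tmul (tmul E.ract 𝒳.lact0 e x) b ∈ S
  rw [← pushNu_tmul]
  have h1 : iSup E.gr ≤ S.comap ((pushNu 𝒳 E).flip (𝒳.tmul x b)) :=
    iSup_le fun i e he => h i e he _
  rw [E.isFrechetModule.iSup_gr] at h1
  exact h1 (Submodule.mem_top (x := e))

theorem pushT_ext {Z : Type*} [AddCommGroup Z] [Module ℂ Z] [UniformSpace Z] [FrechetSpace Z]
    {f g : PushT 𝒳 E →L[ℂ] Z}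
    (h : ∀ (i : ℤ), ∀ e ∈ E.gr i, ∀ t, f (pushNu 𝒳 E e t) = g (pushNu 𝒳 E e t)) : f = g :=
  ContinuousLinearMap.ext fun p =>
    pushT_induction (S := LinearMap.eqLocus f.toLinearMap g.toLinearMap)
      (isClosed_eq f.continuous g.continuous) h p

/-! ### Lifting -/

variable (𝒳 E) in
/-- The continuous linear map on `E ⊗ X ⊗ ℬ` given by a bilinear map on `E × (X ⊗ ℬ)`. -/
def pushLift {Z : Type*} [AddCommGroup Z] [Module ℂ Z] [UniformSpace Z] [FrechetSpace Z]
    (T : E.carrier →ₗ[ℂ] 𝒳.T →ₗ[ℂ] Z) (hT : Continuous fun p : E.carrier × 𝒳.T => T p.1 p.2)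
    (hbal : ∀ e (a : 𝒜.zero) t, T (E.ract e a) t = T e (𝒳.lact (a : 𝒜) t)) :
    PushT 𝒳 E →L[ℂ] Z :=
  liftAssoc (lb := ℬ.lmul0) (rb₂ := pushRact 𝒳 E) (pushRact_tmul 𝒳 E)
    (fun b => (pushRactL 𝒳 E b).continuous) T hT
    (fun e a x b => by rw [hbal, TwBimodule.lact_tmul])

theorem pushLift_pushNu {Z : Type*} [AddCommGroup Z] [Module ℂ Z] [UniformSpace Z]
    [FrechetSpace Z] (T : E.carrier →ₗ[ℂ] 𝒳.T →ₗ[ℂ] Z)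
    (hT : Continuous fun p : E.carrier × 𝒳.T => T p.1 p.2)
    (hbal : ∀ e (a : 𝒜.zero) t, T (E.ract e a) t = T e (𝒳.lact (a : 𝒜) t)) (e : E.carrier)
    (t : 𝒳.T) : pushLift 𝒳 E T hT hbal (pushNu 𝒳 E e t) = T e t :=
  liftAssoc_assocMk (lb := ℬ.lmul0) (rb₂ := pushRact 𝒳 E) (pushRact_tmul 𝒳 E)
    (fun b => (pushRactL 𝒳 E b).continuous) T hT
    (fun e a x b => by rw [hbal, TwBimodule.lact_tmul]) e t

/-- The continuous linear map `e ↦ e ⊗ 1`. -/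
def QPObj.inclL {𝒜 : CurvedDGA.{u}} (E : QPObj.{u, w} 𝒜) : E.carrier →L[ℂ] E.T :=
  clmLeft (CTensor.mk E.ract 𝒜.lmul0) CTensor.continuous_tmul (1 : 𝒜)

theorem QPObj.incl_ract {𝒜 : CurvedDGA.{u}} (E : QPObj.{u, w} 𝒜) (e : E.carrier) (a : 𝒜.zero) :
    E.incl (E.ract e a) = E.rmul a (E.incl e) := by
  rw [GrModule.incl, GrModule.incl, GrModule.rmul_tmul, GrModule.tmul, balanced]
  congr 1
  exact (mul_one _).trans (one_mul _).symm

theorem QPObj.tmul_eq_rmul {𝒜 : CurvedDGA.{u}} (E : QPObj.{u, w} 𝒜) (e : E.carrier) (a : 𝒜) :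
    E.tmul e a = E.rmul a (E.incl e) := by
  rw [GrModule.incl, GrModule.rmul_tmul, one_mul]

theorem QPObj.incl_mem {𝒜 : CurvedDGA.{u}} (E : QPObj.{u, w} 𝒜) {i : ℤ} {e : E.carrier}
    (he : e ∈ E.gr i) : E.incl e ∈ GrModule.T.gr E.toGrModule i :=
  GrModule.tmul_mem_T_gr (by simp) he 𝒜.isCurvedDGA.one_mem

end Functor

section Bilinear

variable {M M' S S' Z : Type*} [AddCommGroup M] [Module ℂ M] [TopologicalSpace M]
  [AddCommGroup M'] [Module ℂ M'] [TopologicalSpace M']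
  [AddCommGroup S] [Module ℂ S] [TopologicalSpace S]
  [AddCommGroup S'] [Module ℂ S'] [TopologicalSpace S']
  [AddCommGroup Z] [Module ℂ Z] [TopologicalSpace Z]

/-- The bilinear map `(m, s) ↦ T (f m) (g s)`. -/
def bicomp (T : M →ₗ[ℂ] S →ₗ[ℂ] Z) (f : M' →L[ℂ] M) (g : S' →L[ℂ] S) : M' →ₗ[ℂ] S' →ₗ[ℂ] Z :=
  T.compl₁₂ f.toLinearMap g.toLinearMap

theorem continuous_bicomp {T : M →ₗ[ℂ] S →ₗ[ℂ] Z} (hT : Continuous fun p : M × S => T p.1 p.2)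
    (f : M' →L[ℂ] M) (g : S' →L[ℂ] S) : Continuous fun p : M' × S' => bicomp T f g p.1 p.2 :=
  hT.comp ((f.continuous.comp continuous_fst).prodMk (g.continuous.comp continuous_snd))

theorem continuous_bilinear_add [ContinuousAdd Z] {T T' : M →ₗ[ℂ] S →ₗ[ℂ] Z}
    (hT : Continuous fun p : M × S => T p.1 p.2) (hT' : Continuous fun p : M × S => T' p.1 p.2) :
    Continuous fun p : M × S => (T + T') p.1 p.2 :=
  hT.add hT'

end Bilinear

/-! ### The connection on the pushforward -/

section Functor

open CTensor

variable {𝒜 : CurvedDGA.{u}} {ℬ : CurvedDGA.{v}}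

theorem neg_one_zpow_add (m n : ℤ) : ((-1 : ℂ) ^ (m + n)) = (-1) ^ m * (-1) ^ n :=
  zpow_add₀ (by norm_num) m n

theorem neg_one_zpow_mul_self (n : ℤ) : ((-1 : ℂ) ^ n) * (-1) ^ n = 1 := by
  rw [← mul_zpow]; simp

/-- The operator `(-1)^i` in degree `i`. -/
def QPObj.sign (E : QPObj.{u, w} 𝒜) : E.carrier →L[ℂ] E.carrier :=
  E.isFrechetModule.exists_sign.choose

theorem QPObj.sign_apply (E : QPObj.{u, w} 𝒜) {i : ℤ} {e : E.carrier} (he : e ∈ E.gr i) :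
    E.sign e = ((-1 : ℂ) ^ i) • e :=
  E.isFrechetModule.exists_sign.choose_spec.1 i e he

theorem QPObj.sign_ract (E : QPObj.{u, w} 𝒜) (e : E.carrier) (a : 𝒜.zero) :
    E.sign (E.ract e a) = E.ract (E.sign e) a :=
  E.isFrechetModule.exists_sign.choose_spec.2 e a

theorem QPObj.conn_tmul (E : QPObj.{u, w} 𝒜) {i : ℤ} {e : E.carrier} (he : e ∈ E.gr i) (a : 𝒜) :
    E.conn (E.tmul e a) = E.rmul a (E.conn (E.incl e)) + ((-1 : ℂ) ^ i) • E.tmul e (𝒜.d a) := by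
  rw [E.tmul_eq_rmul, E.isZConnection.leibniz a (E.incl_mem he), ← E.tmul_eq_rmul]

/-- The Leibniz rule of `𝔼` against `a ∈ A`, written with the sign operator so that it is linear in
`e` and may be checked on homogeneous elements. -/
theorem QPObj.conn_incl_ract (E : QPObj.{u, w} 𝒜) (e : E.carrier) (a : 𝒜.zero) :
    E.conn (E.incl (E.ract e a)) =
      E.rmul (a : 𝒜) (E.conn (E.incl e)) + E.tmul (E.sign e) (𝒜.d a) := by
  let f : E.carrier →L[ℂ] E.T := E.conn.comp ((E.rmul (a : 𝒜)).comp E.inclL)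
  let g : E.carrier →L[ℂ] E.T := (E.rmul (a : 𝒜)).comp (E.conn.comp E.inclL) +
    (clmLeft (CTensor.mk E.ract 𝒜.lmul0) CTensor.continuous_tmul (𝒜.d a)).comp E.sign
  have h : f e = g e := E.isFrechetModule.linear_ext (f := f.toLinearMap) (g := g.toLinearMap)
    (fun i x hx => by
      show E.conn (E.rmul (a : 𝒜) (E.incl x)) =
        E.rmul (a : 𝒜) (E.conn (E.incl x)) + E.tmul (E.sign x) (𝒜.d a)
      rw [← E.tmul_eq_rmul, E.conn_tmul hx, E.sign_apply hx]
      congr 1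
      exact (CTensor.smul_tmul _ _ _).symm) e
  rw [E.incl_ract]
  exact h

variable (𝒳 : TwBimodule.{u, v, w'} 𝒜 ℬ) (E : QPObj.{u, w} 𝒜)

/-- The bilinear map `(e, t) ↦ 𝔼(e) t + (-1)^|e| e ⊗ 𝕏(t)`. -/
def pushConnAux : E.carrier →ₗ[ℂ] 𝒳.T →ₗ[ℂ] PushT 𝒳 E :=
  bicomp (pushMu 𝒳 E) (E.conn.comp E.inclL) (ContinuousLinearMap.id ℂ _) +
    bicomp (pushNu 𝒳 E) E.sign 𝒳.conn

theorem pushConnAux_apply (e : E.carrier) (t : 𝒳.T) : pushConnAux 𝒳 E e t =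
    pushMu 𝒳 E (E.conn (E.incl e)) t + pushNu 𝒳 E (E.sign e) (𝒳.conn t) := rfl

theorem continuous_pushConnAux :
    Continuous fun p : E.carrier × 𝒳.T => pushConnAux 𝒳 E p.1 p.2 :=
  continuous_bilinear_add (continuous_bicomp (continuous_pushMu 𝒳 E) _ _)
    (continuous_bicomp (continuous_pushNu 𝒳 E) _ _)

/-- Well-definedness over `A`: the term `(-1)^|e| e ⊗ da · t` comes on the left from the Leibniz
rule of `𝔼`, and on the right from `𝕏(a t) = da · t + a 𝕏(t)`. -/
theorem pushConnAux_ract (e : E.carrier) (a : 𝒜.zero) (t : 𝒳.T) :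
    pushConnAux 𝒳 E (E.ract e a) t = pushConnAux 𝒳 E e (𝒳.lact (a : 𝒜) t) := by
  rw [pushConnAux_apply, pushConnAux_apply, E.conn_incl_ract, map_add, LinearMap.add_apply,
    pushMu_rmul, pushMu_tmul, E.sign_ract, pushNu_ract, 𝒳.prop.leibniz t a.2, pow_zero, one_smul,
    map_add, add_assoc]

/-- The connection on `E ⊗ X`. -/
def pushConn : PushT 𝒳 E →L[ℂ] PushT 𝒳 E :=
  pushLift 𝒳 E (pushConnAux 𝒳 E) (continuous_pushConnAux 𝒳 E) (pushConnAux_ract 𝒳 E)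

variable {E} in
theorem pushConn_pushNu {i : ℤ} {e : E.carrier} (he : e ∈ E.gr i) (t : 𝒳.T) :
    pushConn 𝒳 E (pushNu 𝒳 E e t) =
      pushMu 𝒳 E (E.conn (E.incl e)) t + ((-1 : ℂ) ^ i) • pushNu 𝒳 E e (𝒳.conn t) := by
  refine (pushLift_pushNu _ _ _ e t).trans ?_
  rw [pushConnAux_apply, E.sign_apply he, map_smul, LinearMap.smul_apply]

-- Extends the defining formula from `e ∈ E` to `s ∈ E ⊗ 𝒜`. For `s = e ⊗ a` the term with `da`
-- appears on one side through the Leibniz rule of `𝔼` and on the other through that of `𝕏`.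
variable {E} in
theorem pushConn_pushMu {n : ℤ} {s : E.T} (hs : s ∈ GrModule.T.gr E.toGrModule n) (t : 𝒳.T) :
    pushConn 𝒳 E (pushMu 𝒳 E s t) =
      pushMu 𝒳 E (E.conn s) t + ((-1 : ℂ) ^ n) • pushMu 𝒳 E s (𝒳.conn t) := by
  refine eq_of_mem_closure_span hs
    ((pushConn 𝒳 E).comp (clmLeft _ (continuous_pushMu 𝒳 E) t))
    ((clmLeft _ (continuous_pushMu 𝒳 E) t).comp E.conn +
      ((-1 : ℂ) ^ n) • clmLeft _ (continuous_pushMu 𝒳 E) (𝒳.conn t)) ?_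
  rintro _ ⟨i, j, e, a, hij, he, ha, rfl⟩
  show pushConn 𝒳 E (pushMu 𝒳 E (E.tmul e a) t) = pushMu 𝒳 E (E.conn (E.tmul e a)) t +
    ((-1 : ℂ) ^ n) • pushMu 𝒳 E (E.tmul e a) (𝒳.conn t)
  rw [pushMu_tmul, pushConn_pushNu 𝒳 he, E.conn_tmul he a, map_add, LinearMap.add_apply, pushMu_rmul,
    map_smul, LinearMap.smul_apply, pushMu_tmul, pushMu_tmul, 𝒳.prop.leibniz t ha, map_add,
    smul_add, map_smul, smul_smul, ← hij, neg_one_zpow_add, zpow_natCast, add_assoc]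

theorem pushConn_isZConnection : (pushModule 𝒳 E).IsZConnection (pushConn 𝒳 E) where
  map_mem {n t} ht := by
    refine pushT_gr_le (S := (GrModule.T.gr (pushModule 𝒳 E) (n + 1)).comap
      (pushConn 𝒳 E).toLinearMap)
      ((GrModule.isClosed_T_gr (pushModule 𝒳 E) (n + 1)).preimage (pushConn 𝒳 E).continuous) ?_ ht
    intro i j hij e he t ht
    show pushConn 𝒳 E (pushNu 𝒳 E e t) ∈ GrModule.T.gr (pushModule 𝒳 E) (n + 1)
    rw [pushConn_pushNu 𝒳 he]
    refine Submodule.add_mem _ (pushMu_mem (by lia) (E.isZConnection.map_mem (E.incl_mem he)) ht)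
      (Submodule.smul_mem _ _ (pushNu_mem (by lia) he (𝒳.prop.isZConnection.map_mem ht)))
  leibniz {n t} b ht := by
    let f : PushT 𝒳 E →L[ℂ] PushT 𝒳 E := (pushConn 𝒳 E).comp ((pushModule 𝒳 E).rmul b)
    let g : PushT 𝒳 E →L[ℂ] PushT 𝒳 E := ((pushModule 𝒳 E).rmul b).comp (pushConn 𝒳 E) +
      ((-1 : ℂ) ^ n) • (pushModule 𝒳 E).rmul (ℬ.d b)
    refine pushT_gr_le (S := LinearMap.eqLocus f.toLinearMap g.toLinearMap)
      (isClosed_eq f.continuous g.continuous) ?_ ht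
    intro i j hij e he t ht
    show pushConn 𝒳 E ((pushModule 𝒳 E).rmul b (pushNu 𝒳 E e t)) =
      (pushModule 𝒳 E).rmul b (pushConn 𝒳 E (pushNu 𝒳 E e t)) +
        ((-1 : ℂ) ^ n) • (pushModule 𝒳 E).rmul (ℬ.d b) (pushNu 𝒳 E e t)
    rw [rmul_pushNu, pushConn_pushNu 𝒳 he, pushConn_pushNu 𝒳 he, map_add, rmul_pushMu, map_smul,
      rmul_pushNu, rmul_pushNu, 𝒳.prop.isZConnection.leibniz b ht, map_add, smul_add, map_smul,
      smul_smul, ← hij, neg_one_zpow_add, add_assoc]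

theorem QPObj.conn_mem_one (E : QPObj.{u, w} 𝒜) {i : ℤ} {e : E.carrier} (he : e ∈ E.gr i) :
    E.conn (E.incl e) ∈ GrModule.T.gr E.toGrModule (i + 1) :=
  E.isZConnection.map_mem (E.incl_mem he)

/-- When the operator is squared on `e ⊗ t`, the mixed terms `𝔼(e) · 𝕏(t)` carry the signs
`(-1)^(|e|+1)` and `(-1)^|e|` and cancel. There remain `-e ⊗ c₁ t` from `𝔼²` and `e ⊗ (c₁ t - t c₂)`
from `𝕏²`. -/
theorem pushConn_curvature (p : PushT 𝒳 E) :
    pushConn 𝒳 E (pushConn 𝒳 E p) = -(pushModule 𝒳 E).rmul ℬ.curv p := by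
  have : (pushConn 𝒳 E).comp (pushConn 𝒳 E) = -(pushModule 𝒳 E).rmul ℬ.curv :=
    pushT_ext fun i e he t => by
      show pushConn 𝒳 E (pushConn 𝒳 E (pushNu 𝒳 E e t)) =
        -(pushModule 𝒳 E).rmul ℬ.curv (pushNu 𝒳 E e t)
      rw [pushConn_pushNu 𝒳 he, map_add, map_smul, pushConn_pushNu 𝒳 he,
        pushConn_pushMu 𝒳 (E.conn_mem_one he), E.curvature, map_neg, LinearMap.neg_apply,
        pushMu_rmul, pushMu_incl, 𝒳.prop.curvature, map_sub, rmul_pushNu, smul_add, smul_smul,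
        neg_one_zpow_mul_self, neg_one_zpow_add, zpow_one]
      module
  exact DFunLike.congr_fun this p

/-- The object `𝒳_* E`. -/
def pushObj : QPObj.{v, max w w'} ℬ where
  toGrModule := pushModule 𝒳 E
  isFrechetModule := pushModule_isFrechetModule 𝒳 E
  isRelProjective := pushModule_isRelProjective 𝒳 E
  conn := pushConn 𝒳 E
  isZConnection := pushConn_isZConnection 𝒳 E
  curvature _ := pushConn_curvature 𝒳 E _

/-! ### The pushforward of morphisms -/

section Hom

variable {E} {E' E'' : QPObj.{u, w} 𝒜} {k l : ℤ}

/-- The bilinear map `(e, t) ↦ φ(e) t`. -/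
def pushMapAux (φ : E.T →L[ℂ] E'.T) : E.carrier →ₗ[ℂ] 𝒳.T →ₗ[ℂ] PushT 𝒳 E' :=
  bicomp (pushMu 𝒳 E') (φ.comp E.inclL) (ContinuousLinearMap.id ℂ _)

theorem pushMapAux_apply (φ : E.T →L[ℂ] E'.T) (e : E.carrier) (t : 𝒳.T) :
    pushMapAux 𝒳 φ e t = pushMu 𝒳 E' (φ (E.incl e)) t := rfl

theorem continuous_pushMapAux (φ : E.T →L[ℂ] E'.T) :
    Continuous fun p : E.carrier × 𝒳.T => pushMapAux 𝒳 φ p.1 p.2 :=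
  continuous_bicomp (continuous_pushMu 𝒳 E') _ _

theorem pushMapAux_ract (φ : QPObj.Hom k E E') (e : E.carrier) (a : 𝒜.zero) (t : 𝒳.T) :
    pushMapAux 𝒳 φ.1 (E.ract e a) t = pushMapAux 𝒳 φ.1 e (𝒳.lact (a : 𝒜) t) := by
  rw [pushMapAux_apply, pushMapAux_apply, E.incl_ract, φ.2.2, pushMu_rmul]

/-- The map `e ⊗ t ↦ φ(e) t`. -/
def pushMap (φ : QPObj.Hom k E E') : PushT 𝒳 E →L[ℂ] PushT 𝒳 E' :=
  pushLift 𝒳 E (pushMapAux 𝒳 φ.1) (continuous_pushMapAux 𝒳 φ.1) (pushMapAux_ract 𝒳 φ)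

theorem pushMap_pushNu (φ : QPObj.Hom k E E') (e : E.carrier) (t : 𝒳.T) :
    pushMap 𝒳 φ (pushNu 𝒳 E e t) = pushMu 𝒳 E' (φ.1 (E.incl e)) t :=
  pushLift_pushNu _ _ _ e t

theorem pushMap_pushMu (φ : QPObj.Hom k E E') (s : E.T) (t : 𝒳.T) :
    pushMap 𝒳 φ (pushMu 𝒳 E s t) = pushMu 𝒳 E' (φ.1 s) t := by
  have : (pushMap 𝒳 φ).comp (clmLeft _ (continuous_pushMu 𝒳 E) t) =
      (clmLeft _ (continuous_pushMu 𝒳 E') t).comp φ.1 := CTensor.ext fun e a => by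
    show pushMap 𝒳 φ (pushMu 𝒳 E (E.tmul e a) t) = pushMu 𝒳 E' (φ.1 (E.tmul e a)) t
    rw [pushMu_tmul, pushMap_pushNu, E.tmul_eq_rmul, φ.2.2, pushMu_rmul]
  exact DFunLike.congr_fun this s

theorem pushMap_mem (φ : QPObj.Hom k E E') (n : ℤ) (p : PushT 𝒳 E)
    (hp : p ∈ GrModule.T.gr (pushModule 𝒳 E) n) :
    pushMap 𝒳 φ p ∈ GrModule.T.gr (pushModule 𝒳 E') (n + k) := by
  refine pushT_gr_le (S := (GrModule.T.gr (pushModule 𝒳 E') (n + k)).comap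
    (pushMap 𝒳 φ).toLinearMap)
    ((GrModule.isClosed_T_gr (pushModule 𝒳 E') (n + k)).preimage (pushMap 𝒳 φ).continuous) ?_ hp
  intro i j hij e he t ht
  show pushMap 𝒳 φ (pushNu 𝒳 E e t) ∈ GrModule.T.gr (pushModule 𝒳 E') (n + k)
  rw [pushMap_pushNu]
  exact pushMu_mem (by lia) (φ.2.1 i _ (E.incl_mem he)) ht

theorem pushMap_rmul (φ : QPObj.Hom k E E') (p : PushT 𝒳 E) (b : ℬ) :
    pushMap 𝒳 φ ((pushModule 𝒳 E).rmul b p) = (pushModule 𝒳 E').rmul b (pushMap 𝒳 φ p) := by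
  have : (pushMap 𝒳 φ).comp ((pushModule 𝒳 E).rmul b) =
      ((pushModule 𝒳 E').rmul b).comp (pushMap 𝒳 φ) := pushT_ext fun i e he t => by
    show pushMap 𝒳 φ ((pushModule 𝒳 E).rmul b (pushNu 𝒳 E e t)) =
      (pushModule 𝒳 E').rmul b (pushMap 𝒳 φ (pushNu 𝒳 E e t))
    rw [rmul_pushNu, pushMap_pushNu, pushMap_pushNu, rmul_pushMu]
  exact DFunLike.congr_fun this p

/-- The morphism `𝒳_* φ`. -/
def pushHom (φ : QPObj.Hom k E E') : QPObj.Hom k (pushObj 𝒳 E) (pushObj 𝒳 E') :=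
  ⟨pushMap 𝒳 φ, pushMap_mem 𝒳 φ, pushMap_rmul 𝒳 φ⟩

theorem pushHom_ext {φ ψ : QPObj.Hom k (pushObj 𝒳 E) (pushObj 𝒳 E')}
    (h : ∀ (i : ℤ), ∀ e ∈ E.gr i, ∀ t, φ.1 (pushNu 𝒳 E e t) = ψ.1 (pushNu 𝒳 E e t)) : φ = ψ :=
  Subtype.ext (pushT_ext (Z := PushT 𝒳 E') h)

/-- The map `φ ↦ 𝒳_* φ` as a linear map. -/
def pushHomL : QPObj.Hom k E E' →ₗ[ℂ] QPObj.Hom k (pushObj 𝒳 E) (pushObj 𝒳 E') where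
  toFun := pushHom 𝒳
  map_add' φ ψ := pushHom_ext 𝒳 fun i e he t => by
    show pushMap 𝒳 (φ + ψ) (pushNu 𝒳 E e t) =
      pushMap 𝒳 φ (pushNu 𝒳 E e t) + pushMap 𝒳 ψ (pushNu 𝒳 E e t)
    rw [pushMap_pushNu, pushMap_pushNu, pushMap_pushNu, ← LinearMap.add_apply, ← map_add]
    rfl
  map_smul' c φ := pushHom_ext 𝒳 fun i e he t => by
    show pushMap 𝒳 (c • φ) (pushNu 𝒳 E e t) = c • pushMap 𝒳 φ (pushNu 𝒳 E e t)
    rw [pushMap_pushNu, pushMap_pushNu, ← LinearMap.smul_apply, ← map_smul]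
    rfl

theorem pushHom_id : pushHom 𝒳 (QPObj.id E) = QPObj.id (pushObj 𝒳 E) :=
  pushHom_ext 𝒳 fun i e he t => by
    show pushMap 𝒳 (QPObj.id E) (pushNu 𝒳 E e t) = pushNu 𝒳 E e t
    rw [pushMap_pushNu]
    exact pushMu_incl 𝒳 E e t

theorem pushHom_comp (ψ : QPObj.Hom l E' E'') (φ : QPObj.Hom k E E') :
    pushHom 𝒳 (QPObj.comp ψ φ) = QPObj.comp (pushHom 𝒳 ψ) (pushHom 𝒳 φ) :=
  pushHom_ext 𝒳 fun i e he t => by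
    show pushMap 𝒳 (QPObj.comp ψ φ) (pushNu 𝒳 E e t) =
      pushMap 𝒳 ψ (pushMap 𝒳 φ (pushNu 𝒳 E e t))
    rw [pushMap_pushNu, pushMap_pushNu, pushMap_pushMu]
    rfl

/-- The terms `φ(e) · 𝕏(t)` have the coefficients `(-1)^(|e|+k)` and `-(-1)^k (-1)^|e|` and cancel,
which leaves `(dφ)(e) · t`. -/
theorem pushHom_d (φ : QPObj.Hom k E E') : pushHom 𝒳 (QPObj.d φ) = QPObj.d (pushHom 𝒳 φ) :=
  pushHom_ext 𝒳 fun i e he t => by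
    show pushMap 𝒳 (QPObj.d φ) (pushNu 𝒳 E e t) =
      pushConn 𝒳 E' (pushMap 𝒳 φ (pushNu 𝒳 E e t)) -
        ((-1 : ℂ) ^ k) • pushMap 𝒳 φ (pushConn 𝒳 E (pushNu 𝒳 E e t))
    have h : (QPObj.d φ).1 (E.incl e) =
        E'.conn (φ.1 (E.incl e)) - ((-1 : ℂ) ^ k) • φ.1 (E.conn (E.incl e)) := rfl
    rw [pushMap_pushNu, pushMap_pushNu, pushConn_pushNu 𝒳 he,
      pushConn_pushMu 𝒳 (φ.2.1 i _ (E.incl_mem he)), map_add, map_smul, pushMap_pushMu,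
      pushMap_pushNu, h, map_sub, LinearMap.sub_apply, map_smul, LinearMap.smul_apply,
      neg_one_zpow_add, mul_comm]
    module

end Hom

/-- The DG functor `𝒳_*`. -/
def pushFunctor : DGFunctor.{u, v, max w w'} 𝒜 ℬ where
  obj E := pushObj.{u, v, max w w', w'} 𝒳 E
  map := pushHomL 𝒳
  map_id _ := pushHom_id 𝒳
  map_comp ψ φ := pushHom_comp 𝒳 ψ φ
  map_d φ := pushHom_d 𝒳 φ

theorem pushFunctor_isPushforward :
    IsPushforward 𝒳.toBimoduleData (pushFunctor.{u, v, w, w'} 𝒳) := by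
  -- The object `𝒳_* E` is built on `E ⊗ X` itself, so `θ` is the identity.
  refine ⟨fun E => ContinuousLinearEquiv.refl ℂ (PushCarrier 𝒳 E), fun E => pushMu 𝒳 E, ?_, ?_, ?_,
    ?_, ?_, ?_, ?_⟩
  · exact fun E n => (Submodule.map_id _).symm
  · exact fun E e x b => pushRact_tmul 𝒳 E e x b
  · exact fun E => continuous_pushMu 𝒳 E
  · exact fun E e x b => (pushMu_incl 𝒳 E e _).trans (pushNu_tmul 𝒳 E e x b)
  · exact fun E s a t => pushMu_rmul 𝒳 E s a t
  · exact fun E n s t hs => pushConn_pushMu 𝒳 hs t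
  · exact fun k E₁ E₂ φ s t => pushMap_pushMu 𝒳 φ s t

end Functor

/-! ### Smooth functions on an open set -/

open Filter

instance ContinuousMap.isUniformAddGroup_compactConvergence {α G : Type*} [TopologicalSpace α]
    [AddCommGroup G] [UniformSpace G] [IsUniformAddGroup G] : IsUniformAddGroup C(α, G) := by
  let f : C(α, G) →+ UniformOnFun α G {K | IsCompact K} :=
    { toFun := ContinuousMap.toUniformOnFunIsCompact
      map_zero' := rfl
      map_add' := fun _ _ => rfl }
  exact IsUniformInducing.isUniformAddGroup f
    ContinuousMap.isUniformEmbedding_toUniformOnFunIsCompact.isUniformInducing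

instance ContinuousMap.frechetSpace {α G : Type*} [TopologicalSpace α] [WeaklyLocallyCompactSpace α]
    [SigmaCompactSpace α] [CompactlyCoherentSpace α] [NormedAddCommGroup G] [NormedSpace ℂ G]
    [CompleteSpace G] : FrechetSpace C(α, G) := by
  have h : LocallyConvexSpace ℝ C(α, G) := inferInstance
  exact { h with }

section SmoothLimit

variable {E G : Type*} [NormedAddCommGroup E] [NormedSpace ℝ E] [NormedAddCommGroup G]
  [NormedSpace ℝ G]

theorem hasFTaylorSeriesUpToOn_of_tendsto {U : Set E} (hU : IsOpen U) {f : ℕ → E → G}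
    (hf : ∀ n, ContDiffOn ℝ ∞ (f n) U) {g : E → FormalMultilinearSeries ℝ E G}
    (h : ∀ k, TendstoLocallyUniformlyOn (fun n => iteratedFDeriv ℝ k (f n)) (fun z => g z k)
      atTop U) :
    HasFTaylorSeriesUpToOn ∞ (fun z => (g z 0).curry0) g U := by
  have hd : ∀ k, ∀ n, ∀ x ∈ U, HasFDerivAt (iteratedFDeriv ℝ k (f n))
      (fderiv ℝ (iteratedFDeriv ℝ k (f n)) x) x := by
    intro k n x hx
    have h1 : ContDiffAt ℝ ∞ (f n) x := (hf n).contDiffAt (hU.mem_nhds hx)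
    exact ((h1.iteratedFDeriv_right (m := 1) (i := k) (by
      exact_mod_cast le_top)).differentiableAt (by simp)).hasFDerivAt
  refine ⟨fun x _ => rfl, fun k _ x hx => ?_, fun k _ => ?_⟩
  · refine HasFDerivAt.hasFDerivWithinAt ?_
    refine hasFDerivAt_of_tendstoLocallyUniformlyOn (𝕜 := ℝ) (g' := fun x => (g x k.succ).curryLeft)
      hU ?_ (hd k) (fun x hx => (h k).tendsto_at hx) hx
    let L := continuousMultilinearCurryLeftEquiv ℝ (fun _ : Fin (k + 1) => E) G
    have := L.isometry.uniformContinuous.comp_tendstoLocallyUniformlyOn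
      (h (k + 1))
    refine this.congr fun n z hz => ?_
    show L (iteratedFDeriv ℝ (k + 1) (f n) z) = _
    rw [iteratedFDeriv_succ_eq_comp_left]
    exact L.apply_symm_apply _
  · refine (h k).continuousOn (Eventually.of_forall fun n => ?_).frequently
    intro x hx
    exact (hd k n x hx).continuousAt.continuousWithinAt

end SmoothLimit

section CInf

variable {E G : Type*} [NormedAddCommGroup E] [NormedSpace ℝ E]
  [NormedAddCommGroup G] [NormedSpace ℂ G] (U : TopologicalSpace.Opens E)

variable (G) in
/-- The smooth functions on `U`, extended by zero. -/
def smoothFunctions : Submodule ℂ (E → G) where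
  carrier := {f | ContDiffOn ℝ ∞ f U ∧ ∀ z ∉ U, f z = 0}
  add_mem' h h' := ⟨h.1.add h'.1, fun z hz => by simp [h.2 z hz, h'.2 z hz]⟩
  zero_mem' := ⟨contDiffOn_const, fun _ _ => rfl⟩
  smul_mem' c _ h := ⟨h.1.const_smul c, fun z hz => by simp [h.2 z hz]⟩

variable (G) in
/-- The space `C^∞(U, G)`. -/
def CInf : Type _ := smoothFunctions G U

namespace CInf

instance : AddCommGroup (CInf G U) := inferInstanceAs (AddCommGroup (smoothFunctions G U))
instance : Module ℂ (CInf G U) := inferInstanceAs (Module ℂ (smoothFunctions G U))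
instance : CoeFun (CInf G U) (fun _ => E → G) := ⟨fun f => f.1⟩

variable {U}

theorem contDiffOn (f : CInf G U) : ContDiffOn ℝ ∞ f U := f.2.1

theorem contDiffAt (f : CInf G U) {z : E} (hz : z ∈ U) : ContDiffAt ℝ ∞ f z :=
  f.contDiffOn.contDiffAt (U.isOpen.mem_nhds hz)

theorem ext {f g : CInf G U} (h : ∀ z ∈ U, f z = g z) : f = g :=
  Subtype.ext (funext fun z => by
    by_cases hz : z ∈ U
    · exact h z hz
    · exact (f.2.2 z hz).trans (g.2.2 z hz).symm)

theorem continuousOn_iteratedFDeriv (f : CInf G U) (k : ℕ) :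
    ContinuousOn (iteratedFDeriv ℝ k f) U := fun _ hz =>
  (((f.contDiffAt hz).iteratedFDeriv_right (m := 0) (i := k) (by
    exact_mod_cast le_top)).continuousAt).continuousWithinAt

variable (U G) in
/-- All derivatives of a smooth function. -/
def jet : CInf G U →ₗ[ℂ] (∀ k : ℕ, C(U, E [×k]→L[ℝ] G)) where
  toFun f k := ⟨fun z => iteratedFDeriv ℝ k f z.1, (f.continuousOn_iteratedFDeriv k).domRestrict⟩
  map_add' f g := funext fun k => ContinuousMap.ext fun z =>
    iteratedFDeriv_add_apply ((f.contDiffAt z.2).of_le (by exact_mod_cast le_top))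
      ((g.contDiffAt z.2).of_le (by exact_mod_cast le_top))
  map_smul' c f := funext fun k => ContinuousMap.ext fun z =>
    iteratedFDeriv_const_smul_apply ((f.contDiffAt z.2).of_le (by exact_mod_cast le_top))

theorem jet_apply (f : CInf G U) (k : ℕ) (z : U) : jet G U f k z = iteratedFDeriv ℝ k f z := rfl

instance : UniformSpace (CInf G U) := UniformSpace.comap (jet G U) inferInstance

theorem isUniformInducing_jet : IsUniformInducing (jet G U) := ⟨rfl⟩

theorem jet_injective : Function.Injective (jet G U) := fun f g h => ext fun z hz => by
  have := DFunLike.congr_fun (DFunLike.congr_fun (congrFun h 0) ⟨z, hz⟩) ![]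
  simpa [jet_apply] using this

theorem continuous_eval {z : E} (hz : z ∈ U) : Continuous fun f : CInf G U => f z := by
  have h1 : Continuous fun f : CInf G U => jet G U f 0 ⟨z, hz⟩ :=
    (continuous_eval_const (F := C(U, E [×0]→L[ℝ] G)) _).comp
      ((continuous_apply 0).comp isUniformInducing_jet.isInducing.continuous)
  have h2 := (continuousMultilinearCurryFin0 ℝ E G).continuous.comp h1
  exact h2

theorem continuous_fderiv {z : E} (hz : z ∈ U) (v : E) :
    Continuous fun f : CInf G U => fderiv ℝ f z v := by
  have h1 : Continuous fun f : CInf G U => jet G U f 1 ⟨z, hz⟩ :=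
    (continuous_eval_const (F := C(U, E [×1]→L[ℝ] G)) _).comp
      ((continuous_apply 1).comp isUniformInducing_jet.isInducing.continuous)
  have h2 : Continuous fun f : CInf G U => jet G U f 1 ⟨z, hz⟩ (fun _ => v) :=
    (ContinuousMultilinearMap.apply ℝ (fun _ : Fin 1 => E) G (fun _ => v)).continuous.comp h1
  simpa [jet_apply, iteratedFDeriv_one_apply] using h2

variable [FiniteDimensional ℝ E] [CompleteSpace G]

instance : SigmaCompactSpace U := by
  have := FiniteDimensional.proper ℝ E
  have : SecondCountableTopology E := inferInstance
  have : LocallyCompactSpace U := U.isOpen.locallyCompactSpace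
  infer_instance

/-- The jets of smooth functions form a closed subspace of a countable product of spaces of
continuous maps, because a limit of jets is the jet of the limit function. -/
instance : FrechetSpace (CInf G U) := by
  have := FiniteDimensional.proper ℝ E
  have : LocallyCompactSpace U := U.isOpen.locallyCompactSpace
  refine FrechetSpace.of_isUniformInducing (jet G U) isUniformInducing_jet jet_injective ?_
  refine IsSeqClosed.isClosed fun s y hs hy => ?_
  choose f hf using hs
  let g : E → FormalMultilinearSeries ℝ E G := fun z k =>
    open Classical in if hz : z ∈ U then y k ⟨z, hz⟩ else 0
  have hg : ∀ (z : U) k, g z k = y k z := fun z k => dif_pos z.2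
  have hlim : ∀ k, TendstoLocallyUniformlyOn (fun n => iteratedFDeriv ℝ k (f n))
      (fun z => g z k) atTop U := by
    intro k
    rw [tendstoLocallyUniformlyOn_iff_tendstoLocallyUniformly_comp_coe]
    have h1 := ContinuousMap.tendsto_iff_tendstoLocallyUniformly.1 ((tendsto_pi_nhds.1 hy) k)
    have h2 : ((fun z => g z k) ∘ ((↑) : U → E)) = y k := funext fun z => hg z k
    have h3 : (fun n (z : U) => iteratedFDeriv ℝ k (f n) z) = fun n z => s n k z := by
      funext n z
      rw [← hf n]; rfl
    erw [h2, h3]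
    exact h1
  have hT := hasFTaylorSeriesUpToOn_of_tendsto U.isOpen (fun n => (f n).contDiffOn) hlim
  refine ⟨⟨fun z => (g z 0).curry0, hT.contDiffOn, fun z hz => ?_⟩, ?_⟩
  · show (g z 0).curry0 = 0
    simp [g, hz]
  · funext k
    refine ContinuousMap.ext fun z => ?_
    show iteratedFDeriv ℝ k (fun z => (g z 0).curry0) z = y k z
    rw [← hg, hT.eq_iteratedFDerivWithin_of_uniqueDiffOn (by exact_mod_cast le_top)
      U.isOpen.uniqueDiffOn z.2, iteratedFDerivWithin_of_isOpen k U.isOpen z.2]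

end CInf

/-- Reparametrising along `γ` is uniformly continuous, so it can only coarsen the structure. Used in
both directions, it lets compact subsets of `U` be taken either in `E` or in the subtype. -/
theorem comap_uniformFun_le {A B G S : Type*} [UniformSpace G] (f : S → A → G) (γ : B → A)
    (f' : S → B → G) (h : ∀ s b, f' s b = f s (γ b)) :
    UniformSpace.comap (fun s => UniformFun.ofFun (f s)) (UniformFun.uniformSpace A G) ≤
      UniformSpace.comap (fun s => UniformFun.ofFun (f' s)) (UniformFun.uniformSpace B G) := by
  obtain rfl : f' = fun s => f s ∘ γ := funext fun s => funext fun b => h s b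
  let _ : UniformSpace S :=
    UniformSpace.comap (fun s => UniformFun.ofFun (f s)) (UniformFun.uniformSpace A G)
  rw [← uniformContinuous_iff_le_comap]
  exact (UniformFun.precomp_uniformContinuous (f := γ)).comp uniformContinuous_comap

/-- Uniform convergence on the compact subsets of an open set `U`, expressed on `U`. -/
theorem comap_uniformOnFun_eq {E G S : Type*} [TopologicalSpace E] [UniformSpace G]
    (U : TopologicalSpace.Opens E) (j : S → E → G) (J : S → C(U, G)) (h : ∀ s z, J s z = j s z) :
    UniformSpace.comap (fun s => UniformOnFun.ofFun {K : Set E | IsCompact K ∧ K ⊆ U} (j s))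
      inferInstance = UniformSpace.comap J inferInstance := by
  have e1 : (inferInstance : UniformSpace C(U, G)) =
      UniformSpace.comap ContinuousMap.toUniformOnFunIsCompact inferInstance :=
    ContinuousMap.isUniformEmbedding_toUniformOnFunIsCompact.isUniformInducing.comap_uniformSpace.symm
  rw [e1]
  let 𝔖 : Set (Set E) := {K : Set E | IsCompact K ∧ K ⊆ U}
  have h1 : UniformSpace.comap (fun s => UniformOnFun.ofFun 𝔖 (j s)) inferInstance =
      ⨅ (K : Set E) (_ : K ∈ 𝔖), UniformSpace.comap
        (fun s => UniformFun.ofFun (K.domRestrict (j s))) (UniformFun.uniformSpace K G) := by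
    simp only [inferInstance, UniformOnFun.uniformSpace, UniformSpace.comap_iInf,
      ← UniformSpace.comap_comap]
    rfl
  have h2 : UniformSpace.comap J
        (UniformSpace.comap ContinuousMap.toUniformOnFunIsCompact inferInstance) =
      ⨅ (K : Set U) (_ : K ∈ {K : Set U | IsCompact K}), UniformSpace.comap
        (fun s => UniformFun.ofFun (K.domRestrict (J s))) (UniformFun.uniformSpace K G) := by
    simp only [inferInstance, UniformOnFun.uniformSpace, UniformSpace.comap_iInf,
      ← UniformSpace.comap_comap]
    rfl
  refine h1.trans (Eq.trans ?_ h2.symm)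
  refine le_antisymm (le_iInf₂ fun K hK => ?_) (le_iInf₂ fun K hK => ?_)
  · refine iInf₂_le_of_le (((↑) : U → E) '' K) ⟨hK.image continuous_subtype_val, ?_⟩
      (comap_uniformFun_le _ (fun z : K => (⟨z.1.1, mem_image_of_mem _ z.2⟩ :
        ↥(((↑) : U → E) '' K))) _ fun s b => by exact h s b.1)
    rintro _ ⟨z, _, rfl⟩
    exact z.2
  · refine iInf₂_le_of_le (((↑) : U → E) ⁻¹' K) ?_
      (comap_uniformFun_le _ (fun z : K => (⟨⟨z.1, hK.2 z.2⟩, z.2⟩ : ↥(((↑) : U → E) ⁻¹' K))) _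
        fun s b => by exact (h s ⟨b.1, hK.2 b.2⟩).symm)
    exact (IsInducing.subtypeVal.isCompact_preimage_iff (by simpa using hK.2)).2 hK.1

end CInf

attribute [local instance] FiniteDimensional.complexToReal

open Filter

/-! ### Fréchet structures from families of maps -/

section Family

variable {V ι : Type*} {W : ι → Type*} [AddCommGroup V] [Module ℂ V]
    [∀ i, AddCommGroup (W i)] [∀ i, Module ℂ (W i)] [∀ i, UniformSpace (W i)]
    [∀ i, FrechetSpace (W i)] (r : ∀ i, V →ₗ[ℂ] W i) {s : Set ι}

/-- The maps in `s` embed `V` into a countable product of Fréchet spaces, and `hcl` says that the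
image is sequentially closed. -/
theorem FrechetSpace.of_pi (hs : s.Countable) [u : UniformSpace V]
    (hR : IsUniformInducing (LinearMap.pi fun i : s => r i))
    (hinj : ∀ v, (∀ i ∈ s, r i v = 0) → v = 0)
    (hcl : ∀ (v : ℕ → V) (w : ∀ i, W i),
      (∀ i ∈ s, Tendsto (fun n => r i (v n)) atTop (𝓝 (w i))) → ∃ v₀, ∀ i ∈ s, r i v₀ = w i) :
    FrechetSpace V := by
  have := hs.to_subtype
  refine FrechetSpace.of_isUniformInducing (LinearMap.pi fun i : s => r i) hR ?_ ?_
  · exact (injective_iff_map_eq_zero _).2 fun v hv => hinj v fun i hi => congrFun hv ⟨i, hi⟩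
  · refine IsSeqClosed.isClosed fun x y hx hy => ?_
    choose v hv using hx
    obtain ⟨v₀, h₀⟩ := hcl v (fun i => open Classical in if h : i ∈ s then y ⟨i, h⟩ else 0)
      fun i hi => by
        simp only [dif_pos hi]
        have := (tendsto_pi_nhds.1 hy) ⟨i, hi⟩
        simp only [← hv] at this
        exact this
    exact ⟨v₀, funext fun i => (h₀ i i.2).trans (dif_pos i.2)⟩

/-- The closed graph theorem applied to all `r i`, including those outside `s`: by `hgraph` they are
automatically continuous for the structure defined by `s`. -/
theorem FrechetSpace.uniformContinuous_of_graph [u : UniformSpace V] [FrechetSpace V]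
    (hR : IsUniformInducing (LinearMap.pi fun i : s => r i))
    (hgraph : ∀ i (v : ℕ → V) (v₀ : V) (w : W i),
      (∀ j ∈ s, Tendsto (fun n => r j (v n)) atTop (𝓝 (r j v₀))) →
        Tendsto (fun n => r i (v n)) atTop (𝓝 w) → w = r i v₀) (i : ι) :
    UniformContinuous (r i) := by
  refine uniformContinuous_addMonoidHom_of_continuous (f := r i)
    (continuous_of_seq_closed_graph (r i) fun v v₀ w hv hw => hgraph i v v₀ w (fun j hj => ?_) hw)
  have h1 : Continuous (r j) :=
    (continuous_apply (⟨j, hj⟩ : s)).comp hR.isInducing.continuous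
  exact (h1.tendsto v₀).comp hv

/-- The initial uniform structure of a family of linear maps to Fréchet spaces is Fréchet, if
countably many of the maps suffice to control the space. -/
theorem FrechetSpace.of_family (hs : s.Countable) [u : UniformSpace V]
    (hu : u = ⨅ i, UniformSpace.comap (r i) inferInstance)
    (hinj : ∀ v, (∀ i ∈ s, r i v = 0) → v = 0)
    (hcl : ∀ (v : ℕ → V) (w : ∀ i, W i),
      (∀ i ∈ s, Tendsto (fun n => r i (v n)) atTop (𝓝 (w i))) → ∃ v₀, ∀ i ∈ s, r i v₀ = w i)
    (hgraph : ∀ i (v : ℕ → V) (v₀ : V) (w : W i),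
      (∀ j ∈ s, Tendsto (fun n => r j (v n)) atTop (𝓝 (r j v₀))) →
        Tendsto (fun n => r i (v n)) atTop (𝓝 w) → w = r i v₀) : FrechetSpace V := by
  let uc : UniformSpace V := UniformSpace.comap (LinearMap.pi fun i : s => r i) inferInstance
  have hF := FrechetSpace.of_pi (u := uc) r hs ⟨rfl⟩ hinj hcl
  have hUC := FrechetSpace.uniformContinuous_of_graph (u := uc) r ⟨rfl⟩ hgraph
  -- Uniform continuity of every `r i` makes the countable structure at least as fine as the full
  -- one; the converse holds because `s` is a subfamily.
  have hle : uc = u := by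
    rw [hu]
    refine le_antisymm (le_iInf fun i => uniformContinuous_iff_le_comap.1 (hUC i)) ?_
    show _ ≤ UniformSpace.comap (LinearMap.pi fun i : s => r i) (Pi.uniformSpace _)
    rw [Pi.uniformSpace_eq, UniformSpace.comap_iInf]
    refine le_iInf fun i => ?_
    rw [← UniformSpace.comap_comap]
    exact iInf_le _ i.1
  exact hle ▸ hF

end Family

/-! ### Smoothness of forms -/

section LinearForms

variable {E F V : Type*} [NormedAddCommGroup E] [NormedSpace ℂ E] [FiniteDimensional ℂ E]
  [NormedAddCommGroup F] [NormedSpace ℂ F] [FiniteDimensional ℂ F]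
  [NormedAddCommGroup V] [NormedSpace ℝ V]

instance : CompleteSpace (ExtConj E) := FiniteDimensional.complete ℂ _

/-- The pullback of a fixed covector as a linear map in the linear map. -/
def pullConjL (α : ConjDual F) : (E →L[ℂ] F) →ₗ[ℝ] ConjDual E where
  toFun L := pullConj L α
  map_add' L L' := LinearMap.ext fun v => map_add α (L v) (L' v)
  map_smul' c L := LinearMap.ext fun v => by
    show α (c • L v) = c • α (L v)
    rw [← Complex.coe_smul, map_smulₛₗ, Complex.conj_ofReal, Complex.coe_smul]

theorem contDiff_mul_form {n : ℕ∞ω} {f g : V → ExtConj E} {z : V} (hf : ContDiffAt ℝ n f z)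
    (hg : ContDiffAt ℝ n g z) : ContDiffAt ℝ n (fun w => f w * g w) z :=
  ((ExtConj.mulB E).isBoundedBilinearMap.contDiff.contDiffAt).comp z (hf.prodMk hg)

/-- In a pulled back product of covectors each factor is real-linear in `L`, so the product depends
polynomially on `L`. -/
theorem contDiff_pull (b : ExtConj F) : ContDiff ℝ ∞ fun L : E →L[ℂ] F => pull L b := by
  induction b using ExtConj.induction with
  | h0 c =>
    simp only [AlgHom.commutes]
    exact contDiff_const (c := algebraMap ℂ (ExtConj E) c)
  | hadd x y hx hy => simpa only [map_add] using hx.add hy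
  | hι x α hx =>
    have h1 : ContDiff ℝ ∞ fun L : E →L[ℂ] F => (ExtConj.ι (pullConj L α) : ExtConj E) :=
      (((ExtConj.ι (E := E)).restrictScalars ℝ).comp
        (pullConjL α)).toContinuousLinearMap.contDiff
    simp only [map_mul, pull_ι]
    rw [contDiff_iff_contDiffAt]
    exact fun L => contDiff_mul_form h1.contDiffAt hx.contDiffAt

theorem ContDiffAt.pull_form {f : V → E →L[ℂ] F} {g : V → ExtConj F} {z : V}
    (hf : ContDiffAt ℝ ∞ f z) (hg : ContDiffAt ℝ ∞ g z) :
    ContDiffAt ℝ ∞ (fun w => pull (f w) (g w)) z := by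
  let B := Module.finBasis ℂ (ExtConj F)
  have h : (fun w => pull (f w) (g w)) = fun w =>
      ∑ i, ((B.coord i).toContinuousLinearMap.restrictScalars ℝ) (g w) • pull (f w) (B i) := by
    funext w
    conv_lhs => rw [← B.sum_repr (g w), map_sum]
    exact Finset.sum_congr rfl fun i _ => map_smul _ _ _
  rw [h]
  refine ContDiffAt.sum fun i _ => ?_
  have h1 : ContDiffAt ℝ ∞
      (fun w => ((B.coord i).toContinuousLinearMap.restrictScalars ℝ) (g w)) z :=
    ((B.coord i).toContinuousLinearMap.restrictScalars ℝ).contDiff.contDiffAt.comp z hg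
  exact h1.smul ((contDiff_pull (B i)).contDiffAt.comp z hf)

end LinearForms

section Manifold

variable {E : Type*} [NormedAddCommGroup E] [NormedSpace ℂ E] [FiniteDimensional ℂ E]
  {H : Type*} [TopologicalSpace H] {I : ModelWithCorners ℂ E H} [I.Boundaryless]
  {X : Type*} [TopologicalSpace X] [ChartedSpace H X] [IsManifold I ω X]

theorem contDiffAt_change_omega (x₀ x₁ : X) {z : E}
    (hz : z ∈ (extChartAt I x₀).target)
    (hz' : (extChartAt I x₀).symm z ∈ (extChartAt I x₁).source) :
    ContDiffAt ℂ ω (extChartAt I x₁ ∘ (extChartAt I x₀).symm) z := by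
  have h := contDiffWithinAt_ext_coord_change (I := I) (n := ω) x₁ x₀ (y := z) (by
    rw [PartialEquiv.trans_source]
    exact ⟨hz, hz'⟩)
  rwa [I.range_eq_univ, contDiffWithinAt_univ] at h

theorem eventually_mem_source (x₀ x₁ : X) {z : E} (hz : z ∈ (extChartAt I x₀).target)
    (hz' : (extChartAt I x₀).symm z ∈ (extChartAt I x₁).source) :
    ∀ᶠ w in 𝓝 z, w ∈ (extChartAt I x₀).target ∧
      (extChartAt I x₀).symm w ∈ (extChartAt I x₁).source :=
  (eventually_mem_set.2 ((isOpen_extChartAt_target x₀).mem_nhds hz)).and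
    ((continuousAt_extChartAt_symm'' hz).eventually ((isOpen_extChartAt_source x₁).mem_nhds hz'))

/-- Smoothness of a form near a point can be checked in any chart. -/
theorem contDiffAt_inChart_of_chart {η : X → ExtConj E} (x₀ x₁ : X) {z : E}
    (hz : z ∈ (extChartAt I x₀).target)
    (hz' : (extChartAt I x₀).symm z ∈ (extChartAt I x₁).source)
    (h : ContDiffAt ℝ ∞ (inChart I η x₁) (extChartAt I x₁ ((extChartAt I x₀).symm z))) :
    ContDiffAt ℝ ∞ (inChart I η x₀) z := by
  have hφ := contDiffAt_change_omega x₀ x₁ hz hz'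
  have hφ' : ContDiffAt ℝ ∞ (fderiv ℂ (extChartAt I x₁ ∘ (extChartAt I x₀).symm)) z :=
    (hφ.fderiv_right (m := ∞) (by simp)).restrict_scalars ℝ
  have hφ'' : ContDiffAt ℝ ∞ (extChartAt I x₁ ∘ (extChartAt I x₀).symm) z :=
    (hφ.restrict_scalars ℝ).of_le le_top
  refine (hφ'.pull_form (ContDiffAt.comp z h hφ'')).congr_of_eventuallyEq ?_
  filter_upwards [eventually_mem_source x₀ x₁ hz hz'] with w hw
  exact inChart_change η x₀ x₁ hw.1 hw.2

/-- The definition asks for smoothness in every preferred chart; by the transformation rule one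
chart around each point is enough. -/
theorem isSmoothForm_of_cover {η : X → ExtConj E}
    (h : ∀ x, ∃ x₁, x ∈ (extChartAt I x₁).source ∧
      ContDiffAt ℝ ∞ (inChart I η x₁) (extChartAt I x₁ x)) : IsSmoothForm I η := by
  intro x₀ z hz
  obtain ⟨x₁, h1, h2⟩ := h ((extChartAt I x₀).symm z)
  exact (contDiffAt_inChart_of_chart x₀ x₁ hz h1 h2).contDiffWithinAt

namespace DForm

theorem contDiffAt (η : DForm I X) (x₀ : X) {z : E} (hz : z ∈ (extChartAt I x₀).target) :
    ContDiffAt ℝ ∞ (inChart I η x₀) z :=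
  (η.2 x₀).contDiffAt ((isOpen_extChartAt_target x₀).mem_nhds hz)

theorem inChart_add (η η' : X → ExtConj E) (x₀ : X) (z : E) :
    inChart I (η + η') x₀ z = inChart I η x₀ z + inChart I η' x₀ z := map_add (pull _) _ _

theorem inChart_smul (c : ℂ) (η : X → ExtConj E) (x₀ : X) (z : E) :
    inChart I (c • η) x₀ z = c • inChart I η x₀ z := map_smul (pull _) c _

theorem inChart_mul (η η' : X → ExtConj E) (x₀ : X) (z : E) :
    inChart I (η * η') x₀ z = inChart I η x₀ z * inChart I η' x₀ z := map_mul (pull _) _ _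

variable (I) in
/-- The domain of the chart at `x₀`, as an open subset of `E`. -/
def chartOpens (x₀ : X) : TopologicalSpace.Opens E :=
  ⟨(extChartAt I x₀).target, isOpen_extChartAt_target x₀⟩

variable (I) in
/-- The coordinate expression of a form in a chart. -/
def toCInf (x₀ : X) : DForm I X →ₗ[ℂ] CInf (ExtConj E) (chartOpens I x₀) where
  toFun η := ⟨(extChartAt I x₀).target.indicator (inChart I η x₀),
    (η.2 x₀).congr fun z hz => indicator_of_mem hz _, fun z hz => indicator_of_notMem hz _⟩
  map_add' η η' := CInf.ext fun z hz => by
    have hz' : z ∈ (extChartAt I x₀).target := hz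
    refine (indicator_of_mem hz' _).trans ((inChart_add η.1 η'.1 x₀ z).trans ?_)
    exact congrArg₂ (· + ·) (indicator_of_mem hz' _).symm (indicator_of_mem hz' _).symm
  map_smul' c η := CInf.ext fun z hz => by
    have hz' : z ∈ (extChartAt I x₀).target := hz
    refine (indicator_of_mem hz' _).trans ((inChart_smul c η.1 x₀ z).trans ?_)
    exact congrArg (c • ·) (indicator_of_mem hz' _).symm

theorem toCInf_apply (x₀ : X) (η : DForm I X) {z : E} (hz : z ∈ (extChartAt I x₀).target) :
    toCInf I x₀ η z = inChart I η x₀ z := indicator_of_mem hz _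

theorem toCInf_eventuallyEq (x₀ : X) (η : DForm I X) {z : E} (hz : z ∈ (extChartAt I x₀).target) :
    (toCInf I x₀ η : E → ExtConj E) =ᶠ[𝓝 z] inChart I η x₀ := by
  filter_upwards [(isOpen_extChartAt_target x₀).mem_nhds hz] with w hw
  exact toCInf_apply x₀ η hw

/-- Presents the `C^∞` structure as an initial structure for maps to Fréchet spaces, the form needed
by `FrechetSpace.of_family`. -/
theorem uniformSpace_eq : (inferInstance : UniformSpace (DForm I X)) =
    ⨅ x₀ : X, UniformSpace.comap (toCInf I x₀) inferInstance := by
  refine iInf_congr fun x₀ => ?_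
  have h : (inferInstance : UniformSpace (CInf (ExtConj E) (chartOpens I x₀))) =
      ⨅ k, UniformSpace.comap (fun f => CInf.jet (ExtConj E) (chartOpens I x₀) f k)
        inferInstance := by
    show UniformSpace.comap (CInf.jet (ExtConj E) (chartOpens I x₀)) (Pi.uniformSpace _) = _
    rw [Pi.uniformSpace_eq, UniformSpace.comap_iInf]
    simp only [← UniformSpace.comap_comap]
    rfl
  rw [h, UniformSpace.comap_iInf]
  refine iInf_congr fun k => ?_
  rw [← UniformSpace.comap_comap]
  refine comap_uniformOnFun_eq (chartOpens I x₀) _ _ fun η z => ?_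
  exact ((toCInf_eventuallyEq x₀ η z.2).iteratedFDeriv ℝ k).eq_of_nhds

/-- The value of a form at `x`, computed in the chart at `x₀`. -/
theorem eq_pull_toCInf (η : DForm I X) {x x₀ : X} (hx : x ∈ (extChartAt I x₀).source) :
    η x = pull (fderiv ℂ (extChartAt I x₀ ∘ (extChartAt I x).symm) (extChartAt I x x))
      (toCInf I x₀ η (extChartAt I x₀ x)) := by
  have h1 := inChart_change (I := I) η.1 x x₀ (mem_extChartAt_target x)
    (by rwa [extChartAt_to_inv])
  rw [inChart_self] at h1
  rw [h1, toCInf_apply _ _ ((extChartAt I x₀).map_source hx), Function.comp_apply,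
    extChartAt_to_inv]

theorem continuous_pull (L : E →L[ℂ] E) : Continuous (pull L) :=
  (pull L).toLinearMap.continuous_of_finiteDimensional

theorem tendsto_apply {η : ℕ → DForm I X} {x x₀ : X} (hx : x ∈ (extChartAt I x₀).source)
    {w : CInf (ExtConj E) (chartOpens I x₀)}
    (h : Tendsto (fun n => toCInf I x₀ (η n)) atTop (𝓝 w)) :
    Tendsto (fun n => η n x) atTop
      (𝓝 (pull (fderiv ℂ (extChartAt I x₀ ∘ (extChartAt I x).symm) (extChartAt I x x))
        (w (extChartAt I x₀ x)))) := by
  simp only [eq_pull_toCInf _ hx]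
  exact ((continuous_pull _).tendsto _).comp
    (((CInf.continuous_eval (U := chartOpens I x₀)
      ((extChartAt I x₀).map_source hx)).tendsto w).comp h)

theorem tendsto_toCInf {η : ℕ → DForm I X} {ζ : X → ExtConj E}
    (h : ∀ x, Tendsto (fun n => η n x) atTop (𝓝 (ζ x))) (x₀ : X) {z : E}
    (hz : z ∈ (extChartAt I x₀).target) :
    Tendsto (fun n => toCInf I x₀ (η n) z) atTop (𝓝 (inChart I ζ x₀ z)) := by
  simp only [toCInf_apply x₀ _ hz]
  exact ((continuous_pull _).tendsto _).comp (h _)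

/-- Countably many charts cover `X`. If the expressions of a sequence of forms converge in those
charts, the forms converge pointwise, and the limit has the limiting expressions, hence is smooth.
The other charts are controlled by the graph condition, again through pointwise limits. -/
instance frechetSpace [SecondCountableTopology X] : FrechetSpace (DForm I X) := by
  obtain ⟨s, hs, hcov⟩ := TopologicalSpace.countable_cover_nhds
    fun x : X => extChartAt_source_mem_nhds (I := I) x
  have hc : ∀ x : X, ∃ i ∈ s, x ∈ (extChartAt I i).source := fun x => by
    have := hcov.ge (mem_univ x)
    simpa using this
  refine FrechetSpace.of_family (toCInf I) hs uniformSpace_eq (fun η hη => ?_)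
    (fun η w hw => ?_) (fun x₀ η η₀ w h hw => ?_)
  · refine Subtype.ext (funext fun x => ?_)
    obtain ⟨i, hi, hx⟩ := hc x
    have := eq_pull_toCInf η hx
    rw [hη i hi] at this
    rw [show η.1 x = _ from this]
    exact map_zero (pull (fderiv ℂ (extChartAt I i ∘ (extChartAt I x).symm) (extChartAt I x x)))
  · choose i hi hx using hc
    -- The limit at `x` is read off in a chart of the cover chosen for `x`; `heq` shows that it has
    -- the right expression in every chart of the cover.
    let ζ : X → ExtConj E := fun x =>
      pull (fderiv ℂ (extChartAt I (i x) ∘ (extChartAt I x).symm) (extChartAt I x x))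
        (w (i x) (extChartAt I (i x) x))
    have hζ : ∀ x, Tendsto (fun n => η n x) atTop (𝓝 (ζ x)) := fun x =>
      tendsto_apply (hx x) (hw (i x) (hi x))
    have heq : ∀ j ∈ s, ∀ z ∈ (extChartAt I j).target, inChart I ζ j z = w j z := fun j hj z hz =>
      tendsto_nhds_unique (tendsto_toCInf hζ j hz)
        (((CInf.continuous_eval (U := chartOpens I j) hz).tendsto _).comp (hw j hj))
    have hsm : IsSmoothForm I ζ := isSmoothForm_of_cover fun x => ⟨i x, hx x, by
      have hz := (extChartAt I (i x)).map_source (hx x)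
      refine ((w (i x)).contDiffAt (U := chartOpens I (i x)) hz).congr_of_eventuallyEq ?_
      filter_upwards [(isOpen_extChartAt_target (i x)).mem_nhds hz] with z hz
      exact heq _ (hi x) z hz⟩
    exact ⟨⟨ζ, hsm⟩, fun j hj => CInf.ext fun z hz =>
      (toCInf_apply j ⟨ζ, hsm⟩ hz).trans (heq j hj z hz)⟩
  · refine CInf.ext fun z hz => ?_
    rw [toCInf_apply x₀ η₀ hz]
    refine tendsto_nhds_unique
      (((CInf.continuous_eval (U := chartOpens I x₀) hz).tendsto _).comp hw)
      (tendsto_toCInf (fun x => ?_) x₀ hz)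
    obtain ⟨i, hi, hx⟩ := hc x
    have := tendsto_apply hx (h i hi)
    rwa [← eq_pull_toCInf η₀ hx] at this

theorem continuous_toCInf (x₀ : X) : Continuous (toCInf I x₀ : DForm I X → _) := by
  have h := uniformSpace_eq (I := I) (X := X)
  have h2 : (inferInstance : UniformSpace (DForm I X)) ≤
      UniformSpace.comap (toCInf I x₀) inferInstance := h ▸ iInf_le _ x₀
  exact (uniformContinuous_iff_le_comap.2 h2).continuous

theorem continuous_eval (x : X) : Continuous fun η : DForm I X => η x := by
  have h : (fun η : DForm I X => η x) = fun η => toCInf I x η (extChartAt I x x) := funext fun η =>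
    ((toCInf_apply x η (mem_extChartAt_target x)).trans (inChart_self _ _)).symm
  rw [h]
  exact (CInf.continuous_eval (U := chartOpens I x) (mem_extChartAt_target x)).comp
    (continuous_toCInf x)

theorem continuous_fderiv (x₀ : X) {z : E} (hz : z ∈ (extChartAt I x₀).target) (v : E) :
    Continuous fun η : DForm I X => fderiv ℝ (inChart I η x₀) z v := by
  have h := (CInf.continuous_fderiv (U := chartOpens I x₀) hz v).comp (continuous_toCInf x₀)
  refine h.congr fun η => ?_
  exact congrArg (fun D : E →L[ℝ] ExtConj E => D v) (toCInf_eventuallyEq x₀ η hz).fderiv_eq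

/-- A linear map to forms is continuous if its values at all points are. -/
theorem continuous_of_eval [SecondCountableTopology X] {V : Type*} [AddCommGroup V] [Module ℂ V]
    [UniformSpace V] [FrechetSpace V] (f : V →ₗ[ℂ] DForm I X)
    (h : ∀ x, Continuous fun v => f v x) : Continuous f :=
  FrechetSpace.continuous_of_separating f (fun (x : X) (g : DForm I X) => g x)
    continuous_eval (fun _ _ h => Subtype.ext (funext h)) h

end DForm

end Manifold

attribute [local instance] FiniteDimensional.complexToReal

open Filter

/-! ### The grading of the exterior algebra -/

section ExtGrading

variable {E F : Type*} [NormedAddCommGroup E] [NormedSpace ℂ E] [FiniteDimensional ℂ E]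
  [NormedAddCommGroup F] [NormedSpace ℂ F] [FiniteDimensional ℂ F]

namespace ExtConj

theorem gr_zero : ExtConj.gr E 0 = 1 := pow_zero _

theorem gr_succ (q : ℕ) : ExtConj.gr E (q + 1) = LinearMap.range ExtConj.ι * ExtConj.gr E q :=
  pow_succ' _ _

theorem mul_mem_gr {p q : ℕ} {x y : ExtConj E} (hx : x ∈ ExtConj.gr E p)
    (hy : y ∈ ExtConj.gr E q) : x * y ∈ ExtConj.gr E (p + q) := by
  have h : ExtConj.gr E (p + q) = ExtConj.gr E p * ExtConj.gr E q := pow_add _ _ _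
  rw [h]
  exact Submodule.mul_mem_mul hx hy

theorem ι_mul_mem_gr {q : ℕ} (α : ConjDual E) {y : ExtConj E}
    (hy : y ∈ ExtConj.gr E q) : ExtConj.ι α * y ∈ ExtConj.gr E (q + 1) := by
  rw [gr_succ]
  exact Submodule.mul_mem_mul (LinearMap.mem_range_self _ α) hy

theorem one_mem_gr : (1 : ExtConj E) ∈ ExtConj.gr E 0 := by
  rw [gr_zero]; exact Submodule.one_le.1 le_rfl

theorem gr_induction {P : ℕ → ExtConj E → Prop} (h0 : ∀ c : ℂ, P 0 (algebraMap ℂ _ c))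
    (hadd : ∀ q x y, P q x → P q y → P q (x + y))
    (hι : ∀ q α x, x ∈ ExtConj.gr E q → P q x → P (q + 1) (ExtConj.ι α * x)) {q : ℕ}
    {x : ExtConj E} (hx : x ∈ ExtConj.gr E q) : P q x := by
  induction q generalizing x with
  | zero =>
    obtain ⟨c, rfl⟩ := ExtConj.exists_of_mem_gr_zero hx
    exact h0 c
  | succ q ih =>
    rw [gr_succ] at hx
    refine Submodule.mul_induction_on hx ?_ (hadd _)
    rintro _ ⟨α, rfl⟩ y hy
    exact hι q α y hy (ih hy)

theorem ι_mul_of_mem {p : ℕ} (α : ConjDual E) {x : ExtConj E} (hx : x ∈ ExtConj.gr E p) :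
    ExtConj.ι α * x = ((-1 : ℂ) ^ p) • (x * ExtConj.ι α) := by
  refine gr_induction (P := fun p x => ExtConj.ι α * x = ((-1 : ℂ) ^ p) • (x * ExtConj.ι α))
    (fun c => ?_) (fun q x y hx hy => ?_) (fun q β x _ hx => ?_) hx
  · rw [pow_zero, one_smul]; exact (Algebra.commutes _ _).symm
  · rw [mul_add, add_mul, smul_add, hx, hy]
  · rw [← mul_assoc, ι_mul_ι, neg_mul, mul_assoc, hx, mul_smul_comm, pow_succ, mul_neg_one,
      neg_smul, mul_assoc]

theorem pull_mem_gr (L : E →L[ℂ] F) {q : ℕ} {x : ExtConj F} (hx : x ∈ ExtConj.gr F q) :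
    pull L x ∈ ExtConj.gr E q := by
  refine gr_induction (P := fun q x => pull L x ∈ ExtConj.gr E q)
    (fun c => ?_) (fun q x y hx hy => ?_) (fun q β x _ hx => ?_) hx
  · rw [AlgHom.commutes, gr_zero]; exact Submodule.algebraMap_mem c
  · rw [map_add]; exact add_mem hx hy
  · rw [map_mul, pull_ι]; exact ι_mul_mem_gr _ hx

variable (E) in
theorem isInternal_gr : DirectSum.IsInternal (ExtConj.gr E) :=
  DirectSum.Decomposition.isInternal (fun i : ℕ => ⋀[ℂ]^i (ConjDual E))

-- In a finite dimensional space an independent family of subspaces has only finitely many nonzero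
-- members.
variable (E) in
theorem exists_gr_eq_bot : ∃ N : ℕ, ∀ q, N ≤ q → ExtConj.gr E q = ⊥ := by
  have h := (isInternal_gr E).submodule_iSupIndep
  have hf := WellFoundedGT.finite_ne_bot_of_iSupIndep h
  obtain ⟨N, hN⟩ := hf.bddAbove
  refine ⟨N + 1, fun q hq => ?_⟩
  by_contra hne
  have := hN hne
  lia

instance : FrechetSpace (ExtConj E) := by
  have : LocallyConvexSpace ℝ (ExtConj E) := inferInstance
  exact { this with }

variable (E) in
theorem exists_proj : ∃ (N : ℕ) (P : ℕ → ExtConj E →L[ℂ] ExtConj E),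
    (∀ q, N ≤ q → ExtConj.gr E q = ⊥) ∧
    (∀ i x, P i x ∈ ExtConj.gr E i) ∧ (∀ i, ∀ x ∈ ExtConj.gr E i, P i x = x) ∧
    (∀ i j, i ≠ j → ∀ x ∈ ExtConj.gr E j, P i x = 0) ∧
    (∀ x, ∑ i ∈ Finset.range N, P i x = x) := by
  obtain ⟨N, hN⟩ := exists_gr_eq_bot E
  obtain ⟨P, h⟩ := exists_projections (isInternal_gr E)
    (fun i => Submodule.closed_of_finiteDimensional _) (Finset.range N)
    fun i hi => hN i (by simpa using hi)
  exact ⟨N, P, hN, h⟩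

variable (E) in
/-- The projection to the elements of type `(0,q)`. -/
def proj (q : ℕ) : ExtConj E →L[ℂ] ExtConj E := (exists_proj E).choose_spec.choose q

variable (E) in
/-- A bound for the degrees of `(0,•)`-covectors. -/
def degBound : ℕ := (exists_proj E).choose

theorem gr_eq_bot {q : ℕ} (h : degBound E ≤ q) : ExtConj.gr E q = ⊥ :=
  (exists_proj E).choose_spec.choose_spec.1 q h

theorem proj_mem (q : ℕ) (x : ExtConj E) : proj E q x ∈ ExtConj.gr E q :=
  (exists_proj E).choose_spec.choose_spec.2.1 q x

theorem proj_of_mem {q : ℕ} {x : ExtConj E} (h : x ∈ ExtConj.gr E q) : proj E q x = x :=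
  (exists_proj E).choose_spec.choose_spec.2.2.1 q x h

theorem proj_of_ne {p q : ℕ} (hpq : p ≠ q) {x : ExtConj E} (h : x ∈ ExtConj.gr E q) :
    proj E p x = 0 :=
  (exists_proj E).choose_spec.choose_spec.2.2.2.1 p q hpq x h

theorem sum_proj (x : ExtConj E) : ∑ q ∈ Finset.range (degBound E), proj E q x = x :=
  (exists_proj E).choose_spec.choose_spec.2.2.2.2 x

theorem proj_comm {f : ExtConj F →ₗ[ℂ] ExtConj E}
    (hf : ∀ q, ∀ x ∈ ExtConj.gr F q, f x ∈ ExtConj.gr E q) (q : ℕ) (x : ExtConj F) :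
    f (proj F q x) = proj E q (f x) := by
  conv_rhs => rw [← sum_proj x, map_sum, map_sum]
  by_cases hq : q ∈ Finset.range (degBound F)
  · rw [Finset.sum_eq_single q]
    · exact (proj_of_mem (hf _ _ (proj_mem q x))).symm
    · exact fun p _ hp => proj_of_ne hp.symm (hf _ _ (proj_mem p x))
    · exact fun h => absurd hq h
  · rw [Finset.sum_eq_zero fun p hp => proj_of_ne (by rintro rfl; exact hq hp) (hf _ _ (proj_mem p x))]
    have h0 : proj F q x = 0 := by
      have := proj_mem q x
      rwa [gr_eq_bot (by simpa using hq), Submodule.mem_bot] at this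
    rw [h0, map_zero]

theorem pull_proj (L : E →L[ℂ] F) (q : ℕ) (x : ExtConj F) :
    pull L (proj F q x) = proj E q (pull L x) :=
  proj_comm (f := (pull L).toLinearMap) (fun _ _ h => pull_mem_gr L h) q x

end ExtConj

/-! ### Calculus of `∂̄` in a chart -/

theorem fderiv_mul_form {V : Type*} [NormedAddCommGroup V] [NormedSpace ℝ V] {f g : V → ExtConj E}
    {z : V} (hf : DifferentiableAt ℝ f z) (hg : DifferentiableAt ℝ g z) (v : V) :
    fderiv ℝ (fun w => f w * g w) z v = f z * fderiv ℝ g z v + fderiv ℝ f z v * g z := by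
  have h := ((ExtConj.mulB E).isBoundedBilinearMap.hasFDerivAt (f z, g z)).comp z
    (hf.hasFDerivAt.prodMk hg.hasFDerivAt)
  have h2 : HasFDerivAt (fun w => f w * g w) _ z := h
  rw [h2.fderiv]
  rfl

/-- The sign comes from moving the covectors `P*dz̄ⱼ` past `a`, which has degree `p`. -/
theorem wedgeDeriv_mul (P : E →L[ℂ] E) {D D' D'' : E →L[ℝ] ExtConj E} {a b : ExtConj E} {p : ℕ}
    (ha : a ∈ ExtConj.gr E p) (h : ∀ v, D'' v = a * D' v + D v * b) :
    wedgeDeriv P D'' = wedgeDeriv P D * b + ((-1 : ℂ) ^ p) • (a * wedgeDeriv P D') := by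
  have h1 : ∀ v, conjPart D'' v = a * conjPart D' v + conjPart D v * b := by
    intro v
    simp only [conjPart, h, mul_smul_comm, smul_mul_assoc, mul_add, add_mul, smul_add]
    abel
  simp only [wedgeDeriv, h1, mul_add, Finset.sum_add_distrib, Finset.sum_mul, Finset.mul_sum,
    Finset.smul_sum]
  rw [add_comm]
  congr 1
  · exact Finset.sum_congr rfl fun j _ => (mul_assoc _ _ _).symm
  · refine Finset.sum_congr rfl fun j _ => ?_
    rw [← mul_assoc, ExtConj.ι_mul_of_mem _ ha, smul_mul_assoc, mul_assoc]

/-- The projection to degree `q` is linear and fixes `f`, hence fixes its derivative. -/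
theorem fderiv_mem_gr {V : Type*} [NormedAddCommGroup V] [NormedSpace ℝ V] {f : V → ExtConj E}
    {z : V} {q : ℕ} (hf : DifferentiableAt ℝ f z) (h : ∀ w, f w ∈ ExtConj.gr E q) (v : V) :
    fderiv ℝ f z v ∈ ExtConj.gr E q := by
  have h1 : HasFDerivAt (fun w => (ExtConj.proj E q).restrictScalars ℝ (f w)) _ z :=
    ((ExtConj.proj E q).restrictScalars ℝ).hasFDerivAt.comp z hf.hasFDerivAt
  have h2 : (fun w => (ExtConj.proj E q).restrictScalars ℝ (f w)) = f :=
    funext fun w => ExtConj.proj_of_mem (h w)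
  rw [h2] at h1
  rw [h1.fderiv]
  exact ExtConj.proj_mem q _

theorem wedgeDeriv_mem_gr (P : E →L[ℂ] E) {D : E →L[ℝ] ExtConj E} {q : ℕ}
    (h : ∀ v, D v ∈ ExtConj.gr E q) : wedgeDeriv P D ∈ ExtConj.gr E (q + 1) :=
  Submodule.sum_mem _ fun _ _ => ExtConj.ι_mul_mem_gr _
    (Submodule.smul_mem _ _ (add_mem (h _) (Submodule.smul_mem _ _ (h _))))

/-- Here `S` stands for a second derivative. The double sum pairs the array of second derivatives
`∂²/∂z̄ₖ∂z̄ⱼ`, symmetric in its indices, with the antisymmetric products of covectors, so it equals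
its own negative. -/
theorem wedgeDeriv_wedgeDeriv {S : E →L[ℝ] E →L[ℝ] ExtConj E} (hS : ∀ v w, S v w = S w v)
    {D : E →L[ℝ] ExtConj E}
    (hD : ∀ v, D v = wedgeDeriv (ContinuousLinearMap.id ℂ E) (S v)) :
    wedgeDeriv (ContinuousLinearMap.id ℂ E) D = 0 := by
  let b := Module.finBasis ℂ E
  let T : E → E → ExtConj E := fun v w =>
    (2⁻¹ : ℂ) • (conjPart (S v) w + Complex.I • conjPart (S (Complex.I • v)) w)
  have hT : ∀ v w, T v w = T w v := by
    intro v w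
    simp only [T, conjPart, hS w, hS (Complex.I • w), smul_add, smul_smul]
    module
  have h1 : ∀ v, conjPart D v = ∑ j, ExtConj.ι (dzbar j) * T v (b j) := by
    intro v
    simp only [conjPart, hD, wedgeDeriv_eq, T, mul_smul_comm, mul_add, Finset.smul_sum,
      Finset.sum_add_distrib, smul_add]
    rfl
  have h2 : wedgeDeriv (ContinuousLinearMap.id ℂ E) D =
      ∑ k, ∑ j, ExtConj.ι (dzbar k) * (ExtConj.ι (dzbar j) * T (b k) (b j)) := by
    rw [wedgeDeriv_eq]
    exact Finset.sum_congr rfl fun k _ => by rw [h1, Finset.mul_sum]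
  have h3 : wedgeDeriv (ContinuousLinearMap.id ℂ E) D =
      -wedgeDeriv (ContinuousLinearMap.id ℂ E) D := by
    conv_lhs => rw [h2, Finset.sum_comm]
    rw [h2, ← Finset.sum_neg_distrib]
    refine Finset.sum_congr rfl fun k _ => ?_
    rw [← Finset.sum_neg_distrib]
    refine Finset.sum_congr rfl fun j _ => ?_
    rw [← mul_assoc, ← mul_assoc, ExtConj.ι_mul_ι (dzbar j), neg_mul, hT]
  have h4 := add_eq_zero_iff_eq_neg.2 h3
  rw [← two_smul ℂ] at h4
  exact (smul_eq_zero.1 h4).resolve_left two_ne_zero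

end ExtGrading

/-! ### The Dolbeault algebra -/

section Manifold

variable {E : Type*} [NormedAddCommGroup E] [NormedSpace ℂ E] [FiniteDimensional ℂ E]
  {H : Type*} [TopologicalSpace H] {I : ModelWithCorners ℂ E H} [I.Boundaryless]
  {X : Type*} [TopologicalSpace X] [ChartedSpace H X] [IsManifold I ω X]

namespace DForm

theorem ext {η η' : DForm I X} (h : ∀ x, η x = η' x) : η = η' := Subtype.ext (funext h)

theorem coe_add (η η' : DForm I X) (x : X) : (η + η') x = η x + η' x := rfl
theorem coe_smul (c : ℂ) (η : DForm I X) (x : X) : (c • η) x = c • η x := rfl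
theorem coe_mul (η η' : DForm I X) (x : X) : (η * η') x = η x * η' x := rfl
theorem coe_one (x : X) : (1 : DForm I X) x = 1 := rfl

/-- The evaluation at a point. -/
def evalL (x : X) : DForm I X →ₗ[ℂ] ExtConj E where
  toFun η := η x
  map_add' _ _ := rfl
  map_smul' _ _ := rfl

theorem coe_sum {ι : Type*} (s : Finset ι) (f : ι → DForm I X) (x : X) :
    (∑ i ∈ s, f i) x = ∑ i ∈ s, f i x := map_sum (evalL x) f s

theorem dbar_apply (η : DForm I X) (x : X) : (dbar I X η) x =
    wedgeDeriv (ContinuousLinearMap.id ℂ E) (fderiv ℝ (inChart I η x) (extChartAt I x x)) := rfl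

theorem inChart_mem_gr {η : DForm I X} {q : ℕ} (h : η ∈ DForm.gr I q) (x₀ : X) (z : E) :
    inChart I η x₀ z ∈ ExtConj.gr E q := ExtConj.pull_mem_gr _ (h _)

theorem dbar_mem {η : DForm I X} {q : ℕ} (h : η ∈ DForm.gr I q) :
    dbar I X η ∈ DForm.gr I (q + 1) := fun x =>
  wedgeDeriv_mem_gr _ (fderiv_mem_gr (hasFDerivAt_inChart I η x) (inChart_mem_gr h x))

theorem dbar_mul {η : DForm I X} {p : ℕ} (η' : DForm I X) (h : η ∈ DForm.gr I p) :
    dbar I X (η * η') = dbar I X η * η' + ((-1 : ℂ) ^ p) • (η * dbar I X η') := by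
  refine ext fun x => ?_
  rw [coe_add, coe_smul, coe_mul, coe_mul, dbar_apply, dbar_apply, dbar_apply]
  refine wedgeDeriv_mul _ (h x) fun v => ?_
  have h1 : inChart I (η * η').1 x = fun z => inChart I η x z * inChart I η' x z :=
    funext fun z => inChart_mul η.1 η'.1 x z
  have h2 := fderiv_mul_form (hasFDerivAt_inChart I η x) (hasFDerivAt_inChart I η' x) v
  rw [inChart_self, inChart_self] at h2
  exact (congrArg (fun f => fderiv ℝ f _ v) h1).trans h2

theorem dbar_dbar (η : DForm I X) : dbar I X (dbar I X η) = 0 := by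
  refine ext fun x => ?_
  rw [dbar_apply]
  set z := extChartAt I x x with hz
  have hf : ContDiffAt ℝ ∞ (inChart I η x) z := η.contDiffAt x (mem_extChartAt_target x)
  have hs : IsSymmSndFDerivAt ℝ (inChart I η x) z :=
    hf.isSymmSndFDerivAt (by
      rw [minSmoothness_of_isRCLikeNormedField]; exact WithTop.coe_le_coe.2 le_top)
  refine wedgeDeriv_wedgeDeriv (S := fderiv ℝ (fderiv ℝ (inChart I η x)) z) hs.eq fun v => ?_
  -- By definition `∂̄η` is computed at each point in that point's own chart. Near `x` it agrees
  -- with the expression in the single chart at `x`, which can be differentiated once more.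
  have hev : inChart I (dbar I X η) x =ᶠ[𝓝 z] fun w =>
      wedgeDerivL (ContinuousLinearMap.id ℂ E) (fderiv ℝ (inChart I η x) w) := by
    filter_upwards [(isOpen_extChartAt_target x).mem_nhds (mem_extChartAt_target x)] with w hw
    exact inChart_dbar η.2 x hw
  have hd : HasFDerivAt (fderiv ℝ (inChart I η x)) (fderiv ℝ (fderiv ℝ (inChart I η x)) z) z :=
    ((hf.fderiv_right (m := 1) (by rw [one_add_one_eq_two]; exact WithTop.coe_le_coe.2 le_top)).differentiableAt (by norm_num)).hasFDerivAt
  rw [hev.fderiv_eq]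
  have := ((wedgeDerivL (ContinuousLinearMap.id ℂ E)).hasFDerivAt.comp z hd).fderiv
  exact congrArg (fun D : E →L[ℝ] ExtConj E => D v) this

variable (I X) in
/-- The projection to the forms of type `(0,q)`. -/
def proj (q : ℕ) : DForm I X →ₗ[ℂ] DForm I X where
  toFun η := ⟨fun x => ExtConj.proj E q (η x), fun x₀ => by
    refine (((ExtConj.proj E q).restrictScalars ℝ).contDiff.comp_contDiffOn (η.2 x₀)).congr
      fun z _ => ?_
    exact ExtConj.pull_proj _ _ _⟩
  map_add' _ _ := Subtype.ext (funext fun _ => map_add (ExtConj.proj E q) _ _)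
  map_smul' c _ := Subtype.ext (funext fun _ => map_smul (ExtConj.proj E q) c _)

theorem proj_apply (q : ℕ) (η : DForm I X) (x : X) : (proj I X q η) x = ExtConj.proj E q (η x) :=
  rfl

theorem gr_eq_bot {q : ℕ} (h : ExtConj.degBound E ≤ q) : DForm.gr I q = (⊥ : Submodule ℂ (DForm I X)) := by
  refine eq_bot_iff.2 fun η hη => (Submodule.mem_bot ℂ).2 (ext fun x => ?_)
  have := hη x
  rwa [ExtConj.gr_eq_bot h, Submodule.mem_bot] at this

theorem isInternal_gr : DirectSum.IsInternal (DForm.gr I (X := X)) :=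
  isInternal_of_projections _ (proj I X) (Finset.range (ExtConj.degBound E))
    (fun q η x => ExtConj.proj_mem q (η x))
    (fun q η h => ext fun x => ExtConj.proj_of_mem (h x))
    (fun p q hpq η h => ext fun x => ExtConj.proj_of_ne hpq (h x))
    (fun η => ext fun x => by
      rw [coe_sum]
      exact ExtConj.sum_proj (η x))

theorem isClosed_gr (q : ℕ) : IsClosed ((DForm.gr I q : Submodule ℂ (DForm I X)) : Set (DForm I X)) := by
  have : ((DForm.gr I q : Submodule ℂ (DForm I X)) : Set (DForm I X)) = ⋂ x, (fun η : DForm I X => η x) ⁻¹' ExtConj.gr E q := by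
    ext η
    simp only [mem_iInter]
    rfl
  rw [this]
  exact isClosed_iInter fun x => (Submodule.closed_of_finiteDimensional _).preimage
    (continuous_eval x)

theorem continuous_const_mul (a : ExtConj E) : Continuous fun b : ExtConj E => a * b :=
  (LinearMap.mulLeft ℂ a).continuous_of_finiteDimensional

theorem continuous_mul_const (a : ExtConj E) : Continuous fun b : ExtConj E => b * a :=
  (LinearMap.mulRight ℂ a).continuous_of_finiteDimensional

variable [SecondCountableTopology X]

/-- Separate continuity suffices in Fréchet spaces, and that is tested by evaluation at points. -/
theorem continuous_mul : Continuous fun p : DForm I X × DForm I X => p.1 * p.2 :=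
  FrechetSpace.continuous_of_separately (LinearMap.mul ℂ (DForm I X))
    (fun a => continuous_of_eval _ fun x => (continuous_const_mul (a x)).comp (continuous_eval x))
    (fun b => continuous_of_eval ((LinearMap.mul ℂ (DForm I X)).flip b) fun x =>
      (continuous_mul_const (b x)).comp (continuous_eval x))

theorem continuous_wedgeDeriv (P : E →L[ℂ] E) (x : X) : Continuous fun η : DForm I X =>
    wedgeDeriv P (fderiv ℝ (inChart I η x) (extChartAt I x x)) := by
  have h : ∀ v : E, Continuous fun η : DForm I X =>
      fderiv ℝ (inChart I η x) (extChartAt I x x) v :=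
    continuous_fderiv x (mem_extChartAt_target x)
  refine continuous_finsetSum _ fun j _ => (continuous_const_mul _).comp ?_
  exact ((h _).add ((h _).const_smul Complex.I)).const_smul (2⁻¹ : ℂ)

theorem continuous_dbar : Continuous (dbar I X) :=
  continuous_of_eval (dbar I X) fun x => continuous_wedgeDeriv _ x

end DForm

theorem isCurvedDGA_dolbeault [SecondCountableTopology X] : IsCurvedDGA (dolbeault I X) where
  frechet := FrechetSpace.isFrechet (DForm I X)
  continuous_mul := DForm.continuous_mul
  continuous_d := DForm.continuous_dbar
  one_mem := fun _ => ExtConj.one_mem_gr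
  mul_mem h h' := fun x => ExtConj.mul_mem_gr (h x) (h' x)
  internal := DForm.isInternal_gr
  isClosed_gr := DForm.isClosed_gr
  d_mem h := DForm.dbar_mem h
  leibniz b h := DForm.dbar_mul b h
  d_d a := by
    have h : ∀ a : DForm I X, dbar I X (dbar I X a) = 0 * a - a * 0 := fun a => by
      rw [DForm.dbar_dbar, zero_mul, mul_zero, sub_zero]
    exact h a
  curv_mem := Submodule.zero_mem _
  d_curv := map_zero (dbar I X)

end Manifold

attribute [local instance] FiniteDimensional.complexToReal

open Filter

/-! ### The exterior algebra of a product -/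

namespace ExtConj

variable {E F : Type*} [NormedAddCommGroup E] [NormedSpace ℂ E] [FiniteDimensional ℂ E]
  [NormedAddCommGroup F] [NormedSpace ℂ F] [FiniteDimensional ℂ F]

theorem finrank_eq : Module.finrank ℂ (ExtConj E) = 2 ^ Module.finrank ℂ (ConjDual E) := by
  have h := Module.finrank_eq_card_basis (Module.finBasis ℂ (ConjDual E)).ExteriorAlgebra
  rw [Fintype.card_finset, Fintype.card_fin] at h
  exact h

variable (E F) in
/-- The conjugate dual of a product. -/
def conjDualProd : ConjDual (E × F) ≃ₗ[ℂ] ConjDual E × ConjDual F where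
  toFun α := (pullConj (ContinuousLinearMap.inl ℂ E F) α, pullConj (ContinuousLinearMap.inr ℂ E F) α)
  map_add' _ _ := rfl
  map_smul' _ _ := rfl
  invFun α := pullConj (ContinuousLinearMap.fst ℂ E F) α.1 +
    pullConj (ContinuousLinearMap.snd ℂ E F) α.2
  left_inv α := LinearMap.ext fun v => by
    show α (v.1, 0) + α (0, v.2) = α v
    rw [← map_add, Prod.mk_add_mk, add_zero, zero_add]
  right_inv α := by
    refine Prod.ext (LinearMap.ext fun v => ?_) (LinearMap.ext fun v => ?_)
    · show α.1 v + α.2 0 = α.1 v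
      rw [map_zero, add_zero]
    · show α.1 0 + α.2 v = α.2 v
      rw [map_zero, zero_add]

variable (E F) in
/-- The map `α ⊗ β ↦ p₁*α ∧ p₂*β`. -/
def mulProd : ExtConj E ⊗[ℂ] ExtConj F →ₗ[ℂ] ExtConj (E × F) :=
  TensorProduct.lift ((LinearMap.mul ℂ (ExtConj (E × F))).compl₁₂
    (pull (ContinuousLinearMap.fst ℂ E F)).toLinearMap
    (pull (ContinuousLinearMap.snd ℂ E F)).toLinearMap)

theorem mulProd_tmul (α : ExtConj E) (β : ExtConj F) : mulProd E F (α ⊗ₜ β) =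
    pull (ContinuousLinearMap.fst ℂ E F) α * pull (ContinuousLinearMap.snd ℂ E F) β := rfl

/-- Moving `p₂*β` past `p₁*x` changes `x` only by signs, degree by degree; the existence of some `y`
is all that is needed. -/
theorem exists_ι_snd_mul (β : ConjDual F) (x : ExtConj E) : ∃ y : ExtConj E,
    pull (ContinuousLinearMap.snd ℂ E F) (ExtConj.ι β) * pull (ContinuousLinearMap.fst ℂ E F) x =
      pull (ContinuousLinearMap.fst ℂ E F) y *
        pull (ContinuousLinearMap.snd ℂ E F) (ExtConj.ι β) := by
  induction x using ExtConj.induction with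
  | h0 c =>
    refine ⟨algebraMap ℂ _ c, ?_⟩
    rw [AlgHom.commutes]
    exact (Algebra.commutes _ _).symm
  | hadd x y hx hy =>
    obtain ⟨x', hx⟩ := hx
    obtain ⟨y', hy⟩ := hy
    exact ⟨x' + y', by rw [map_add, mul_add, hx, hy, map_add, add_mul]⟩
  | hι x α hx =>
    obtain ⟨x', hx⟩ := hx
    refine ⟨-(ExtConj.ι α * x'), ?_⟩
    rw [map_mul, ← mul_assoc, pull_ι, pull_ι, ι_mul_ι, map_neg, map_mul, neg_mul, neg_mul,
      mul_assoc, mul_assoc, pull_ι, ← pull_ι (ContinuousLinearMap.snd ℂ E F), hx]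

/-- The range contains the scalars and is stable under left multiplication by covectors: a covector
of the product splits into parts pulled back from the two factors, and the second part can be moved
past `p₁*a`. -/
theorem mulProd_surjective : Function.Surjective (mulProd E F) := by
  intro x
  rw [← LinearMap.mem_range]
  induction x using ExtConj.induction with
  | h0 c =>
    refine ⟨algebraMap ℂ _ c ⊗ₜ 1, ?_⟩
    rw [mulProd_tmul, map_one, mul_one, AlgHom.commutes]
  | hadd x y hx hy => exact add_mem hx hy
  | hι x α hx =>
    obtain ⟨t, rfl⟩ := hx
    induction t using TensorProduct.induction_on with
    | zero => rw [map_zero, mul_zero]; exact zero_mem _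
    | add s t hs ht => rw [map_add, mul_add]; exact add_mem hs ht
    | tmul a b =>
      obtain ⟨a', ha⟩ := exists_ι_snd_mul (pullConj (ContinuousLinearMap.inr ℂ E F) α) a
      have h : ExtConj.ι α = pull (ContinuousLinearMap.fst ℂ E F)
          (ExtConj.ι (pullConj (ContinuousLinearMap.inl ℂ E F) α)) +
          pull (ContinuousLinearMap.snd ℂ E F)
          (ExtConj.ι (pullConj (ContinuousLinearMap.inr ℂ E F) α)) := by
        rw [pull_ι, pull_ι, ← map_add]
        exact congrArg ExtConj.ι ((conjDualProd E F).left_inv α).symm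
      rw [mulProd_tmul, h, add_mul, ← mul_assoc, ← mul_assoc, ← map_mul, ha, mul_assoc, ← map_mul]
      exact add_mem ⟨_ ⊗ₜ _, mulProd_tmul _ _⟩ ⟨_ ⊗ₜ _, mulProd_tmul _ _⟩

/-- Exterior algebras have dimension `2` to the dimension of the space of covectors, and covectors
of a product form a direct sum. The dimensions agree, so surjectivity suffices. -/
theorem mulProd_bijective : Function.Bijective (mulProd E F) := by
  refine ⟨(LinearMap.injective_iff_surjective_of_finrank_eq_finrank ?_).2 mulProd_surjective,
    mulProd_surjective⟩
  rw [Module.finrank_tensorProduct, finrank_eq, finrank_eq, finrank_eq,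
    (conjDualProd E F).finrank_eq, Module.finrank_prod, pow_add]

variable (E F) in
/-- The isomorphism `α ⊗ β ↦ p₁*α ∧ p₂*β`. -/
def prodEquiv : ExtConj E ⊗[ℂ] ExtConj F ≃ₗ[ℂ] ExtConj (E × F) :=
  LinearEquiv.ofBijective (mulProd E F) mulProd_bijective

/-- The contraction of the second factor with a functional. -/
def coeff (β : ExtConj F →ₗ[ℂ] ℂ) : ExtConj (E × F) →ₗ[ℂ] ExtConj E :=
  (TensorProduct.rid ℂ (ExtConj E)).toLinearMap ∘ₗ β.lTensor (ExtConj E) ∘ₗ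
    (prodEquiv E F).symm.toLinearMap

theorem coeff_mul (β : ExtConj F →ₗ[ℂ] ℂ) (x : ExtConj E) (y : ExtConj F) :
    coeff β (pull (ContinuousLinearMap.fst ℂ E F) x * pull (ContinuousLinearMap.snd ℂ E F) y) =
      β y • x := by
  have h : (prodEquiv E F).symm (pull (ContinuousLinearMap.fst ℂ E F) x *
      pull (ContinuousLinearMap.snd ℂ E F) y) = x ⊗ₜ y :=
    (prodEquiv E F).symm_apply_apply (x ⊗ₜ y)
  simp only [coeff, LinearMap.comp_apply, LinearEquiv.coe_coe, h, LinearMap.lTensor_tmul,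
    TensorProduct.rid_tmul]

theorem prod_induction {p : ExtConj (E × F) → Prop} (hadd : ∀ x y, p x → p y → p (x + y))
    (hmul : ∀ x y, p (pull (ContinuousLinearMap.fst ℂ E F) x *
      pull (ContinuousLinearMap.snd ℂ E F) y)) (x : ExtConj (E × F)) : p x := by
  obtain ⟨t, rfl⟩ := mulProd_surjective x
  induction t using TensorProduct.induction_on with
  | zero => simpa using hmul 0 0
  | add s t hs ht => rw [map_add]; exact hadd _ _ hs ht
  | tmul a b => exact hmul a b

theorem sum_coeff {ι : Type*} [Fintype ι] (b : Module.Basis ι ℂ (ExtConj F)) (x : ExtConj (E × F)) :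
    ∑ j, pull (ContinuousLinearMap.fst ℂ E F) (coeff (b.coord j) x) *
      pull (ContinuousLinearMap.snd ℂ E F) (b j) = x := by
  induction x using prod_induction with
  | hadd x y hx hy =>
    simp only [map_add, add_mul, Finset.sum_add_distrib, hx, hy]
  | hmul x y =>
    simp only [coeff_mul, map_smul, smul_mul_assoc, ← mul_smul_comm, ← Finset.mul_sum]
    simp only [← map_smul, ← map_sum, Module.Basis.coord_apply, b.sum_repr]

theorem pull_prodMap_fst {E' F' : Type*} [NormedAddCommGroup E'] [NormedSpace ℂ E']
    [FiniteDimensional ℂ E'] [NormedAddCommGroup F'] [NormedSpace ℂ F'] [FiniteDimensional ℂ F']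
    (A : E →L[ℂ] E') (B : F →L[ℂ] F') (x : ExtConj E') :
    pull (A.prodMap B) (pull (ContinuousLinearMap.fst ℂ E' F') x) =
      pull (ContinuousLinearMap.fst ℂ E F) (pull A x) := by
  rw [pull_comp, pull_comp]; rfl

theorem pull_prodMap_snd {E' F' : Type*} [NormedAddCommGroup E'] [NormedSpace ℂ E']
    [FiniteDimensional ℂ E'] [NormedAddCommGroup F'] [NormedSpace ℂ F'] [FiniteDimensional ℂ F']
    (A : E →L[ℂ] E') (B : F →L[ℂ] F') (x : ExtConj F') :
    pull (A.prodMap B) (pull (ContinuousLinearMap.snd ℂ E' F') x) =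
      pull (ContinuousLinearMap.snd ℂ E F) (pull B x) := by
  rw [pull_comp, pull_comp]; rfl

theorem coeff_pull (β : ExtConj F →ₗ[ℂ] ℂ) {E' : Type*} [NormedAddCommGroup E']
    [NormedSpace ℂ E'] [FiniteDimensional ℂ E'] (A : E →L[ℂ] E') (x : ExtConj (E' × F)) :
    coeff β (pull (A.prodMap (ContinuousLinearMap.id ℂ F)) x) = pull A (coeff β x) := by
  induction x using prod_induction with
  | hadd x y hx hy => simp only [map_add, hx, hy]
  | hmul x y =>
    rw [map_mul, pull_prodMap_fst, pull_prodMap_snd, pull_id, coeff_mul, coeff_mul, map_smul]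

theorem pull_inl_fst (x : ExtConj E) :
    pull (ContinuousLinearMap.inl ℂ E F) (pull (ContinuousLinearMap.fst ℂ E F) x) = x := by
  rw [pull_comp, ContinuousLinearMap.fst_comp_inl, pull_id]

end ExtConj

attribute [local instance] FiniteDimensional.complexToReal

open Filter

/-! ### Partitions subordinate to charts -/

section Manifold

variable {E : Type*} [NormedAddCommGroup E] [NormedSpace ℂ E] [FiniteDimensional ℂ E]
  {H : Type*} [TopologicalSpace H] (I : ModelWithCorners ℂ E H) [I.Boundaryless]
  (X : Type u) [TopologicalSpace X] [ChartedSpace H X]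

/-- A locally finite family of smooth functions `wt i`, `cut i` with compact supports in charts,
such that the products `wt i * cut i` form a partition of unity. All functions are given
in the charts. -/
structure ChartPartition where
  ι : Type u
  countable : Countable ι
  c : ι → X
  K : ι → Set E
  isCompact : ∀ i, IsCompact (K i)
  subset : ∀ i, K i ⊆ (extChartAt I (c i)).target
  locallyFinite : LocallyFinite fun i => (extChartAt I (c i)).symm '' K i
  cut : ι → E → ℂ
  wt : ι → E → ℂ
  contDiff_cut : ∀ i, ContDiff ℝ ∞ (cut i)
  contDiff_wt : ∀ i, ContDiff ℝ ∞ (wt i)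
  cut_zero : ∀ i, ∀ z ∉ K i, cut i z = 0
  wt_zero : ∀ i, ∀ z ∉ K i, wt i z = 0
  sum_eq_one : ∀ x, ∑ i ∈ (locallyFinite.point_finite x).toFinset,
    wt i (extChartAt I (c i) x) * cut i (extChartAt I (c i) x) = 1

/-- The underlying real model. -/
def realModel : ModelWithCorners ℝ E H :=
  ModelWithCorners.ofTargetUniv ℝ I.toPartialEquiv I.source_eq
    (I.range_eq_target.symm.trans I.range_eq_univ) I.continuous I.continuous_symm

/-- Bump functions belong to the underlying real model, whereas smoothness is measured in
holomorphic charts. Within the chart domain of the bump one composes with the chart change, which is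
real smooth. Elsewhere the function vanishes nearby, since its closed support lies in that domain.
-/
theorem contDiffAt_bump [IsManifold I ω X] [T2Space X] {c : X}
    (f : SmoothBumpFunction (realModel I) c) (x₀ : X) {z : E}
    (hz : z ∈ (extChartAt I x₀).target) :
    ContDiffAt ℝ ∞ (fun w => f ((extChartAt I x₀).symm w)) z := by
  by_cases hs : (extChartAt I x₀).symm z ∈ (extChartAt I c).source
  · have hφ : ContDiffAt ℝ ∞ (extChartAt I c ∘ (extChartAt I x₀).symm) z :=
      ((contDiffAt_change_omega x₀ c hz hs).restrict_scalars ℝ).of_le le_top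
    refine (f.toContDiffBump.contDiffAt.comp z hφ).congr_of_eventuallyEq ?_
    filter_upwards [eventually_mem_source x₀ c hz hs] with w hw
    rw [extChartAt_source] at hw
    exact f.eqOn_source hw.2
  · have h0 : (extChartAt I x₀).symm z ∉ tsupport f := fun h =>
      hs (f.tsupport_subset_extChartAt_source h)
    refine (contDiffAt_const (c := (0 : ℝ))).congr_of_eventuallyEq ?_
    filter_upwards [(continuousAt_extChartAt_symm'' hz).eventually
      ((isClosed_tsupport f).isOpen_compl.mem_nhds h0)] with w hw
    exact image_eq_zero_of_notMem_tsupport hw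

-- From a covering by bump functions `fᵢ` one takes `cutᵢ = fᵢ` and `wtᵢ = fᵢ / S` with `S = ∑ fᵢ²`.
-- Two compactly supported factors are wanted: one localises the coefficients of a form and the
-- other the local generators, and each has to extend by zero on its own.
open Classical in
theorem exists_chartPartition [IsManifold I ω X] [T2Space X] [SecondCountableTopology X] :
    Nonempty (ChartPartition I X) := by
  have : LocallyCompactSpace H := I.locallyCompactSpace
  have : LocallyCompactSpace X := ChartedSpace.locallyCompactSpace H X
  obtain ⟨ι, fs, -⟩ := SmoothBumpCovering.exists_isSubordinate (realModel I) (s := (univ : Set X))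
    (U := fun _ => univ) isClosed_univ (fun _ _ => univ_mem)
  let K : ι → Set E := fun i => extChartAt I (fs.c i) '' tsupport (fs i)
  have hsub : ∀ i, tsupport (fs i) ⊆ (extChartAt I (fs.c i)).source := fun i =>
    (fs i).tsupport_subset_extChartAt_source
  have hK : ∀ i, IsCompact (K i) := fun i =>
    (fs i).hasCompactSupport.isCompact.image_of_continuousOn
      ((continuousOn_extChartAt _).mono (hsub i))
  have hKt : ∀ i, K i ⊆ (extChartAt I (fs.c i)).target := by
    rintro i _ ⟨x, hx, rfl⟩
    exact (extChartAt I (fs.c i)).map_source (hsub i hx)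
  have hKs : ∀ i, (extChartAt I (fs.c i)).symm '' K i = tsupport (fs i) := fun i =>
    (extChartAt I (fs.c i)).symm_image_image_of_subset_source (hsub i)
  have hlf : LocallyFinite fun i => (extChartAt I (fs.c i)).symm '' K i := by
    simp only [hKs]
    exact fs.locallyFinite.closure
  let S : X → ℝ := fun x => ∑ i ∈ (hlf.point_finite x).toFinset, fs i x ^ 2
  have hmem : ∀ i x, i ∈ (hlf.point_finite x).toFinset ↔ x ∈ tsupport (fs i) := fun i x => by
    rw [Finite.mem_toFinset, mem_ofPred_eq, hKs]
  have hSpos : ∀ x, 0 < S x := fun x => by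
    obtain ⟨i, hi⟩ : ∃ i, fs i =ᶠ[𝓝 x] 1 := fs.eventuallyEq_one' x (mem_univ x)
    have h1 : fs i x = 1 := hi.eq_of_nhds
    have h2 : i ∈ (hlf.point_finite x).toFinset := by
      rw [hmem]
      exact subset_tsupport _ (by rw [Function.mem_support, h1]; exact one_ne_zero)
    refine Finset.sum_pos' (fun j _ => sq_nonneg _) ⟨i, h2, ?_⟩
    rw [h1]; norm_num
  -- By local finiteness `S` is, near each point, a fixed finite sum of squares of bump functions.
  have hSsm : ∀ (x₀ : X) (z : E), z ∈ (extChartAt I x₀).target →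
      ContDiffAt ℝ ∞ (fun w => S ((extChartAt I x₀).symm w)) z := by
    intro x₀ z hz
    obtain ⟨t, ht, hfin⟩ := hlf ((extChartAt I x₀).symm z)
    have h1 : ContDiffAt ℝ ∞
        (fun w => ∑ i ∈ hfin.toFinset, fs i ((extChartAt I x₀).symm w) ^ 2) z :=
      ContDiffAt.sum fun i _ => (contDiffAt_bump I X (fs i) x₀ hz).pow 2
    refine h1.congr_of_eventuallyEq ?_
    filter_upwards [(continuousAt_extChartAt_symm'' hz).eventually ht] with w hw
    refine Finset.sum_subset (fun i hi => ?_) fun i _ hi => ?_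
    · rw [Finite.mem_toFinset] at hi ⊢
      exact ⟨_, hi, hw⟩
    · rw [hmem] at hi
      rw [image_eq_zero_of_notMem_tsupport hi]; norm_num
  have hb : ∀ i, ∀ z ∈ (extChartAt I (fs.c i)).target,
      fs i ((extChartAt I (fs.c i)).symm z) = (fs i).toContDiffBump z := fun i z hz => by
    have h1 := (extChartAt I (fs.c i)).map_target hz
    rw [extChartAt_source] at h1
    have h2 := (fs i).eqOn_source h1
    exact h2.trans (congrArg (fs i).toContDiffBump ((extChartAt I (fs.c i)).right_inv hz))
  -- The support of the bump in coordinates is a ball contained in the chart, so it lies in the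
  -- image `K i` of the closed support on `X`.
  have hb0 : ∀ i, ∀ z ∉ K i, (fs i).toContDiffBump z = 0 := by
    intro i z hz
    by_contra hne
    have h1 : z ∈ Metric.ball (extChartAt I (fs.c i) (fs.c i)) (fs i).rOut := 
      (fs i).toContDiffBump.support_eq.le hne
    have h2 : z ∈ (extChartAt I (fs.c i)).target :=
      (fs i).closedBall_subset ⟨Metric.ball_subset_closedBall h1, by
        show z ∈ range I
        rw [I.range_eq_univ]; trivial⟩
    rw [← hb i z h2] at hne
    exact hz ⟨_, subset_tsupport _ hne, (extChartAt I (fs.c i)).right_inv h2⟩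
  have hcount : Countable ι := by
    have h := fs.locallyFinite.countable_univ fun i => ⟨fs.c i, by
      rw [Function.mem_support, (fs i).eq_one]; exact one_ne_zero⟩
    exact countable_univ_iff.1 h
  refine ⟨{
    ι := ι
    countable := hcount
    c := fs.c
    K := K
    isCompact := hK
    subset := hKt
    locallyFinite := hlf
    cut := fun i z => ((fs i).toContDiffBump z : ℂ)
    wt := fun i => (extChartAt I (fs.c i)).target.indicator fun z =>
      (((fs i).toContDiffBump z / S ((extChartAt I (fs.c i)).symm z) : ℝ) : ℂ)
    contDiff_cut := fun i => Complex.ofRealCLM.contDiff.comp (fs i).toContDiffBump.contDiff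
    contDiff_wt := fun i => ?_
    cut_zero := fun i z hz => by rw [hb0 i z hz, Complex.ofReal_zero]
    wt_zero := fun i z hz => ?_
    sum_eq_one := fun x => ?_ }⟩
  · rw [contDiff_iff_contDiffAt]
    intro z
    by_cases hz : z ∈ (extChartAt I (fs.c i)).target
    · refine (Complex.ofRealCLM.contDiff.contDiffAt.comp z
        ((fs i).toContDiffBump.contDiffAt.div (hSsm (fs.c i) z hz)
          (hSpos _).ne')).congr_of_eventuallyEq ?_
      filter_upwards [(isOpen_extChartAt_target (I := I) (fs.c i)).mem_nhds hz] with w hw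
      exact indicator_of_mem hw _
    · refine (contDiffAt_const (c := (0 : ℂ))).congr_of_eventuallyEq ?_
      filter_upwards [(hK i).isClosed.isOpen_compl.mem_nhds fun h => hz (hKt i h)] with w hw
      rw [indicator_apply]
      split_ifs
      · rw [hb0 i w hw, zero_div, Complex.ofReal_zero]
      · rfl
  · rw [indicator_apply]
    split_ifs
    · rw [hb0 i z hz, zero_div, Complex.ofReal_zero]
    · rfl
  · have h1 : ∀ i ∈ (hlf.point_finite x).toFinset,
        (extChartAt I (fs.c i)).target.indicator (fun z =>
          (((fs i).toContDiffBump z / S ((extChartAt I (fs.c i)).symm z) : ℝ) : ℂ))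
          (extChartAt I (fs.c i) x) * ((fs i).toContDiffBump (extChartAt I (fs.c i) x) : ℂ) =
        ((fs i x ^ 2 / S x : ℝ) : ℂ) := by
      intro i hi
      rw [hmem] at hi
      have hs := hsub i hi
      have ht := (extChartAt I (fs.c i)).map_source hs
      have := hb i _ ht
      rw [(extChartAt I (fs.c i)).left_inv hs] at this
      rw [indicator_of_mem ht, (extChartAt I (fs.c i)).left_inv hs, ← this, ← Complex.ofReal_mul]
      congr 1
      ring
    rw [Finset.sum_congr rfl h1, ← Complex.ofReal_sum, ← Finset.sum_div, div_self (hSpos x).ne',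
      Complex.ofReal_one]

end Manifold

/-! ### Gluing compactly supported pieces of forms -/

section Operators

variable {E : Type*} [NormedAddCommGroup E] [NormedSpace ℂ E] [FiniteDimensional ℂ E]
  {H : Type*} [TopologicalSpace H] {I : ModelWithCorners ℂ E H} [I.Boundaryless]
  {X : Type u} [TopologicalSpace X] [ChartedSpace H X] [IsManifold I ω X]

theorem pull_tangentCoordChange_cancel (b : ExtConj E) {x c : X}
    (hx : x ∈ (extChartAt I c).source) :
    pull (tangentCoordChange I x c x) (pull (tangentCoordChange I c x x) b) = b := by
  rw [pull_comp]
  have h : (tangentCoordChange I c x x).comp (tangentCoordChange I x c x) =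
      ContinuousLinearMap.id ℂ E := ContinuousLinearMap.ext fun v => by
    rw [ContinuousLinearMap.comp_apply, tangentCoordChange_comp
      ⟨⟨mem_extChartAt_source x, hx⟩, mem_extChartAt_source x⟩]
    exact tangentCoordChange_self (mem_extChartAt_source x)
  rw [h, pull_id]

theorem pull_tangentCoordChange_cancel' (b : ExtConj E) {x c : X}
    (hx : x ∈ (extChartAt I c).source) :
    pull (tangentCoordChange I c x x) (pull (tangentCoordChange I x c x) b) = b := by
  rw [pull_comp]
  have h : (tangentCoordChange I x c x).comp (tangentCoordChange I c x x) =
      ContinuousLinearMap.id ℂ E := ContinuousLinearMap.ext fun v => by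
    rw [ContinuousLinearMap.comp_apply, tangentCoordChange_comp
      ⟨⟨hx, mem_extChartAt_source x⟩, hx⟩]
    exact tangentCoordChange_self hx
  rw [h, pull_id]

/-- A section that vanishes outside of a compact set in a chart is smooth if it is so in
this chart. -/
theorem isSmoothForm_of_compact [T2Space X] {η : X → ExtConj E} {c : X} {K : Set E}
    (hK : IsCompact K) (hKt : K ⊆ (extChartAt I c).target)
    (h0 : ∀ x ∉ (extChartAt I c).symm '' K, η x = 0)
    (h : ∀ z ∈ (extChartAt I c).target, ContDiffAt ℝ ∞ (inChart I η c) z) :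
    IsSmoothForm I η := by
  refine isSmoothForm_of_cover fun x => ?_
  by_cases hx : x ∈ (extChartAt I c).source
  · exact ⟨c, hx, h _ ((extChartAt I c).map_source hx)⟩
  · refine ⟨x, mem_extChartAt_source x, ?_⟩
    have hcl : IsClosed ((extChartAt I c).symm '' K) :=
      (hK.image_of_continuousOn ((continuousOn_extChartAt_symm c).mono hKt)).isClosed
    have hx' : x ∉ (extChartAt I c).symm '' K := by
      rintro ⟨z, hz, rfl⟩
      exact hx ((extChartAt I c).map_target (hKt hz))
    refine (contDiffAt_const (c := (0 : ExtConj E))).congr_of_eventuallyEq ?_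
    have hz := mem_extChartAt_target (I := I) x
    filter_upwards [(continuousAt_extChartAt_symm'' hz).eventually
      (hcl.isOpen_compl.mem_nhds (by rwa [extChartAt_to_inv]))] with w hw
    rw [inChart, h0 _ hw, map_zero]

namespace ChartPartition

variable (P : ChartPartition I X)

/-- The indices of the charts that matter at a point. -/
def idx (x : X) : Finset P.ι := (P.locallyFinite.point_finite x).toFinset

theorem mem_idx {x : X} {i : P.ι} : i ∈ P.idx x ↔ x ∈ (extChartAt I (P.c i)).symm '' P.K i := by
  rw [idx, Finite.mem_toFinset]; rfl

theorem mem_source {x : X} {i : P.ι} (h : i ∈ P.idx x) : x ∈ (extChartAt I (P.c i)).source := by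
  obtain ⟨z, hz, rfl⟩ := P.mem_idx.1 h
  exact (extChartAt I (P.c i)).map_target (P.subset i hz)

theorem notMem_K {x : X} {i : P.ι} (h : i ∉ P.idx x) (hx : x ∈ (extChartAt I (P.c i)).source) :
    extChartAt I (P.c i) x ∉ P.K i := fun hz =>
  h (P.mem_idx.2 ⟨_, hz, (extChartAt I (P.c i)).left_inv hx⟩)

theorem sum_idx (x : X) : ∑ i ∈ P.idx x,
    P.wt i (extChartAt I (P.c i) x) * P.cut i (extChartAt I (P.c i) x) = 1 := P.sum_eq_one x

open Classical in
/-- The section that is the product of `P.cut i` and a form in the chart at `P.c i`. -/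
def glue1 (i : P.ι) (h : E → ExtConj E) (x : X) : ExtConj E :=
  if i ∈ P.idx x then P.cut i (extChartAt I (P.c i) x) •
    pull (tangentCoordChange I x (P.c i) x) (h (extChartAt I (P.c i) x)) else 0

theorem glue1_of_mem {i : P.ι} {x : X} (hi : i ∈ P.idx x) (h : E → ExtConj E) :
    P.glue1 i h x = P.cut i (extChartAt I (P.c i) x) •
      pull (tangentCoordChange I x (P.c i) x) (h (extChartAt I (P.c i) x)) := if_pos hi

theorem glue1_of_notMem {i : P.ι} {x : X} (hi : i ∉ P.idx x) (h : E → ExtConj E) :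
    P.glue1 i h x = 0 := if_neg hi

theorem inChart_glue1 (i : P.ι) (h : E → ExtConj E) {z : E}
    (hz : z ∈ (extChartAt I (P.c i)).target) :
    inChart I (P.glue1 i h) (P.c i) z = P.cut i z • h z := by
  have hs := (extChartAt I (P.c i)).map_target hz
  by_cases hi : i ∈ P.idx ((extChartAt I (P.c i)).symm z)
  · rw [inChart, P.glue1_of_mem hi, map_smul, (extChartAt I (P.c i)).right_inv hz,
      pull_tangentCoordChange_cancel' _ hs]
  · have := P.notMem_K hi hs
    rw [(extChartAt I (P.c i)).right_inv hz] at this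
    rw [inChart, P.glue1_of_notMem hi, map_zero, P.cut_zero i z this, zero_smul]

theorem isSmoothForm_glue1 [T2Space X] (i : P.ι) {h : E → ExtConj E} (hh : ContDiff ℝ ∞ h) :
    IsSmoothForm I (P.glue1 i h) := by
  refine isSmoothForm_of_compact (P.isCompact i) (P.subset i) (fun x hx => ?_) fun z hz => ?_
  · exact P.glue1_of_notMem (fun h => hx (P.mem_idx.1 h)) h
  · refine (((P.contDiff_cut i).smul hh).contDiffAt (x := z)).congr_of_eventuallyEq ?_
    filter_upwards [(isOpen_extChartAt_target (P.c i)).mem_nhds hz] with w hw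
    exact P.inChart_glue1 i h hw

/-- Locally finite sums of smooth forms are smooth. -/
theorem isSmoothForm_sum {η : P.ι → X → ExtConj E} (hη : ∀ i, IsSmoothForm I (η i))
    (h0 : ∀ i x, i ∉ P.idx x → η i x = 0) : IsSmoothForm I fun x => ∑ i ∈ P.idx x, η i x := by
  refine isSmoothForm_of_cover fun x => ⟨x, mem_extChartAt_source x, ?_⟩
  obtain ⟨t, ht, hfin⟩ := P.locallyFinite x
  let ζ : DForm I X := ∑ i ∈ hfin.toFinset, ⟨η i, hη i⟩
  have hz := mem_extChartAt_target (I := I) x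
  refine (ζ.contDiffAt x hz).congr_of_eventuallyEq ?_
  filter_upwards [(continuousAt_extChartAt_symm'' hz).eventually
    ((extChartAt_to_inv (I := I) x).symm ▸ ht)] with w hw
  refine congrArg (pull _) (Eq.trans ?_ (DForm.coe_sum _ _ _).symm)
  refine Finset.sum_subset (fun i hi => ?_) fun i _ hi => h0 i _ hi
  rw [Finite.mem_toFinset]
  exact ⟨_, P.mem_idx.1 hi, hw⟩

/-- The gluing of forms in the charts. -/
def glue [T2Space X] : (P.ι → CInf (ExtConj E) (⊤ : TopologicalSpace.Opens E)) →ₗ[ℂ] DForm I X where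
  toFun h := ⟨fun x => ∑ i ∈ P.idx x, P.glue1 i (h i) x,
    P.isSmoothForm_sum (fun i => P.isSmoothForm_glue1 i (contDiffOn_univ.1 (h i).contDiffOn))
      fun i _ hi => P.glue1_of_notMem hi _⟩
  map_add' h h' := DForm.ext fun x => by
    refine Eq.trans (Finset.sum_congr rfl fun i hi => ?_) Finset.sum_add_distrib
    rw [P.glue1_of_mem hi, P.glue1_of_mem hi, P.glue1_of_mem hi, ← smul_add, ← map_add]
    rfl
  map_smul' c h := DForm.ext fun x => by
    refine Eq.trans (Finset.sum_congr rfl fun i hi => ?_)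
      (Finset.smul_sum (r := c) (f := fun i => P.glue1 i (h i) x)).symm
    rw [P.glue1_of_mem hi, P.glue1_of_mem hi, smul_comm]
    exact congrArg (P.cut i (extChartAt I (P.c i) x) • ·) (map_smul (pull _) c _)

theorem glue_apply [T2Space X] (h : P.ι → CInf (ExtConj E) (⊤ : TopologicalSpace.Opens E)) (x : X) :
    P.glue h x = ∑ i ∈ P.idx x, P.glue1 i (h i) x := rfl

open Classical in
theorem glue_single [T2Space X] (i : P.ι) (h : CInf (ExtConj E) (⊤ : TopologicalSpace.Opens E)) (x : X) :
    P.glue (Pi.single i h) x = P.glue1 i h x := by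
  by_cases hi : i ∈ P.idx x
  · rw [glue_apply, Finset.sum_eq_single_of_mem i hi, Pi.single_eq_same]
    intro j hj hji
    rw [P.glue1_of_mem hj, Pi.single_eq_of_ne hji]
    exact (congrArg _ (map_zero _)).trans (smul_zero _)
  · rw [P.glue1_of_notMem hi, glue_apply]
    refine Finset.sum_eq_zero fun j hj => ?_
    have hji : j ≠ i := by rintro rfl; exact hi hj
    rw [P.glue1_of_mem hj, Pi.single_eq_of_ne hji]
    exact (congrArg _ (map_zero _)).trans (smul_zero _)

theorem continuous_glue [T2Space X] [SecondCountableTopology X] : Continuous P.glue := by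
  have := P.countable
  refine DForm.continuous_of_eval P.glue fun x => continuous_finsetSum _ fun i hi => ?_
  simp only [P.glue1_of_mem hi]
  refine ((DForm.continuous_pull
    (tangentCoordChange I x (P.c i) x)).comp ?_).const_smul (P.cut i (extChartAt I (P.c i) x))
  exact (CInf.continuous_eval (U := (⊤ : TopologicalSpace.Opens E)) trivial).comp (continuous_apply i)

open Classical in
/-- A continuous seminorm sees only finitely many terms of a glued form. -/
theorem finite_seminorm_glue [T2Space X] [SecondCountableTopology X] {q : Seminorm ℂ (DForm I X)}
    (hq : Continuous q) : ∃ s : Finset P.ι, ∀ i ∉ s, ∀ h, q (P.glue (Pi.single i h)) = 0 := by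
  have h1 : {h | q (P.glue h) < 1} ∈ 𝓝 (0 : P.ι → CInf (ExtConj E) (⊤ : TopologicalSpace.Opens E)) := by
    refine (isOpen_lt (hq.comp P.continuous_glue) continuous_const).mem_nhds ?_
    show q (P.glue 0) < 1
    rw [map_zero, map_zero]; exact one_pos
  -- A neighbourhood of `0` in a product restricts finitely many coordinates only. All multiples of
  -- a family concentrated at another index stay in the unit ball of the seminorm pulled back along
  -- `glue`, which forces the value `0`.
  rw [nhds_pi, Filter.mem_pi] at h1
  obtain ⟨s, hs, t, ht, hst⟩ := h1
  refine ⟨hs.toFinset, fun i hi h => ?_⟩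
  rw [Finite.mem_toFinset] at hi
  by_contra hne
  have hpos := lt_of_le_of_ne (apply_nonneg q (P.glue (Pi.single i h))) (Ne.symm hne)
  let c : ℂ := ((q (P.glue (Pi.single i h)))⁻¹ : ℝ)
  have h2 : c • Pi.single i h ∈ s.pi t := fun j hj => by
    have : j ≠ i := by rintro rfl; exact hi hj
    rw [Pi.smul_apply, Pi.single_eq_of_ne this, smul_zero]
    exact mem_of_mem_nhds (ht j)
  have h3 : q (P.glue (c • Pi.single i h)) < 1 := hst h2
  rw [map_smul, map_smul_eq_mul, Complex.norm_real, norm_inv, Real.norm_of_nonneg hpos.le,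
    inv_mul_cancel₀ hne] at h3
  exact lt_irrefl _ h3

end ChartPartition

end Operators

attribute [local instance] FiniteDimensional.complexToReal

open Filter

/-! ### Expansions in completed tensor products -/

section Expansion

variable {A M N W Z : Type*} [AddCommGroup A] [Module ℂ A]
  [AddCommGroup M] [Module ℂ M] [UniformSpace M] [FrechetSpace M]
  [AddCommGroup N] [Module ℂ N] [UniformSpace N] [FrechetSpace N]
  [AddCommGroup W] [Module ℂ W] [UniformSpace W] [FrechetSpace W]
  [AddCommGroup Z] [Module ℂ Z] [UniformSpace Z] [FrechetSpace Z]

/-- The sum is a pointwise limit of continuous linear maps along the filter of finite subsets of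
`α`, which is countably generated because `α` is countable; Banach–Steinhaus gives continuity. -/
theorem FrechetSpace.exists_clm_hasSum {α : Type*} [Countable α] (g : α → W →L[ℂ] Z)
    (h : ∀ w, Summable fun a => g a w) : ∃ s : W →L[ℂ] Z, ∀ w, HasSum (fun a => g a w) (s w) := by
  let f : W →ₗ[ℂ] Z :=
    { toFun := fun w => ∑' a, g a w
      map_add' := fun w w' => by simp only [map_add]; exact (h w).tsum_add (h w')
      map_smul' := fun c w => by simp only [map_smul]; exact (h w).tsum_const_smul c }
  have hf : Continuous f := FrechetSpace.continuous_of_tendsto f atTop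
    (fun s : Finset α => ∑ a ∈ s, g a) fun w => by
      simp only [sum_apply]
      exact (h w).hasSum
  exact ⟨⟨f, hf⟩, fun w => (h w).hasSum⟩

theorem FrechetSpace.exists_seminorm_bilin_le (b : M →ₗ[ℂ] N →ₗ[ℂ] Z)
    (hb : Continuous fun p : M × N => b p.1 p.2) {r : Seminorm ℂ Z} (hr : Continuous r) :
    ∃ (p : Seminorm ℂ M) (q : Seminorm ℂ N), Continuous p ∧ Continuous q ∧
      ∀ m n, r (b m n) ≤ p m * q n := by
  -- With zero actions the balancing condition is void, so the estimate for admissible seminorms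
  -- applies to any continuous bilinear map.
  have hadm : Admissible (A := Z) (0 : M →ₗ[ℂ] Z →ₗ[ℂ] M) (0 : Z →ₗ[ℂ] N →ₗ[ℂ] N)
      (r.comp (TensorProduct.lift b)) :=
    ⟨hr.comp hb, fun m a n => by simp⟩
  obtain ⟨p, q, hp, hq, h⟩ := hadm.exists_le
  exact ⟨p, q, hp, hq, h⟩

theorem FrechetSpace.summable_bilin (b : M →ₗ[ℂ] N →ₗ[ℂ] Z)
    (hb : Continuous fun p : M × N => b p.1 p.2) {α : Type*} {m : α → M} {n : α → N}
    (h : ∀ (p : Seminorm ℂ M) (q : Seminorm ℂ N), Continuous p → Continuous q →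
      Summable fun a => p (m a) * q (n a)) : Summable fun a => b (m a) (n a) := by
  refine FrechetSpace.summable_of_seminorm _ fun r hr => ?_
  obtain ⟨p, q, hp, hq, hpq⟩ := FrechetSpace.exists_seminorm_bilin_le b hb hr
  exact Summable.of_nonneg_of_le (fun a => apply_nonneg r _) (fun a => hpq _ _) (h p q hp hq)

end Expansion

/-! ### Forms on products -/

section Product

variable {E : Type*} [NormedAddCommGroup E] [NormedSpace ℂ E] [FiniteDimensional ℂ E]
  {H : Type*} [TopologicalSpace H] {I : ModelWithCorners ℂ E H} [I.Boundaryless]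
  {X : Type u} [TopologicalSpace X] [ChartedSpace H X] [IsManifold I ω X]
  {F : Type*} [NormedAddCommGroup F] [NormedSpace ℂ F] [FiniteDimensional ℂ F]
  {H' : Type*} [TopologicalSpace H'] {J : ModelWithCorners ℂ F H'} [J.Boundaryless]
  {Y : Type v} [TopologicalSpace Y] [ChartedSpace H' Y] [IsManifold J ω Y]

/-- Both sides are the derivative of the same chart change at the same point, as product charts are
products. -/
theorem tangentCoordChange_prod {x₀ x : X} {y₀ y : Y} (hx : x ∈ (extChartAt I x₀).source)
    (hy : y ∈ (extChartAt J y₀).source) :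
    tangentCoordChange (I.prod J) (x₀, y₀) (x, y) (x, y) =
      (tangentCoordChange I x₀ x x).prodMap (tangentCoordChange J y₀ y y) := by
  have h1 := hasFDerivWithinAt_tangentCoordChange (I := I.prod J) (x := (x₀, y₀)) (y := (x, y))
    (z := (x, y)) ⟨by rw [extChartAt_prod]; exact ⟨hx, hy⟩, mem_extChartAt_source _⟩
  have h2 := hasFDerivWithinAt_tangentCoordChange (I := J) (x := y₀) (y := y)
    (z := y) ⟨hy, mem_extChartAt_source _⟩
  have h3 := hasFDerivWithinAt_tangentCoordChange (I := I) (x := x₀) (y := x)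
    (z := x) ⟨hx, mem_extChartAt_source _⟩
  rw [ModelWithCorners.range_eq_univ, hasFDerivWithinAt_univ] at h1 h2 h3
  have h4 := HasFDerivAt.prodMap (p := (extChartAt I x₀ x, extChartAt J y₀ y)) h3 h2
  refine h1.unique ?_
  rw [extChartAt_prod, extChartAt_prod]
  exact h4

theorem mem_source_prod {x₀ x : X} {y₀ y : Y} : (x, y) ∈ (extChartAt (I.prod J) (x₀, y₀)).source ↔
    x ∈ (extChartAt I x₀).source ∧ y ∈ (extChartAt J y₀).source := by
  rw [extChartAt_prod]; rfl

theorem mem_target_prod {x₀ : X} {y₀ : Y} {z : E} {w : F} :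
    (z, w) ∈ (extChartAt (I.prod J) (x₀, y₀)).target ↔
    z ∈ (extChartAt I x₀).target ∧ w ∈ (extChartAt J y₀).target := by
  rw [extChartAt_prod]; rfl

theorem extChartAt_prod_apply (x₀ x : X) (y₀ y : Y) : extChartAt (I.prod J) (x₀, y₀) (x, y) =
    (extChartAt I x₀ x, extChartAt J y₀ y) := by
  rw [extChartAt_prod]; rfl

theorem extChartAt_prod_symm (x₀ : X) (y₀ : Y) (z : E) (w : F) :
    (extChartAt (I.prod J) (x₀, y₀)).symm (z, w) =
    ((extChartAt I x₀).symm z, (extChartAt J y₀).symm w) := by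
  rw [extChartAt_prod]; rfl

theorem inChart_prod (η : X × Y → ExtConj (E × F)) (x₀ : X) (y₀ : Y) {z : E} {w : F}
    (hz : z ∈ (extChartAt I x₀).target) (hw : w ∈ (extChartAt J y₀).target) :
    inChart (I.prod J) η (x₀, y₀) (z, w) =
      pull ((tangentCoordChange I x₀ ((extChartAt I x₀).symm z) ((extChartAt I x₀).symm z)).prodMap
        (tangentCoordChange J y₀ ((extChartAt J y₀).symm w) ((extChartAt J y₀).symm w)))
        (η ((extChartAt I x₀).symm z, (extChartAt J y₀).symm w)) := by
  rw [inChart, extChartAt_prod_symm, tangentCoordChange_prod ((extChartAt I x₀).map_target hz)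
    ((extChartAt J y₀).map_target hw)]

theorem ExtConj.contDiff_linear {G : Type*} [NormedAddCommGroup G] [NormedSpace ℂ G]
    (f : ExtConj E →ₗ[ℂ] G) : ContDiff ℝ ∞ f :=
  (f.toContinuousLinearMap.restrictScalars ℝ).contDiff

variable (X J) in
theorem sndPull_apply (η : DForm J Y) (p : X × Y) :
    sndPull I X J η p = pull (ContinuousLinearMap.snd ℂ E F) (η p.2) := rfl

variable (X J) in
theorem sndPull_mul (η η' : DForm J Y) :
    sndPull I X J (η * η') = sndPull I X J η * sndPull I X J η' :=
  DForm.ext fun _ => map_mul (pull _) _ _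

variable (I X J Y) in
/-- The pullback of a form along the projection `X × Y → X`. -/
def fstPull : DForm I X →ₗ[ℂ] fibreForms I X J Y where
  toFun η := ⟨⟨fun p => pull (ContinuousLinearMap.fst ℂ E F) (η p.1), by
    refine isSmoothForm_of_cover fun p => ⟨p, mem_extChartAt_source p, ?_⟩
    obtain ⟨x₀, y₀⟩ := p
    have hz := mem_extChartAt_target (I := I) x₀
    have hw := mem_extChartAt_target (I := J) y₀
    rw [extChartAt_prod_apply]
    have h1 : ContDiffAt ℝ ∞ (fun z : E × F => pull (ContinuousLinearMap.fst ℂ E F)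
        (inChart I η.1 x₀ z.1)) (extChartAt I x₀ x₀, extChartAt J y₀ y₀) :=
      (ExtConj.contDiff_linear (pull (ContinuousLinearMap.fst ℂ E F)).toLinearMap).contDiffAt.comp _
        (ContDiffAt.comp (f := Prod.fst) (g := inChart I η.1 x₀) (extChartAt I x₀ x₀, extChartAt J y₀ y₀)
          (η.contDiffAt x₀ hz) contDiffAt_fst)
    refine h1.congr_of_eventuallyEq ?_
    filter_upwards [prod_mem_nhds ((isOpen_extChartAt_target x₀).mem_nhds hz)
      ((isOpen_extChartAt_target y₀).mem_nhds hw)] with q hq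
    exact (inChart_prod _ x₀ y₀ hq.1 hq.2).trans (ExtConj.pull_prodMap_fst _ _ _)⟩,
    fun p => ⟨η p.1, rfl⟩⟩
  map_add' _ _ := Subtype.ext (DForm.ext fun _ => map_add (pull _) _ _)
  map_smul' c _ := Subtype.ext (DForm.ext fun _ => map_smul (pull _) c _)

theorem isClosed_fibreForms [T2Space X] :
    IsClosed (fibreForms I X J Y : Set (DForm (I.prod J) (X × Y))) := by
  have : (fibreForms I X J Y : Set (DForm (I.prod J) (X × Y))) =
      ⋂ p, (fun η : DForm (I.prod J) (X × Y) => η p) ⁻¹'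
        (Subalgebra.toSubmodule (pull (ContinuousLinearMap.fst ℂ E F)).range) := by
    ext η
    simp only [mem_iInter]
    rfl
  rw [this]
  exact isClosed_iInter fun x => (Submodule.closed_of_finiteDimensional _).preimage
    (DForm.continuous_eval x)

variable [SecondCountableTopology X] [SecondCountableTopology Y]

instance [T2Space X] : FrechetSpace (fibreForms I X J Y) := FrechetSpace.of_isClosed _ isClosed_fibreForms

theorem continuous_sndPull : Continuous (sndPull I X J : DForm J Y → _) :=
  DForm.continuous_of_eval (sndPull I X J) fun p =>
    ((pull (ContinuousLinearMap.snd ℂ E F)).toLinearMap.continuous_of_finiteDimensional).comp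
      (DForm.continuous_eval p.2)

theorem continuous_fstPull : Continuous (fstPull I X J Y) :=
  (DForm.continuous_of_eval ((fibreForms I X J Y).subtype ∘ₗ fstPull I X J Y) fun p =>
    ((pull (ContinuousLinearMap.fst ℂ E F)).toLinearMap.continuous_of_finiteDimensional).comp
      (DForm.continuous_eval p.1)).subtype_mk _

end Product

/-! ### Coefficients along the base and local generators -/

section Coefficients

variable {E : Type*} [NormedAddCommGroup E] [NormedSpace ℂ E] [FiniteDimensional ℂ E]
  {H : Type*} [TopologicalSpace H] {I : ModelWithCorners ℂ E H} [I.Boundaryless]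
  {X : Type u} [TopologicalSpace X] [ChartedSpace H X] [IsManifold I ω X]
  {F : Type*} [NormedAddCommGroup F] [NormedSpace ℂ F] [FiniteDimensional ℂ F]
  {H' : Type*} [TopologicalSpace H'] {J : ModelWithCorners ℂ F H'} [J.Boundaryless]
  {Y : Type v} [TopologicalSpace Y] [ChartedSpace H' Y] [IsManifold J ω Y] [T2Space Y]

namespace ChartPartition

variable (Q : ChartPartition J Y)

open Classical in
/-- The coefficient of a form on `X × Y` along the fibres of `X × Y → Y`, as a function on
`X × Y`. -/
def coeffFun (j : Q.ι) (β : ExtConj F →ₗ[ℂ] ℂ) (η : X × Y → ExtConj (E × F)) (p : X × Y) :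
    ExtConj (E × F) :=
  if j ∈ Q.idx p.2 then Q.wt j (extChartAt J (Q.c j) p.2) •
    pull (ContinuousLinearMap.fst ℂ E F) (ExtConj.coeff β (pull ((ContinuousLinearMap.id ℂ E).prodMap
      (tangentCoordChange J (Q.c j) p.2 p.2)) (η p))) else 0

theorem coeffFun_of_mem {j : Q.ι} {p : X × Y} (h : j ∈ Q.idx p.2) (β : ExtConj F →ₗ[ℂ] ℂ)
    (η : X × Y → ExtConj (E × F)) : Q.coeffFun j β η p =
    Q.wt j (extChartAt J (Q.c j) p.2) •
    pull (ContinuousLinearMap.fst ℂ E F) (ExtConj.coeff β (pull ((ContinuousLinearMap.id ℂ E).prodMap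
      (tangentCoordChange J (Q.c j) p.2 p.2)) (η p))) := if_pos h

theorem coeffFun_of_notMem {j : Q.ι} {p : X × Y} (h : j ∉ Q.idx p.2) (β : ExtConj F →ₗ[ℂ] ℂ)
    (η : X × Y → ExtConj (E × F)) : Q.coeffFun j β η p = 0 := if_neg h

theorem inChart_coeffFun (j : Q.ι) (β : ExtConj F →ₗ[ℂ] ℂ) (η : X × Y → ExtConj (E × F)) (x₀ : X)
    {z : E} {w : F} (hz : z ∈ (extChartAt I x₀).target) (hw : w ∈ (extChartAt J (Q.c j)).target) :
    inChart (I.prod J) (Q.coeffFun j β η) (x₀, Q.c j) (z, w) =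
      Q.wt j w • pull (ContinuousLinearMap.fst ℂ E F)
        (ExtConj.coeff β (inChart (I.prod J) η (x₀, Q.c j) (z, w))) := by
  rw [inChart_prod _ _ _ hz hw, inChart_prod _ _ _ hz hw]
  have hs := (extChartAt J (Q.c j)).map_target hw
  by_cases hj : j ∈ Q.idx ((extChartAt J (Q.c j)).symm w)
  · rw [Q.coeffFun_of_mem (p := ((extChartAt I x₀).symm z, (extChartAt J (Q.c j)).symm w)) hj,
      map_smul, (extChartAt J (Q.c j)).right_inv hw,
      ExtConj.pull_prodMap_fst, ← ExtConj.coeff_pull, pull_comp]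
    rfl
  · have := Q.notMem_K hj hs
    rw [(extChartAt J (Q.c j)).right_inv hw] at this
    rw [Q.coeffFun_of_notMem (p := ((extChartAt I x₀).symm z, (extChartAt J (Q.c j)).symm w)) hj,
      map_zero, Q.wt_zero j w this, zero_smul]

/-- Over the chart domain in `Y` the coefficient is a smooth expression. Off this domain it vanishes
near the point, since it is supported over the image of a compact set, which is closed in `Y`. -/
theorem isSmoothForm_coeffFun (j : Q.ι) (β : ExtConj F →ₗ[ℂ] ℂ) (η : DForm (I.prod J) (X × Y)) :
    IsSmoothForm (I.prod J) (Q.coeffFun j β η.1) := by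
  refine isSmoothForm_of_cover ?_
  rintro ⟨x, y⟩
  by_cases hy : y ∈ (extChartAt J (Q.c j)).source
  · refine ⟨(x, Q.c j), mem_source_prod.2 ⟨mem_extChartAt_source x, hy⟩, ?_⟩
    have hz := mem_extChartAt_target (I := I) x
    have hw := (extChartAt J (Q.c j)).map_source hy
    rw [extChartAt_prod_apply]
    have h1 : ContDiffAt ℝ ∞ (fun q : E × F => Q.wt j q.2 • pull (ContinuousLinearMap.fst ℂ E F)
        (ExtConj.coeff β (inChart (I.prod J) η.1 (x, Q.c j) q)))
        (extChartAt I x x, extChartAt J (Q.c j) y) := by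
      refine ((Q.contDiff_wt j).comp contDiff_snd).contDiffAt.smul ?_
      refine (ExtConj.contDiff_linear ((pull (ContinuousLinearMap.fst ℂ E F)).toLinearMap ∘ₗ
        ExtConj.coeff (E := E) β)).contDiffAt.comp _ (η.contDiffAt (x, Q.c j) ?_)
      exact mem_target_prod.2 ⟨hz, hw⟩
    refine h1.congr_of_eventuallyEq ?_
    filter_upwards [prod_mem_nhds ((isOpen_extChartAt_target x).mem_nhds hz)
      ((isOpen_extChartAt_target (Q.c j)).mem_nhds hw)] with q hq
    exact Q.inChart_coeffFun j β η.1 x hq.1 hq.2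
  · refine ⟨(x, y), mem_extChartAt_source _, ?_⟩
    have hcl : IsClosed ((extChartAt J (Q.c j)).symm '' Q.K j) :=
      ((Q.isCompact j).image_of_continuousOn
        ((continuousOn_extChartAt_symm _).mono (Q.subset j))).isClosed
    have hy' : y ∉ (extChartAt J (Q.c j)).symm '' Q.K j := by
      rintro ⟨z, hz, rfl⟩
      exact hy ((extChartAt J (Q.c j)).map_target (Q.subset j hz))
    refine (contDiffAt_const (c := (0 : ExtConj (E × F)))).congr_of_eventuallyEq ?_
    have hz := mem_extChartAt_target (I := I.prod J) (x, y)
    filter_upwards [(continuousAt_extChartAt_symm'' hz).eventually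
      ((hcl.preimage continuous_snd).isOpen_compl.mem_nhds
        (by rw [extChartAt_to_inv]; exact hy'))] with w hw
    rw [inChart, Q.coeffFun_of_notMem (fun h => hw (Q.mem_idx.1 h)), map_zero]

/-- The coefficient of a form on `X × Y` along the fibres of `X × Y → Y`. -/
def coeffForm (j : Q.ι) (β : ExtConj F →ₗ[ℂ] ℂ) :
    DForm (I.prod J) (X × Y) →ₗ[ℂ] fibreForms I X J Y where
  toFun η := ⟨⟨Q.coeffFun j β η.1, Q.isSmoothForm_coeffFun j β η⟩, fun p => by
    show Q.coeffFun j β η.1 p ∈ (pull (ContinuousLinearMap.fst ℂ E F)).range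
    by_cases h : j ∈ Q.idx p.2
    · rw [Q.coeffFun_of_mem h]
      exact Subalgebra.smul_mem _ (AlgHom.mem_range_self _ _) _
    · rw [Q.coeffFun_of_notMem h]
      exact zero_mem _⟩
  map_add' η η' := Subtype.ext (DForm.ext fun p => by
    show Q.coeffFun j β (η.1 + η'.1) p = Q.coeffFun j β η.1 p + Q.coeffFun j β η'.1 p
    by_cases h : j ∈ Q.idx p.2
    · rw [Q.coeffFun_of_mem h, Q.coeffFun_of_mem h, Q.coeffFun_of_mem h, Pi.add_apply, map_add,
        map_add, map_add, smul_add]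
    · rw [Q.coeffFun_of_notMem h, Q.coeffFun_of_notMem h, Q.coeffFun_of_notMem h, add_zero])
  map_smul' c η := Subtype.ext (DForm.ext fun p => by
    show Q.coeffFun j β (c • η.1) p = c • Q.coeffFun j β η.1 p
    by_cases h : j ∈ Q.idx p.2
    · rw [Q.coeffFun_of_mem h, Q.coeffFun_of_mem h, Pi.smul_apply, map_smul,
        map_smul, map_smul, smul_comm]
    · rw [Q.coeffFun_of_notMem h, Q.coeffFun_of_notMem h, smul_zero])

theorem coeffForm_apply (j : Q.ι) (β : ExtConj F →ₗ[ℂ] ℂ) (η : DForm (I.prod J) (X × Y))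
    (p : X × Y) : (Q.coeffForm j β η).1 p = Q.coeffFun j β η.1 p := rfl

theorem continuous_coeffForm [SecondCountableTopology X] [SecondCountableTopology Y] (j : Q.ι)
    (β : ExtConj F →ₗ[ℂ] ℂ) :
    Continuous (Q.coeffForm j β : DForm (I.prod J) (X × Y) → fibreForms I X J Y) := by
  refine (DForm.continuous_of_eval ((fibreForms I X J Y).subtype ∘ₗ Q.coeffForm j β)
    fun p => ?_).subtype_mk _
  show Continuous fun η : DForm (I.prod J) (X × Y) => Q.coeffFun j β η.1 p
  by_cases h : j ∈ Q.idx p.2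
  · simp only [Q.coeffFun_of_mem h]
    exact (((pull (ContinuousLinearMap.fst ℂ E F)).toLinearMap ∘ₗ ExtConj.coeff (E := E) β ∘ₗ
      (pull ((ContinuousLinearMap.id ℂ E).prodMap
      (tangentCoordChange J (Q.c j) p.2 p.2))).toLinearMap).continuous_of_finiteDimensional.comp
      (DForm.continuous_eval p)).const_smul (Q.wt j (extChartAt J (Q.c j) p.2))
  · simp only [Q.coeffFun_of_notMem h]
    exact continuous_const

open Classical in
/-- The coefficients of a form on `Y`. -/
def coeffBase (j : Q.ι) (β : ExtConj F →ₗ[ℂ] ℂ) (η : DForm J Y) : DForm.gr J (X := Y) 0 :=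
  ⟨⟨fun y => if j ∈ Q.idx y then algebraMap ℂ (ExtConj F) (Q.wt j (extChartAt J (Q.c j) y) *
    β (pull (tangentCoordChange J (Q.c j) y y) (η y))) else 0, by
    refine isSmoothForm_of_compact (Q.isCompact j) (Q.subset j) (fun y hy => ?_) fun w hw => ?_
    · exact if_neg fun h => hy (Q.mem_idx.1 h)
    · have h1 : ContDiffAt ℝ ∞ (fun w => (Q.wt j w * β (inChart J η.1 (Q.c j) w)) •
          (1 : ExtConj F)) w :=
        ((Q.contDiff_wt j).contDiffAt.mul ((ExtConj.contDiff_linear β).contDiffAt.comp _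
          (η.contDiffAt (Q.c j) hw))).smul (contDiffAt_const (c := (1 : ExtConj F)))
      refine h1.congr_of_eventuallyEq ?_
      filter_upwards [(isOpen_extChartAt_target (Q.c j)).mem_nhds hw] with w hw
      have hs := (extChartAt J (Q.c j)).map_target hw
      rw [inChart, ← Algebra.algebraMap_eq_smul_one]
      split_ifs with hj
      · rw [AlgHom.commutes, (extChartAt J (Q.c j)).right_inv hw]
        rfl
      · have := Q.notMem_K hj hs
        rw [(extChartAt J (Q.c j)).right_inv hw] at this
        rw [Q.wt_zero j w this, zero_mul, map_zero, map_zero]⟩, fun y => by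
    show (if j ∈ Q.idx y then _ else _) ∈ _
    split_ifs
    · rw [ExtConj.gr_zero]; exact Submodule.algebraMap_mem _
    · exact zero_mem _⟩

theorem coeffBase_of_mem {j : Q.ι} {y : Y} (h : j ∈ Q.idx y) (β : ExtConj F →ₗ[ℂ] ℂ)
    (η : DForm J Y) : (Q.coeffBase j β η).1 y = algebraMap ℂ (ExtConj F)
      (Q.wt j (extChartAt J (Q.c j) y) * β (pull (tangentCoordChange J (Q.c j) y y) (η y))) :=
  if_pos h

theorem coeffBase_of_notMem {j : Q.ι} {y : Y} (h : j ∉ Q.idx y) (β : ExtConj F →ₗ[ℂ] ℂ)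
    (η : DForm J Y) : (Q.coeffBase j β η).1 y = 0 :=
  if_neg h

/-- Taking coefficients is linear over forms along the fibres: `m` passes through and only `η` is
expanded. This makes the series for the inverse of the canonical map computable on pure tensors. -/
theorem coeffForm_mul (j : Q.ι) (β : ExtConj F →ₗ[ℂ] ℂ) (m : fibreForms I X J Y) (η : DForm J Y) :
    Q.coeffForm j β (m.1 * sndPull I X J η) = fibreRact I X J m (Q.coeffBase j β η) := by
  refine Subtype.ext (DForm.ext fun p => ?_)
  show Q.coeffFun j β (m.1 * sndPull I X J η).1 p =
    m.1 p * pull (ContinuousLinearMap.snd ℂ E F) ((Q.coeffBase j β η).1 p.2)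
  by_cases h : j ∈ Q.idx p.2
  · obtain ⟨a, ha⟩ := m.2 p
    have ha' : m.1 p = pull (ContinuousLinearMap.fst ℂ E F) a := ha.symm
    rw [Q.coeffFun_of_mem h, Q.coeffBase_of_mem h, AlgHom.commutes,
      show (m.1 * sndPull I X J η).1 p = m.1 p * pull (ContinuousLinearMap.snd ℂ E F) (η p.2)
      from rfl, ha', map_mul, ExtConj.pull_prodMap_fst, ExtConj.pull_prodMap_snd, pull_id,
      ExtConj.coeff_mul, map_smul, smul_smul, Algebra.algebraMap_eq_smul_one, mul_smul_comm, mul_one]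
  · rw [Q.coeffFun_of_notMem h, Q.coeffBase_of_notMem h, map_zero, mul_zero]

open Classical in
/-- The local generators of the forms on `Y`. -/
def gen (j : Q.ι) (b : ExtConj F) : DForm J Y :=
  Q.glue (Pi.single j ⟨fun _ => b, contDiffOn_const, fun _ h => absurd trivial h⟩)

theorem gen_of_mem {j : Q.ι} {y : Y} (h : j ∈ Q.idx y) (b : ExtConj F) : Q.gen j b y =
    Q.cut j (extChartAt J (Q.c j) y) • pull (tangentCoordChange J y (Q.c j) y) b :=
  (Q.glue_single _ _ _).trans (Q.glue1_of_mem h _)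

end ChartPartition

end Coefficients

attribute [local instance] FiniteDimensional.complexToReal

open Filter

/-! ### The canonical isomorphism -/

section Product

variable {E : Type*} [NormedAddCommGroup E] [NormedSpace ℂ E] [FiniteDimensional ℂ E]
  {H : Type*} [TopologicalSpace H] {I : ModelWithCorners ℂ E H} [I.Boundaryless]
  {X : Type u} [TopologicalSpace X] [ChartedSpace H X] [IsManifold I ω X]
  {F : Type*} [NormedAddCommGroup F] [NormedSpace ℂ F] [FiniteDimensional ℂ F]
  {H' : Type*} [TopologicalSpace H'] {J : ModelWithCorners ℂ F H'} [J.Boundaryless]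
  {Y : Type v} [TopologicalSpace Y] [ChartedSpace H' Y] [IsManifold J ω Y] [T2Space Y]

namespace ChartPartition

variable (Q : ChartPartition J Y)

/-- The index set of the local generators of the forms on `Y`. -/
abbrev GenIdx : Type _ := Q.ι × Fin (Module.finrank ℂ (ExtConj F))

/-- The local generators of the forms on `Y`. -/
def genB (a : Q.GenIdx) : DForm J Y := Q.gen a.1 (Module.finBasis ℂ (ExtConj F) a.2)

/-- At a fixed point only finitely many `j` contribute. For each of them, expansion in a basis of
covectors of `Y` in the chart recovers `wt j * cut j` times `η p`, and these weights sum to `1`. -/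
theorem hasSum_coeffForm (η : DForm (I.prod J) (X × Y)) (p : X × Y) :
    HasSum (fun a : Q.GenIdx =>
      (Q.coeffForm a.1 ((Module.finBasis ℂ (ExtConj F)).coord a.2) η).1 p *
        sndPull I X J (Q.genB a) p) (η p) := by
  have h := hasSum_sum_of_ne_finset_zero (s := Q.idx p.2 ×ˢ Finset.univ)
    (f := fun a : Q.GenIdx => (Q.coeffForm a.1 ((Module.finBasis ℂ (ExtConj F)).coord a.2) η).1 p *
        sndPull I X J (Q.genB a) p) (L := SummationFilter.unconditional _) fun a ha => by
      have ha' : a.1 ∉ Q.idx p.2 := fun h => ha (Finset.mk_mem_product h (Finset.mem_univ _))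
      rw [coeffForm_apply, Q.coeffFun_of_notMem ha', zero_mul]
  convert h using 1
  rw [Finset.sum_product]
  have h1 : ∀ j ∈ Q.idx p.2, ∑ k, (Q.coeffForm j ((Module.finBasis ℂ (ExtConj F)).coord k) η).1 p *
        sndPull I X J (Q.genB (j, k)) p =
      (Q.wt j (extChartAt J (Q.c j) p.2) * Q.cut j (extChartAt J (Q.c j) p.2)) • η p := by
    intro j hj
    have h2 : ∀ k, (Q.coeffForm j ((Module.finBasis ℂ (ExtConj F)).coord k) η).1 p *
        sndPull I X J (Q.genB (j, k)) p =
        (Q.wt j (extChartAt J (Q.c j) p.2) * Q.cut j (extChartAt J (Q.c j) p.2)) •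
          pull ((ContinuousLinearMap.id ℂ E).prodMap (tangentCoordChange J p.2 (Q.c j) p.2))
          (pull (ContinuousLinearMap.fst ℂ E F)
            (ExtConj.coeff ((Module.finBasis ℂ (ExtConj F)).coord k)
              (pull ((ContinuousLinearMap.id ℂ E).prodMap
                (tangentCoordChange J (Q.c j) p.2 p.2)) (η p))) *
            pull (ContinuousLinearMap.snd ℂ E F) (Module.finBasis ℂ (ExtConj F) k)) := by
      intro k
      rw [coeffForm_apply, Q.coeffFun_of_mem hj, sndPull_apply, genB, Q.gen_of_mem hj, map_smul,
        smul_mul_smul_comm, map_mul, ExtConj.pull_prodMap_fst, ExtConj.pull_prodMap_snd, pull_id]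
    simp only [h2]
    rw [← Finset.smul_sum, ← map_sum, ExtConj.sum_coeff, pull_comp]
    congr 1
    have h3 : ((ContinuousLinearMap.id ℂ E).prodMap (tangentCoordChange J (Q.c j) p.2 p.2)).comp
        ((ContinuousLinearMap.id ℂ E).prodMap (tangentCoordChange J p.2 (Q.c j) p.2)) =
        ContinuousLinearMap.id ℂ (E × F) := by
      refine ContinuousLinearMap.ext fun v => Prod.ext rfl ?_
      show tangentCoordChange J (Q.c j) p.2 p.2 (tangentCoordChange J p.2 (Q.c j) p.2 v.2) = v.2
      rw [tangentCoordChange_comp ⟨⟨mem_extChartAt_source p.2, Q.mem_source hj⟩,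
        mem_extChartAt_source p.2⟩, tangentCoordChange_self (mem_extChartAt_source p.2)]
    rw [h3, pull_id]
  rw [Finset.sum_congr rfl h1, ← Finset.sum_smul, Q.sum_idx, one_smul]

theorem hasSum_coeffBase_apply (η : DForm J Y) (y : Y) :
    HasSum (fun a : Q.GenIdx =>
      (Q.coeffBase a.1 ((Module.finBasis ℂ (ExtConj F)).coord a.2) η).1 y * Q.genB a y) (η y) := by
  have h := hasSum_sum_of_ne_finset_zero (s := Q.idx y ×ˢ Finset.univ)
    (f := fun a : Q.GenIdx => (Q.coeffBase a.1 ((Module.finBasis ℂ (ExtConj F)).coord a.2) η).1 y *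
      Q.genB a y) (L := SummationFilter.unconditional _) fun a ha => by
      have ha' : a.1 ∉ Q.idx y := fun h => ha (Finset.mk_mem_product h (Finset.mem_univ _))
      rw [Q.coeffBase_of_notMem ha', zero_mul]
  convert h using 1
  rw [Finset.sum_product]
  have h1 : ∀ j ∈ Q.idx y, ∑ k, (Q.coeffBase j ((Module.finBasis ℂ (ExtConj F)).coord k) η).1 y *
        Q.genB (j, k) y =
      (Q.wt j (extChartAt J (Q.c j) y) * Q.cut j (extChartAt J (Q.c j) y)) • η y := by
    intro j hj
    have h2 : ∀ k, (Q.coeffBase j ((Module.finBasis ℂ (ExtConj F)).coord k) η).1 y *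
        Q.genB (j, k) y =
        (Q.wt j (extChartAt J (Q.c j) y) * Q.cut j (extChartAt J (Q.c j) y)) •
          pull (tangentCoordChange J y (Q.c j) y)
          ((Module.finBasis ℂ (ExtConj F)).repr (pull (tangentCoordChange J (Q.c j) y y) (η y)) k •
            (Module.finBasis ℂ (ExtConj F) k)) := by
      intro k
      rw [Q.coeffBase_of_mem hj, genB, Q.gen_of_mem hj, map_smul, Algebra.algebraMap_eq_smul_one,
        smul_mul_smul_comm, one_mul, smul_smul, Module.Basis.coord_apply]
      congr 1
      ring
    simp only [h2]
    rw [← Finset.smul_sum, ← map_sum, Module.Basis.sum_repr,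
      pull_tangentCoordChange_cancel _ (Q.mem_source hj)]
  rw [Finset.sum_congr rfl h1, ← Finset.sum_smul, Q.sum_idx, one_smul]

variable [SecondCountableTopology Y]

/-- The coefficients `c` are arbitrary: a continuous seminorm sees only finitely many of the
generators, so the sum is finite. -/
theorem summable_genB {q : Seminorm ℂ (DForm J Y)} (hq : Continuous q) (c : Q.GenIdx → ℝ) :
    Summable fun a => c a * q (Q.genB a) := by
  obtain ⟨s, hs⟩ := Q.finite_seminorm_glue hq
  refine summable_of_ne_finset_zero (s := s ×ˢ Finset.univ) fun a ha => ?_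
  have ha' : a.1 ∉ s := fun h => ha (Finset.mk_mem_product h (Finset.mem_univ _))
  have h0 : q (Q.genB a) = 0 := hs a.1 ha' ⟨fun _ => Module.finBasis ℂ (ExtConj F) a.2,
    contDiffOn_const, fun _ h => absurd trivial h⟩
  rw [h0, mul_zero]

theorem hasSum_coeffBase (η : DForm J Y) :
    HasSum (fun a : Q.GenIdx =>
      (Q.coeffBase a.1 ((Module.finBasis ℂ (ExtConj F)).coord a.2) η).1 * Q.genB a) η := by
  have h : Summable fun a : Q.GenIdx =>
      (Q.coeffBase a.1 ((Module.finBasis ℂ (ExtConj F)).coord a.2) η).1 * Q.genB a :=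
    FrechetSpace.summable_bilin (LinearMap.mul ℂ (DForm J Y)) DForm.continuous_mul
      fun p q _ hq => Q.summable_genB hq _
  convert h.hasSum using 1
  refine DForm.ext fun y => ?_
  exact (Q.hasSum_coeffBase_apply η y).unique
    (h.hasSum.map (DForm.evalL y : DForm J Y →ₗ[ℂ] ExtConj F) (DForm.continuous_eval y))

end ChartPartition

variable (J Y) in
/-- The action of functions on forms. -/
abbrev formLmul : DForm.gr J (X := Y) 0 →ₗ[ℂ] DForm J Y →ₗ[ℂ] DForm J Y :=
  LinearMap.mul ℂ (DForm J Y) ∘ₗ (DForm.gr J 0).subtype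

/-- The inverse sends a form to `∑ coeff_a ⊗ gen_a`, which converges because seminorms on the forms
of `Y` see finitely many generators. One composite is the expansion of a form on `Y`, tensored with
`m`; the other is the expansion of a form on `X × Y`, checked at points. -/
theorem exists_wedgeIso [T2Space X] [SecondCountableTopology X] [SecondCountableTopology Y] :
    ∃ Φ : CTensor (fibreRact I X J (Y := Y)) (formLmul J Y) ≃L[ℂ] DForm (I.prod J) (X × Y),
      ∀ m η, Φ (CTensor.tmul _ _ m η) = m.1 * sndPull I X J η := by
  obtain ⟨Q⟩ := exists_chartPartition J Y
  have := Q.countable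
  let bil : fibreForms I X J Y →ₗ[ℂ] DForm J Y →ₗ[ℂ] DForm (I.prod J) (X × Y) :=
    (LinearMap.mul ℂ (DForm (I.prod J) (X × Y))).compl₁₂ (fibreForms I X J Y).subtype
      (sndPull I X J)
  have hbil : Continuous fun p : fibreForms I X J Y × DForm J Y => bil p.1 p.2 :=
    DForm.continuous_mul.comp ((continuous_subtype_val.comp continuous_fst).prodMk
      (continuous_sndPull.comp continuous_snd))
  let Φ : CTensor (fibreRact I X J (Y := Y)) (formLmul J Y) →L[ℂ] DForm (I.prod J) (X × Y) :=
    CTensor.lift bil hbil fun m a η => by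
      show m.1 * sndPull I X J a.1 * sndPull I X J η = m.1 * sndPull I X J (a.1 * η)
      rw [sndPull_mul, mul_assoc]
  have hΦ : ∀ m η, Φ (CTensor.tmul _ _ m η) = m.1 * sndPull I X J η := fun m η =>
    CTensor.lift_tmul _ _ _ _ _
  let tm : fibreForms I X J Y →ₗ[ℂ] DForm J Y →ₗ[ℂ]
    CTensor (fibreRact I X J (Y := Y)) (formLmul J Y) := CTensor.mk _ _
  have htm : Continuous fun p : fibreForms I X J Y × DForm J Y => tm p.1 p.2 :=
    CTensor.continuous_tmul
  let g : Q.GenIdx → DForm (I.prod J) (X × Y) →L[ℂ]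
      CTensor (fibreRact I X J (Y := Y)) (formLmul J Y) := fun a =>
    (clmLeft tm htm (Q.genB a)).comp
      ⟨Q.coeffForm a.1 ((Module.finBasis ℂ (ExtConj F)).coord a.2), Q.continuous_coeffForm _ _⟩
  obtain ⟨s, hs⟩ := FrechetSpace.exists_clm_hasSum g fun η =>
    FrechetSpace.summable_bilin tm htm fun p q _ hq => Q.summable_genB hq _
  have hs' : ∀ η, HasSum (fun a => CTensor.tmul (fibreRact I X J (Y := Y)) (formLmul J Y)
      (Q.coeffForm a.1 ((Module.finBasis ℂ (ExtConj F)).coord a.2) η) (Q.genB a)) (s η) := hs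
  refine ⟨FrechetSpace.equivOfBijective Φ s.toLinearMap (fun t => ?_) (fun η => ?_), hΦ⟩
  · have h : s.comp Φ = ContinuousLinearMap.id ℂ _ := CTensor.ext fun m η => by
      refine (hs' (Φ (CTensor.tmul _ _ m η))).unique ?_
      have h1 := (Q.hasSum_coeffBase η).map (clmRight tm htm m) (clmRight tm htm m).continuous
      have h2 : (fun a => CTensor.tmul (fibreRact I X J (Y := Y)) (formLmul J Y)
          (Q.coeffForm a.1 ((Module.finBasis ℂ (ExtConj F)).coord a.2)
            (Φ (CTensor.tmul _ _ m η))) (Q.genB a)) = fun a =>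
          CTensor.tmul (fibreRact I X J (Y := Y)) (formLmul J Y) m
            ((Q.coeffBase a.1 ((Module.finBasis ℂ (ExtConj F)).coord a.2) η).1 * Q.genB a) := by
        funext a
        -- The coefficient of `m ∧ p₂*η` is `m` times a function on `Y`. Balancing moves this
        -- function over to the generator, and the series becomes the expansion of `η`.
        rw [hΦ, Q.coeffForm_mul, CTensor.balanced]
        rfl
      rw [h2]
      exact h1
    exact DFunLike.congr_fun h t
  · refine DForm.ext fun p => ?_
    refine HasSum.unique ?_ (Q.hasSum_coeffForm η p)
    have h1 := (hs' η).map ((DForm.evalL p).comp Φ.toLinearMap)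
      ((DForm.continuous_eval p).comp Φ.continuous)
    have h2 : (fun a => Φ (CTensor.tmul (fibreRact I X J (Y := Y)) (formLmul J Y)
        (Q.coeffForm a.1 ((Module.finBasis ℂ (ExtConj F)).coord a.2) η) (Q.genB a)) p) = fun a =>
        (Q.coeffForm a.1 ((Module.finBasis ℂ (ExtConj F)).coord a.2) η).1 p *
          sndPull I X J (Q.genB a) p := by
      funext a
      rw [hΦ]
      rfl
    rw [← h2]
    exact h1

end Product

attribute [local instance] FiniteDimensional.complexToReal

open Filter MeasureTheory

/-! ### Exponentials and Fourier series -/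

instance {α : Type*} [TopologicalSpace α] : FrechetSpace (BoundedContinuousFunction α ℂ) := by
  have h : LocallyConvexSpace ℝ (BoundedContinuousFunction α ℂ) := inferInstance
  exact { h with }

section Wave

variable {d : ℕ}

/-- The linear form `x ↦ 2π k · x`. -/
def freq (k : Fin d → ℤ) : (Fin d → ℝ) →L[ℝ] ℝ :=
  ∑ j, (2 * Real.pi * k j) • ContinuousLinearMap.proj (R := ℝ) (φ := fun _ => ℝ) j

theorem freq_apply (k : Fin d → ℤ) (x : Fin d → ℝ) : freq k x = ∑ j, 2 * Real.pi * k j * x j := by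
  simp [freq, sum_apply]

theorem norm_freq_le (k : Fin d → ℤ) : ‖freq k‖ ≤ 2 * Real.pi * d * ‖k‖ := by
  refine (norm_sum_le _ _).trans ?_
  have h : ∀ j ∈ Finset.univ, ‖(2 * Real.pi * k j) • ContinuousLinearMap.proj (R := ℝ)
      (φ := fun _ : Fin d => ℝ) j‖ ≤ 2 * Real.pi * ‖k‖ := by
    intro j _
    have h1 : ‖ContinuousLinearMap.proj (R := ℝ) (φ := fun _ : Fin d => ℝ) j‖ ≤ 1 :=
      ContinuousLinearMap.opNorm_le_bound _ zero_le_one fun x => by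
        rw [one_mul]; exact norm_le_pi_norm x j
    have h2 : ‖(k j : ℝ)‖ ≤ ‖k‖ := by
      rw [Int.norm_cast_real]
      exact norm_le_pi_norm k j
    rw [norm_smul, norm_mul, Real.norm_of_nonneg (by positivity : 0 ≤ 2 * Real.pi)]
    calc 2 * Real.pi * ‖(k j : ℝ)‖ * _ ≤ 2 * Real.pi * ‖k‖ * 1 := by gcongr
      _ = _ := mul_one _
  refine (Finset.sum_le_sum h).trans_eq ?_
  rw [Finset.sum_const, Finset.card_univ, Fintype.card_fin, nsmul_eq_mul]
  ring

/-- The exponential `x ↦ e^{2πi k · x}`. -/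
def wave (k : Fin d → ℤ) (x : Fin d → ℝ) : ℂ := Complex.exp ((freq k x : ℝ) * Complex.I)

theorem norm_wave (k : Fin d → ℤ) (x : Fin d → ℝ) : ‖wave k x‖ = 1 :=
  Complex.norm_exp_ofReal_mul_I _

theorem contDiff_expSMul {E G : Type*} [NormedAddCommGroup E] [NormedSpace ℝ E]
    [NormedAddCommGroup G] [NormedSpace ℂ G] (ℓ : E →L[ℝ] ℝ) (b : G) :
    ContDiff ℝ ∞ fun z => Complex.exp ((ℓ z : ℝ) * Complex.I) • b :=
  (ContDiff.cexp ((Complex.ofRealCLM.contDiff.comp ℓ.contDiff).mul contDiff_const)).smul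
    contDiff_const

/-- The function is `t ↦ e^{it} b` composed with `ℓ`. Every derivative in `t` has norm `‖b‖`, and
each differentiation of the composite contributes a factor `‖ℓ‖`. -/
theorem norm_iteratedFDeriv_expSMul_le {E G : Type*} [NormedAddCommGroup E] [NormedSpace ℝ E]
    [NormedAddCommGroup G] [NormedSpace ℂ G] (ℓ : E →L[ℝ] ℝ) (b : G) (n : ℕ) (z : E) :
    ‖iteratedFDeriv ℝ n (fun z => Complex.exp ((ℓ z : ℝ) * Complex.I) • b) z‖ ≤ ‖ℓ‖ ^ n * ‖b‖ := by
  have h1 : ∀ n, iteratedDeriv n (fun t : ℝ => Complex.exp ((t : ℂ) * Complex.I) • b) =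
      fun t : ℝ => (Complex.I ^ n * Complex.exp ((t : ℂ) * Complex.I)) • b := by
    intro n
    induction n with
    | zero => simp
    | succ n ih =>
      rw [iteratedDeriv_succ, ih]
      funext t
      have h2 : HasDerivAt (fun t : ℝ => Complex.exp ((t : ℂ) * Complex.I))
          (Complex.exp ((t : ℂ) * Complex.I) * (1 * Complex.I)) t :=
        ((Complex.ofRealCLM.hasDerivAt (x := t)).mul_const Complex.I).cexp
      have h3 := (h2.const_mul (Complex.I ^ n)).smul_const b
      rw [h3.deriv]
      congr 1
      ring
  have h2 := ContinuousLinearMap.iteratedFDeriv_comp_right ℓ (n := ∞) (i := n)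
    (contDiff_expSMul (ContinuousLinearMap.id ℝ ℝ) b) z (by exact_mod_cast le_top)
  have h3 : ((fun z : ℝ => Complex.exp (((ContinuousLinearMap.id ℝ ℝ) z : ℝ) * Complex.I) • b) ∘ ℓ) =
    fun z => Complex.exp ((ℓ z : ℝ) * Complex.I) • b := rfl
  rw [h3] at h2
  rw [h2]
  refine (ContinuousMultilinearMap.norm_compContinuousLinearMap_le _ _).trans ?_
  rw [norm_iteratedFDeriv_eq_norm_iteratedDeriv]
  have h4 : (fun z : ℝ => Complex.exp (((ContinuousLinearMap.id ℝ ℝ) z : ℝ) * Complex.I) • b) =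
    fun t : ℝ => Complex.exp ((t : ℂ) * Complex.I) • b := rfl
  rw [h4, h1 n]
  simp only [norm_smul, norm_mul, norm_pow, Complex.norm_I, one_pow, Complex.norm_exp_ofReal_mul_I,
    Finset.prod_const, Finset.card_univ, Fintype.card_fin, one_mul]
  exact (mul_comm _ _).le

theorem mFourier_coe (k : Fin d → ℤ) (x : Fin d → ℝ) :
    UnitAddTorus.mFourier k (fun j => (x j : UnitAddCircle)) = wave k x := by
  have h : UnitAddTorus.mFourier k (fun j => (x j : UnitAddCircle)) =
    ∏ j, fourier (k j) (x j : UnitAddCircle) := rfl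
  rw [h, wave, freq_apply]
  push_cast
  rw [Finset.sum_mul, Complex.exp_sum]
  refine Finset.prod_congr rfl fun j _ => ?_
  rw [fourier_coe_apply]
  congr 1
  push_cast
  ring

/-- The open unit cube centred at the origin. -/
def openCube (d : ℕ) : Set (Fin d → ℝ) := {x | ∀ j, x j ∈ Ioo (-(1 / 2) : ℝ) (1 / 2)}

/-- A function supported in a compact subset of the open unit cube descends to a continuous function
on the torus, with the given integrals as Fourier coefficients. Their summability makes the Fourier
series converge to it at every point. -/
theorem hasSum_wave {f : (Fin d → ℝ) → ℂ} (hf : Continuous f) {K : Set (Fin d → ℝ)}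
    (hK : IsCompact K) (hKc : K ⊆ openCube d) (h0 : ∀ x ∉ K, f x = 0)
    (hs : Summable fun k : Fin d → ℤ => ∫ x, wave (-k) x * f x) {x : Fin d → ℝ}
    (hx : x ∈ openCube d) :
    HasSum (fun k : Fin d → ℤ => (∫ x, wave (-k) x * f x) * wave k x) (f x) := by
  let p : (Fin d → ℝ) → UnitAddTorus (Fin d) := fun x j => (x j : UnitAddCircle)
  have hp : Continuous p := continuous_pi fun j =>
    (AddCircle.continuous_mk' (1 : ℝ)).comp (continuous_apply j)
  let s : UnitAddTorus (Fin d) → (Fin d → ℝ) := fun t j =>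
    (AddCircle.equivIoc (1 : ℝ) (-(1 / 2)) (t j) : ℝ)
  have hps : ∀ t, p (s t) = t := fun t => funext fun j => AddCircle.coe_equivIoc
  have hsp : ∀ x ∈ {x : Fin d → ℝ | ∀ i, x i ∈ Ioc (-(1 / 2) : ℝ) (-(1 / 2) + 1)}, s (p x) = x :=
    fun x hx => funext fun j => AddCircle.equivIoc_coe_of_mem (hx j)
  have hsub : openCube d ⊆ {x : Fin d → ℝ | ∀ i, x i ∈ Ioc (-(1 / 2) : ℝ) (-(1 / 2) + 1)} :=
    fun x hx j => ⟨(hx j).1, by have := (hx j).2; linarith⟩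
  -- The section `s` jumps only over the faces of the cube. Points of `p '' K` are off the faces,
  -- and away from this compact set `f ∘ s` vanishes in a neighbourhood.
  have hF : Continuous fun t => f (s t) := by
    rw [continuous_iff_continuousAt]
    intro t
    by_cases ht : t ∈ p '' K
    · obtain ⟨y, hy, rfl⟩ := ht
      refine hf.continuousAt.comp (continuousAt_pi.2 fun j => ?_)
      have h1 : p y j ≠ ((-(1 / 2) : ℝ) : UnitAddCircle) := by
        intro h
        have h2 : (AddCircle.equivIoc (1 : ℝ) (-(1 / 2)) (p y j) : ℝ) = y j :=
          congrFun (hsp y (hsub (hKc hy))) j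
        have h3 : p y j = ((-(1 / 2) + 1 : ℝ) : UnitAddCircle) := by
          rw [h]; exact (AddCircle.coe_add_period (1 : ℝ) (-(1 / 2))).symm
        rw [h3, AddCircle.equivIoc_coe_of_mem (⟨by norm_num, le_rfl⟩)] at h2
        have := (hKc hy j).2
        rw [← h2] at this
        norm_num at this
      have h2 := AddCircle.continuousAt_equivIoc (1 : ℝ) (-(1 / 2)) h1
      exact ContinuousAt.comp (f := fun t : UnitAddTorus (Fin d) => t j)
        (continuous_subtype_val.continuousAt.comp h2) (continuous_apply j).continuousAt
    · have h1 : ∀ᶠ t' in 𝓝 t, t' ∉ p '' K :=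
        ((hK.image hp).isClosed.isOpen_compl).mem_nhds ht
      refine (continuousAt_const (y := (0 : ℂ))).congr ?_
      filter_upwards [h1] with t' ht'
      exact (h0 _ fun h => ht' ⟨_, h, hps t'⟩).symm
  let Fc : C(UnitAddTorus (Fin d), ℂ) := ⟨fun t => f (s t), hF⟩
  have hcoef : ∀ k, UnitAddTorus.mFourierCoeff Fc k = ∫ x, wave (-k) x * f x := by
    intro k
    rw [UnitAddTorus.mFourierCoeff_eq_integral _ _ (fun _ => -(1 / 2)),
      ← setIntegral_eq_integral_of_forall_compl_eq_zero
        (s := {x : Fin d → ℝ | ∀ i, x i ∈ Ioc (-(1 / 2) : ℝ) (-(1 / 2) + 1)})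
        (f := fun x => wave (-k) x * f x)
        (fun x hx => by rw [h0 x fun h => hx (hsub (hKc h)), mul_zero])]
    refine setIntegral_congr_fun ?_ fun x hx => ?_
    · have : {x : Fin d → ℝ | ∀ i, x i ∈ Ioc (-(1 / 2) : ℝ) (-(1 / 2) + 1)} =
        Set.pi univ fun _ => Ioc (-(1 / 2) : ℝ) (-(1 / 2) + 1) := by ext; simp
      rw [this]
      exact MeasurableSet.univ_pi fun _ => measurableSet_Ioc
    · show UnitAddTorus.mFourier (-k) (p x) • f (s (p x)) = _
      rw [hsp x hx, smul_eq_mul]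
      exact congrArg (· * f x) (mFourier_coe (-k) x)
  have hsum : Summable (UnitAddTorus.mFourierCoeff Fc) := by
    refine hs.congr fun k => (hcoef k).symm
  have h := UnitAddTorus.hasSum_mFourier_series_apply_of_summable hsum (p x)
  have hfx : Fc (p x) = f x := congrArg f (hsp x (hsub hx))
  rw [hfx] at h
  have h2 : (fun k => UnitAddTorus.mFourierCoeff Fc k • UnitAddTorus.mFourier k (p x)) =
      fun k : Fin d → ℤ => (∫ x, wave (-k) x * f x) * wave k x :=
    funext fun k => by rw [hcoef, smul_eq_mul]; exact congrArg _ (mFourier_coe k x)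
  rwa [h2] at h

/-- The integer vectors form a lattice in `ℝᵈ`, and inverse powers of the norm with exponent above
the rank are summable over a lattice. -/
theorem exists_summable_one_add_norm_pow_inv (d : ℕ) :
    ∃ N : ℕ, Summable fun k : Fin d → ℤ => ((1 + ‖k‖) ^ N)⁻¹ := by
  let L : Submodule ℤ (Fin d → ℝ) := Submodule.span ℤ (range (Pi.basisFun ℝ (Fin d)))
  let f : (Fin d → ℤ) → L := fun k => ⟨fun j => (k j : ℝ), by
    have h : (fun j => (k j : ℝ)) = ∑ j, k j • Pi.basisFun ℝ (Fin d) j := by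
      funext i
      simp [Pi.single_apply]
    rw [h]
    exact Submodule.sum_mem _ fun j _ => Submodule.smul_mem _ _ (Submodule.subset_span ⟨j, rfl⟩)⟩
  have hf : Function.Injective f := fun k k' h => funext fun j => by
    have h1 : (k j : ℝ) = k' j := congrFun (congrArg Subtype.val h) j
    exact_mod_cast h1
  have hn : ∀ k, ‖f k‖ = ‖k‖ := by
    intro k
    show ‖(f k).1‖ = ‖k‖
    refine le_antisymm ((pi_norm_le_iff_of_nonneg (norm_nonneg _)).2 fun j => ?_)
      ((pi_norm_le_iff_of_nonneg (norm_nonneg _)).2 fun j => ?_)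
    · exact (Int.norm_cast_real (k j)).trans_le (norm_le_pi_norm k j)
    · exact (Int.norm_cast_real (k j)).symm.trans_le (norm_le_pi_norm (f k).1 j)
  refine ⟨Module.finrank ℤ L + 1, ?_⟩
  have h := (ZLattice.summable_norm_pow_inv (L := L) _ (Nat.lt_succ_self _)).comp_injective hf
  refine Summable.of_norm_bounded_eventually h ?_
  -- The comparison with the lattice sum fails only at `k = 0`, where the inverse norm is zero by
  -- convention.
  refine (Set.finite_singleton (0 : Fin d → ℤ)).subset fun k hk => ?_
  by_contra hk0
  refine hk ?_
  have h0 : 0 < ‖k‖ := norm_pos_iff.2 hk0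
  show ‖((1 + ‖k‖) ^ (Module.finrank ℤ L + 1))⁻¹‖ ≤ ‖f k‖⁻¹ ^ (Module.finrank ℤ L + 1)
  rw [hn, norm_inv, norm_pow, Real.norm_of_nonneg (by positivity), inv_pow]
  gcongr
  linarith

end Wave

/-! ### Continuous seminorms on smooth functions and bounds on derivatives -/

section Growth

variable {E G : Type*} [NormedAddCommGroup E] [NormedSpace ℝ E] [FiniteDimensional ℝ E]
  [NormedAddCommGroup G] [NormedSpace ℂ G] [CompleteSpace G]

/-- A neighbourhood of `0` constrains finitely many derivatives on compact sets, so global bounds up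
to some order `r` are enough. Scaling `h` by `δ / (2 * B)` makes these derivatives at most `δ / 2`
and puts `h` in the unit ball of `p`, whence the constant `2 / δ`. -/
theorem CInf.exists_seminorm_le {p : Seminorm ℂ (CInf G (⊤ : TopologicalSpace.Opens E))}
    (hp : Continuous p) : ∃ (r : ℕ) (C : ℝ), 0 ≤ C ∧
      ∀ (h : CInf G (⊤ : TopologicalSpace.Opens E)) (B : ℝ), 0 < B →
        (∀ j ≤ r, ∀ z, ‖iteratedFDeriv ℝ j h z‖ ≤ B) → p h ≤ C * B := by
  have h1 : {h | p h < 1} ∈ 𝓝 (0 : CInf G (⊤ : TopologicalSpace.Opens E)) :=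
    hp.continuousAt.eventually_lt continuousAt_const (by simp)
  rw [isUniformInducing_jet.isInducing.nhds_eq_comap, map_zero] at h1
  obtain ⟨t, ht, htp⟩ := h1
  rw [nhds_pi, Filter.mem_pi] at ht
  obtain ⟨S, hS, V, hV, hVt⟩ := ht
  have h2 : ∀ k, ∃ ε > 0, ∀ f : C((⊤ : TopologicalSpace.Opens E), E [×k]→L[ℝ] G),
      (∀ z, ‖f z‖ < ε) → f ∈ V k := by
    intro k
    obtain ⟨W, hW, hWV⟩ := UniformSpace.mem_nhds_iff.1 (hV k)
    obtain ⟨K, W', _, hW', h⟩ := (ContinuousMap.mem_compactConvergence_entourage_iff W).1 hW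
    obtain ⟨ε, hε, hd⟩ := Metric.mem_uniformity_dist.1 hW'
    refine ⟨ε, hε, fun f hf => hWV (h fun z _ => hd ?_)⟩
    rw [dist_comm, dist_eq_norm]
    simpa using hf z
  choose ε hε hεV using h2
  obtain ⟨δ, hδ, hδε⟩ : ∃ δ > 0, ∀ k ∈ S, δ ≤ ε k := by
    have h3 : ∀ᶠ δ in 𝓝[>] (0 : ℝ), ∀ k ∈ S, δ ≤ ε k := (Filter.eventually_all_finite hS).2
      fun k _ => mem_nhdsWithin_of_mem_nhds (Iic_mem_nhds (hε k))
    obtain ⟨δ, h, h'⟩ := (h3.and self_mem_nhdsWithin).exists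
    exact ⟨δ, h', h⟩
  obtain ⟨r, hr⟩ := hS.bddAbove
  refine ⟨r, 2 / δ, by positivity, fun h B hB hle => ?_⟩
  have h3 : (δ / (2 * B) : ℂ) • h ∈ jet G ⊤ ⁻¹' t := hVt fun k hk => hεV k _ fun z => by
    rw [jet_apply]
    have h4 : iteratedFDeriv ℝ k ((δ / (2 * B) : ℂ) • h : CInf G (⊤ : TopologicalSpace.Opens E)) z =
        (δ / (2 * B) : ℂ) • iteratedFDeriv ℝ k h z :=
      iteratedFDeriv_const_smul_apply ((h.contDiffAt z.2).of_le (by exact_mod_cast le_top))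
    rw [h4, norm_smul]
    have h5 : ‖(δ / (2 * B) : ℂ)‖ = δ / (2 * B) := by
      rw [show (δ / (2 * B) : ℂ) = ((δ / (2 * B) : ℝ) : ℂ) by push_cast; rfl, Complex.norm_real,
        Real.norm_of_nonneg (by positivity)]
    rw [h5]
    calc δ / (2 * B) * _ ≤ δ / (2 * B) * B := by gcongr; exact hle k (hr hk) z
      _ = δ / 2 := by field_simp
      _ < ε k := by linarith [hδε k hk]
  have h4 : p ((δ / (2 * B) : ℂ) • h) < 1 := htp h3
  rw [map_smul_eq_mul, show (δ / (2 * B) : ℂ) = ((δ / (2 * B) : ℝ) : ℂ) by push_cast; rfl,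
    Complex.norm_real, Real.norm_of_nonneg (by positivity), div_mul_eq_mul_div,
    div_lt_one (by positivity)] at h4
  rw [div_mul_eq_mul_div, le_div_iff₀ hδ]
  linarith

end Growth

attribute [local instance] FiniteDimensional.complexToReal

open Filter MeasureTheory
open scoped BoundedContinuousFunction

/-! ### Integrals of smooth families of functions -/

section Family

variable {d : ℕ} {F : Type*} [NormedAddCommGroup F] [NormedSpace ℂ F] [FiniteDimensional ℂ F]
  {H' : Type*} [TopologicalSpace H'] {J : ModelWithCorners ℂ F H'} [J.Boundaryless]
  {Y : Type v} [TopologicalSpace Y] [ChartedSpace H' Y] [IsManifold J ω Y]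

variable (J) in
/-- A smooth family of functions on `Y` indexed by `ℝᵈ` that vanishes outside a compact set. -/
structure IsSmoothFamily (K : Set (Fin d → ℝ)) (u : (Fin d → ℝ) → Y → ℂ) : Prop where
  isCompact : IsCompact K
  smooth : ∀ y₀ : Y, ContDiffOn ℝ ∞
    (fun q : (Fin d → ℝ) × F => u q.1 ((extChartAt J y₀).symm q.2))
    (univ ×ˢ (extChartAt J y₀).target)
  zero : ∀ x ∉ K, ∀ y, u x y = 0

namespace IsSmoothFamily

variable {K : Set (Fin d → ℝ)} {u : (Fin d → ℝ) → Y → ℂ} (hu : IsSmoothFamily J K u)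

include hu

theorem contDiffAt (y₀ : Y) (x : Fin d → ℝ) {w : F} (hw : w ∈ (extChartAt J y₀).target) :
    ContDiffAt ℝ ∞ (fun q : (Fin d → ℝ) × F => u q.1 ((extChartAt J y₀).symm q.2)) (x, w) :=
  (hu.smooth y₀).contDiffAt ((isOpen_univ.prod (isOpen_extChartAt_target y₀)).mem_nhds
    ⟨mem_univ _, hw⟩)

theorem contDiff (y : Y) : ContDiff ℝ ∞ fun x => u x y := by
  rw [contDiff_iff_contDiffAt]
  intro x
  have h := (hu.contDiffAt y x (mem_extChartAt_target y)).comp x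
    (contDiffAt_id.prodMk (contDiffAt_const (c := extChartAt J y y)))
  simpa [Function.comp_def, extChartAt_to_inv] using h

theorem hasCompactSupport (y : Y) : HasCompactSupport fun x => u x y :=
  HasCompactSupport.intro hu.isCompact fun x hx => hu.zero x hx y

theorem integrable_mul {h : (Fin d → ℝ) → ℂ} (hh : Continuous h) (y : Y) :
    Integrable fun x => h x * u x y :=
  (hh.mul (hu.contDiff y).continuous).integrable_of_hasCompactSupport
    ((hu.hasCompactSupport y).mul_left)

theorem contDiffOn_integral {h : (Fin d → ℝ) → ℂ} (hh : Continuous h) (y₀ : Y) :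
    ContDiffOn ℝ ∞ (fun w => ∫ x, h x * u x ((extChartAt J y₀).symm w))
      (extChartAt J y₀).target := by
  -- The integral is the convolution of `h` with the reflected function `x ↦ u (-x) y`, evaluated at
  -- `0`; hence the set `-K` and the constant map `v`.
  have h1 := contDiffOn_convolution_right_with_param_comp (𝕜 := ℝ) (n := ⊤) (μ := volume)
    (ContinuousLinearMap.mul ℝ ℂ) (s := (extChartAt J y₀).target) (v := fun _ : F => (0 : Fin d → ℝ))
    contDiffOn_const (f := h) (g := fun w x => u (-x) ((extChartAt J y₀).symm w)) (k := -K)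
    (isOpen_extChartAt_target y₀) hu.isCompact.neg
    (fun w x _ hx => hu.zero _ (fun hk => hx hk) _) hh.locallyIntegrable
    ((hu.smooth y₀).comp (contDiff_snd.neg.prodMk contDiff_fst).contDiffOn
      fun q hq => ⟨mem_univ _, hq.1⟩)
  refine h1.congr fun w _ => ?_
  simp [convolution]

/-- The map `h ↦ ∫ h(x) u(x, ·) dx`. -/
def integralLin : ((Fin d → ℝ) →ᵇ ℂ) →ₗ[ℂ] DForm.gr J (X := Y) 0 where
  toFun h := ⟨⟨fun y => algebraMap ℂ (ExtConj F) (∫ x, h x * u x y), fun y₀ =>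
    ((((Algebra.linearMap ℂ (ExtConj F)).toContinuousLinearMap.restrictScalars ℝ).contDiff
      ).comp_contDiffOn (hu.contDiffOn_integral h.continuous y₀)).congr
      fun w _ => AlgHom.commutes _ _⟩, fun y => by
    rw [ExtConj.gr_zero]
    exact Submodule.algebraMap_mem _⟩
  map_add' h h' := Subtype.ext (DForm.ext fun y => by
    refine Eq.trans (congrArg (algebraMap ℂ (ExtConj F)) ?_) (map_add (algebraMap ℂ (ExtConj F)) _ _)
    simp only [BoundedContinuousFunction.coe_add, Pi.add_apply, add_mul]
    exact integral_add (hu.integrable_mul h.continuous y) (hu.integrable_mul h'.continuous y))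
  map_smul' c h := Subtype.ext (DForm.ext fun y => by
    refine Eq.trans (congrArg (algebraMap ℂ (ExtConj F)) ?_)
      (map_smul (Algebra.linearMap ℂ (ExtConj F)) c _)
    simp only [BoundedContinuousFunction.coe_smul, smul_mul_assoc]
    exact integral_smul c _)

theorem continuous_integralLin [SecondCountableTopology Y] : Continuous hu.integralLin := by
  refine (DForm.continuous_of_eval ((DForm.gr J (X := Y) 0).subtype ∘ₗ hu.integralLin)
    fun y => ?_).subtype_mk _
  have hint : Integrable fun x => u x y :=
    (hu.contDiff y).continuous.integrable_of_hasCompactSupport (hu.hasCompactSupport y)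
  let f : ((Fin d → ℝ) →ᵇ ℂ) →ₗ[ℂ] ℂ :=
    { toFun := fun h => ∫ x, h x * u x y
      map_add' := fun h h' => by
        simp only [BoundedContinuousFunction.coe_add, Pi.add_apply, add_mul]
        exact integral_add (hu.integrable_mul h.continuous y) (hu.integrable_mul h'.continuous y)
      map_smul' := fun c h => by
        simp only [BoundedContinuousFunction.coe_smul, smul_mul_assoc]
        exact integral_smul c _ }
  have hf : Continuous f := (f.mkContinuous (∫ x, ‖u x y‖) fun h => by
    refine (norm_integral_le_integral_norm _).trans ?_
    rw [mul_comm, ← integral_const_mul]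
    refine integral_mono (hu.integrable_mul h.continuous y).norm (hint.norm.const_mul _) fun x => ?_
    simp only [norm_mul]
    gcongr
    exact h.norm_coe_le_norm x).continuous
  exact ((Algebra.linearMap ℂ (ExtConj F)).continuous_of_finiteDimensional).comp hf

/-- Derivatives along `ℝᵈ` stay within the class of smooth families supported over `K`, which is
what allows repeated integration by parts. -/
theorem deriv (j : Fin d) :
    IsSmoothFamily J K fun x y => fderiv ℝ (fun x => u x y) x (Pi.single j 1) where
  isCompact := hu.isCompact
  smooth y₀ := by
    have h1 : ContDiffOn ℝ ∞ (fun q => fderiv ℝ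
        (fun q : (Fin d → ℝ) × F => u q.1 ((extChartAt J y₀).symm q.2)) q
          ((Pi.single j 1 : Fin d → ℝ), (0 : F)))
        (univ ×ˢ (extChartAt J y₀).target) :=
      ((hu.smooth y₀).fderiv_of_isOpen (isOpen_univ.prod (isOpen_extChartAt_target y₀))
        (by simp)).clm_apply contDiffOn_const
    refine h1.congr ?_
    rintro ⟨x, w⟩ ⟨-, hw⟩
    have h2 := ((hu.contDiffAt y₀ x hw).differentiableAt (by simp)).hasFDerivAt
    have h3 := HasFDerivAt.comp (f := fun x : Fin d → ℝ => (id x, w)) x h2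
      ((hasFDerivAt_id x).prodMk (hasFDerivAt_const w x))
    have h4 : ((fun q : (Fin d → ℝ) × F => u q.1 ((extChartAt J y₀).symm q.2)) ∘
      fun x => (id x, w)) = fun x => u x ((extChartAt J y₀).symm w) := rfl
    rw [h4] at h3
    show fderiv ℝ (fun x => u x ((extChartAt J y₀).symm w)) x _ = _
    rw [h3.fderiv]
    simp
  zero x hx y := by
    have h1 : (fun x => u x y) =ᶠ[𝓝 x] fun _ => 0 := by
      filter_upwards [hu.isCompact.isClosed.isOpen_compl.mem_nhds hx] with x' hx'
      exact hu.zero x' hx' y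
    rw [h1.fderiv_eq]
    simp

end IsSmoothFamily

theorem continuous_wave (k : Fin d → ℤ) : Continuous (wave k) := by
  unfold wave
  fun_prop

/-- The exponential as a bounded continuous function. -/
def waveB (k : Fin d → ℤ) : (Fin d → ℝ) →ᵇ ℂ :=
  BoundedContinuousFunction.ofNormedAddCommGroup (wave k) (continuous_wave k) 1
    fun x => (norm_wave k x).le

theorem norm_waveB_le (k : Fin d → ℤ) : ‖waveB k‖ ≤ 1 :=
  BoundedContinuousFunction.norm_ofNormedAddCommGroup_le _ zero_le_one _

theorem hasFDerivAt_wave (k : Fin d → ℤ) (x : Fin d → ℝ) :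
    HasFDerivAt (wave k) ((wave k x * Complex.I) • (Complex.ofRealCLM.comp (freq k))) x := by
  have h := ((Complex.ofRealCLM.hasFDerivAt.comp x (freq k).hasFDerivAt).mul_const
    Complex.I).cexp
  refine h.congr_fderiv ?_
  ext v
  simp [wave, mul_assoc]

namespace IsSmoothFamily

variable {K : Set (Fin d → ℝ)} {u : (Fin d → ℝ) → Y → ℂ} (hu : IsSmoothFamily J K u)

include hu

/-- Integration by parts at each point of `Y`; there are no boundary terms because the family is
supported in a compact set. -/
theorem integralLin_deriv (j : Fin d) (k : Fin d → ℤ) :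
    (hu.deriv j).integralLin (waveB (-k)) =
      (2 * Real.pi * k j * Complex.I : ℂ) • hu.integralLin (waveB (-k)) := by
  refine Subtype.ext (DForm.ext fun y => ?_)
  have h1 : ∀ x, fderiv ℝ (wave (-k)) x (Pi.single j 1) =
      -(2 * Real.pi * k j * Complex.I : ℂ) * wave (-k) x := by
    intro x
    rw [(hasFDerivAt_wave _ _).fderiv]
    simp [freq_apply, Pi.single_apply]
    ring
  have h2 := integral_mul_fderiv_eq_neg_fderiv_mul_of_integrable (μ := volume) (f := wave (-k))
    (g := fun x => u x y) (v := Pi.single j 1)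
    (by
      simp only [h1, mul_assoc]
      exact (hu.integrable_mul (continuous_wave (-k)) y).const_mul _)
    ((hu.deriv j).integrable_mul (continuous_wave (-k)) y)
    (hu.integrable_mul (continuous_wave (-k)) y)
    (fun x _ => (hasFDerivAt_wave _ _).differentiableAt)
    (fun x _ => ((hu.contDiff y).differentiable (by simp)) x)
  refine Eq.trans (congrArg (algebraMap ℂ (ExtConj F)) ?_)
    (map_smul (Algebra.linearMap ℂ (ExtConj F)) _ _)
  refine h2.trans ?_
  have h3 : ∀ x, fderiv ℝ (wave (-k)) x (Pi.single j 1) * u x y =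
      -(2 * Real.pi * k j * Complex.I : ℂ) * (wave (-k) x * u x y) := fun x => by
    rw [h1, mul_assoc]
  simp only [h3]
  rw [integral_const_mul, smul_eq_mul, neg_mul, neg_neg]
  rfl

-- Differentiating the family multiplies its coefficient at `k` by `2πi kⱼ`, so boundedness of the
-- coefficients of all derivatives is rapid decay. The induction runs over all families at once,
-- since its step is applied to the derivatives of `u`.
omit hu in
theorem exists_decay_norm [SecondCountableTopology Y] {q : Seminorm ℂ (DForm.gr J (X := Y) 0)}
    (hq : Continuous q) (N : ℕ) {u : (Fin d → ℝ) → Y → ℂ} (hu : IsSmoothFamily J K u) :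
    ∃ C : ℝ, 0 ≤ C ∧ ∀ k, ‖k‖ ^ N * q (hu.integralLin (waveB (-k))) ≤ C := by
  induction N generalizing u with
  | zero =>
    obtain ⟨C, hC, h⟩ := (q.comp hu.integralLin).bound_of_continuous_normedSpace
      (hq.comp hu.continuous_integralLin)
    refine ⟨C, hC.le, fun k => ?_⟩
    rw [pow_zero, one_mul]
    calc q (hu.integralLin (waveB (-k))) ≤ C * ‖waveB (-k)‖ := h _
      _ ≤ C * 1 := by gcongr; exact norm_waveB_le _
      _ = C := mul_one C
  | succ N ih =>
    choose C hC h using fun j => ih (hu.deriv j)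
    refine ⟨∑ j, C j, Finset.sum_nonneg fun j _ => hC j, fun k => ?_⟩
    have h1 : ‖k‖ ≤ ∑ j, ‖k j‖ := (pi_norm_le_iff_of_nonneg
      (Finset.sum_nonneg fun j _ => norm_nonneg _)).2 fun j =>
        Finset.single_le_sum (f := fun j => ‖k j‖) (fun j _ => norm_nonneg _) (Finset.mem_univ j)
    have h2 : ∀ j, ‖k j‖ * (‖k‖ ^ N * q (hu.integralLin (waveB (-k)))) ≤ C j := by
      intro j
      have h3 := h j k
      rw [hu.integralLin_deriv, map_smul_eq_mul] at h3
      refine le_trans ?_ h3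
      have h4 : ‖(2 * Real.pi * k j * Complex.I : ℂ)‖ = 2 * Real.pi * ‖k j‖ := by
        simp [abs_of_nonneg Real.pi_nonneg, Int.norm_eq_abs]
      rw [h4]
      -- The factor `2π` is simply dropped, being at least `1`.
      have h5 : (1 : ℝ) ≤ 2 * Real.pi := by linarith [Real.pi_gt_three]
      calc _ = 1 * (‖k j‖ * (‖k‖ ^ N * q (hu.integralLin (waveB (-k))))) := (one_mul _).symm
        _ ≤ (2 * Real.pi) * (‖k j‖ * (‖k‖ ^ N * q (hu.integralLin (waveB (-k))))) := by
          gcongr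
        _ = _ := by ring
    calc ‖k‖ ^ (N + 1) * q (hu.integralLin (waveB (-k)))
        = ‖k‖ * (‖k‖ ^ N * q (hu.integralLin (waveB (-k)))) := by ring
      _ ≤ (∑ j, ‖k j‖) * (‖k‖ ^ N * q (hu.integralLin (waveB (-k)))) := by
        gcongr
      _ ≤ ∑ j, C j := by
        rw [Finset.sum_mul]
        exact Finset.sum_le_sum fun j _ => h2 j

theorem exists_decay [SecondCountableTopology Y] {q : Seminorm ℂ (DForm.gr J (X := Y) 0)}
    (hq : Continuous q) (N : ℕ) :
    ∃ C : ℝ, 0 ≤ C ∧ ∀ k, (1 + ‖k‖) ^ N * q (hu.integralLin (waveB (-k))) ≤ C := by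
  obtain ⟨C₀, hC₀, h₀⟩ := exists_decay_norm hq 0 hu
  obtain ⟨C, hC, h⟩ := exists_decay_norm hq N hu
  refine ⟨2 ^ N * (C₀ + C), by positivity, fun k => ?_⟩
  have hq0 := apply_nonneg q (hu.integralLin (waveB (-k)))
  have h1 : (1 + ‖k‖) ^ N ≤ 2 ^ N * (‖k‖ ^ 0 + ‖k‖ ^ N) := by
    rcases le_total ‖k‖ 1 with hk | hk
    · calc (1 + ‖k‖) ^ N ≤ 2 ^ N := by gcongr; linarith
        _ ≤ 2 ^ N * (‖k‖ ^ 0 + ‖k‖ ^ N) := le_mul_of_one_le_right (by positivity) (by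
          rw [pow_zero]; linarith [pow_nonneg (norm_nonneg k) N])
    · calc (1 + ‖k‖) ^ N ≤ (2 * ‖k‖) ^ N := by gcongr; linarith
        _ = 2 ^ N * ‖k‖ ^ N := mul_pow _ _ _
        _ ≤ 2 ^ N * (‖k‖ ^ 0 + ‖k‖ ^ N) := by gcongr; rw [pow_zero]; linarith
  calc (1 + ‖k‖) ^ N * q (hu.integralLin (waveB (-k)))
      ≤ 2 ^ N * (‖k‖ ^ 0 + ‖k‖ ^ N) * q (hu.integralLin (waveB (-k))) := by gcongr
    _ = 2 ^ N * (‖k‖ ^ 0 * q (hu.integralLin (waveB (-k))) +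
        ‖k‖ ^ N * q (hu.integralLin (waveB (-k)))) := by ring
    _ ≤ 2 ^ N * (C₀ + C) := by gcongr; exacts [h₀ k, h k]

/-- The Fourier coefficients of a smooth family are absolutely summable. -/
theorem summable_integral [SecondCountableTopology Y] (y : Y) :
    Summable fun k : Fin d → ℤ => ∫ x, wave (-k) x * u x y := by
  -- The scalar part recovers the integral from the form of degree zero, so the decay estimate can
  -- be applied to the absolute value of this form at `y`.
  let ℓ : ExtConj F →ₗ[ℂ] ℂ :=
    (ExteriorAlgebra.algebraMapInv (R := ℂ) (M := ConjDual F)).toLinearMap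
  let L : DForm.gr J (X := Y) 0 →ₗ[ℂ] ℂ := ℓ ∘ₗ DForm.evalL y ∘ₗ (DForm.gr J (X := Y) 0).subtype
  have hL : Continuous L := ℓ.continuous_of_finiteDimensional.comp
    ((DForm.continuous_eval y).comp continuous_subtype_val)
  obtain ⟨N, hN⟩ := exists_summable_one_add_norm_pow_inv d
  obtain ⟨C, hC, h⟩ := hu.exists_decay (q := (normSeminorm ℂ ℂ).comp L) (continuous_norm.comp hL) N
  refine Summable.of_norm_bounded (hN.mul_left C) fun k => ?_
  have h1 : L (hu.integralLin (waveB (-k))) = ∫ x, wave (-k) x * u x y :=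
    ExteriorAlgebra.algebraMap_leftInverse (R := ℂ) (ConjDual F) _
  have h2 : (1 + ‖k‖) ^ N * ‖L (hu.integralLin (waveB (-k)))‖ ≤ C := h k
  rw [h1] at h2
  rw [← div_eq_mul_inv, le_div_iff₀ (by positivity), mul_comm]
  exact h2

end IsSmoothFamily

end Family

attribute [local instance] FiniteDimensional.complexToReal

open Filter MeasureTheory
open scoped BoundedContinuousFunction

/-! ### Relative projectivity from a frame -/

section Frame

variable {M W : Type*} [AddCommGroup M] [Module ℂ M] [UniformSpace M] [FrechetSpace M]
  [AddCommGroup W] [Module ℂ W] [UniformSpace W] [FrechetSpace W]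

/-- A frame `x = ∑ r (e_a) (θ_a x)` splits the map `m ⊗ w ↦ r m w` by `x ↦ ∑ e_a ⊗ θ_a x`; `hs` is
the absolute convergence of this series in the completed tensor product. The last clause carries
linearity over: operators `f` and `g` that correspond under `θ` and `r` are intertwined by both
maps. -/
theorem CTensor.exists_section_of_frame (r : M →ₗ[ℂ] W →ₗ[ℂ] M)
    (hr : Continuous fun p : M × W => r p.1 p.2)
    {α : Type*} [Countable α] (e : α → M) (θ : α → M →L[ℂ] W)
    (hs : ∀ (p : Seminorm ℂ M) (q : Seminorm ℂ W), Continuous p → Continuous q →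
      ∀ x, Summable fun a => p (e a) * q (θ a x))
    (hsum : ∀ x, HasSum (fun a => r (e a) (θ a x)) x) :
    ∃ (s : M →L[ℂ] CTensorC M W) (π : CTensorC M W →L[ℂ] M), (∀ x, π (s x) = x) ∧
      ∀ (f : W →L[ℂ] W) (hf : ∀ (c : ℂ) n, f (LinearMap.lsmul ℂ W c n) = LinearMap.lsmul ℂ W c (f n))
        (g : M →L[ℂ] M),
        (∀ a x, θ a (g x) = f (θ a x)) → (∀ m w, r m (f w) = g (r m w)) →
        (∀ x, s (g x) = CTensor.map f hf (s x)) ∧ ∀ t, π (CTensor.map f hf t) = g (π t) := by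
  let b := CTensor.mk (LinearMap.lsmul ℂ M).flip (LinearMap.lsmul ℂ W)
  have hb : Continuous fun p : M × W => b p.1 p.2 := CTensor.continuous_tmul
  have hsm : ∀ x, Summable fun a => b (e a) (θ a x) := fun x =>
    FrechetSpace.summable_bilin b hb fun p q hp hq => hs p q hp hq x
  obtain ⟨s, h⟩ := FrechetSpace.exists_clm_hasSum (fun a => (clmRight b hb (e a)).comp (θ a)) hsm
  have h' : ∀ x, HasSum (fun a => CTensor.tmul (LinearMap.lsmul ℂ M).flip (LinearMap.lsmul ℂ W)
    (e a) (θ a x)) (s x) := h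
  let π : CTensorC M W →L[ℂ] M := CTensor.lift r hr fun x c a => by
    rw [LinearMap.flip_apply, LinearMap.lsmul_apply, LinearMap.lsmul_apply, map_smul, map_smul,
      LinearMap.smul_apply]
  have hπ : ∀ x a, π (CTensor.tmul _ _ x a) = r x a := fun x a => CTensor.lift_tmul _ _ _ x a
  refine ⟨s, π, fun x => ?_, fun f hf g h1 h2 => ⟨fun x => ?_, fun t => ?_⟩⟩
  · have h3 := π.hasSum (h' x)
    simp only [hπ] at h3
    exact h3.unique (hsum x)
  · have h3 := (CTensor.map f hf).hasSum (h' x)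
    simp only [CTensor.map_tmul, ← h1] at h3
    exact (h' (g x)).unique h3
  · have : π.comp (CTensor.map f hf) = g.comp π := CTensor.ext fun m n => by
      rw [ContinuousLinearMap.comp_apply, CTensor.map_tmul, hπ, ContinuousLinearMap.comp_apply, hπ,
        h2]
    exact DFunLike.congr_fun this t

end Frame

/-- The Fréchet space generating the free module is `M` itself; `f` and `g` are right multiplication
by `b` on `A` and on `M`. -/
theorem GrModule.isRelProjective_of_frame {𝒜 : CurvedDGA.{u}} (M : GrModule.{u, v} 𝒜)
    (hM : IsFrechet M) (hact : Continuous fun p : M × 𝒜.zero => M.ract p.1 p.2)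
    (hmul : ∀ x a b, M.ract x (𝒜.mulRight0 b a) = M.ract (M.ract x a) b)
    {α : Type*} [Countable α] (e : α → M) (θ : α → M →L[ℂ] 𝒜.zero)
    (hθ : ∀ a x b, θ a (M.ract x b) = 𝒜.mulRight0 b (θ a x))
    (hs : ∀ (p : Seminorm ℂ M) (q : Seminorm ℂ 𝒜.zero), Continuous p → Continuous q →
      ∀ x, Summable fun a => p (e a) * q (θ a x))
    (hsum : ∀ x, HasSum (fun a => M.ract (e a) (θ a x)) x) : M.IsRelProjective := by
  have := hM.frechetSpace
  obtain ⟨s, π, h, h'⟩ := CTensor.exists_section_of_frame M.ract hact e θ hs hsum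
  have hb := fun b => h' (𝒜.mulRight0 b) (fun c n => map_smul (𝒜.mulRight0 b) c n)
    (clmLeft M.ract hact b) (fun a x => hθ a x b) (fun m w => hmul m w b)
  exact ⟨M.carrier, inferInstance, inferInstance, inferInstance, hM, s, π, h,
    fun x b => (hb b).1 x, fun t b => (hb b).2 t⟩

attribute [local instance] FiniteDimensional.complexToReal

open Filter MeasureTheory
open scoped BoundedContinuousFunction

/-! ### Fourier frames -/

section FamilyCLM

variable {d : ℕ} {F : Type*} [NormedAddCommGroup F] [NormedSpace ℂ F] [FiniteDimensional ℂ F]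
  {H' : Type*} [TopologicalSpace H'] {J : ModelWithCorners ℂ F H'} [J.Boundaryless]
  {Y : Type v} [TopologicalSpace Y] [ChartedSpace H' Y] [IsManifold J ω Y]
  [SecondCountableTopology Y]
  {V : Type*} [AddCommGroup V] [Module ℂ V] [UniformSpace V] [FrechetSpace V]

/-- By the closed graph criterion `v ↦ U v` is continuous into bounded continuous functions, because
its point evaluations are. Integration against `h` over the compact set `K` is continuous there. -/
theorem continuous_integral_family {K : Set (Fin d → ℝ)} (hK : IsCompact K)
    (U : V →ₗ[ℂ] (Fin d → ℝ) → ℂ) (hc : ∀ v, Continuous (U v)) (h0 : ∀ v, ∀ x ∉ K, U v x = 0)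
    (hU : ∀ x, Continuous fun v => U v x) (h : (Fin d → ℝ) →ᵇ ℂ) :
    Continuous fun v => ∫ x, h x * U v x := by
  have hcs : ∀ v, HasCompactSupport (U v) := fun v => HasCompactSupport.intro hK (h0 v)
  choose C hC using fun v => (hcs v).exists_bound_of_continuous (hc v)
  let B : V →ₗ[ℂ] ((Fin d → ℝ) →ᵇ ℂ) :=
    { toFun := fun v => BoundedContinuousFunction.ofNormedAddCommGroup (U v) (hc v) (C v) (hC v)
      map_add' := fun v v' => BoundedContinuousFunction.ext fun x => congrFun (map_add U v v') x
      map_smul' := fun c v => BoundedContinuousFunction.ext fun x => congrFun (map_smul U c v) x }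
  have hB : Continuous B := FrechetSpace.continuous_of_separating B
    (fun (x : Fin d → ℝ) (g : (Fin d → ℝ) →ᵇ ℂ) => g x)
    (fun x => continuous_eval_const x)
    (fun _ _ h => BoundedContinuousFunction.ext h) hU
  have hi : ∀ g : (Fin d → ℝ) →ᵇ ℂ, IntegrableOn (fun x => h x * g x) K := fun g =>
    (h.continuous.mul g.continuous).continuousOn.integrableOn_compact hK
  let f : ((Fin d → ℝ) →ᵇ ℂ) →ₗ[ℂ] ℂ :=
    { toFun := fun g => ∫ x in K, h x * g x
      map_add' := fun g g' => by
        simp only [BoundedContinuousFunction.coe_add, Pi.add_apply, mul_add]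
        exact integral_add (hi g) (hi g')
      map_smul' := fun c g => by
        simp only [BoundedContinuousFunction.coe_smul, mul_smul_comm]
        exact integral_smul c _ }
  have hf : Continuous f := (f.mkContinuous (‖h‖ * volume.real K) fun g => by
    refine (norm_setIntegral_le_of_norm_le_const (C := ‖h‖ * ‖g‖) hK.measure_lt_top
      fun x _ => ?_).trans_eq (by ring)
    rw [norm_mul]
    gcongr
    · exact h.norm_coe_le_norm x
    · exact g.norm_coe_le_norm x).continuous
  refine (hf.comp hB).congr fun v => ?_
  refine setIntegral_eq_integral_of_forall_compl_eq_zero (f := fun x => h x * U v x) fun x hx => ?_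
  rw [h0 v x hx, mul_zero]

namespace IsSmoothFamily

variable {K : Set (Fin d → ℝ)} (U : V →ₗ[ℂ] (Fin d → ℝ) → Y → ℂ)
  (hU : ∀ v, IsSmoothFamily J K (U v))

/-- The map `v ↦ ∫ h(x) U(v)(x, ·) dx`. -/
def integralMap (h : (Fin d → ℝ) →ᵇ ℂ) : V →ₗ[ℂ] DForm.gr J (X := Y) 0 where
  toFun v := (hU v).integralLin h
  map_add' v v' := Subtype.ext (DForm.ext fun y => by
    refine Eq.trans (congrArg (algebraMap ℂ (ExtConj F)) ?_) (map_add (algebraMap ℂ (ExtConj F)) _ _)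
    simp only [map_add, Pi.add_apply, mul_add]
    exact integral_add ((hU v).integrable_mul h.continuous y)
      ((hU v').integrable_mul h.continuous y))
  map_smul' c v := Subtype.ext (DForm.ext fun y => by
    refine Eq.trans (congrArg (algebraMap ℂ (ExtConj F)) ?_)
      (map_smul (Algebra.linearMap ℂ (ExtConj F)) c _)
    simp only [map_smul, Pi.smul_apply, mul_smul_comm]
    exact integral_smul c _)

theorem continuous_integralMap (hc : ∀ x y, Continuous fun v => U v x y)
    (h : (Fin d → ℝ) →ᵇ ℂ) : Continuous (integralMap U hU h) := by
  refine (DForm.continuous_of_eval ((DForm.gr J (X := Y) 0).subtype ∘ₗ integralMap U hU h)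
    fun y => ?_).subtype_mk _
  have h1 := continuous_integral_family (hU 0).isCompact
    (U := { toFun := fun v x => U v x y
            map_add' := fun v v' => by rw [map_add]; rfl
            map_smul' := fun c v => by rw [map_smul]; rfl })
    (fun v => ((hU v).contDiff y).continuous) (fun v x hx => (hU v).zero x hx y)
    (fun x => hc x y) h
  exact ((Algebra.linearMap ℂ (ExtConj F)).continuous_of_finiteDimensional).comp h1

end IsSmoothFamily

end FamilyCLM

section Wave

variable {E : Type*} [NormedAddCommGroup E] [NormedSpace ℂ E] [FiniteDimensional ℂ E]

theorem exists_equiv_openCube {K : Set E} (hK : IsCompact K) :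
    ∃ L : E ≃L[ℝ] (Fin (Module.finrank ℝ E) → ℝ), L '' K ⊆ openCube (Module.finrank ℝ E) := by
  let L : E ≃L[ℝ] (Fin (Module.finrank ℝ E) → ℝ) :=
    ContinuousLinearEquiv.ofFinrankEq (Module.finrank_fin_fun ℝ).symm
  obtain ⟨R, hR⟩ := (hK.image L.continuous).isBounded.exists_norm_le
  have hR' : 0 < 2 * (|R| + 1) := by positivity
  -- As `|L z j| ≤ |R| < |R| + 1`, division by `2 * (|R| + 1)` puts every coordinate strictly
  -- between `-1/2` and `1/2`.
  refine ⟨L.trans (ContinuousLinearEquiv.smulLeft (Units.mk0 (2 * (|R| + 1))⁻¹ (by positivity))),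
    ?_⟩
  rintro _ ⟨z, hz, rfl⟩ j
  have h1 : ‖L z j‖ ≤ |R| := (norm_le_pi_norm (L z) j).trans ((hR _ ⟨z, hz, rfl⟩).trans (le_abs_self R))
  rw [Real.norm_eq_abs, abs_le] at h1
  show (2 * (|R| + 1))⁻¹ * L z j ∈ _
  have h3 : (2 * (|R| + 1))⁻¹ * L z j = L z j / (2 * (|R| + 1)) := by ring
  rw [h3]
  constructor
  · rw [lt_div_iff₀ hR']; linarith
  · rw [div_lt_iff₀ hR']; linarith

/-- The function `z ↦ e^{2πi k · L z} b`. -/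
def waveCInf {d : ℕ} (L : E →L[ℝ] (Fin d → ℝ)) (k : Fin d → ℤ) (b : ExtConj E) :
    CInf (ExtConj E) (⊤ : TopologicalSpace.Opens E) :=
  ⟨fun z => wave k (L z) • b, (contDiff_expSMul ((freq k).comp L) b).contDiffOn,
    fun _ h => absurd trivial h⟩

theorem waveCInf_growth {d : ℕ} (L : E →L[ℝ] (Fin d → ℝ)) (b : ExtConj E)
    {p : Seminorm ℂ (CInf (ExtConj E) (⊤ : TopologicalSpace.Opens E))} (hp : Continuous p) :
    ∃ (r : ℕ) (C : ℝ), 0 ≤ C ∧ ∀ k, p (waveCInf L k b) ≤ C * (1 + ‖k‖) ^ r := by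
  obtain ⟨r, C, hC, h⟩ := CInf.exists_seminorm_le hp
  -- The constant is at least `1`, so that lower powers of `c * (1 + ‖k‖)` are dominated by the
  -- `r`-th one. Likewise `‖b‖ + 1` keeps the bound positive.
  let c := 2 * Real.pi * d * ‖L‖ + 1
  have hc1 : 0 ≤ 2 * Real.pi * d * ‖L‖ := by positivity
  have hc : 1 ≤ c := by simp only [c]; linarith
  refine ⟨r, C * (c ^ r * (‖b‖ + 1)), by positivity, fun k => ?_⟩
  refine (h _ ((c * (1 + ‖k‖)) ^ r * (‖b‖ + 1)) (by positivity) fun j hj z => ?_).trans_eq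
    (by rw [mul_pow]; ring)
  refine (norm_iteratedFDeriv_expSMul_le ((freq k).comp L) b j z).trans ?_
  have h1 : ‖(freq k).comp L‖ ≤ c * (1 + ‖k‖) := by
    refine (ContinuousLinearMap.opNorm_comp_le _ _).trans ?_
    calc ‖freq k‖ * ‖L‖ ≤ (2 * Real.pi * d * ‖k‖) * ‖L‖ := by gcongr; exact norm_freq_le k
      _ = (2 * Real.pi * d * ‖L‖) * ‖k‖ := by ring
      _ ≤ c * (1 + ‖k‖) := by gcongr <;> simp [c]
  have h2 : 1 ≤ c * (1 + ‖k‖) := by nlinarith [norm_nonneg k]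
  gcongr
  · exact (pow_le_pow_left₀ (norm_nonneg _) h1 j).trans (pow_le_pow_right₀ h2 hj)
  · linarith

end Wave

attribute [local instance] FiniteDimensional.complexToReal

open Filter MeasureTheory
open scoped BoundedContinuousFunction

/-! ### Relative projectivity of the forms along the fibres -/

section Product

variable {E : Type*} [NormedAddCommGroup E] [NormedSpace ℂ E] [FiniteDimensional ℂ E]
  {H : Type*} [TopologicalSpace H] {I : ModelWithCorners ℂ E H} [I.Boundaryless]
  {X : Type u} [TopologicalSpace X] [ChartedSpace H X] [IsManifold I ω X]
  {F : Type*} [NormedAddCommGroup F] [NormedSpace ℂ F] [FiniteDimensional ℂ F]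
  {H' : Type*} [TopologicalSpace H'] {J : ModelWithCorners ℂ F H'} [J.Boundaryless]
  {Y : Type v} [TopologicalSpace Y] [ChartedSpace H' Y] [IsManifold J ω Y]

namespace ChartPartition

variable (P : ChartPartition I X)

theorem mem_K {x : X} {i : P.ι} (h : i ∈ P.idx x) : extChartAt I (P.c i) x ∈ P.K i := by
  obtain ⟨z, hz, rfl⟩ := P.mem_idx.1 h
  rwa [(extChartAt I (P.c i)).right_inv (P.subset i hz)]

/-- The dimension of the charts. -/
abbrev dim (_P : ChartPartition I X) : ℕ := Module.finrank ℝ E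

/-- Linear coordinates that map the compact set in the chart into the unit cube. -/
def coord (i : P.ι) : E ≃L[ℝ] (Fin P.dim → ℝ) := (exists_equiv_openCube (P.isCompact i)).choose

theorem coord_subset (i : P.ι) : P.coord i '' P.K i ⊆ openCube P.dim :=
  (exists_equiv_openCube (P.isCompact i)).choose_spec

/-- The coefficients of a form on `X × Y` in a chart of `X`. -/
def fibreCoeff (i : P.ι) (β : ExtConj E →ₗ[ℂ] ℂ) :
    DForm (I.prod J) (X × Y) →ₗ[ℂ] (Fin P.dim → ℝ) → Y → ℂ where
  toFun η t y := P.wt i ((P.coord i).symm t) *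
    β (pull (tangentCoordChange I (P.c i) ((extChartAt I (P.c i)).symm ((P.coord i).symm t))
        ((extChartAt I (P.c i)).symm ((P.coord i).symm t)))
      (pull (ContinuousLinearMap.inl ℂ E F)
        (η ((extChartAt I (P.c i)).symm ((P.coord i).symm t), y))))
  map_add' η η' := funext fun t => funext fun y => by
    rw [DForm.coe_add, map_add, map_add, map_add, mul_add]
    rfl
  map_smul' c η := funext fun t => funext fun y => by
    rw [DForm.coe_smul, map_smul, map_smul, map_smul, smul_eq_mul, mul_left_comm]
    rfl

theorem fibreCoeff_apply (i : P.ι) (β : ExtConj E →ₗ[ℂ] ℂ) (η : DForm (I.prod J) (X × Y))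
    (t : Fin P.dim → ℝ) (y : Y) : P.fibreCoeff i β η t y = P.wt i ((P.coord i).symm t) *
    β (pull (tangentCoordChange I (P.c i) ((extChartAt I (P.c i)).symm ((P.coord i).symm t))
        ((extChartAt I (P.c i)).symm ((P.coord i).symm t)))
      (pull (ContinuousLinearMap.inl ℂ E F)
        (η ((extChartAt I (P.c i)).symm ((P.coord i).symm t), y)))) := rfl

theorem pull_inl_inChart (η : X × Y → ExtConj (E × F)) (x₀ : X) (y₀ : Y) {z : E} {w : F}
    (hz : z ∈ (extChartAt I x₀).target) (hw : w ∈ (extChartAt J y₀).target) :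
    pull (ContinuousLinearMap.inl ℂ E F) (inChart (I.prod J) η (x₀, y₀) (z, w)) =
      pull (tangentCoordChange I x₀ ((extChartAt I x₀).symm z) ((extChartAt I x₀).symm z))
        (pull (ContinuousLinearMap.inl ℂ E F)
          (η ((extChartAt I x₀).symm z, (extChartAt J y₀).symm w))) := by
  rw [inChart_prod _ _ _ hz hw, pull_comp, pull_comp]
  congr 2
  ext v <;> simp

/-- Outside the chart of `X` the coordinate expression carries no information, but there `wt i`
already vanishes on a neighbourhood. -/
theorem isSmoothFamily_fibreCoeff (i : P.ι) (β : ExtConj E →ₗ[ℂ] ℂ)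
    (η : DForm (I.prod J) (X × Y)) :
    IsSmoothFamily J (P.coord i '' P.K i) (P.fibreCoeff i β η) where
  isCompact := (P.isCompact i).image (P.coord i).continuous
  smooth y₀ := by
    rintro ⟨t, w⟩ ⟨-, hw⟩
    refine ContDiffAt.contDiffWithinAt ?_
    by_cases hz : (P.coord i).symm t ∈ (extChartAt I (P.c i)).target
    · have h1 : ContDiffAt ℝ ∞ (fun q : E × F => P.wt i q.1 * β (pull (ContinuousLinearMap.inl ℂ E F)
          (inChart (I.prod J) η.1 (P.c i, y₀) q))) ((P.coord i).symm t, w) :=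
        ((P.contDiff_wt i).comp contDiff_fst).contDiffAt.mul
          ((ExtConj.contDiff_linear (β ∘ₗ (pull (ContinuousLinearMap.inl ℂ E F)).toLinearMap)
            ).contDiffAt.comp _ (η.contDiffAt (P.c i, y₀) (mem_target_prod.2 ⟨hz, hw⟩)))
      have h2 : ContDiffAt ℝ ∞ (fun q : (Fin P.dim → ℝ) × F => ((P.coord i).symm q.1, q.2)) (t, w) :=
        (((P.coord i).symm.contDiff.comp contDiff_fst).prodMk contDiff_snd).contDiffAt
      refine (ContDiffAt.comp (t, w) h1 h2).congr_of_eventuallyEq ?_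
      filter_upwards [prod_mem_nhds ((P.coord i).symm.continuous.continuousAt.preimage_mem_nhds
        ((isOpen_extChartAt_target (P.c i)).mem_nhds hz))
        ((isOpen_extChartAt_target y₀).mem_nhds hw)] with q hq
      rw [Function.comp_apply, pull_inl_inChart _ _ _ hq.1 hq.2]
      rfl
    · have hK : (P.coord i).symm t ∉ P.K i := fun h => hz (P.subset i h)
      refine (contDiffAt_const (c := (0 : ℂ))).congr_of_eventuallyEq ?_
      filter_upwards [prod_mem_nhds ((P.coord i).symm.continuous.continuousAt.preimage_mem_nhds
        ((P.isCompact i).isClosed.isOpen_compl.mem_nhds hK))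
        ((isOpen_extChartAt_target y₀).mem_nhds hw)] with q hq
      rw [fibreCoeff_apply, P.wt_zero i _ hq.1, zero_mul]
  zero t ht y := by
    have hK : (P.coord i).symm t ∉ P.K i := fun h => ht ⟨_, h, (P.coord i).apply_symm_apply t⟩
    rw [fibreCoeff_apply, P.wt_zero i _ hK, zero_mul]

theorem continuous_fibreCoeff [SecondCountableTopology X] [SecondCountableTopology Y] (i : P.ι)
    (β : ExtConj E →ₗ[ℂ] ℂ) (t : Fin P.dim → ℝ) (y : Y) :
    Continuous fun η : DForm (I.prod J) (X × Y) => P.fibreCoeff i β η t y :=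
  continuous_const.mul ((β ∘ₗ (pull (tangentCoordChange I (P.c i) _ _)).toLinearMap ∘ₗ
    (pull (ContinuousLinearMap.inl ℂ E F)).toLinearMap).continuous_of_finiteDimensional.comp
    (DForm.continuous_eval _))

/-- The index set of the Fourier frame. -/
abbrev FrameIdx : Type _ :=
  (P.ι × Fin (Module.finrank ℂ (ExtConj E))) × (Fin P.dim → ℤ)

open Classical in
/-- The forms of the Fourier frame. -/
def frameForm [T2Space X] (a : P.FrameIdx) : DForm I X :=
  P.glue (Pi.single a.1.1
    (waveCInf (P.coord a.1.1 : E →L[ℝ] _) a.2 (Module.finBasis ℂ (ExtConj E) a.1.2)))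

variable [SecondCountableTopology X] [SecondCountableTopology Y]

/-- The coefficients of the Fourier frame. -/
def frameCoeff (a : P.FrameIdx) : DForm (I.prod J) (X × Y) →L[ℂ] DForm.gr J (X := Y) 0 :=
  ⟨IsSmoothFamily.integralMap (P.fibreCoeff a.1.1 ((Module.finBasis ℂ (ExtConj E)).coord a.1.2))
      (P.isSmoothFamily_fibreCoeff _ _) (waveB (-a.2)),
    IsSmoothFamily.continuous_integralMap _ _ (P.continuous_fibreCoeff _ _) _⟩

theorem frameCoeff_apply (a : P.FrameIdx) (η : DForm (I.prod J) (X × Y)) (y : Y) :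
    (P.frameCoeff (J := J) (Y := Y) a η).1 y = algebraMap ℂ (ExtConj F) (∫ t, wave (-a.2) t *
      P.fibreCoeff a.1.1 ((Module.finBasis ℂ (ExtConj E)).coord a.1.2) η t y) := rfl

/-- The function `f` depends only on the point of `Y` and not on the variable of integration, so it
comes out of the integral. This is the `𝒜(Y)`-linearity of the frame coefficients. -/
theorem frameCoeff_mul (a : P.FrameIdx) (η : DForm (I.prod J) (X × Y))
    (f : DForm.gr J (X := Y) 0) :
    (P.frameCoeff (J := J) (Y := Y) a (η * sndPull I X J f.1)).1 =
      (P.frameCoeff (J := J) (Y := Y) a η).1 * f.1 := by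
  refine DForm.ext fun y => ?_
  obtain ⟨c, hc⟩ := ExtConj.exists_of_mem_gr_zero (f.2 y)
  have h1 : ∀ t, P.fibreCoeff a.1.1 ((Module.finBasis ℂ (ExtConj E)).coord a.1.2)
      (η * sndPull I X J f.1) t y =
      P.fibreCoeff a.1.1 ((Module.finBasis ℂ (ExtConj E)).coord a.1.2) η t y * c := by
    intro t
    have h2 : ∀ x, (η * sndPull I X J f.1) (x, y) = c • η (x, y) := by
      intro x
      rw [DForm.coe_mul, sndPull_apply]
      show η (x, y) * pull _ (f.1 y) = _
      rw [hc, AlgHom.commutes, Algebra.algebraMap_eq_smul_one, mul_smul_comm, mul_one]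
    rw [fibreCoeff_apply, fibreCoeff_apply, h2, map_smul, map_smul, map_smul, smul_eq_mul]
    ring
  rw [DForm.coe_mul, hc, frameCoeff_apply, frameCoeff_apply, ← map_mul]
  congr 1
  simp only [h1, ← mul_assoc]
  exact integral_mul_const _ _

end ChartPartition

end Product

attribute [local instance] FiniteDimensional.complexToReal

open Filter MeasureTheory
open scoped BoundedContinuousFunction

/-! ### Convergence of the Fourier frame -/

section Product

variable {E : Type*} [NormedAddCommGroup E] [NormedSpace ℂ E] [FiniteDimensional ℂ E]
  {H : Type*} [TopologicalSpace H] {I : ModelWithCorners ℂ E H} [I.Boundaryless]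
  {X : Type u} [TopologicalSpace X] [ChartedSpace H X] [IsManifold I ω X]
  {F : Type*} [NormedAddCommGroup F] [NormedSpace ℂ F] [FiniteDimensional ℂ F]
  {H' : Type*} [TopologicalSpace H'] {J : ModelWithCorners ℂ F H'} [J.Boundaryless]
  {Y : Type v} [TopologicalSpace Y] [ChartedSpace H' Y] [IsManifold J ω Y]
  [T2Space X] [SecondCountableTopology X] [SecondCountableTopology Y]

namespace ChartPartition

variable (P : ChartPartition I X)

-- Gluing the piece of a single chart is continuous and linear, so this is the polynomial growth of
-- the exponentials in `C^∞`.
open Classical in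
theorem frameForm_growth {p : Seminorm ℂ (DForm I X)} (hp : Continuous p)
    (b : P.ι × Fin (Module.finrank ℂ (ExtConj E))) :
    ∃ (r : ℕ) (C : ℝ), 0 ≤ C ∧ ∀ k, p (P.frameForm (b, k)) ≤ C * (1 + ‖k‖) ^ r := by
  let g : CInf (ExtConj E) (⊤ : TopologicalSpace.Opens E) →ₗ[ℂ] DForm I X :=
    P.glue ∘ₗ LinearMap.single ℂ (fun _ => CInf (ExtConj E) (⊤ : TopologicalSpace.Opens E)) b.1
  have hg : Continuous g := P.continuous_glue.comp
    (continuous_single (A := fun _ : P.ι => CInf (ExtConj E) (⊤ : TopologicalSpace.Opens E)) b.1)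
  exact waveCInf_growth (P.coord b.1 : E →L[ℝ] (Fin P.dim → ℝ))
    (Module.finBasis ℂ (ExtConj E) b.2) (p := p.comp g) (hp.comp hg)

/-- Only finitely many charts are seen by `p`. In each of them the polynomial growth of the frame
forms is beaten by the rapid decay of the coefficients. -/
theorem summable_frame {p : Seminorm ℂ (DForm I X)} {q : Seminorm ℂ (DForm.gr J (X := Y) 0)}
    (hp : Continuous p) (hq : Continuous q) (η : DForm (I.prod J) (X × Y)) :
    Summable fun a : P.FrameIdx => p (P.frameForm a) * q (P.frameCoeff a η) := by
  obtain ⟨s, hs⟩ := P.finite_seminorm_glue hp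
  have h0 : ∀ b : P.ι × Fin (Module.finrank ℂ (ExtConj E)), b ∉ s ×ˢ (Finset.univ : Finset _) →
      ∀ k, p (P.frameForm (b, k)) * q (P.frameCoeff (b, k) η) = 0 := by
    intro b hb k
    have : p (P.frameForm (b, k)) = 0 :=
      hs b.1 (fun h => hb (Finset.mem_product.2 ⟨h, Finset.mem_univ _⟩)) _
    rw [this, zero_mul]
  refine (summable_prod_of_nonneg fun a => mul_nonneg (apply_nonneg p _) (apply_nonneg q _)).2
    ⟨fun b => ?_, summable_of_ne_finset_zero (s := s ×ˢ Finset.univ) fun b hb => by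
      simp only [h0 b hb, tsum_zero]⟩
  obtain ⟨r, C, hC, h⟩ := P.frameForm_growth hp b
  obtain ⟨N, hN⟩ := exists_summable_one_add_norm_pow_inv P.dim
  -- Of the exponent `r + N`, the part `r` absorbs the growth of the frame form and `N` is left for
  -- summability over the frequencies.
  obtain ⟨C', hC', h'⟩ := (P.isSmoothFamily_fibreCoeff b.1
    ((Module.finBasis ℂ (ExtConj E)).coord b.2) η).exists_decay hq (r + N)
  refine Summable.of_nonneg_of_le
    (fun k => mul_nonneg (apply_nonneg p _) (apply_nonneg q _)) (fun k => ?_)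
    (hN.mul_left (C * C'))
  have h1 : (1 + ‖k‖) ^ (r + N) * q (P.frameCoeff (b, k) η) ≤ C' := h' k
  rw [← div_eq_mul_inv, le_div_iff₀ (by positivity)]
  calc p (P.frameForm (b, k)) * q (P.frameCoeff (b, k) η) * (1 + ‖k‖) ^ N
      ≤ C * (1 + ‖k‖) ^ r * q (P.frameCoeff (b, k) η) * (1 + ‖k‖) ^ N := by
        gcongr
        exact h k
    _ = C * ((1 + ‖k‖) ^ (r + N) * q (P.frameCoeff (b, k) η)) := by rw [pow_add]; ring
    _ ≤ C * C' := by gcongr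

omit [SecondCountableTopology X] [SecondCountableTopology Y] in
theorem frameForm_of_mem {a : P.FrameIdx} {x : X} (h : a.1.1 ∈ P.idx x) : P.frameForm a x =
    (P.cut a.1.1 (extChartAt I (P.c a.1.1) x) *
      wave a.2 (P.coord a.1.1 (extChartAt I (P.c a.1.1) x))) •
      pull (tangentCoordChange I x (P.c a.1.1) x) (Module.finBasis ℂ (ExtConj E) a.1.2) := by
  refine (P.glue_single _ _ _).trans ((P.glue1_of_mem h _).trans ?_)
  rw [mul_smul, ← map_smul (pull _) (wave _ _)]
  rfl

omit [SecondCountableTopology X] [SecondCountableTopology Y] in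
theorem frameForm_of_notMem {a : P.FrameIdx} {x : X} (h : a.1.1 ∉ P.idx x) :
    P.frameForm a x = 0 :=
  (P.glue_single _ _ _).trans (P.glue1_of_notMem h _)

-- Fourier inversion at the point of the cube that corresponds to `x` under the chart and the linear
-- coordinates.
omit [T2Space X] in
theorem hasSum_wave_fibreCoeff (i : P.ι) (β : ExtConj E →ₗ[ℂ] ℂ) (η : DForm (I.prod J) (X × Y))
    {x : X} (hi : i ∈ P.idx x) (y : Y) :
    HasSum (fun k => (∫ t, wave (-k) t * P.fibreCoeff i β η t y) *
      wave k (P.coord i (extChartAt I (P.c i) x)))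
      (P.wt i (extChartAt I (P.c i) x) * β (pull (tangentCoordChange I (P.c i) x x)
        (pull (ContinuousLinearMap.inl ℂ E F) (η (x, y))))) := by
  have hu := P.isSmoothFamily_fibreCoeff i β η
  have h := hasSum_wave (hu.contDiff y).continuous hu.isCompact (P.coord_subset i)
    (fun t ht => hu.zero t ht y) (hu.summable_integral y)
    (P.coord_subset i ⟨_, P.mem_K hi, rfl⟩)
  convert h using 1
  rw [fibreCoeff_apply, (P.coord i).symm_apply_apply, (extChartAt I (P.c i)).left_inv
    (P.mem_source hi)]

/-- What remains once the Fourier series are summed. At each point `m` is `p₁*b`, and restriction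
along `inl` recovers `b`. Expanding `b` in a basis in each chart and using that the products `wt *
cut` sum to `1` gives back `m`. -/
theorem sum_frame_apply (m : fibreForms I X J Y) (x : X) (y : Y) :
    ∑ i ∈ P.idx x, ∑ l, (P.cut i (extChartAt I (P.c i) x) *
      (P.wt i (extChartAt I (P.c i) x) * (Module.finBasis ℂ (ExtConj E)).coord l
        (pull (tangentCoordChange I (P.c i) x x)
          (pull (ContinuousLinearMap.inl ℂ E F) (m.1 (x, y)))))) •
      pull (ContinuousLinearMap.fst ℂ E F) (pull (tangentCoordChange I x (P.c i) x)
        (Module.finBasis ℂ (ExtConj E) l)) = m.1 (x, y) := by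
  have h1 : ∀ i ∈ P.idx x, ∑ l, (P.cut i (extChartAt I (P.c i) x) *
      (P.wt i (extChartAt I (P.c i) x) * (Module.finBasis ℂ (ExtConj E)).coord l
        (pull (tangentCoordChange I (P.c i) x x)
          (pull (ContinuousLinearMap.inl ℂ E F) (m.1 (x, y)))))) •
      pull (ContinuousLinearMap.fst ℂ E F) (pull (tangentCoordChange I x (P.c i) x)
        (Module.finBasis ℂ (ExtConj E) l)) =
      (P.wt i (extChartAt I (P.c i) x) * P.cut i (extChartAt I (P.c i) x)) • m.1 (x, y) := by
    intro i hi
    obtain ⟨b, hb⟩ := m.2 (x, y)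
    have hb' : m.1 (x, y) = pull (ContinuousLinearMap.fst ℂ E F) b := hb.symm
    rw [hb', ExtConj.pull_inl_fst]
    have h2 := (Module.finBasis ℂ (ExtConj E)).sum_repr (pull (tangentCoordChange I (P.c i) x x) b)
    have h3 : b = ∑ l, (Module.finBasis ℂ (ExtConj E)).repr
        (pull (tangentCoordChange I (P.c i) x x) b) l • pull (tangentCoordChange I x (P.c i) x)
        (Module.finBasis ℂ (ExtConj E) l) := by
      simp only [← map_smul]
      rw [← map_sum, h2, pull_tangentCoordChange_cancel b (P.mem_source hi)]
    conv_rhs => rw [h3]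
    rw [map_sum, Finset.smul_sum]
    refine Finset.sum_congr rfl fun l _ => ?_
    rw [map_smul, smul_smul, Module.Basis.coord_apply, ← mul_assoc,
      mul_comm (P.cut i (extChartAt I (P.c i) x))]
  rw [Finset.sum_congr rfl h1, ← Finset.sum_smul, P.sum_idx, one_smul]

-- Convergence in `M•` is known beforehand from the seminorm estimates, so the sum can be identified
-- pointwise. At a point one sums over the frequencies first, and then over the finitely many
-- relevant charts and basis covectors.
open Classical in
theorem hasSum_frame (hact : Continuous fun p : fibreForms I X J Y × DForm.gr J (X := Y) 0 =>
      fibreRact I X J p.1 p.2) (m : fibreForms I X J Y) :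
    HasSum (fun a : P.FrameIdx => fibreRact I X J (fstPull I X J Y (P.frameForm a))
      (P.frameCoeff a m.1)) m := by
  have := P.countable
  have : FrechetSpace (DForm.gr J (X := Y) 0) := FrechetSpace.of_isClosed _ (DForm.isClosed_gr 0)
  obtain ⟨m', hm'⟩ := FrechetSpace.summable_bilin (fibreRact I X J) hact
    (m := fun a : P.FrameIdx => fstPull I X J Y (P.frameForm a)) (n := fun a => P.frameCoeff a m.1)
    fun p q hp hq => P.summable_frame (p := p.comp (fstPull I X J Y))
      (hp.comp continuous_fstPull) hq m.1
  suffices h : m' = m by rwa [h] at hm'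
  refine Subtype.ext (DForm.ext ?_)
  rintro ⟨x, y⟩
  have h1 := hm'.map (DForm.evalL (x, y) ∘ₗ (fibreForms I X J Y).subtype)
    ((DForm.continuous_eval (x, y)).comp continuous_subtype_val)
  have h2 : ∀ a : P.FrameIdx, (DForm.evalL (x, y) ∘ₗ (fibreForms I X J Y).subtype)
      (fibreRact I X J (fstPull I X J Y (P.frameForm a)) (P.frameCoeff a m.1)) =
      (∫ t, wave (-a.2) t * P.fibreCoeff a.1.1 ((Module.finBasis ℂ (ExtConj E)).coord a.1.2)
        m.1 t y) • pull (ContinuousLinearMap.fst ℂ E F) (P.frameForm a x) := by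
    intro a
    show pull (ContinuousLinearMap.fst ℂ E F) (P.frameForm a x) *
      pull (ContinuousLinearMap.snd ℂ E F) ((P.frameCoeff (J := J) (Y := Y) a m.1).1 y) = _
    rw [frameCoeff_apply, AlgHom.commutes, Algebra.algebraMap_eq_smul_one, mul_smul_comm, mul_one]
  have h3 := HasSum.prod_fiberwise h1 (g := fun b => if b.1 ∈ P.idx x then
      (P.cut b.1 (extChartAt I (P.c b.1) x) *
      (P.wt b.1 (extChartAt I (P.c b.1) x) * (Module.finBasis ℂ (ExtConj E)).coord b.2
        (pull (tangentCoordChange I (P.c b.1) x x)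
          (pull (ContinuousLinearMap.inl ℂ E F) (m.1 (x, y)))))) •
      pull (ContinuousLinearMap.fst ℂ E F) (pull (tangentCoordChange I x (P.c b.1) x)
        (Module.finBasis ℂ (ExtConj E) b.2)) else 0) fun b => by
    simp only [Function.comp_apply, h2]
    split_ifs with hb
    · have h4 := ((P.hasSum_wave_fibreCoeff b.1 ((Module.finBasis ℂ (ExtConj E)).coord b.2) m.1 hb
        y).mul_left (P.cut b.1 (extChartAt I (P.c b.1) x))).smul_const
        (pull (ContinuousLinearMap.fst ℂ E F) (pull (tangentCoordChange I x (P.c b.1) x)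
          (Module.finBasis ℂ (ExtConj E) b.2)))
      convert h4 using 1
      funext k
      rw [P.frameForm_of_mem (a := (b, k)) hb, map_smul, smul_smul]
      congr 1
      ring
    · simp only [P.frameForm_of_notMem (a := (b, _)) hb, map_zero, smul_zero]
      exact hasSum_zero
  have h4 := hasSum_sum_of_ne_finset_zero (s := P.idx x ×ˢ Finset.univ)
    (f := fun b : P.ι × Fin (Module.finrank ℂ (ExtConj E)) => if b.1 ∈ P.idx x then
      (P.cut b.1 (extChartAt I (P.c b.1) x) *
      (P.wt b.1 (extChartAt I (P.c b.1) x) * (Module.finBasis ℂ (ExtConj E)).coord b.2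
        (pull (tangentCoordChange I (P.c b.1) x x)
          (pull (ContinuousLinearMap.inl ℂ E F) (m.1 (x, y)))))) •
      pull (ContinuousLinearMap.fst ℂ E F) (pull (tangentCoordChange I x (P.c b.1) x)
        (Module.finBasis ℂ (ExtConj E) b.2)) else 0) (L := SummationFilter.unconditional _)
    fun b hb => if_neg fun h => hb (Finset.mk_mem_product h (Finset.mem_univ _))
  refine (h3.unique h4).trans ?_
  rw [Finset.sum_product]
  refine Eq.trans (Finset.sum_congr rfl fun i hi => ?_) (P.sum_frame_apply m x y)
  simp only [if_pos hi]

end ChartPartition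

end Product

attribute [local instance] FiniteDimensional.complexToReal

open Filter

/-! ### Bidegrees -/

section ExtConj

variable {E F : Type*} [NormedAddCommGroup E] [NormedSpace ℂ E] [FiniteDimensional ℂ E]
  [NormedAddCommGroup F] [NormedSpace ℂ F] [FiniteDimensional ℂ F]

/-- Naturality of `∑ⱼ dz̄ⱼ ∧ ∂/∂z̄ⱼ` under complex linear maps between different spaces. -/
theorem wedgeDeriv_pull_comp (A : E →L[ℂ] F) (D : F →L[ℝ] ExtConj F) :
    wedgeDeriv (ContinuousLinearMap.id ℂ E)
      ((((pull A).toLinearMap.toContinuousLinearMap).restrictScalars ℝ).comp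
        (D.comp (A.restrictScalars ℝ))) =
      pull A (wedgeDeriv (ContinuousLinearMap.id ℂ F) D) := by
  have h1 : ∀ v, conjPart ((((pull A).toLinearMap.toContinuousLinearMap).restrictScalars ℝ).comp
        (D.comp (A.restrictScalars ℝ))) v = pull A (conjPart D (A v)) := by
    intro v
    simp [conjPart]
  have h2 : ∀ v : F, conjPart D v = ∑ k, starRingEnd ℂ ((Module.finBasis ℂ F).repr v k) •
      conjPart D (Module.finBasis ℂ F k) := by
    intro v
    have hadd : ∀ x y, conjPart D (x + y) = conjPart D x + conjPart D y := by
      intro x y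
      simp only [conjPart, smul_add, map_add]
      abel
    let f : F →ₗ⋆[ℂ] ExtConj F :=
      { toFun := conjPart D, map_add' := hadd, map_smul' := conjPart_smul D }
    have : f v = f (∑ k, (Module.finBasis ℂ F).repr v k • Module.finBasis ℂ F k) := by
      rw [(Module.finBasis ℂ F).sum_repr]
    rw [map_sum] at this
    refine this.trans (Finset.sum_congr rfl fun k _ => ?_)
    exact conjPart_smul D _ _
  have h3 : ∀ k, pull A (ExtConj.ι (dzbar k)) = ∑ j : Fin (Module.finrank ℂ E),
      starRingEnd ℂ ((Module.finBasis ℂ F).repr (A (Module.finBasis ℂ E j)) k) •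
        ExtConj.ι (dzbar j) := by
    intro k
    rw [pull_ι, conjDual_eq_sum (pullConj A (dzbar k)), map_sum]
    refine Finset.sum_congr rfl fun j _ => ?_
    rw [map_smul]
    rfl
  have h4 : ∀ α : ConjDual E, pullConj (ContinuousLinearMap.id ℂ E) α = α := fun α => rfl
  have h5 : ∀ α : ConjDual F, pullConj (ContinuousLinearMap.id ℂ F) α = α := fun α => rfl
  simp only [wedgeDeriv, h1, h4, h5, map_sum, map_mul, h3]
  conv_lhs => enter [2, j]; rw [h2, map_sum, Finset.mul_sum]
  rw [Finset.sum_comm]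
  refine Finset.sum_congr rfl fun k _ => ?_
  rw [Finset.sum_mul]
  refine Finset.sum_congr rfl fun j _ => ?_
  rw [map_smul, mul_smul_comm, smul_mul_assoc]

namespace ExtConj

/-- The part of degree `q` in the covectors of the second factor. -/
def sndProj (q : ℕ) : ExtConj (E × F) →ₗ[ℂ] ExtConj (E × F) :=
  ∑ l, (LinearMap.mulRight ℂ (pull (ContinuousLinearMap.snd ℂ E F)
      (proj F q (Module.finBasis ℂ (ExtConj F) l)))) ∘ₗ
    (pull (ContinuousLinearMap.fst ℂ E F)).toLinearMap ∘ₗ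
      coeff (E := E) ((Module.finBasis ℂ (ExtConj F)).coord l)

/-- Characterises `sndProj` without reference to the basis used in its definition, since such
products span. -/
theorem sndProj_mul (q : ℕ) (x : ExtConj E) (y : ExtConj F) :
    sndProj q (pull (ContinuousLinearMap.fst ℂ E F) x * pull (ContinuousLinearMap.snd ℂ E F) y) =
      pull (ContinuousLinearMap.fst ℂ E F) x *
        pull (ContinuousLinearMap.snd ℂ E F) (proj F q y) := by
  conv_rhs => rw [← (Module.finBasis ℂ (ExtConj F)).sum_repr y]
  rw [map_sum, map_sum, Finset.mul_sum, sndProj, LinearMap.sum_apply]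
  refine Finset.sum_congr rfl fun l _ => ?_
  rw [LinearMap.comp_apply, LinearMap.comp_apply, coeff_mul, LinearMap.mulRight_apply,
    AlgHom.toLinearMap_apply, map_smul, map_smul, map_smul, smul_mul_assoc, mul_smul_comm]
  rfl

theorem sndProj_pull {E' F' : Type*} [NormedAddCommGroup E'] [NormedSpace ℂ E']
    [FiniteDimensional ℂ E'] [NormedAddCommGroup F'] [NormedSpace ℂ F'] [FiniteDimensional ℂ F']
    (A : E →L[ℂ] E') (B : F →L[ℂ] F') (q : ℕ) (x : ExtConj (E' × F')) :
    sndProj q (pull (A.prodMap B) x) = pull (A.prodMap B) (sndProj q x) := by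
  induction x using prod_induction with
  | hadd x y hx hy => simp only [map_add, hx, hy]
  | hmul x y =>
    rw [sndProj_mul, map_mul (pull _), map_mul (pull _), pull_prodMap_fst, pull_prodMap_snd, sndProj_mul,
      pull_prodMap_snd, ← pull_proj B q y]

theorem sndProj_zero_fst (x : ExtConj E) :
    sndProj 0 (pull (ContinuousLinearMap.fst ℂ E F) x) = pull (ContinuousLinearMap.fst ℂ E F) x := by
  have h := sndProj_mul (F := F) 0 x 1
  rwa [proj_of_mem one_mem_gr, map_one, mul_one] at h

theorem sndProj_one_fst (x : ExtConj E) :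
    sndProj 1 (pull (ContinuousLinearMap.fst ℂ E F) x) = 0 := by
  have h := sndProj_mul (F := F) 1 x 1
  rwa [proj_of_ne one_ne_zero one_mem_gr, map_one, mul_one, map_zero, mul_zero] at h

theorem ι_mem_gr (β : ConjDual E) : ExtConj.ι β ∈ ExtConj.gr E 1 := by
  have := ι_mul_mem_gr β (one_mem_gr (E := E))
  rwa [mul_one] at this

/-- Once the covector of `F` is moved to the right of `z`, the product visibly has degree one along
`F`. -/
theorem sndProj_ι_snd_mul (β : ConjDual F) {z : ExtConj (E × F)}
    (hz : z ∈ (pull (ContinuousLinearMap.fst ℂ E F)).range) :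
    sndProj 0 (ExtConj.ι (pullConj (ContinuousLinearMap.snd ℂ E F) β) * z) = 0 ∧
    sndProj 1 (ExtConj.ι (pullConj (ContinuousLinearMap.snd ℂ E F) β) * z) =
      ExtConj.ι (pullConj (ContinuousLinearMap.snd ℂ E F) β) * z := by
  obtain ⟨x, rfl⟩ := hz
  obtain ⟨y, hy⟩ := exists_ι_snd_mul β x
  show sndProj 0 (_ * pull (ContinuousLinearMap.fst ℂ E F) x) = 0 ∧
    sndProj 1 (_ * pull (ContinuousLinearMap.fst ℂ E F) x) =
      _ * pull (ContinuousLinearMap.fst ℂ E F) x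
  rw [← pull_ι, hy, sndProj_mul, sndProj_mul, proj_of_mem (ι_mem_gr β),
    proj_of_ne zero_ne_one (ι_mem_gr β), map_zero, mul_zero]
  exact ⟨rfl, rfl⟩

end ExtConj

theorem pullConj_eq_add (α : ConjDual (E × F)) : α =
    pullConj ((ContinuousLinearMap.inl ℂ E F).comp (ContinuousLinearMap.fst ℂ E F)) α +
    pullConj ((ContinuousLinearMap.inr ℂ E F).comp (ContinuousLinearMap.snd ℂ E F)) α :=
  LinearMap.ext fun v => by
    show α v = α (v.1, 0) + α (0, v.2)
    rw [← map_add]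
    simp

/-- Pointwise form of `∂̄ = ∂̄_X + ∂̄_Y`: every covector is the sum of its parts along the two
factors. -/
theorem wedgeDeriv_id_prod (D : E × F →L[ℝ] ExtConj (E × F)) :
    wedgeDeriv (ContinuousLinearMap.id ℂ (E × F)) D =
    wedgeDeriv ((ContinuousLinearMap.inl ℂ E F).comp (ContinuousLinearMap.fst ℂ E F)) D +
    wedgeDeriv ((ContinuousLinearMap.inr ℂ E F).comp (ContinuousLinearMap.snd ℂ E F)) D := by
  rw [wedgeDeriv, wedgeDeriv, wedgeDeriv, ← Finset.sum_add_distrib]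
  refine Finset.sum_congr rfl fun j _ => ?_
  rw [← add_mul, ← map_add, ← pullConj_eq_add]
  rfl

section Range

variable {D : E × F →L[ℝ] ExtConj (E × F)}
  (hD : ∀ v, D v ∈ (pull (ContinuousLinearMap.fst ℂ E F)).range)

include hD

theorem conjPart_mem_range_fst (v : E × F) :
    conjPart D v ∈ (pull (ContinuousLinearMap.fst ℂ E F)).range :=
  Subalgebra.smul_mem _ (add_mem (hD _) (Subalgebra.smul_mem _ (hD _) _)) _

theorem wedgeDeriv_fst_mem :
    wedgeDeriv ((ContinuousLinearMap.inl ℂ E F).comp (ContinuousLinearMap.fst ℂ E F)) D ∈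
      (pull (ContinuousLinearMap.fst ℂ E F)).range := by
  refine sum_mem fun j _ => mul_mem ⟨ExtConj.ι (pullConj (ContinuousLinearMap.inl ℂ E F) (dzbar j)),
    ?_⟩ (conjPart_mem_range_fst hD _)
  exact pull_ι _ _

theorem sndProj_wedgeDeriv_snd :
    ExtConj.sndProj 0 (wedgeDeriv ((ContinuousLinearMap.inr ℂ E F).comp
      (ContinuousLinearMap.snd ℂ E F)) D) = 0 ∧
    ExtConj.sndProj 1 (wedgeDeriv ((ContinuousLinearMap.inr ℂ E F).comp
      (ContinuousLinearMap.snd ℂ E F)) D) = wedgeDeriv ((ContinuousLinearMap.inr ℂ E F).comp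
      (ContinuousLinearMap.snd ℂ E F)) D := by
  have h := fun j => ExtConj.sndProj_ι_snd_mul (pullConj (ContinuousLinearMap.inr ℂ E F) (dzbar j))
    (conjPart_mem_range_fst hD (Module.finBasis ℂ (E × F) j))
  constructor
  · rw [wedgeDeriv, map_sum]
    exact Finset.sum_eq_zero fun j _ => (h j).1
  · rw [wedgeDeriv, map_sum]
    exact Finset.sum_congr rfl fun j _ => (h j).2

theorem sndProj_wedgeDeriv :
    ExtConj.sndProj 0 (wedgeDeriv (ContinuousLinearMap.id ℂ (E × F)) D) =
      wedgeDeriv ((ContinuousLinearMap.inl ℂ E F).comp (ContinuousLinearMap.fst ℂ E F)) D ∧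
    ExtConj.sndProj 1 (wedgeDeriv (ContinuousLinearMap.id ℂ (E × F)) D) =
      wedgeDeriv ((ContinuousLinearMap.inr ℂ E F).comp (ContinuousLinearMap.snd ℂ E F)) D := by
  obtain ⟨x, hx⟩ := wedgeDeriv_fst_mem hD
  have hx' : pull (ContinuousLinearMap.fst ℂ E F) x = wedgeDeriv
    ((ContinuousLinearMap.inl ℂ E F).comp (ContinuousLinearMap.fst ℂ E F)) D := hx
  have h := sndProj_wedgeDeriv_snd hD
  rw [wedgeDeriv_id_prod, map_add, map_add, h.1, h.2, ← hx', ExtConj.sndProj_zero_fst,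
    ExtConj.sndProj_one_fst, add_zero, zero_add]
  exact ⟨rfl, rfl⟩

end Range

end ExtConj

attribute [local instance] FiniteDimensional.complexToReal

open Filter

/-! ### Operators on forms on a product -/

section Product

variable {E : Type*} [NormedAddCommGroup E] [NormedSpace ℂ E] [FiniteDimensional ℂ E]
  {H : Type*} [TopologicalSpace H] {I : ModelWithCorners ℂ E H} [I.Boundaryless]
  {X : Type u} [TopologicalSpace X] [ChartedSpace H X] [IsManifold I ω X]
  {F : Type*} [NormedAddCommGroup F] [NormedSpace ℂ F] [FiniteDimensional ℂ F]
  {H' : Type*} [TopologicalSpace H'] {J : ModelWithCorners ℂ F H'} [J.Boundaryless]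
  {Y : Type v} [TopologicalSpace Y] [ChartedSpace H' Y] [IsManifold J ω Y]

/-- In product charts `p₂` is the linear projection, so this is naturality of `wedgeDeriv` under a
complex linear map. -/
theorem dbar_sndPull (η : DForm J Y) :
    dbar (I.prod J) (X × Y) (sndPull I X J η) = sndPull I X J (dbar J Y η) := by
  refine DForm.ext ?_
  rintro ⟨x, y⟩
  rw [DForm.dbar_apply, sndPull_apply, DForm.dbar_apply, extChartAt_prod_apply]
  have hz := mem_extChartAt_target (I := I) x
  have hw := mem_extChartAt_target (I := J) y
  have h1 : inChart (I.prod J) (sndPull I X J η).1 (x, y) =ᶠ[𝓝 (extChartAt I x x, extChartAt J y y)]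
      fun q => pull (ContinuousLinearMap.snd ℂ E F) (inChart J η.1 y q.2) := by
    filter_upwards [prod_mem_nhds ((isOpen_extChartAt_target x).mem_nhds hz)
      ((isOpen_extChartAt_target y).mem_nhds hw)] with q hq
    exact (inChart_prod _ x y hq.1 hq.2).trans (ExtConj.pull_prodMap_snd _ _ _)
  have h2 := (hasFDerivAt_inChart J η y).hasFDerivAt
  have h3 : HasFDerivAt (fun q : E × F => pull (ContinuousLinearMap.snd ℂ E F) (inChart J η.1 y q.2))
      ((((pull (ContinuousLinearMap.snd ℂ E F)).toLinearMap.toContinuousLinearMap).restrictScalars ℝ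
        ).comp ((fderiv ℝ (inChart J η.1 y) (extChartAt J y y)).comp
          ((ContinuousLinearMap.snd ℂ E F).restrictScalars ℝ)))
      (extChartAt I x x, extChartAt J y y) :=
    (((pull (ContinuousLinearMap.snd ℂ E F)).toLinearMap.toContinuousLinearMap).restrictScalars ℝ
      ).hasFDerivAt.comp _ (HasFDerivAt.comp (f := Prod.snd) (extChartAt I x x, extChartAt J y y) h2
        ((ContinuousLinearMap.snd ℂ E F).restrictScalars ℝ).hasFDerivAt)
  rw [h1.fderiv_eq, h3.fderiv]
  exact wedgeDeriv_pull_comp (ContinuousLinearMap.snd ℂ E F) _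

/-- The linear projection `T` onto the range of `p₁*` fixes the coordinate expression of `m` near
the point, hence also its derivative. -/
theorem fderiv_mem_range_fst (m : fibreForms I X J Y) (p : X × Y) (v : E × F) :
    fderiv ℝ (inChart (I.prod J) m.1.1 p) (extChartAt (I.prod J) p p) v ∈
      (pull (ContinuousLinearMap.fst ℂ E F)).range := by
  obtain ⟨x, y⟩ := p
  let T : ExtConj (E × F) →L[ℝ] ExtConj (E × F) :=
    (((pull (ContinuousLinearMap.fst ℂ E F)).toLinearMap ∘ₗ
      (pull (ContinuousLinearMap.inl ℂ E F)).toLinearMap).toContinuousLinearMap).restrictScalars ℝ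
  have hT : ∀ b, T b = pull (ContinuousLinearMap.fst ℂ E F) (pull (ContinuousLinearMap.inl ℂ E F) b) :=
    fun _ => rfl
  have h1 := T.hasFDerivAt.comp _ (hasFDerivAt_inChart (I.prod J) m.1 (x, y)).hasFDerivAt
  have h2 : inChart (I.prod J) m.1.1 (x, y) =ᶠ[𝓝 (extChartAt (I.prod J) (x, y) (x, y))]
      T ∘ inChart (I.prod J) m.1.1 (x, y) := by
    filter_upwards [(isOpen_extChartAt_target (x, y)).mem_nhds
      (mem_extChartAt_target (I := I.prod J) (x, y))] with q hq
    obtain ⟨z, w⟩ := q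
    obtain ⟨hz, hw⟩ := mem_target_prod.1 hq
    obtain ⟨b, hb⟩ := m.2 ((extChartAt I x).symm z, (extChartAt J y).symm w)
    have hb' : m.1.1 ((extChartAt I x).symm z, (extChartAt J y).symm w) =
      pull (ContinuousLinearMap.fst ℂ E F) b := hb.symm
    rw [Function.comp_apply, inChart_prod _ _ _ hz hw, hb', ExtConj.pull_prodMap_fst, hT,
      ExtConj.pull_inl_fst]
  rw [h2.fderiv_eq, h1.fderiv]
  exact ⟨_, rfl⟩

variable (I X J Y) in
/-- The part of a form on `X × Y` of degree `q` along `Y`. -/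
def DForm.sndProj (q : ℕ) : DForm (I.prod J) (X × Y) →ₗ[ℂ] DForm (I.prod J) (X × Y) where
  toFun η := ⟨fun p => ExtConj.sndProj q (η p), by
    rintro ⟨x₀, y₀⟩
    refine ((ExtConj.contDiff_linear (ExtConj.sndProj q)).comp_contDiffOn (η.2 (x₀, y₀))).congr ?_
    rintro ⟨z, w⟩ hzw
    obtain ⟨hz, hw⟩ := mem_target_prod.1 hzw
    rw [inChart_prod _ _ _ hz hw, Function.comp_apply, inChart_prod _ _ _ hz hw,
      ExtConj.sndProj_pull]⟩
  map_add' _ _ := DForm.ext fun _ => map_add (ExtConj.sndProj q) _ _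
  map_smul' c _ := DForm.ext fun _ => map_smul (ExtConj.sndProj q) c _

theorem DForm.sndProj_apply (q : ℕ) (η : DForm (I.prod J) (X × Y)) (p : X × Y) :
    DForm.sndProj I X J Y q η p = ExtConj.sndProj q (η p) := rfl

theorem DForm.sndProj_mul (q : ℕ) (m : fibreForms I X J Y) (η : DForm J Y) :
    DForm.sndProj I X J Y q (m.1 * sndPull I X J η) =
      m.1 * sndPull I X J (DForm.proj J Y q η) := by
  refine DForm.ext fun p => ?_
  obtain ⟨b, hb⟩ := m.2 p
  have hb' : m.1 p = pull (ContinuousLinearMap.fst ℂ E F) b := hb.symm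
  rw [DForm.sndProj_apply, DForm.coe_mul, DForm.coe_mul, sndPull_apply, sndPull_apply, hb',
    ExtConj.sndProj_mul, DForm.proj_apply]

/-- The part of degree `q` of a form along the fibres. -/
def fibreProj (q : ℕ) : fibreForms I X J Y →ₗ[ℂ] fibreForms I X J Y :=
  (DForm.proj (I.prod J) (X × Y) q).restrict fun m hm p => by
    obtain ⟨b, hb⟩ := hm p
    refine ⟨ExtConj.proj E q b, ?_⟩
    exact (ExtConj.pull_proj _ _ _).trans (congrArg _ hb)

theorem sndPull_mem_gr {q : ℕ} {η : DForm J Y} (h : η ∈ DForm.gr J q) :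
    sndPull I X J η ∈ DForm.gr (I.prod J) q := fun p => ExtConj.pull_mem_gr _ (h p.2)

theorem DForm.mul_mem_gr {a b : ℕ} {η ζ : DForm I X} (hη : η ∈ DForm.gr I a)
    (hζ : ζ ∈ DForm.gr I b) : η * ζ ∈ DForm.gr I (a + b) :=
  fun x => ExtConj.mul_mem_gr (hη x) (hζ x)

theorem continuous_sndProj [SecondCountableTopology X] [SecondCountableTopology Y] (q : ℕ) :
    Continuous (DForm.sndProj I X J Y q) :=
  DForm.continuous_of_eval _ fun p =>
    (ExtConj.sndProj q).continuous_of_finiteDimensional.comp (DForm.continuous_eval p)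

theorem DForm.continuous_proj [SecondCountableTopology X] (q : ℕ) :
    Continuous (DForm.proj I X q) :=
  DForm.continuous_of_eval _ fun x => (ExtConj.proj E q).continuous.comp (DForm.continuous_eval x)

/-- Identifies `∂̄_X m` and `∂̄_Y m` with components of the smooth form `∂̄m`, so that their
smoothness needs no separate argument. -/
theorem sndProj_dbar (m : fibreForms I X J Y) :
    (DForm.sndProj I X J Y 0 (dbar (I.prod J) (X × Y) m.1)).1 = dbarX I X J m.1.1 ∧
    (DForm.sndProj I X J Y 1 (dbar (I.prod J) (X × Y) m.1)).1 = dbarY I X J m.1.1 := by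
  constructor
  · funext p
    exact (sndProj_wedgeDeriv (fderiv_mem_range_fst m p)).1
  · funext p
    exact (sndProj_wedgeDeriv (fderiv_mem_range_fst m p)).2

theorem dbarX_mem (m : fibreForms I X J Y) :
    DForm.sndProj I X J Y 0 (dbar (I.prod J) (X × Y) m.1) ∈ fibreForms I X J Y := by
  intro p
  have h : (DForm.sndProj I X J Y 0 (dbar (I.prod J) (X × Y) m.1)) p = dbarX I X J m.1.1 p :=
    congrFun (sndProj_dbar m).1 p
  rw [h]
  exact wedgeDeriv_fst_mem (fderiv_mem_range_fst m p)

theorem sndProj_add_dbar (m : fibreForms I X J Y) :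
    dbar (I.prod J) (X × Y) m.1 = DForm.sndProj I X J Y 0 (dbar (I.prod J) (X × Y) m.1) +
      DForm.sndProj I X J Y 1 (dbar (I.prod J) (X × Y) m.1) := by
  refine DForm.ext fun p => ?_
  have h0 : (DForm.sndProj I X J Y 0 (dbar (I.prod J) (X × Y) m.1)) p = dbarX I X J m.1.1 p :=
    congrFun (sndProj_dbar m).1 p
  have h1 : (DForm.sndProj I X J Y 1 (dbar (I.prod J) (X × Y) m.1)) p = dbarY I X J m.1.1 p :=
    congrFun (sndProj_dbar m).2 p
  rw [DForm.coe_add, h0, h1]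
  exact wedgeDeriv_id_prod _

end Product

attribute [local instance] FiniteDimensional.complexToReal

open Filter

/-- Forms are graded by `ℕ` and modules by `ℤ`; the negative degrees are filled with zero. -/
theorem isInternal_extend_of_projections {V : Type*} [AddCommGroup V] [Module ℂ V]
    (gr : ℕ → Submodule ℂ V) (P : ℕ → V →ₗ[ℂ] V) (s : Finset ℕ)
    (hmem : ∀ i x, P i x ∈ gr i) (hid : ∀ i, ∀ x ∈ gr i, P i x = x)
    (hne : ∀ i j, i ≠ j → ∀ x ∈ gr j, P i x = 0) (hsum : ∀ x, ∑ i ∈ s, P i x = x) :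
    DirectSum.IsInternal fun i : ℤ => if 0 ≤ i then gr i.toNat else ⊥ := by
  refine isInternal_of_projections _ (fun i : ℤ => if 0 ≤ i then P i.toNat else 0)
    (s.map Nat.castEmbedding) ?_ ?_ ?_ ?_
  · intro i x
    split_ifs
    · exact hmem _ _
    · exact Submodule.zero_mem _
  · intro i x hx
    split_ifs at hx ⊢
    · exact hid _ _ hx
    · exact ((Submodule.mem_bot ℂ).1 hx).symm
  · intro i j hij x hx
    split_ifs at hx ⊢
    · exact hne _ _ (by omega) _ hx
    · rw [(Submodule.mem_bot ℂ).1 hx, map_zero]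
    · rfl
    · rfl
  · intro x
    rw [Finset.sum_map]
    simpa using hsum x

/-! ### The bimodule of forms along the fibres -/

section Product

variable {E : Type*} [NormedAddCommGroup E] [NormedSpace ℂ E] [FiniteDimensional ℂ E]
  {H : Type*} [TopologicalSpace H] {I : ModelWithCorners ℂ E H} [I.Boundaryless]
  {X : Type u} [TopologicalSpace X] [ChartedSpace H X] [IsManifold I ω X]
  {F : Type*} [NormedAddCommGroup F] [NormedSpace ℂ F] [FiniteDimensional ℂ F]
  {H' : Type*} [TopologicalSpace H'] {J : ModelWithCorners ℂ F H'} [J.Boundaryless]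
  {Y : Type v} [TopologicalSpace Y] [ChartedSpace H' Y] [IsManifold J ω Y]
  [T2Space X] [SecondCountableTopology X] [T2Space Y] [SecondCountableTopology Y]

theorem continuous_fibreRact : Continuous fun p : fibreForms I X J Y × DForm.gr J (X := Y) 0 =>
    fibreRact I X J p.1 p.2 :=
  (DForm.continuous_mul.comp ((continuous_subtype_val.comp continuous_fst).prodMk
    (continuous_sndPull.comp (continuous_subtype_val.comp continuous_snd)))).subtype_mk _

variable (hY : IsCurvedDGA (dolbeault J Y))

theorem mem_fibreModule_gr {i : ℤ} {m : fibreForms I X J Y} :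
    m ∈ (fibreModule I X J hY).gr i ↔
      if 0 ≤ i then m.1 ∈ DForm.gr (I.prod J) i.toNat else m = 0 := by
  show m ∈ (if 0 ≤ i then (DForm.gr (I.prod J) i.toNat).comap (fibreForms I X J Y).subtype else ⊥) ↔ _
  split_ifs
  · rfl
  · exact Submodule.mem_bot ℂ

theorem mem_fibreModule_gr_natCast {n : ℕ} {m : fibreForms I X J Y} :
    m ∈ (fibreModule I X J hY).gr n ↔ m.1 ∈ DForm.gr (I.prod J) n := by
  rw [mem_fibreModule_gr, if_pos (Int.natCast_nonneg n), Int.toNat_natCast]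

theorem internal_fibreModule : DirectSum.IsInternal (fibreModule I X J hY).gr :=
  isInternal_extend_of_projections
    (fun q => (DForm.gr (I.prod J) q).comap (fibreForms I X J Y).subtype)
    fibreProj (Finset.range (ExtConj.degBound (E × F)))
    (fun _ _ _ => ExtConj.proj_mem _ _)
    (fun _ _ hm => Subtype.ext (DForm.ext fun p => ExtConj.proj_of_mem (hm p)))
    (fun _ _ hij _ hm => Subtype.ext (DForm.ext fun p => ExtConj.proj_of_ne hij (hm p)))
    fun m => Subtype.ext (DForm.ext fun p =>
      (map_sum (DForm.evalL p ∘ₗ (fibreForms I X J Y).subtype) _ _).trans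
        (ExtConj.sum_proj (m.1 p)))

theorem fibreRact_one (x : fibreForms I X J Y) {a : DForm.gr J (X := Y) 0}
    (ha : a.1 = (1 : DForm J Y)) : fibreRact I X J x a = x :=
  Subtype.ext (by
    show x.1 * sndPull I X J a.1 = x.1
    rw [ha]
    refine DForm.ext fun p => ?_
    rw [DForm.coe_mul, sndPull_apply, DForm.coe_one, map_one, mul_one])

theorem fibreRact_mul (x : fibreForms I X J Y) {a b c : DForm.gr J (X := Y) 0}
    (hc : c.1 = (a.1 * b.1 : DForm J Y)) :
    fibreRact I X J x c = fibreRact I X J (fibreRact I X J x a) b :=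
  Subtype.ext (by
    show x.1 * sndPull I X J c.1 = x.1 * sndPull I X J a.1 * sndPull I X J b.1
    rw [hc, sndPull_mul, mul_assoc])

theorem fibreRact_mem {i : ℤ} {x : fibreForms I X J Y} (a : DForm.gr J (X := Y) 0)
    (hx : x ∈ (fibreModule I X J hY).gr i) :
    fibreRact I X J x a ∈ (fibreModule I X J hY).gr i := by
  have hx := (mem_fibreModule_gr hY).1 hx
  refine (mem_fibreModule_gr hY).2 ?_
  split_ifs at hx ⊢
  · have := DForm.mul_mem_gr hx (sndPull_mem_gr (I := I) (X := X) a.2)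
    rwa [add_zero] at this
  · rw [hx]
    exact LinearMap.map_zero₂ _ _

theorem fibreModule_gr_eq_bot {i : ℤ} (hi : (ExtConj.degBound (E × F) : ℤ) < |i|) :
    (fibreModule I X J hY).gr i = ⊥ := by
  refine eq_bot_iff.2 fun (m : fibreForms I X J Y) hm => ?_
  have hm := (mem_fibreModule_gr hY).1 hm
  refine (Submodule.mem_bot ℂ).2 ?_
  split_ifs at hm with h
  · rw [DForm.gr_eq_bot (by rw [abs_of_nonneg h] at hi; omega)] at hm
    exact Subtype.ext hm
  · exact hm

theorem isFrechetModule_fibreModule : (fibreModule I X J hY).IsFrechetModule where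
  frechet := FrechetSpace.isFrechet (fibreForms I X J Y)
  continuous_ract := continuous_fibreRact
  ract_one x a ha := fibreRact_one x ha
  ract_mul x a b c hc := (fibreRact_mul x hc).symm
  ract_mem a hx := fibreRact_mem hY a hx
  internal := internal_fibreModule hY
  isClosed_gr i := by
    show IsClosed ((if 0 ≤ i then (DForm.gr (I.prod J) i.toNat).comap (fibreForms I X J Y).subtype
      else ⊥ : Submodule ℂ (fibreForms I X J Y)) : Set (fibreForms I X J Y))
    split_ifs
    · exact (DForm.isClosed_gr _).preimage continuous_subtype_val
    · exact isClosed_singleton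
  bounded := ⟨ExtConj.degBound (E × F), fun _ hi => fibreModule_gr_eq_bot hY hi⟩

/-- The frame consists of cut-off exponentials pulled back from `X`, with Fourier coefficients in
`𝒜(Y)`. -/
theorem isRelProjective_fibreModule : (fibreModule I X J hY).IsRelProjective := by
  obtain ⟨P⟩ := exists_chartPartition I X
  have := P.countable
  have := FrechetSpace.isFrechet (fibreForms I X J Y)
  refine GrModule.isRelProjective_of_frame (fibreModule I X J hY)
    this continuous_fibreRact (fun x a b => ?_)
    (α := P.FrameIdx) (fun a => fstPull I X J Y (P.frameForm a))
    (fun a => (P.frameCoeff (J := J) (Y := Y) a).comp (fibreForms I X J Y).subtypeL)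
    (fun a x b => ?_) (fun p q hp hq x => ?_) fun x => ?_
  · exact fibreRact_mul x rfl
  · exact Subtype.ext (P.frameCoeff_mul a x.1 b)
  · exact P.summable_frame (p := p.comp (fstPull I X J Y)) (hp.comp continuous_fstPull) hq x.1
  · exact P.hasSum_frame continuous_fibreRact x

end Product

attribute [local instance] FiniteDimensional.complexToReal

open Filter

/-! ### Bimodules whose tensor product with the base algebra is the total algebra -/

section Transport

variable {𝒜 : CurvedDGA.{u}} {ℬ : CurvedDGA.{v}} {E : GrModule.{v, w} ℬ} (Φ : E.T ≃L[ℂ] 𝒜)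
  {j : E →ₗ[ℂ] 𝒜} {σ : ℬ →ₗ[ℂ] 𝒜}

/-- An identification `m ⊗ η ↦ j m * σ η` of `E ⊗̂ ℬ` with `𝒜`, compatible with the gradings. -/
structure IsGradedIso (j : E →ₗ[ℂ] 𝒜) (σ : ℬ →ₗ[ℂ] 𝒜) : Prop where
  map_tmul : ∀ e η, Φ (E.tmul e η) = j e * σ η
  map_mul : ∀ a b, σ (a * b) = σ a * σ b
  map_one : σ 1 = 1
  map_mem : ∀ {q : ℕ} {a : ℬ}, a ∈ ℬ.gr q → σ a ∈ 𝒜.gr q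
  incl_mem : ∀ {q : ℕ} {e : E}, e ∈ E.gr q → j e ∈ 𝒜.gr q
  gr_neg : ∀ {i : ℤ}, i < 0 → E.gr i = ⊥
  proj : ∃ P : ℕ → 𝒜 →L[ℂ] 𝒜, (∀ q, ∀ a ∈ 𝒜.gr q, P q a = a) ∧
    ∀ p q, p ≠ q → ∀ a ∈ 𝒜.gr q, P p a = 0

namespace IsGradedIso

variable {Φ}

theorem map_incl (h : IsGradedIso Φ j σ) (e : E) : Φ (E.incl e) = j e := by
  rw [h.map_tmul, h.map_one, mul_one]

theorem map_rmul (h : IsGradedIso Φ j σ) (hE : E.IsFrechetModule) (b : ℬ) (t : E.T) : Φ (E.rmul b t) = Φ t * σ b := by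
  have := 𝒜.isCurvedDGA.frechet.frechetSpace
  have := hE.frechet.frechetSpace
  have := ℬ.isCurvedDGA.frechet.frechetSpace
  have key : (Φ : E.T →L[ℂ] 𝒜).comp (E.rmul b) = (𝒜.mulRight (σ b)).comp (Φ : E.T →L[ℂ] 𝒜) :=
    CTensor.ext fun e η => by
      show Φ (E.rmul b (E.tmul e η)) = Φ (E.tmul e η) * σ b
      rw [GrModule.rmul_tmul, h.map_tmul, h.map_tmul, h.map_mul, mul_assoc]
  exact DFunLike.congr_fun key t

theorem map_mem_gr (h : IsGradedIso Φ j σ) (hE : E.IsFrechetModule) {n : ℕ} {t : E.T} (ht : t ∈ GrModule.T.gr E n) : Φ t ∈ 𝒜.gr n := by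
  have := hE.frechet.frechetSpace
  have := ℬ.isCurvedDGA.frechet.frechetSpace
  refine map_mem_of_mem_closure_span ht (Φ : E.T →L[ℂ] 𝒜) (𝒜.isCurvedDGA.isClosed_gr n) ?_
  rintro _ ⟨i, q, e, η, hn, he, hη, rfl⟩
  show Φ (E.tmul e η) ∈ _
  rw [h.map_tmul]
  obtain hi | hi := lt_or_ge i 0
  · rw [h.gr_neg hi, Submodule.mem_bot] at he
    rw [he, map_zero, zero_mul]
    exact Submodule.zero_mem _
  · obtain ⟨p, rfl⟩ := Int.eq_ofNat_of_zero_le hi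
    have hpq : p + q = n := by exact_mod_cast hn
    rw [← hpq]
    exact 𝒜.isCurvedDGA.mul_mem (h.incl_mem he) (h.map_mem hη)

theorem eq_zero_of_neg (h : IsGradedIso Φ j σ) (hE : E.IsFrechetModule) {n : ℤ} (hn : n < 0) {t : E.T} (ht : t ∈ GrModule.T.gr E n) : t = 0 := by
  have := hE.frechet.frechetSpace
  have := ℬ.isCurvedDGA.frechet.frechetSpace
  have h0 : t ∈ (⊥ : Submodule ℂ E.T) := by
    refine map_mem_of_mem_closure_span ht (ContinuousLinearMap.id ℂ E.T) isClosed_singleton ?_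
    rintro _ ⟨i, q, e, η, hiq, he, -, rfl⟩
    rw [h.gr_neg (by omega), Submodule.mem_bot] at he
    rw [he]
    exact (Submodule.mem_bot ℂ).2 (LinearMap.map_zero₂ (CTensor.mk E.ract ℬ.lmul0) η)
  exact (Submodule.mem_bot ℂ).1 h0

/-- The map `Φ⁻¹ ∘ P n ∘ Φ` sends every tensor into degree `n`, as is seen on tensors of homogeneous
elements, and it fixes `t`. -/
theorem mem_gr (h : IsGradedIso Φ j σ) (hE : E.IsFrechetModule) {n : ℕ} {t : E.T} (ht : Φ t ∈ 𝒜.gr n) : t ∈ GrModule.T.gr E n := by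
  obtain ⟨P, hid, hne⟩ := h.proj
  have := hE.frechet.frechetSpace
  have := ℬ.isCurvedDGA.frechet.frechetSpace
  have key : ∀ s : E.T, ((Φ.symm : 𝒜 →L[ℂ] E.T).comp ((P n).comp (Φ : E.T →L[ℂ] 𝒜))) s ∈
      GrModule.T.gr E n := by
    intro s
    refine CTensor.homog_induction
      (S := (GrModule.T.gr E n).comap
        ((Φ.symm : 𝒜 →L[ℂ] E.T).comp ((P n).comp (Φ : E.T →L[ℂ] 𝒜))).toLinearMap)
      hE.iSup_gr ℬ.isCurvedDGA.internal.submodule_iSup_eq_top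
      ((GrModule.isClosed_T_gr E n).preimage (ContinuousLinearMap.continuous _)) ?_ s
    intro i q e he η hη
    show Φ.symm (P n (Φ (E.tmul e η))) ∈ GrModule.T.gr E n
    obtain hi | hi := lt_or_ge i 0
    · rw [h.gr_neg hi, Submodule.mem_bot] at he
      rw [h.map_tmul, he, map_zero, zero_mul, map_zero, map_zero]
      exact Submodule.zero_mem _
    · obtain ⟨p, rfl⟩ := Int.eq_ofNat_of_zero_le hi
      have hm : Φ (E.tmul e η) ∈ 𝒜.gr (p + q) := by
        rw [h.map_tmul]
        exact 𝒜.isCurvedDGA.mul_mem (h.incl_mem he) (h.map_mem hη)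
      by_cases hpq : n = p + q
      · subst hpq
        rw [hid _ _ hm, Φ.symm_apply_apply]
        exact GrModule.tmul_mem_T_gr (by push_cast; rfl) he hη
      · rw [hne _ _ hpq _ hm, map_zero]
        exact Submodule.zero_mem _
  have := key t
  have h2 : ((Φ.symm : 𝒜 →L[ℂ] E.T).comp ((P n).comp (Φ : E.T →L[ℂ] 𝒜))) t = t := by
    show Φ.symm (P n (Φ t)) = t
    rw [hid _ _ ht, Φ.symm_apply_apply]
  rwa [h2] at this

/-- Negative degrees vanish; in the others both claims are properties of the derivation of `𝒜`, read
through `Φ`. -/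
theorem isZConnection (h : IsGradedIso Φ j σ) (hE : E.IsFrechetModule) (hd : ∀ a, σ (ℬ.d a) = 𝒜.d (σ a)) {D : E.T →L[ℂ] E.T}
    (hD : ∀ t, Φ (D t) = 𝒜.d (Φ t)) : E.IsZConnection D where
  map_mem {n t} ht := by
    obtain hn | hn := lt_or_ge n 0
    · rw [h.eq_zero_of_neg hE hn ht, map_zero]
      exact Submodule.zero_mem _
    · obtain ⟨n, rfl⟩ := Int.eq_ofNat_of_zero_le hn
      have := h.mem_gr hE (n := n + 1) (t := D t)
        (by rw [hD]; exact 𝒜.isCurvedDGA.d_mem (h.map_mem_gr hE ht))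
      exact_mod_cast this
  leibniz {n t} b ht := by
    obtain hn | hn := lt_or_ge n 0
    · rw [h.eq_zero_of_neg hE hn ht]
      simp only [map_zero, smul_zero, add_zero]
    · obtain ⟨n, rfl⟩ := Int.eq_ofNat_of_zero_le hn
      refine Φ.injective ?_
      rw [hD, map_add, map_smul, h.map_rmul hE, h.map_rmul hE, h.map_rmul hE, hD, hd, zpow_natCast]
      exact 𝒜.isCurvedDGA.leibniz _ (h.map_mem_gr hE ht)

/-- The algebraic axioms are identities of the algebra `𝒜` read through the injective maps `Φ` and
`j`: the connection becomes `d`, the left action left multiplication, and the right action of `b`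
right multiplication by `σ b`. -/
theorem isQPTwistedBimodule {𝒳 : BimoduleData 𝒜 ℬ} {Φ : 𝒳.T ≃L[ℂ] 𝒜} {j : 𝒳.carrier →ₗ[ℂ] 𝒜}
    (h : IsGradedIso Φ j σ) (hE : 𝒳.IsFrechetModule) (hproj : 𝒳.IsRelProjective)
    (hj : Function.Injective j) (hd : ∀ a, σ (ℬ.d a) = 𝒜.d (σ a)) (hcurv : σ ℬ.curv = 𝒜.curv)
    (hD : ∀ t, Φ (𝒳.conn t) = 𝒜.d (Φ t)) (hact : ∀ a t, Φ (𝒳.lact a t) = a * Φ t)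
    (hact0 : ∀ a x, j (𝒳.lact0 a x) = a * j x) (hract : ∀ x b, j (𝒳.ract x b) = j x * σ b)
    (hact0c : Continuous fun p : 𝒜.zero × 𝒳.carrier => 𝒳.lact0 p.1 p.2)
    (hact0m : ∀ {i : ℤ} {x : 𝒳.carrier} (a : 𝒜.zero), x ∈ 𝒳.gr i → 𝒳.lact0 a x ∈ 𝒳.gr i) :
    IsQPTwistedBimodule 𝒳 where
  isFrechetModule := hE
  isRelProjective := hproj
  isZConnection := h.isZConnection hE hd hD
  continuous_lact0 := hact0c
  lact0_one a x ha := hj (by rw [hact0, ha, one_mul])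
  lact0_mul a b c x hc := hj (by rw [hact0, hact0, hact0, hc, mul_assoc])
  lact0_mem := hact0m
  lact0_ract a x b := hj (by rw [hact0, hract, hract, hact0, mul_assoc])
  lact_incl a x := Φ.injective (by rw [hact, h.map_incl, h.map_incl, hact0])
  continuous_lact := by
    have h1 : (fun p : 𝒜 × 𝒳.T => 𝒳.lact p.1 p.2) = fun p => Φ.symm (p.1 * Φ p.2) := by
      funext p
      rw [← hact, Φ.symm_apply_apply]
    rw [h1]
    exact Φ.symm.continuous.comp (𝒜.isCurvedDGA.continuous_mul.comp
      (continuous_fst.prodMk (Φ.continuous.comp continuous_snd)))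
  lact_one t := Φ.injective (by rw [hact, one_mul])
  lact_mul a b t := Φ.injective (by rw [hact, hact, hact, mul_assoc])
  lact_mem {p n a t} ha ht := by
    obtain hn | hn := lt_or_ge n 0
    · rw [h.eq_zero_of_neg hE hn ht, map_zero]
      exact Submodule.zero_mem _
    · obtain ⟨n, rfl⟩ := Int.eq_ofNat_of_zero_le hn
      have := h.mem_gr hE (n := p + n) (t := 𝒳.lact a t)
        (by rw [hact]; exact 𝒜.isCurvedDGA.mul_mem ha (h.map_mem_gr hE ht))
      exact_mod_cast this
  lact_rmul a t b := Φ.injective (by rw [hact, h.map_rmul hE, h.map_rmul hE, hact, mul_assoc])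
  leibniz t ha := Φ.injective (by
    rw [hD, hact, map_add, map_smul, hact, hact, hD]
    exact 𝒜.isCurvedDGA.leibniz _ ha)
  curvature t := Φ.injective (by
    rw [hD, hD, map_sub, hact, h.map_rmul hE, hcurv]
    exact 𝒜.isCurvedDGA.d_d _)

end IsGradedIso

end Transport

attribute [local instance] FiniteDimensional.complexToReal

open Filter

/-! ### The bimodule of the projection and the components of its connection -/

section Product

variable {E : Type*} [NormedAddCommGroup E] [NormedSpace ℂ E] [FiniteDimensional ℂ E]
  {H : Type*} [TopologicalSpace H] {I : ModelWithCorners ℂ E H} [I.Boundaryless]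
  {X : Type u} [TopologicalSpace X] [ChartedSpace H X] [IsManifold I ω X]
  {F : Type*} [NormedAddCommGroup F] [NormedSpace ℂ F] [FiniteDimensional ℂ F]
  {H' : Type*} [TopologicalSpace H'] {J : ModelWithCorners ℂ F H'} [J.Boundaryless]
  {Y : Type v} [TopologicalSpace Y] [ChartedSpace H' Y] [IsManifold J ω Y]
  [T2Space X] [SecondCountableTopology X] [T2Space Y] [SecondCountableTopology Y]

theorem sndPull_one : sndPull I X J (1 : DForm J Y) = 1 :=
  DForm.ext fun p => by rw [sndPull_apply, DForm.coe_one, DForm.coe_one, map_one]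

theorem continuous_fibreLact0 :
    Continuous fun p : DForm.gr (I.prod J) (X := X × Y) 0 × fibreForms I X J Y =>
      fibreLact0 I X J p.1 p.2 :=
  (DForm.continuous_mul.comp ((continuous_subtype_val.comp continuous_fst).prodMk
    (continuous_subtype_val.comp continuous_snd))).subtype_mk _

variable (hXY : IsCurvedDGA (dolbeault (I.prod J) (X × Y))) {hY : IsCurvedDGA (dolbeault J Y)}
  {Φ : (fibreModule I X J hY).T ≃L[ℂ] DForm (I.prod J) (X × Y)}

theorem isGradedIso_of_isCanonicalIso (hΦ : IsCanonicalIso I X J Φ) :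
    IsGradedIso (𝒜 := ⟨dolbeault (I.prod J) (X × Y), hXY⟩) (E := fibreModule I X J hY) Φ
      (fibreForms I X J Y).subtype (sndPull I X J) where
  map_tmul := hΦ
  map_mul := sndPull_mul X J
  map_one := sndPull_one
  map_mem := sndPull_mem_gr
  incl_mem := (mem_fibreModule_gr_natCast hY).1
  gr_neg {i} hi := by
    refine eq_bot_iff.2 fun (m : fibreForms I X J Y) hm => ?_
    have hm := (mem_fibreModule_gr hY).1 hm
    rw [if_neg (not_le.2 hi)] at hm
    exact hm
  proj := ⟨fun q => ⟨DForm.proj (I.prod J) (X × Y) q, DForm.continuous_proj q⟩,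
    fun q η h => DForm.ext fun x => ExtConj.proj_of_mem (h x),
    fun p q hpq η h => DForm.ext fun x => ExtConj.proj_of_ne hpq (h x)⟩

theorem isQPTwistedBimodule_fibreBimodule (hΦ : IsCanonicalIso I X J Φ) :
    IsQPTwistedBimodule (fibreBimodule I X J hXY hY Φ) :=
  IsGradedIso.isQPTwistedBimodule (𝒳 := fibreBimodule I X J hXY hY Φ)
    (isGradedIso_of_isCanonicalIso hXY hΦ) (isFrechetModule_fibreModule hY)
    (isRelProjective_fibreModule hY) Subtype.val_injective
    (fun η => (dbar_sndPull η).symm) (map_zero (sndPull I X J))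
    (fun _ => Φ.apply_symm_apply _) (fun _ _ => Φ.apply_symm_apply _)
    (fun _ _ => rfl) (fun _ _ => rfl)
    continuous_fibreLact0
    fun {i x} a hx => by
      have hx := (mem_fibreModule_gr hY).1 hx
      refine (mem_fibreModule_gr hY).2 ?_
      split_ifs at hx ⊢
      · have := DForm.mul_mem_gr a.2 hx
        rwa [zero_add] at this
      · rw [hx]
        exact map_zero _

theorem sndProj_canonicalIso_tmul (hΦ : IsCanonicalIso I X J Φ) (q : ℕ)
    (m : fibreForms I X J Y) (η : DForm J Y) :
    Φ.symm (DForm.sndProj I X J Y q (Φ ((fibreModule I X J hY).tmul m η))) =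
      (fibreModule I X J hY).tmul m (DForm.proj J Y q η) := by
  rw [hΦ m η, DForm.sndProj_mul]
  exact Φ.symm_apply_eq.2 (hΦ m _).symm

/-- On `m ⊗ η` the projection replaces `η` by its part of degree `q`; continuity and closedness do
the rest. -/
theorem mem_formDegree (hΦ : IsCanonicalIso I X J Φ) (q : ℕ) (t : (fibreModule I X J hY).T) :
    Φ.symm (DForm.sndProj I X J Y q (Φ t)) ∈
      GrModule.T.formDegree (fibreModule I X J hY) q := by
  have := (isFrechetModule_fibreModule (I := I) (X := X) hY).frechet.frechetSpace
  have := IsFrechet.frechetSpace hY.frechet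
  refine CTensor.closed_induction
    (S := (GrModule.T.formDegree (fibreModule I X J hY) q).comap
      ((Φ.symm : DForm (I.prod J) (X × Y) →L[ℂ] (fibreModule I X J hY).T).comp
        ((⟨DForm.sndProj I X J Y q, continuous_sndProj q⟩ :
          DForm (I.prod J) (X × Y) →L[ℂ] DForm (I.prod J) (X × Y)).comp
          (Φ : (fibreModule I X J hY).T →L[ℂ] DForm (I.prod J) (X × Y)))).toLinearMap)
    ((Submodule.isClosed_topologicalClosure _).preimage (ContinuousLinearMap.continuous _))
    (fun m η => ?_) t
  show Φ.symm (DForm.sndProj I X J Y q (Φ ((fibreModule I X J hY).tmul m η))) ∈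
    GrModule.T.formDegree (fibreModule I X J hY) q
  refine Set.mem_of_eq_of_mem (sndProj_canonicalIso_tmul hΦ q m η) ?_
  exact Submodule.le_topologicalClosure _ (Submodule.subset_span
    ⟨m, _, fun y => ExtConj.proj_mem _ _, rfl⟩)

/-- For a form `m` along the fibres, `∂̄m` has degree at most one along `Y`. Its part of degree zero
is `∂̄_X m`, again a form along the fibres, and its part of degree one is `∂̄_Y m`. -/
theorem exists_conn_incl (hΦ : IsCanonicalIso I X J Φ) (a : fibreForms I X J Y) :
    ∃ (a₀ : fibreForms I X J Y) (r : (fibreModule I X J hY).T),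
      r ∈ GrModule.T.formDegree (fibreModule I X J hY) 1 ∧
      (fibreBimodule I X J hXY hY Φ).conn ((fibreModule I X J hY).incl a) =
        (fibreModule I X J hY).incl a₀ + r ∧
      (a₀ : DForm (I.prod J) (X × Y)).1 = dbarX I X J a.1.1 ∧
      (Φ r).1 = dbarY I X J a.1.1 := by
  have hincl : ∀ m : fibreForms I X J Y, Φ ((fibreModule I X J hY).incl m) = m.1 :=
    (isGradedIso_of_isCanonicalIso hXY hΦ).map_incl
  refine ⟨⟨_, dbarX_mem a⟩, Φ.symm (DForm.sndProj I X J Y 1 (dbar (I.prod J) (X × Y) a.1)), ?_,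
    Φ.injective ?_, (sndProj_dbar a).1, ?_⟩
  · have := mem_formDegree hΦ 1 (Φ.symm (dbar (I.prod J) (X × Y) a.1))
    rwa [Φ.apply_symm_apply] at this
  · rw [map_add, hincl, Φ.apply_symm_apply]
    refine Eq.trans (Φ.apply_symm_apply _) ?_
    show dbar (I.prod J) (X × Y) (Φ ((fibreModule I X J hY).incl a)) = _
    rw [hincl]
    exact sndProj_add_dbar a
  · rw [Φ.apply_symm_apply]
    exact (sndProj_dbar a).2

end Product

end

theorem mainTheorem10 {m n : ℕ}
    (X : Type u) [TopologicalSpace X] [T2Space X] [SecondCountableTopology X]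
    [ChartedSpace (EuclideanSpace ℂ (Fin m)) X]
    [IsManifold 𝓘(ℂ, EuclideanSpace ℂ (Fin m)) ω X]
    (Y : Type v) [TopologicalSpace Y] [T2Space Y] [SecondCountableTopology Y]
    [ChartedSpace (EuclideanSpace ℂ (Fin n)) Y]
    [IsManifold 𝓘(ℂ, EuclideanSpace ℂ (Fin n)) ω Y] :
    let I := 𝓘(ℂ, EuclideanSpace ℂ (Fin m))
    let J := 𝓘(ℂ, EuclideanSpace ℂ (Fin n))
    ∃ (hXY : IsCurvedDGA (dolbeault (I.prod J) (X × Y))) (hY : IsCurvedDGA (dolbeault J Y))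
      (Φ : (fibreModule I X J hY).T ≃L[ℂ] DForm (I.prod J) (X × Y)),
      IsCanonicalIso I X J Φ ∧
      IsQPTwistedBimodule (fibreBimodule I X J hXY hY Φ) ∧
      (∀ a : fibreForms I X J Y,
        ∃ (a₀ : fibreForms I X J Y) (r : (fibreModule I X J hY).T),
          r ∈ GrModule.T.formDegree (fibreModule I X J hY) 1 ∧
          (fibreBimodule I X J hXY hY Φ).conn ((fibreModule I X J hY).incl a) =
            (fibreModule I X J hY).incl a₀ + r ∧
          (a₀ : DForm (I.prod J) (X × Y)).1 = dbarX I X J a.1.1 ∧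
          (Φ r).1 = dbarY I X J a.1.1) ∧
      ∃ F : DGFunctor.{max u v, v, max u v w}
          ⟨dolbeault (I.prod J) (X × Y), hXY⟩ ⟨dolbeault J Y, hY⟩,
        IsPushforward (fibreBimodule I X J hXY hY Φ) F := by
  intro I J
  have hXY : IsCurvedDGA (dolbeault (I.prod J) (X × Y)) := isCurvedDGA_dolbeault
  have hY : IsCurvedDGA (dolbeault J Y) := isCurvedDGA_dolbeault
  -- `(fibreModule I X J hY).T` unfolds to the tensor product of `exists_wedgeIso`, with `formLmul`
  -- as the action `lmul0` of the degree zero part.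
  obtain ⟨Φ, hΦ⟩ : ∃ Φ : (fibreModule I X J hY).T ≃L[ℂ] DForm (I.prod J) (X × Y),
      IsCanonicalIso I X J Φ := exists_wedgeIso
  have hM := isQPTwistedBimodule_fibreBimodule hXY hΦ
  exact ⟨hXY, hY, Φ, hΦ, hM, exists_conn_incl hXY hΦ,
    pushFunctor.{max u v, v, w, max u v} ⟨fibreBimodule I X J hXY hY Φ, hM⟩,
    pushFunctor_isPushforward.{max u v, v, w, max u v} ⟨fibreBimodule I X J hXY hY Φ, hM⟩⟩
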